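/- **Definitions.** A *signed graph* $G_s=(V,E,s)$ is a finite simple graph with $V\neq\varnothing$ and a signature $s:E\to\{-1,1\}$. It is *balanced* if $V$ splits into two (possibly empty) parts such that edges within each part are positive and edges between the parts are negative; a *balanced component* is a connected component whose induced signed subgraph is balanced. The *signed Laplacian* $\mathcal L^{G_s}$ is the real $V\times V$ matrix with diagonal entries $\deg(i)$, entries $-s(\{i,j\})$ for $\{i,j\}\in E$, and $0$ otherwise. Write $[k]=\{0,\dots,k-1\}$. Let $V\subseteq[2^n]\setminus\{0\}$ and let every vertex have at most $S\ge 2$ neighbours. A pair of classical Boolean circuits $(O_{\rm adj},O_{\rm sign})$, each taking an $n$-bit index $i$ and a $\lceil\log_2 S\rceil$-bit index $\ell$, implements *marked sparse access* to $G_s$ if $O_{\rm adj}$ computes a function $\operatorname{adj}:[2^n]\times[S]\to[2^n]$ such that, for $i\in V$, the values $\operatorname{adj}(i,0),\dots,\operatorname{adj}(i,\deg(i)-1)$ list the neighbours of $i$ (each once, in any order) and $\operatorname{adj}(i,\ell)=0$ for $\deg(i)\le\ell<S$, while $\operatorname{adj}(i,\ell)=\ell$ for $i\notin V$; and if $O_{\rm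 sign}$ outputs, for every $i\in V$ and $\ell<\deg(i)$, one bit that is $0$ if $s(\{i,\operatorname{adj}(i,\ell)\})=1$ and $1$ if it is $-1$. **PROMISE SPARSE BALANCEDNESS.** Fix functions $\bar S(n)\in O(\mathrm{poly}\,n)$, $c(n)\in O(\mathrm{poly}\,n)$ and $\delta(n)>0$ with $\delta(n)\in\Omega(1/\mathrm{poly}\,n)$. *Input*: $n$, $S$ and two circuits with at most $c(n)$ gates each that implement marked sparse access to a signed graph $G_s$ with $V\subseteq[2^n]\setminus\{0\}$ and maximum degree at most $S$, where $2\le S\le\bar S(n)$. *Promise*: the smallest eigenvalue of $\mathcal L^{G_s}$ is either $0$ or at least $\delta(n)$. *Output*: YES if $G_s$ has a balanced component, NO otherwise. **Proposition.** For all such $\bar S$, $c$, $\delta$, PROMISE SPARSE BALANCEDNESS is in $\mathsf{QMA}$: there are a polynomial $p$ and a polynomial-time quantum verifier (a polynomial-time Turing machine maps each string $x$ to a quantum circuit over a fixed finite universal gate set) such that for every YES-input $x$ some witness state on $p(|x|)$ qubits is accepted with probability at least $2/3$, and for every NO-input $x$ every witness state on $p(|x|)$ qubits is accepted with probability at most $1/3$.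 -/

import Mathlib

open Filter Asymptotics

namespace QMABalance

/-! ### Binary encodings -/

/-- Self-delimiting unary code of a natural number: `n` ones followed by a zero. -/
def encNat : ℕ → List Bool
  | 0 => [false]
  | n + 1 => true :: encNat n

/-- Self-delimiting code of a list: every entry is preceded by a one, the end is marked by a
zero. -/
def encList {α : Type} (enc : α → List Bool) : List α → List Bool
  | [] => [false]
  | a :: l => true :: (enc a ++ encList enc l)

/-- The code words of `enc` can be read off unambiguously from the beginning of a string. -/
def PrefixCode {α : Type} (enc : α → List Bool) : Prop :=
  ∀ a b u v, enc a ++ u = enc b ++ v → a = b ∧ u = v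

theorem prefixCode_encNat : PrefixCode encNat := by
  intro a
  induction a with
  | zero => intro b u v h; cases b <;> simp_all [encNat]
  | succ n ih =>
    intro b u v h
    cases b with
    | zero => simp [encNat] at h
    | succ m =>
      simp only [encNat, List.cons_append, List.cons.injEq, true_and] at h
      obtain ⟨h1, h2⟩ := ih m u v h
      exact ⟨by rw [h1], h2⟩

theorem prefixCode_encList {α : Type} {enc : α → List Bool} (he : PrefixCode enc) :
    PrefixCode (encList enc) := by
  intro a
  induction a with
  | nil => intro b u v h; cases b <;> simp_all [encList]
  | cons x l ih =>
    intro b u v h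
    cases b with
    | nil => simp [encList] at h
    | cons y m =>
      simp only [encList, List.cons_append, List.append_assoc, List.cons.injEq, true_and] at h
      obtain ⟨h1, h2⟩ := he _ _ _ _ h
      obtain ⟨h3, h4⟩ := ih m u v h2
      exact ⟨by rw [h1, h3], h4⟩

/-! ### Classical Boolean circuits -/

/-- A gate of a Boolean circuit; the arguments are the numbers of the wires it reads. -/
inductive BoolGate
  | not (a : ℕ)
  | and (a b : ℕ)
  | or (a b : ℕ)

/-- A Boolean circuit. Wires `0, …, numInputs - 1` carry the input bits, and the `k`-th gate
(counted from `0`) writes wire `numInputs + k`. `outputs` lists the output wires. -/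
structure BoolCircuit where
  numInputs : ℕ
  gates : List BoolGate
  outputs : List ℕ

/-- The bit computed by a gate from the values of the wires that precede it. -/
def BoolGate.eval (w : List Bool) : BoolGate → Bool
  | .not a => !(w.getD a false)
  | .and a b => w.getD a false && w.getD b false
  | .or a b => w.getD a false || w.getD b false

/-- All wires read by the gate have a number below `k`. -/
def BoolGate.ReadsBelow (k : ℕ) : BoolGate → Prop
  | .not a => a < k
  | .and a b => a < k ∧ b < k
  | .or a b => a < k ∧ b < k

namespace BoolCircuit

/-- Each gate reads only inputs and earlier gates, and the output wires exist. -/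
def WellFormed (C : BoolCircuit) : Prop :=
  (∀ (k : ℕ) (h : k < C.gates.length), (C.gates[k]).ReadsBelow (C.numInputs + k)) ∧
    ∀ o ∈ C.outputs, o < C.numInputs + C.gates.length

/-- The number of gates. -/
def size (C : BoolCircuit) : ℕ := C.gates.length

/-- The output bits of the circuit on a list of input bits. -/
def eval (C : BoolCircuit) (input : List Bool) : List Bool :=
  let wires := C.gates.foldl (fun w g => w ++ [g.eval w]) input
  C.outputs.map fun o => wires.getD o false

end BoolCircuit

def encBoolGate : BoolGate → List Bool
  | .not a => encNat 0 ++ encNat a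
  | .and a b => encNat 1 ++ (encNat a ++ encNat b)
  | .or a b => encNat 2 ++ (encNat a ++ encNat b)

def encBoolCircuit (C : BoolCircuit) : List Bool :=
  encNat C.numInputs ++ (encList encBoolGate C.gates ++ encList encNat C.outputs)

theorem prefixCode_encBoolGate : PrefixCode encBoolGate := by
  intro a b u v h
  cases a <;> cases b <;>
    simp only [encBoolGate, List.append_assoc] at h <;>
    obtain ⟨h0, h⟩ := prefixCode_encNat _ _ _ _ h <;>
    first
      | (exact absurd h0 (by decide))
      | (obtain ⟨h1, h⟩ := prefixCode_encNat _ _ _ _ h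
         first
          | exact ⟨by rw [h1], h⟩
          | (obtain ⟨h2, h⟩ := prefixCode_encNat _ _ _ _ h
             exact ⟨by rw [h1, h2], h⟩))

theorem prefixCode_encBoolCircuit : PrefixCode encBoolCircuit := by
  rintro ⟨n, g, o⟩ ⟨n', g', o'⟩ u v h
  simp only [encBoolCircuit, List.append_assoc] at h
  obtain ⟨h1, h⟩ := prefixCode_encNat _ _ _ _ h
  obtain ⟨h2, h⟩ := prefixCode_encList prefixCode_encBoolGate _ _ _ _ h
  obtain ⟨h3, h⟩ := prefixCode_encList prefixCode_encNat _ _ _ _ h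
  exact ⟨by rw [h1, h2, h3], h⟩

/-! ### Quantum circuits -/

/-- Quantum gates over a fixed finite universal gate set: Pauli `X`, Hadamard `H`, the phase gate
`T = diag(1, exp (i π / 4))`, controlled not (control, target) and Toffoli (control, control,
target). The arguments are the numbers of the qubits. -/
inductive QGate
  | x (a : ℕ)
  | h (a : ℕ)
  | t (a : ℕ)
  | cnot (a b : ℕ)
  | ccx (a b c : ℕ)

/-- A quantum verification circuit on `1 + witness + ancilla` qubits. Qubit `0` is the output
qubit, qubits `1, …, witness` hold the witness state, and the remaining ones are ancillas. -/
structure QCircuit where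
  witness : ℕ
  ancilla : ℕ
  gates : List QGate

/-- A (not necessarily normalized) state vector of `N` qubits, given by its amplitudes in the
computational basis. -/
abbrev QState (N : ℕ) : Type := (Fin N → Bool) → ℂ

/-- The norm of the state vector is one. -/
def IsNormalized {N : ℕ} (ψ : QState N) : Prop := ∑ b, ‖ψ b‖ ^ 2 = 1

open Function in
/-- The action of a gate on `N` qubits. A gate that names a qubit which does not exist, or the same
qubit twice, is ignored. -/
noncomputable def QGate.apply (N : ℕ) (g : QGate) (ψ : QState N) : QState N :=
  match g with
  | .x a =>
    if h : a < N then
      let i : Fin N := ⟨a, h⟩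
      fun b => ψ (update b i (!b i))
    else ψ
  | .h a =>
    if h : a < N then
      let i : Fin N := ⟨a, h⟩
      fun b => ((Real.sqrt 2 : ℝ) : ℂ)⁻¹ *
        (ψ (update b i false) + (if b i then -1 else 1) * ψ (update b i true))
    else ψ
  | .t a =>
    if h : a < N then
      let i : Fin N := ⟨a, h⟩
      fun b => (if b i then Complex.exp (Real.pi / 4 * Complex.I) else 1) * ψ b
    else ψ
  | .cnot a c =>
    if h : a < N ∧ c < N ∧ a ≠ c then
      let i : Fin N := ⟨a, h.1⟩
      let k : Fin N := ⟨c, h.2.1⟩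
      fun b => ψ (update b k (xor (b k) (b i)))
    else ψ
  | .ccx a c d =>
    if h : a < N ∧ c < N ∧ d < N ∧ a ≠ c ∧ a ≠ d ∧ c ≠ d then
      let i : Fin N := ⟨a, h.1⟩
      let j : Fin N := ⟨c, h.2.1⟩
      let k : Fin N := ⟨d, h.2.2.1⟩
      fun b => ψ (update b k (xor (b k) (b i && b j)))
    else ψ

namespace QCircuit

/-- The number of qubits. -/
def width (C : QCircuit) : ℕ := 1 + C.witness + C.ancilla

/-- The initial state `|0⟩ ⊗ |w⟩ ⊗ |0…0⟩` for a witness state `w`. -/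
def startState (C : QCircuit) (w : QState C.witness) : QState C.width := fun b =>
  if ∀ i : Fin C.width, (i : ℕ) = 0 ∨ C.witness < i → b i = false then
    w fun j => b ⟨1 + j, by have := j.isLt; unfold width; omega⟩
  else 0

/-- The state after all gates have been applied in order. -/
noncomputable def finalState (C : QCircuit) (w : QState C.witness) : QState C.width :=
  C.gates.foldl (fun ψ g => g.apply C.width ψ) (C.startState w)

/-- The probability that the final measurement of the output qubit yields `1`. -/
noncomputable def acceptProb (C : QCircuit) (w : QState C.witness) : ℝ :=
  ∑ b : Fin C.width → Bool,
    if b ⟨0, by unfold width; omega⟩ then ‖C.finalState w b‖ ^ 2 else 0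

end QCircuit

def encQGate : QGate → List Bool
  | .x a => encNat 0 ++ encNat a
  | .h a => encNat 1 ++ encNat a
  | .t a => encNat 2 ++ encNat a
  | .cnot a b => encNat 3 ++ (encNat a ++ encNat b)
  | .ccx a b c => encNat 4 ++ (encNat a ++ (encNat b ++ encNat c))

/-- Qubit numbers are written in unary, which is at most polynomially longer than binary for
circuits with polynomially many qubits. -/
def encQCircuit (C : QCircuit) : List Bool :=
  encNat C.witness ++ (encNat C.ancilla ++ encList encQGate C.gates)

theorem prefixCode_encQGate : PrefixCode encQGate := by
  intro a b u v h
  cases a <;> cases b <;>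
    simp only [encQGate, List.append_assoc] at h <;>
    obtain ⟨h0, h⟩ := prefixCode_encNat _ _ _ _ h <;>
    first
      | (exact absurd h0 (by decide))
      | (obtain ⟨h1, h⟩ := prefixCode_encNat _ _ _ _ h
         first
          | exact ⟨by rw [h1], h⟩
          | (obtain ⟨h2, h⟩ := prefixCode_encNat _ _ _ _ h
             first
              | exact ⟨by rw [h1, h2], h⟩
              | (obtain ⟨h3, h⟩ := prefixCode_encNat _ _ _ _ h
                 exact ⟨by rw [h1, h2, h3], h⟩)))

theorem prefixCode_encQCircuit : PrefixCode encQCircuit := by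
  rintro ⟨n, a, g⟩ ⟨n', a', g'⟩ u v h
  simp only [encQCircuit, List.append_assoc] at h
  obtain ⟨h1, h⟩ := prefixCode_encNat _ _ _ _ h
  obtain ⟨h2, h⟩ := prefixCode_encNat _ _ _ _ h
  obtain ⟨h3, h⟩ := prefixCode_encList prefixCode_encQGate _ _ _ _ h
  exact ⟨by rw [h1, h2, h3], h⟩

/-! ### Promise problems and the class QMA -/

/-- A promise problem: a set of yes-inputs and a set of no-inputs. -/
structure PromiseProblem where
  yes : Set (List Bool)
  no : Set (List Bool)

/-- The class QMA: a polynomial-time Turing machine maps the input `x` to (the description of) a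
quantum verification circuit `V x` that takes a witness of `p |x|` qubits and has completeness
`2/3` and soundness `1/3`. -/
def InQMA (A : PromiseProblem) : Prop :=
  ∃ (p : Polynomial ℕ) (V : List Bool → QCircuit),
    Nonempty (Turing.TM2ComputableInPolyTime (id : List Bool → List Bool) encQCircuit V) ∧
    (∀ x, (V x).witness = p.eval x.length) ∧
    (∀ x ∈ A.yes, ∃ w : QState (V x).witness, IsNormalized w ∧ 2 / 3 ≤ (V x).acceptProb w) ∧
    (∀ x ∈ A.no, ∀ w : QState (V x).witness, IsNormalized w → (V x).acceptProb w ≤ 1 / 3)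

/-! ### Signed graphs -/

/-- A simple graph with a sign `±1` on each edge. -/
structure SignedGraph (V : Type) where
  graph : SimpleGraph V
  sign : graph.edgeSet → ℤˣ

namespace SignedGraph

variable {V : Type}

/-- The signed subgraph induced on a set of vertices. -/
def induce (G : SignedGraph V) (s : Set V) : SignedGraph s where
  graph := G.graph.induce s
  sign := fun e => G.sign ((SimpleGraph.Embedding.induce s).mapEdgeSet e)

/-- A signed graph is balanced if its vertices can be split into two (possibly empty) parts, `A`
and its complement, such that the edges within a part are positive and the edges between the parts
are negative. -/
def IsBalanced (G : SignedGraph V) : Prop :=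
  ∃ A : Set V, ∀ (u v : V) (h : G.graph.Adj u v),
    ((u ∈ A ↔ v ∈ A) → G.sign ⟨s(u, v), h⟩ = 1) ∧
      (¬(u ∈ A ↔ v ∈ A) → G.sign ⟨s(u, v), h⟩ = -1)

/-- Some connected component is balanced. -/
def HasBalancedComponent (G : SignedGraph V) : Prop :=
  ∃ c : G.graph.ConnectedComponent, (G.induce c.supp).IsBalanced

open Classical in
/-- The number of neighbours of a vertex. -/
noncomputable def deg [Fintype V] (G : SignedGraph V) (v : V) : ℕ := G.graph.degree v

open Classical in
/-- The signed Laplacian. -/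
noncomputable def laplacian [Fintype V] (G : SignedGraph V) : Matrix V V ℝ :=
  Matrix.of fun i j =>
    if i = j then (G.deg i : ℝ)
    else if h : G.graph.Adj i j then -(((G.sign ⟨s(i, j), h⟩ : ℤˣ) : ℤ) : ℝ)
    else 0

/-- `μ` is the smallest eigenvalue of the signed Laplacian. -/
def IsSmallestEigenvalue [Fintype V] [DecidableEq V] (G : SignedGraph V) (μ : ℝ) : Prop :=
  IsLeast {t : ℝ | Module.End.HasEigenvalue (Matrix.toLin' G.laplacian) t} μ

end SignedGraph

/-! ### Marked sparse access and the computational problem -/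

/-- The data of an input: the bit length `n` of the vertex names, the degree bound `S`, and two
Boolean circuits. -/
structure Input where
  n : ℕ
  S : ℕ
  adj : BoolCircuit
  sgn : BoolCircuit

/-- The bit string handed to the problem's solver. -/
def encInput (I : Input) : List Bool :=
  encNat I.n ++ (encNat I.S ++ (encBoolCircuit I.adj ++ encBoolCircuit I.sgn))

theorem encInput_injective : Function.Injective encInput := by
  rintro ⟨n, S, a, s⟩ ⟨n', S', a', s'⟩ h
  simp only [encInput] at h
  obtain ⟨h1, h⟩ := prefixCode_encNat _ _ _ _ h
  obtain ⟨h2, h⟩ := prefixCode_encNat _ _ _ _ h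
  obtain ⟨h3, h⟩ := prefixCode_encBoolCircuit _ _ _ _ h
  obtain ⟨h4, -⟩ := prefixCode_encBoolCircuit s s' [] [] (by simpa using h)
  rw [h1, h2, h3, h4]

/-- The `w` lowest binary digits of `k`, least significant first. -/
def toBits (w k : ℕ) : List Bool := List.ofFn fun j : Fin w => k.testBit j

/-- The number whose binary digits, least significant first, are given. -/
def ofBits (l : List Bool) : ℕ := l.foldr Nat.bit 0

namespace Input

/-- The number of bits used for a position `ℓ < S` in an adjacency list. -/
def idxBits (I : Input) : ℕ := Nat.clog 2 I.S

/-- The number computed by the adjacency circuit on `(i, ℓ)`. -/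
def adjValue (I : Input) (i l : ℕ) : ℕ :=
  ofBits (I.adj.eval (toBits I.n i ++ toBits I.idxBits l))

/-- The output of the sign circuit on `(i, ℓ)`; the single output bit is `1` for a negative
edge and `0` for a positive edge. -/
def sgnValue (I : Input) (i l : ℕ) : List Bool :=
  I.sgn.eval (toBits I.n i ++ toBits I.idxBits l)

/-- The two circuits of `I` implement the marked sparse access to the signed graph `G` with vertex
set `V ⊆ {1, …, 2 ^ n - 1}`. -/
structure Implements (I : Input) (V : Finset ℕ) (G : SignedGraph V) : Prop where
  nonempty : V.Nonempty
  vertex_range : ∀ i ∈ V, 0 < i ∧ i < 2 ^ I.n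
  two_le_S : 2 ≤ I.S
  deg_le : ∀ v : V, G.deg v ≤ I.S
  adj_wellFormed : I.adj.WellFormed
  adj_inputs : I.adj.numInputs = I.n + I.idxBits
  adj_outputs : I.adj.outputs.length = I.n
  sgn_wellFormed : I.sgn.WellFormed
  sgn_inputs : I.sgn.numInputs = I.n + I.idxBits
  sgn_outputs : I.sgn.outputs.length = 1
  /-- The positions below the degree of `v` enumerate the neighbours of `v`, in any order. -/
  adj_neighbour : ∀ v : V, ∃ e : Fin (G.deg v) ≃ G.graph.neighborSet v,
    ∀ l : Fin (G.deg v), I.adjValue v l = ((e l : V) : ℕ)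
  /-- The remaining positions hold the placeholder `0`. -/
  adj_end : ∀ v : V, ∀ l : ℕ, G.deg v ≤ l → l < I.S → I.adjValue v l = 0
  /-- Bit strings that are not vertices have the marked list `0, 1, …, S - 1`. -/
  adj_marked : ∀ i : ℕ, i < 2 ^ I.n → i ∉ V → ∀ l : ℕ, l < I.S → I.adjValue i l = l
  sgn_edge : ∀ (v u : V) (h : G.graph.Adj v u) (l : ℕ), l < I.S → I.adjValue v l = u →
    I.sgnValue v l = [decide (G.sign ⟨s(v, u), h⟩ = -1)]

end Input

/-- `f ∈ O(poly n)`. -/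
def IsPolyBounded (f : ℕ → ℕ) : Prop :=
  ∃ k : ℕ, (fun n => (f n : ℝ)) =O[atTop] fun n : ℕ => (n : ℝ) ^ k

/-- `δ` is positive and `δ ∈ Ω(1 / poly n)`. -/
def IsInvPolyBounded (δ : ℕ → ℝ) : Prop :=
  (∀ n, 0 < δ n) ∧ ∃ k : ℕ, (fun n : ℕ => 1 / (n : ℝ) ^ k) =O[atTop] δ

/-- `I` is an input satisfying all requirements and the promise, and it describes `G`. -/
structure Admissible (degBound sizeBound : ℕ → ℕ) (δ : ℕ → ℝ) (I : Input) (V : Finset ℕ)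
    (G : SignedGraph V) : Prop where
  access : I.Implements V G
  sparse : I.S ≤ degBound I.n
  adj_size : I.adj.size ≤ sizeBound I.n
  sgn_size : I.sgn.size ≤ sizeBound I.n
  gap : ∃ μ : ℝ, G.IsSmallestEigenvalue μ ∧ (μ = 0 ∨ δ I.n ≤ μ)

/-- Promise sparse balancedness, with degree bound, circuit size bound and spectral gap given as
functions of `n`. -/
def promiseSparseBalancedness (degBound sizeBound : ℕ → ℕ) (δ : ℕ → ℝ) : PromiseProblem where
  yes := {x | ∃ (I : Input) (V : Finset ℕ) (G : SignedGraph V), x = encInput I ∧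
    Admissible degBound sizeBound δ I V G ∧ G.HasBalancedComponent}
  no := {x | ∃ (I : Input) (V : Finset ℕ) (G : SignedGraph V), x = encInput I ∧
    Admissible degBound sizeBound δ I V G ∧ ¬ G.HasBalancedComponent}

end QMABalance

/-! The quadratic form of the signed Laplacian satisfies 2⟨x, Lx⟩ = Σ (x_i − s_ij x_j)², the sum
running over ordered adjacent pairs (`two_mul_dotProduct_laplacian`). Hence a null vector is one
with x_i = s_ij x_j along every edge. The support of such a vector is a union of components, and on
each of these the signs of its entries exhibit a balancing partition; conversely a balanced
component carries a ±1 vector of this kind (`hasBalancedComponent_of_eigenvector`,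
`HasBalancedComponent.exists_vector`). The verifier projects the witness repeatedly onto conditions
that together say "supported on vertices, and x_i = s_ij x_j".

Tests. The witness consists of 11·|x| qubits in eleven interleaved blocks: `A` and `B` hold two
vertices and the evaluations of the adjacency circuit, `C` the sign circuit, `D` bitwise
comparisons, `Z`, `Y`, `Y'` chains of conjunctions, and `c`, `t`, `s`, `r` a control bit, a
temporary bit, a sign and a verdict. A test is a list U of gates with a qubit q and realizes the
projection U⁻¹[q = 1]U (`testProj`). Only self-inverse gates are used, so U⁻¹ is U read backwards. A
Toffoli gate carries a one from test qubit t to test qubit t + 1 if test t passes, and therefore the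
acceptance probability is the squared norm of the product of all projections applied to the witness
(`acceptProb_testCircuit`).

A round has three kinds of tests. Zero tests keep the strings in which only the n-bit name in block
`A` may be nonzero. The vertex test discards names whose neighbour list begins with 0, 1; no vertex
has such a list (`Implements.mem_iff`). A pair test, for positions l, m < S, puts a Hadamard gate on
the control bit. With the control off, the name i becomes the beginning of an edge whose end is its
l-th neighbour; with the control on, it becomes the end of an edge whose beginning is its m-th
neighbour. If l and m are the positions of j in the list of i and of i in the list of j, then i with
control off and j with control on arrive at the same memory, the second Hadamard gate lets them
interfere, and the rejected outcome has amplitude (ψ_i − s ψ_j)/2 (`runGates_pairTest_edge`).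

Completeness: the normalized ±1 vector of a balanced component is fixed by every projection, hence
accepted with certainty (`exists_passing`).

Soundness: on a state Φ supported on the vertices the rejected masses of the pair tests add up to at
least ¼ Σ |Φ_i − s_ij Φ_j|² = ½⟨Φ, LΦ⟩ ≥ (μ/2)‖Φ‖² (`sum_le_nsq_sub_pairTest`, `sum_adj_le`). These
are masses of the tests taken separately, whereas the circuit applies them in sequence. For M
projections in sequence the sum of the separate rejected masses is at most M² times the loss of
squared norm in the sequence (`sum_nsq_sub_testProj_le`). With M = S² a round multiplies the squared
norm by at most 1 − ε/S⁴, where ε = min(δ/2, 1), and |x|^k rounds for a constant k push it below 1/3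
(`exists_rounds`).

Uniformity: a Turing machine has to write this circuit in polynomial time. Structured stack programs
are compiled to Mathlib's stack machines with exact step counts (`polyTime_of_exec`). On top of them
a command language, with loops over numbers, binary digits and the lists in the input, is shown to
emit gates within polynomial time (`Cmd.emits`, `polyTime_testCircuit`). During the emission of a
test its gates are also stacked in reverse order, so that the inverse can be appended at once.
Finally the tests are expressed as a command (`sem_allTests`). -/

namespace QMABalance

/-! ### A small structured language for stack machines -/

/-- Structured programs over a family of stacks of bits, indexed by `K`. -/
inductive Prog (K : Type)
  | skip
  | push (k : K) (b : Bool)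
  | seq (p q : Prog K)
  /-- Pop the stack `k` and branch on the result (empty, `false`, `true`). -/
  | case (k : K) (pe pf pt : Prog K)
  /-- Pop the stack `k` and run `pf` or `pt` according to the bit, until the stack is empty or, if
  `brk` is set, a `false` has been popped. -/
  | loop (k : K) (brk : Bool) (pf pt : Prog K)

namespace Prog

open Function Turing

variable {K : Type}

/-- The program points of a program. -/
def Lbl : Prog K → Type
  | skip => Unit
  | push _ _ => Unit
  | seq p q => p.Lbl ⊕ q.Lbl
  | case _ pe pf pt => Unit ⊕ (pe.Lbl ⊕ (pf.Lbl ⊕ pt.Lbl))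
  | loop _ _ pf pt => Unit ⊕ (pf.Lbl ⊕ pt.Lbl)

/-- The first program point. -/
def entry : (p : Prog K) → p.Lbl
  | skip => ()
  | push _ _ => ()
  | seq p _ => Sum.inl p.entry
  | case _ _ _ _ => Sum.inl ()
  | loop _ _ _ _ => Sum.inl ()

noncomputable instance fintypeLbl : (p : Prog K) → Fintype p.Lbl
  | skip => inferInstanceAs (Fintype Unit)
  | push _ _ => inferInstanceAs (Fintype Unit)
  | seq p q =>
    letI := fintypeLbl p
    letI := fintypeLbl q
    inferInstanceAs (Fintype (p.Lbl ⊕ q.Lbl))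
  | case _ pe pf pt =>
    letI := fintypeLbl pe
    letI := fintypeLbl pf
    letI := fintypeLbl pt
    inferInstanceAs (Fintype (Unit ⊕ (pe.Lbl ⊕ (pf.Lbl ⊕ pt.Lbl))))
  | loop _ _ pf pt =>
    letI := fintypeLbl pf
    letI := fintypeLbl pt
    inferInstanceAs (Fintype (Unit ⊕ (pf.Lbl ⊕ pt.Lbl)))

/-- Statements of the machines that programs are compiled to. -/
abbrev BStmt (K Λ : Type) : Type := TM2.Stmt (fun _ : K => Bool) Λ (Option Bool)

/-- Pop a stack and go to one of three labels. -/
def popGoto {Λ : Type} (k : K) (le lf lt : Λ) : BStmt K Λ :=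
  .pop k (fun _ o => o) <| .branch (fun v => v == none) (.load (fun _ => none) (.goto fun _ => le)) <|
    .branch (fun v => v == some true) (.load (fun _ => none) (.goto fun _ => lt))
      (.load (fun _ => none) (.goto fun _ => lf))

/-- The machine code of a program whose labels are embedded by `ι` and which exits to `ex`. -/
def code {Λ : Type} : (p : Prog K) → (p.Lbl → Λ) → Λ → p.Lbl → BStmt K Λ
  | skip, _, ex, _ => .goto fun _ => ex
  | push k b, _, ex, _ => .push k (fun _ => b) (.goto fun _ => ex)
  | seq p q, ι, ex, l =>
    match l with
    | .inl l => code p (fun l => ι (.inl l)) (ι (.inr q.entry)) l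
    | .inr l => code q (fun l => ι (.inr l)) ex l
  | case k pe pf pt, ι, ex, l =>
    match l with
    | .inl _ => popGoto k (ι (.inr (.inl pe.entry))) (ι (.inr (.inr (.inl pf.entry))))
        (ι (.inr (.inr (.inr pt.entry))))
    | .inr (.inl l) => code pe (fun l => ι (.inr (.inl l))) ex l
    | .inr (.inr (.inl l)) => code pf (fun l => ι (.inr (.inr (.inl l)))) ex l
    | .inr (.inr (.inr l)) => code pt (fun l => ι (.inr (.inr (.inr l)))) ex l
  | loop k brk pf pt, ι, ex, l =>
    match l with
    | .inl _ => popGoto k ex (if brk then ex else ι (.inr (.inl pf.entry)))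
        (ι (.inr (.inr pt.entry)))
    | .inr (.inl l) => code pf (fun l => ι (.inr (.inl l))) (ι (.inl ())) l
    | .inr (.inr l) => code pt (fun l => ι (.inr (.inr l))) (ι (.inl ())) l

variable [DecidableEq K]

/-- `Exec p s s' t`: started on the stacks `s`, the program `p` halts with the stacks `s'` after
`t` steps. -/
inductive Exec : Prog K → (K → List Bool) → (K → List Bool) → ℕ → Prop
  | skip (s) : Exec skip s s 1
  | push (k b s) : Exec (push k b) s (update s k (b :: s k)) 1
  | seq {p q s s₁ s₂ t₁ t₂} : Exec p s s₁ t₁ → Exec q s₁ s₂ t₂ → Exec (seq p q) s s₂ (t₁ + t₂)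
  | case_nil {k pe pf pt s s' t} : s k = [] → Exec pe s s' t → Exec (case k pe pf pt) s s' (1 + t)
  | case_false {k pe pf pt s s' t l} : s k = false :: l → Exec pf (update s k l) s' t →
      Exec (case k pe pf pt) s s' (1 + t)
  | case_true {k pe pf pt s s' t l} : s k = true :: l → Exec pt (update s k l) s' t →
      Exec (case k pe pf pt) s s' (1 + t)
  | loop_nil {k brk pf pt s} : s k = [] → Exec (loop k brk pf pt) s s 1
  | loop_break {k pf pt s l} : s k = false :: l → Exec (loop k true pf pt) s (update s k l) 1
  | loop_false {k pf pt s s₁ s₂ l t₁ t₂} : s k = false :: l → Exec pf (update s k l) s₁ t₁ →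
      Exec (loop k false pf pt) s₁ s₂ t₂ → Exec (loop k false pf pt) s s₂ (1 + t₁ + t₂)
  | loop_true {k brk pf pt s s₁ s₂ l t₁ t₂} : s k = true :: l → Exec pt (update s k l) s₁ t₁ →
      Exec (loop k brk pf pt) s₁ s₂ t₂ → Exec (loop k brk pf pt) s s₂ (1 + t₁ + t₂)

/-- Machine configurations at a label, with the local variable cleared. -/
def at_ {Λ : Type} (l : Λ) (s : K → List Bool) :
    TM2.Cfg (fun _ : K => Bool) Λ (Option Bool) := ⟨some l, none, s⟩

/-- Every branch clears the local variable before it jumps. Thus each configuration reached at a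
label has the form `at_`, and the stacks alone determine the rest of the run. -/
theorem step_popGoto {Λ : Type} (k : K) (le lf lt : Λ) (s : K → List Bool) :
    TM2.stepAux (popGoto k le lf lt) none s =
      match s k with
      | [] => at_ le s
      | false :: l => at_ lf (update s k l)
      | true :: l => at_ lt (update s k l) := by
  rcases h : s k with _ | ⟨_ | _, l⟩
  · have : update s k [] = s := by rw [← h, update_eq_self]
    simp [popGoto, h, at_, this]
  · simp [popGoto, h, at_]
  · simp [popGoto, h, at_]

/-- Compiler correctness with exact timing: each unit of time in `Exec` is one machine step. The
induction runs over the derivation with the exit label generalized, since a subprogram leaves into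
the code around it. Only the agreement of the machine with the code on the image of `ι` is required,
so the same statement serves for a program embedded in a larger one. -/
theorem iterate_code {Λ : Type} (M : Λ → BStmt K Λ) {p : Prog K} {s s' : K → List Bool} {t : ℕ}
    (h : Exec p s s' t) (ι : p.Lbl → Λ) (ex : Λ) (hM : ∀ l, M (ι l) = code p ι ex l) :
    (flip Bind.bind (TM2.step M))^[t] (some (at_ (ι p.entry) s)) = some (at_ ex s') := by
  induction h generalizing ex with
  | skip s =>
    have := hM ()
    simp only [code] at this
    simp [flip, at_, entry, TM2.step, this]
  | push k b s =>
    have := hM ()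
    simp only [code] at this
    simp [flip, at_, entry, TM2.step, this]
  | @seq p q s s₁ s₂ t₁ t₂ _ _ ih₁ ih₂ =>
    -- `iterate_add_apply` performs the second summand of the exponent first; the first program has
    -- to go there.
    rw [Nat.add_comm, iterate_add_apply]
    have h1 := ih₁ (fun l => ι (.inl l)) (ι (.inr q.entry)) (fun l => by simpa [code] using hM (.inl l))
    have h2 := ih₂ (fun l => ι (.inr l)) ex (fun l => by simpa [code] using hM (.inr l))
    simp only [entry]
    rw [h1, h2]
  | @case_nil k pe pf pt s s' t hk _ ih =>
    have h0 := hM (.inl ())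
    simp only [code] at h0
    rw [Nat.add_comm, iterate_add_apply]
    have h1 := ih (fun l => ι (.inr (.inl l))) ex (fun l => by simpa [code] using hM (.inr (.inl l)))
    simpa [flip, at_, entry, TM2.step, h0, step_popGoto, hk] using h1
  | @case_false k pe pf pt s s' t l hk _ ih =>
    have h0 := hM (.inl ())
    simp only [code] at h0
    rw [Nat.add_comm, iterate_add_apply]
    have h1 := ih (fun l => ι (.inr (.inr (.inl l)))) ex
      (fun l => by simpa [code] using hM (.inr (.inr (.inl l))))
    simpa [flip, at_, entry, TM2.step, h0, step_popGoto, hk] using h1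
  | @case_true k pe pf pt s s' t l hk _ ih =>
    have h0 := hM (.inl ())
    simp only [code] at h0
    rw [Nat.add_comm, iterate_add_apply]
    have h1 := ih (fun l => ι (.inr (.inr (.inr l)))) ex
      (fun l => by simpa [code] using hM (.inr (.inr (.inr l))))
    simpa [flip, at_, entry, TM2.step, h0, step_popGoto, hk] using h1
  | @loop_nil k brk pf pt s hk =>
    have h0 := hM (.inl ())
    simp only [code] at h0
    simp [flip, at_, entry, TM2.step, h0, step_popGoto, hk]
  | @loop_break k pf pt s l hk =>
    have h0 := hM (.inl ())
    simp only [code] at h0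
    simp [flip, at_, entry, TM2.step, h0, step_popGoto, hk]
  | @loop_false k pf pt s s₁ s₂ l t₁ t₂ hk _ _ ih₁ ih₂ =>
    have h0 := hM (.inl ())
    simp only [code] at h0
    rw [Nat.add_comm, iterate_add_apply, Nat.add_comm 1, iterate_add_apply]
    have h1 := ih₁ (fun l => ι (.inr (.inl l))) (ι (.inl ()))
      (fun l => by simpa [code] using hM (.inr (.inl l)))
    have h2 := ih₂ ι ex hM
    simp only [entry] at h2 ⊢
    rw [← h2, ← h1]
    simp [flip, at_, TM2.step, h0, step_popGoto, hk]
  | @loop_true k brk pf pt s s₁ s₂ l t₁ t₂ hk _ _ ih₁ ih₂ =>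
    have h0 := hM (.inl ())
    simp only [code] at h0
    rw [Nat.add_comm, iterate_add_apply, Nat.add_comm 1, iterate_add_apply]
    have h1 := ih₁ (fun l => ι (.inr (.inr l))) (ι (.inl ()))
      (fun l => by simpa [code] using hM (.inr (.inr l)))
    have h2 := ih₂ ι ex hM
    simp only [entry] at h2 ⊢
    rw [← h2, ← h1]
    simp [flip, at_, TM2.step, h0, step_popGoto, hk]

/-- The machine that runs a program and halts. -/
noncomputable def machine [Fintype K] (p : Prog K) (k₀ k₁ : K) : FinTM2 where
  K := K
  k₀ := k₀
  k₁ := k₁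
  Γ := fun _ => Bool
  Λ := Option p.Lbl
  main := some p.entry
  σ := Option Bool
  initialState := none
  m := fun l =>
    match l with
    | none => .halt
    | some l => code p some none l

/-- The stacks with the single nonempty stack `k`. -/
def single (k : K) (l : List Bool) : K → List Bool := update (fun _ => []) k l

/-- A function computed by a program within polynomial time is computable in polynomial time by a
Turing machine. -/
theorem polyTime_of_exec [Fintype K] (p : Prog K) (k₀ k₁ : K) {β : Type} (enc : β → List Bool)
    (f : List Bool → β) (P : Polynomial ℕ)
    (h : ∀ x, ∃ t ≤ P.eval x.length, Exec p (single k₀ x) (single k₁ (enc (f x))) t) :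
    Nonempty (TM2ComputableInPolyTime (id : List Bool → List Bool) enc f) := by
  refine ⟨{ tm := machine p k₀ k₁
            inputAlphabet := Equiv.refl _
            outputAlphabet := Equiv.refl _
            -- The extra step is the one that executes `halt` at the exit label `none`.
            time := P + 1
            outputsFun := fun x => ?_ }⟩
  choose t ht hx using h
  refine ⟨⟨t x + 1, ?_⟩, by simpa using ht x⟩
  have hinit : initList (machine p k₀ k₁) x = at_ (some p.entry : Option p.Lbl) (single k₀ x) := by
    unfold initList at_
    congr 1
    funext k
    by_cases hk : k = k₀
    · exact (dif_pos hk).trans ((update_apply _ _ _ _).trans (if_pos hk)).symm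
    · exact (dif_neg hk).trans (update_of_ne (f := fun _ => ([] : List Bool)) hk _).symm
  have hfin : haltList (machine p k₀ k₁) (enc (f x)) = ⟨none, none, single k₁ (enc (f x))⟩ := by
    unfold haltList
    congr 1
    funext k
    by_cases hk : k = k₁
    · exact (dif_pos hk).trans ((update_apply _ _ _ _).trans (if_pos hk)).symm
    · exact (dif_neg hk).trans (update_of_ne (f := fun _ => ([] : List Bool)) hk _).symm
  have hM := iterate_code (machine p k₀ k₁).m (hx x) some none (fun l => rfl)
  have key : (flip Bind.bind (machine p k₀ k₁).step)^[t x + 1]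
      (some (initList (machine p k₀ k₁) x)) = some (haltList (machine p k₀ k₁) (enc (f x))) := by
    rw [hinit, hfin, Nat.add_comm, iterate_add_apply]
    exact congrArg (fun c => (flip Bind.bind (machine p k₀ k₁).step)^[1] c) hM
  -- The alphabets are matched by the identity equivalence, so input and output occur as images
  -- under `List.map id`.
  exact (congrArg (fun l => (flip Bind.bind (machine p k₀ k₁).step)^[t x + 1]
    (some (initList (machine p k₀ k₁) l))) (List.map_id x)).trans
    (key.trans (congrArg (fun l => some (haltList (machine p k₀ k₁) l)) (List.map_id _).symm))

end Prog

end QMABalance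

namespace QMABalance

open Function

/-! ### Registers and elementary programs -/

/-- Stacks for the machine's own use. -/
inductive MReg
  | inn | out | fwd | bwd | tmp | half | tag | cnt
  | loop (i : Fin 4)
  | scratch (i : Fin 4)
  deriving DecidableEq, Fintype

/-- Stacks that hold data which gates may refer to. -/
inductive DReg
  | len | bits | deg | adjIn | sgnIn | adjGates | adjOuts | sgnGates | sgnOuts | free | rounds
  | idx (i : Fin 4)
  | arg (i : Fin 4)
  | arg' (i : Fin 4)
  deriving DecidableEq, Fintype

inductive Reg
  | m (r : MReg)
  | d (r : DReg)
  deriving DecidableEq, Fintype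

abbrev Stacks := Reg → List Bool

abbrev RProg := Prog Reg

namespace Prog

open Prog

theorem Exec.of_eq {p : RProg} {s s' s'' : Stacks} {t : ℕ} (h : Exec p s s' t) (e : s' = s'') :
    Exec p s s'' t := e ▸ h

/-- Push `n` times the bit `true`. -/
def pushN (k : Reg) : ℕ → RProg
  | 0 => skip
  | n + 1 => seq (push k true) (pushN k n)

theorem exec_pushN (k : Reg) (n : ℕ) (s : Stacks) :
    Exec (pushN k n) s (update s k (List.replicate n true ++ s k)) (n + 1) := by
  induction n generalizing s with
  | zero => simpa [pushN] using Exec.skip s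
  | succ n ih =>
    have h := Exec.seq (Exec.push k true s) (ih _)
    rw [show n + 1 + 1 = 1 + (n + 1) by omega]
    refine h.of_eq ?_
    simp [List.replicate_succ', List.append_assoc]

/-- Empty a stack. -/
def clear (k : Reg) : RProg := loop k false skip skip

theorem exec_clear (k : Reg) (s : Stacks) :
    Exec (clear k) s (update s k []) (2 * (s k).length + 1) := by
  generalize hl : s k = l
  induction l generalizing s with
  | nil => exact (Exec.loop_nil hl).of_eq (by rw [← hl, update_eq_self])
  | cons b l ih =>
    have h := ih (update s k l) (by simp)
    rw [show 2 * (b :: l).length + 1 = 1 + 1 + (2 * l.length + 1) by simp; omega]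
    cases b
    · exact (Exec.loop_false hl (Exec.skip _) h).of_eq (by simp)
    · exact (Exec.loop_true hl (Exec.skip _) h).of_eq (by simp)

/-- Move a stack onto another one, which reverses it. -/
def move (k k' : Reg) : RProg := loop k false (push k' false) (push k' true)

theorem exec_move {k k' : Reg} (hk : k ≠ k') (s : Stacks) :
    Exec (move k k') s (update (update s k []) k' ((s k).reverse ++ s k'))
      (2 * (s k).length + 1) := by
  generalize hl : s k = l
  induction l generalizing s with
  | nil =>
    refine (Exec.loop_nil hl).of_eq ?_
    rw [← hl, update_eq_self]
    simp [hl]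
  | cons b l ih =>
    have h := ih (update (update s k l) k' (b :: s k')) (by simp [hk])
    rw [show 2 * (b :: l).length + 1 = 1 + 1 + (2 * l.length + 1) by simp; omega]
    have e : update (update (update (update s k l) k' (b :: s k')) k []) k'
        (l.reverse ++ update (update s k l) k' (b :: s k') k') =
        update (update s k []) k' ((b :: l).reverse ++ s k') := by
      funext r
      by_cases h1 : r = k' <;> by_cases h2 : r = k <;> simp [h1, h2, update_apply, hk, hk.symm]
    have hp : Exec (push k' b) (update s k l) (update (update s k l) k' (b :: s k')) 1 := by
      simpa [update_of_ne hk.symm] using Exec.push k' b (update s k l)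
    cases b
    · exact (Exec.loop_false hl hp h).of_eq e
    · exact (Exec.loop_true hl hp h).of_eq e

/-- Push one `true` onto `k'` for every bit of `k`, keeping `k`. -/
def addLen (k k' : Reg) : RProg :=
  seq (loop k false (seq (push (.m .tmp) false) (push k' true))
    (seq (push (.m .tmp) true) (push k' true))) (move (.m .tmp) k)

/-- The stack is carried over to `tmp`, with one extra push per bit, and then moved back, which
undoes the reversal. The two passes take 3n + 1 and 2n + 1 steps. -/
theorem exec_addLen {k k' : Reg} (hk : k ≠ k') (h1 : k ≠ .m .tmp) (h2 : k' ≠ .m .tmp)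
    (s : Stacks) (hs : s (.m .tmp) = []) :
    Exec (addLen k k') s (update s k' (List.replicate (s k).length true ++ s k'))
      (5 * (s k).length + 2) := by
  have main : ∀ (l : List Bool) (s : Stacks), s k = l →
      Exec (loop k false (seq (push (.m .tmp) false) (push k' true))
        (seq (push (.m .tmp) true) (push k' true))) s
        (update (update (update s k []) (.m .tmp) (l.reverse ++ s (.m .tmp))) k'
          (List.replicate l.length true ++ s k')) (3 * l.length + 1) := by
    intro l
    induction l with
    | nil =>
      intro s hl
      refine (Exec.loop_nil hl).of_eq ?_
      funext r
      by_cases e1 : r = k' <;> by_cases e2 : r = k <;> by_cases e3 : r = .m .tmp <;>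
        simp_all [update_apply]
    | cons b l ih =>
      intro s hl
      have h := ih (update (update (update s k l) (.m .tmp) (b :: s (.m .tmp))) k' (true :: s k'))
        (by simp [hk, h1])
      rw [show 3 * (b :: l).length + 1 = 1 + (1 + 1) + (3 * l.length + 1) by simp; omega]
      have hp : Exec (seq (push (.m .tmp) b) (push k' true)) (update s k l)
          (update (update (update s k l) (.m .tmp) (b :: s (.m .tmp))) k' (true :: s k')) (1 + 1) := by
        refine (Exec.seq (Exec.push _ b _) (Exec.push k' true _)).of_eq ?_
        simp [update_of_ne hk.symm, update_of_ne h1.symm, update_of_ne h2]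
      have e : ∀ X, Exec (loop k false (seq (push (.m .tmp) false) (push k' true))
          (seq (push (.m .tmp) true) (push k' true))) s X (1 + (1 + 1) + (3 * l.length + 1)) →
          X = update (update (update (update (update (update s k l) (.m .tmp) (b :: s (.m .tmp))) k'
            (true :: s k')) k []) (.m .tmp) (l.reverse ++ (update (update (update s k l) (.m .tmp)
            (b :: s (.m .tmp))) k' (true :: s k')) (.m .tmp))) k' (List.replicate l.length true ++
            (update (update (update s k l) (.m .tmp) (b :: s (.m .tmp))) k' (true :: s k')) k') →
          Exec (loop k false (seq (push (.m .tmp) false) (push k' true))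
            (seq (push (.m .tmp) true) (push k' true))) s
            (update (update (update s k []) (.m .tmp) ((b :: l).reverse ++ s (.m .tmp))) k'
            (List.replicate (b :: l).length true ++ s k')) (1 + (1 + 1) + (3 * l.length + 1)) := by
        intro X hX hXe
        refine hX.of_eq (hXe.trans ?_)
        funext r
        by_cases e1 : r = k' <;> by_cases e2 : r = k <;> by_cases e3 : r = .m .tmp <;>
          simp_all [update_apply, List.replicate_succ', Ne.symm]
      cases b
      · exact e _ (Exec.loop_false hl hp h) rfl
      · exact e _ (Exec.loop_true hl hp h) rfl
  have h := Exec.seq (main _ s rfl) (exec_move h1.symm _)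
  rw [show 5 * (s k).length + 2 = 3 * (s k).length + 1 + (2 * (s k).length + 1) by omega]
  have hlen : (update (update (update s k []) (.m .tmp) ((s k).reverse ++ s (.m .tmp))) k'
    (List.replicate (s k).length true ++ s k') (.m .tmp)).length = (s k).length := by
    simp [update_of_ne h2.symm, hs]
  rw [hlen] at h
  refine h.of_eq ?_
  funext r
  by_cases e1 : r = k' <;> by_cases e2 : r = k <;> by_cases e3 : r = .m .tmp <;>
    simp_all [update_apply, Ne.symm]

/-- Copy a stack onto an empty one. -/
def dup (k k' : Reg) : RProg :=
  seq (move k (.m .tmp))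
    (loop (.m .tmp) false (seq (push k false) (push k' false)) (seq (push k true) (push k' true)))

/-- Once the stack lies reversed on `tmp`, popping it restores the original order on both targets
simultaneously. -/
theorem exec_dup {k k' : Reg} (hk : k ≠ k') (h1 : k ≠ .m .tmp) (h2 : k' ≠ .m .tmp)
    (s : Stacks) (hs : s (.m .tmp) = []) (hs' : s k' = []) :
    Exec (dup k k') s (update s k' (s k)) (5 * (s k).length + 2) := by
  have main : ∀ (l : List Bool) (s : Stacks), s (.m .tmp) = l →
      Exec (loop (.m .tmp) false (seq (push k false) (push k' false))
        (seq (push k true) (push k' true))) s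
        (update (update (update s (.m .tmp) []) k (l.reverse ++ s k)) k'
          (l.reverse ++ s k')) (3 * l.length + 1) := by
    intro l
    induction l with
    | nil =>
      intro s hl
      refine (Exec.loop_nil hl).of_eq ?_
      funext r
      by_cases e1 : r = k' <;> by_cases e2 : r = k <;> by_cases e3 : r = .m .tmp <;>
        simp_all [update_apply]
    | cons b l ih =>
      intro s hl
      have h := ih (update (update (update s (.m .tmp) l) k (b :: s k)) k' (b :: s k'))
        (by simp [h1.symm, h2.symm])
      rw [show 3 * (b :: l).length + 1 = 1 + (1 + 1) + (3 * l.length + 1) by simp; omega]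
      have hp : Exec (seq (push k b) (push k' b)) (update s (.m .tmp) l)
          (update (update (update s (.m .tmp) l) k (b :: s k)) k' (b :: s k')) (1 + 1) := by
        refine (Exec.seq (Exec.push _ b _) (Exec.push k' b _)).of_eq ?_
        simp [update_of_ne hk.symm, update_of_ne h1, update_of_ne h2]
      have e : update (update (update (update (update (update s (.m .tmp) l) k (b :: s k)) k'
            (b :: s k')) (.m .tmp) []) k (l.reverse ++ (update (update (update s (.m .tmp) l) k
            (b :: s k)) k' (b :: s k')) k)) k' (l.reverse ++
            (update (update (update s (.m .tmp) l) k (b :: s k)) k' (b :: s k')) k') =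
            update (update (update s (.m .tmp) []) k ((b :: l).reverse ++ s k)) k'
            ((b :: l).reverse ++ s k') := by
        funext r
        by_cases e1 : r = k' <;> by_cases e2 : r = k <;> by_cases e3 : r = .m .tmp <;>
          simp_all [update_apply, Ne.symm]
      cases b
      · exact (Exec.loop_false hl hp h).of_eq e
      · exact (Exec.loop_true hl hp h).of_eq e
  have h := Exec.seq (exec_move h1 s) (main _ _ rfl)
  rw [show 5 * (s k).length + 2 = 2 * (s k).length + 1 + (3 * (s k).length + 1) by omega]
  have hlen : (update (update s k []) (.m .tmp) ((s k).reverse ++ s (.m .tmp))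
     (.m .tmp)).length = (s k).length := by
    simp [hs]
  rw [hlen] at h
  refine h.of_eq ?_
  funext r
  by_cases e1 : r = k' <;> by_cases e2 : r = k <;> by_cases e3 : r = .m .tmp <;>
    simp_all [update_apply, Ne.symm]

/-- Add the unary number in front of the stack `k` to `k'`. -/
def readNat (k k' : Reg) : RProg := loop k true skip (push k' true)

end Prog

/-- Read a number off a string; the end of the string counts as a zero. -/
def parseNat : List Bool → ℕ × List Bool
  | [] => (0, [])
  | false :: l => (0, l)
  | true :: l => ((parseNat l).1 + 1, (parseNat l).2)

/-- Each unit of the value uses up one bit. Numbers read from the input, and the number of passes of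
loops over it, are thereby bounded by its length. -/
theorem parseNat_length (l : List Bool) : (parseNat l).1 + (parseNat l).2.length ≤ l.length := by
  induction l with
  | nil => simp [parseNat]
  | cons b l ih => cases b <;> simp [parseNat]; omega

theorem parseNat_encNat (n : ℕ) (l : List Bool) : parseNat (encNat n ++ l) = (n, l) := by
  induction n with
  | zero => simp [encNat, parseNat]
  | succ n ih => simp [encNat, parseNat, ih]

theorem encNat_eq (n : ℕ) : encNat n = List.replicate n true ++ [false] := by
  induction n with
  | zero => rfl
  | succ n ih => simp [encNat, ih, List.replicate_succ]

theorem Prog.exec_readNat {k k' : Reg} (hk : k ≠ k') (s : Stacks) :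
    Exec (readNat k k') s (update (update s k (parseNat (s k)).2) k'
      (List.replicate (parseNat (s k)).1 true ++ s k')) (2 * (parseNat (s k)).1 + 1) := by
  generalize hl : s k = l
  induction l generalizing s with
  | nil =>
    refine (Exec.loop_nil hl).of_eq ?_
    simp only [parseNat]
    rw [← hl, update_eq_self]
    simp
  | cons b l ih =>
    cases b
    · refine (Exec.loop_break hl).of_eq ?_
      funext r
      by_cases e1 : r = k' <;> by_cases e2 : r = k <;> simp_all [update_apply, parseNat, Ne.symm]
    · have h := ih (update (update s k l) k' (true :: s k')) (by simp [hk])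
      have hp : Exec (push k' true) (update s k l) (update (update s k l) k' (true :: s k')) 1 := by
        simpa [update_of_ne hk.symm] using Exec.push k' true (update s k l)
      have := Exec.loop_true (brk := true) (pf := skip) hl hp h
      rw [show 2 * (parseNat (true :: l)).1 + 1 = 1 + 1 + (2 * (parseNat l).1 + 1) by
        simp [parseNat]; omega]
      refine this.of_eq ?_
      funext r
      by_cases e1 : r = k' <;> by_cases e2 : r = k <;>
        simp_all [update_apply, parseNat, List.replicate_succ', Ne.symm]

end QMABalance

namespace QMABalance

open Function

/-! ### Emitting encoded gates -/

/-- An affine expression: a constant plus the lengths of some registers. -/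
structure Fld (R : Type) where
  c : ℕ
  rs : List R

namespace Fld

variable {R : Type}

def val (len : R → ℕ) (f : Fld R) : ℕ := f.c + (f.rs.map len).sum

def map {R' : Type} (g : R → R') (f : Fld R) : Fld R' := ⟨f.c, f.rs.map g⟩

theorem val_map {R' : Type} (g : R → R') (len : R' → ℕ) (f : Fld R) :
    (f.map g).val len = f.val (len ∘ g) := by
  simp [val, map]

/-- Bound for the time to write the value of the expression. -/
def cost (B : ℕ) (f : Fld R) : ℕ := f.rs.length * (5 * B + 2) + f.c + 3

theorem cost_map {R' : Type} (g : R → R') (B : ℕ) (f : Fld R) : (f.map g).cost B = f.cost B := by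
  simp [cost, map]

/-- The time bound for writing an expression also bounds its value. It can therefore serve as a
bound for the number of passes of a loop; the slack 3 absorbs the end marker of the unary code and
small constants. -/
theorem val_le_cost {len : R → ℕ} {B : ℕ} {f : Fld R} (h : ∀ r ∈ f.rs, len r ≤ B) :
    f.val len + 3 ≤ f.cost B := by
  have : (f.rs.map len).sum ≤ f.rs.length * (5 * B + 2) := by
    have := List.sum_le_card_nsmul (f.rs.map len) (5 * B + 2) (by
      intro x hx
      obtain ⟨r, hr, rfl⟩ := List.mem_map.1 hx
      have := h r hr
      omega)
    simpa using this
  simp only [val, cost]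
  omega

end Fld

/-- Gates whose qubit numbers are affine expressions. -/
inductive GateF (R : Type)
  | x (a : Fld R)
  | h (a : Fld R)
  | cnot (a b : Fld R)
  | ccx (a b c : Fld R)

namespace GateF

variable {R : Type}

/-- The tag 2 of the phase gate is missing on purpose: the verifier uses only gates that are their
own inverses. -/
def tag : GateF R → ℕ
  | x _ => 0
  | h _ => 1
  | cnot _ _ => 3
  | ccx _ _ _ => 4

def fields : GateF R → List (Fld R)
  | x a => [a]
  | h a => [a]
  | cnot a b => [a, b]
  | ccx a b c => [a, b, c]

def toQ (len : R → ℕ) : GateF R → QGate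
  | x a => .x (a.val len)
  | h a => .h (a.val len)
  | cnot a b => .cnot (a.val len) (b.val len)
  | ccx a b c => .ccx (a.val len) (b.val len) (c.val len)

def map {R' : Type} (g : R → R') : GateF R → GateF R'
  | x a => .x (a.map g)
  | h a => .h (a.map g)
  | cnot a b => .cnot (a.map g) (b.map g)
  | ccx a b c => .ccx (a.map g) (b.map g) (c.map g)

theorem toQ_map {R' : Type} (f : R → R') (len : R' → ℕ) (g : GateF R) :
    (g.map f).toQ len = g.toQ (len ∘ f) := by
  cases g <;> simp [toQ, map, Fld.val_map]

/-- Bound for the time to write the gate. -/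
def cost (B : ℕ) (g : GateF R) : ℕ := g.tag + 5 + (g.fields.map (Fld.cost B)).sum

theorem cost_map {R' : Type} (f : R → R') (B : ℕ) (g : GateF R) :
    (g.map f).cost B = g.cost B := by
  cases g <;> simp [cost, map, fields, tag, Fld.cost_map]

end GateF

/-- An entry of an encoded gate list. -/
def entryCode (g : QGate) : List Bool := true :: encQGate g

theorem entryCode_toQ {R : Type} (len : R → ℕ) (g : GateF R) :
    entryCode (g.toQ len) = true :: (encNat g.tag ++ g.fields.flatMap fun f => encNat (f.val len)) := by
  cases g <;> simp [entryCode, encQGate, GateF.toQ, GateF.tag, GateF.fields]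

theorem length_flatMap_encNat {R : Type} (len : R → ℕ) (B : ℕ) (fs : List (Fld R))
    (h : ∀ f ∈ fs, ∀ r ∈ f.rs, len r ≤ B) :
    (fs.flatMap fun f => encNat (f.val len)).length ≤ (fs.map (Fld.cost B)).sum := by
  induction fs with
  | nil => simp
  | cons f fs ih =>
    have h1 := Fld.val_le_cost (h f (by simp))
    have h2 := ih fun g hg => h g (by simp [hg])
    simp only [List.flatMap_cons, List.length_append, List.map_cons, List.sum_cons, encNat_eq,
      List.length_replicate, List.length_singleton] at h2 ⊢
    omega

theorem length_entryCode_le {R : Type} (len : R → ℕ) (B : ℕ) (g : GateF R)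
    (h : ∀ f ∈ g.fields, ∀ r ∈ f.rs, len r ≤ B) :
    (entryCode (g.toQ len)).length ≤ g.cost B := by
  rw [entryCode_toQ]
  have := length_flatMap_encNat len B g.fields h
  simp only [List.length_cons, List.length_append, encNat_eq, List.length_replicate, List.length_nil,
    GateF.cost] at this ⊢
  omega

/-- The lengths of the registers. -/
def lens (s : Stacks) : Reg → ℕ := fun r => (s r).length

/-- `Runs p s s' T`: the program `p` takes `s` to `s'` within `T` steps. -/
def Runs (p : RProg) (s s' : Stacks) (T : ℕ) : Prop := ∃ t ≤ T, Prog.Exec p s s' t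

namespace Runs

theorem seq {p q : RProg} {s s₁ s₂ : Stacks} {a b : ℕ} (h : Runs p s s₁ a) (h' : Runs q s₁ s₂ b) :
    Runs (.seq p q) s s₂ (a + b) := by
  obtain ⟨t, ht, h⟩ := h
  obtain ⟨t', ht', h'⟩ := h'
  exact ⟨t + t', by omega, h.seq h'⟩

theorem mono {p : RProg} {s s' : Stacks} {a b : ℕ} (h : Runs p s s' a) (hab : a ≤ b) :
    Runs p s s' b := by
  obtain ⟨t, ht, h⟩ := h
  exact ⟨t, by omega, h⟩

theorem of_eq {p : RProg} {s s' s'' : Stacks} {a b : ℕ} (h : Runs p s s' a) (e : s' = s'')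
    (hab : a ≤ b) : Runs p s s'' b := e ▸ h.mono hab

theorem of_exec {p : RProg} {s s' : Stacks} {t : ℕ} (h : Prog.Exec p s s' t) : Runs p s s' t :=
  ⟨t, le_rfl, h⟩

end Runs

namespace Prog

/-- Push the value of an affine expression in unary. -/
def pushVal (k : Reg) (c : ℕ) : List Reg → RProg
  | [] => pushN k c
  | r :: rs => seq (addLen r k) (pushVal k c rs)

theorem runs_pushVal {k : Reg} {B : ℕ} (hk : k ≠ .m .tmp) (c : ℕ) (rs : List Reg) (s : Stacks)
    (hs : s (.m .tmp) = []) (h1 : ∀ r ∈ rs, r ≠ k) (h2 : ∀ r ∈ rs, r ≠ .m .tmp)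
    (hB : ∀ r ∈ rs, (s r).length ≤ B) :
    Runs (pushVal k c rs) s (update s k
      (List.replicate (Fld.val (lens s) ⟨c, rs⟩) true ++ s k)) (rs.length * (5 * B + 2) + c + 1) := by
  induction rs generalizing s with
  | nil => exact (Runs.of_exec (exec_pushN k c s)).of_eq (by simp [Fld.val]) (by simp)
  | cons r rs ih =>
    have hr := hB r (by simp)
    have a := Runs.of_exec (exec_addLen (h1 r (by simp)) (h2 r (by simp)) hk s hs)
    have b := ih (update s k (List.replicate (s r).length true ++ s k)) (by
        rw [update_of_ne hk.symm, hs]) (fun q hq => h1 q (by simp [hq]))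
      (fun q hq => h2 q (by simp [hq])) (fun q hq => by
        rw [update_of_ne (h1 q (by simp [hq]))]
        exact hB q (by simp [hq]))
    refine (a.seq b).of_eq ?_ (by simp only [List.length_cons]; ring_nf; omega)
    have e : Fld.val (lens (update s k (List.replicate (s r).length true ++ s k))) ⟨c, rs⟩ =
        Fld.val (lens s) ⟨c, rs⟩ := by
      simp only [Fld.val]
      congr 2
      refine List.map_congr_left fun q hq => ?_
      simp [lens, update_of_ne (h1 q (by simp [hq]))]
    rw [e]
    simp only [update_idem, update_self]
    congr 1
    rw [← List.append_assoc, List.replicate_append_replicate]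
    congr 2
    simp only [Fld.val, List.map_cons, List.sum_cons, lens]
    omega

/-- Conditions under which an expression can be written onto `k`. -/
def FldOK (k : Reg) (s : Stacks) (B : ℕ) (f : Fld Reg) : Prop :=
  ∀ r ∈ f.rs, r ≠ k ∧ r ≠ .m .tmp ∧ (s r).length ≤ B

theorem FldOK.update {k : Reg} {s : Stacks} {B : ℕ} {f : Fld Reg} (h : FldOK k s B f)
    (l : List Bool) : FldOK k (update s k l) B f := fun r hr => by
  obtain ⟨h1, h2, h3⟩ := h r hr
  exact ⟨h1, h2, by rwa [update_of_ne h1]⟩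

theorem FldOK.val_update {k : Reg} {s : Stacks} {B : ℕ} {f : Fld Reg} (h : FldOK k s B f)
    (l : List Bool) : f.val (lens (Function.update s k l)) = f.val (lens s) := by
  simp only [Fld.val]
  congr 2
  refine List.map_congr_left fun q hq => ?_
  simp [lens, update_of_ne (h q hq).1]

theorem flatMap_val_update {k : Reg} {s : Stacks} {B : ℕ} {fs : List (Fld Reg)}
    (h : ∀ f ∈ fs, FldOK k s B f) (l : List Bool) :
    (fs.flatMap fun f => encNat (f.val (lens (Function.update s k l)))) =
      fs.flatMap fun f => encNat (f.val (lens s)) := by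
  induction fs with
  | nil => rfl
  | cons f fs ih =>
    rw [List.flatMap_cons, List.flatMap_cons, (h f (by simp)).val_update,
      ih fun g hg => h g (by simp [hg])]

/-- Write the codes of the values of expressions onto `k`, the last bit ending up on top. -/
def numsFwd (k : Reg) : List (Fld Reg) → RProg
  | [] => skip
  | f :: fs => seq (pushVal k f.c f.rs) (seq (push k false) (numsFwd k fs))

/-- Write the codes of the values of expressions onto `k`, the first bit ending up on top. -/
def numsBwd (k : Reg) : List (Fld Reg) → RProg
  | [] => skip
  | f :: fs => seq (numsBwd k fs) (seq (push k false) (pushVal k f.c f.rs))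

theorem runs_numsFwd {k : Reg} {B : ℕ} (hk : k ≠ .m .tmp) (fs : List (Fld Reg)) (s : Stacks)
    (hs : s (.m .tmp) = []) (h : ∀ f ∈ fs, FldOK k s B f) :
    Runs (numsFwd k fs) s (update s k
      ((fs.flatMap fun f => encNat (f.val (lens s))).reverse ++ s k))
      ((fs.map (Fld.cost B)).sum + 1) := by
  induction fs generalizing s with
  | nil => exact (Runs.of_exec (Exec.skip s)).of_eq (by simp) (by simp)
  | cons f fs ih =>
    have hf := h f (by simp)
    have a := runs_pushVal hk f.c f.rs s hs (fun r hr => (hf r hr).1) (fun r hr => (hf r hr).2.1)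
      (fun r hr => (hf r hr).2.2)
    have b := Runs.of_exec (Exec.push k false (update s k
      (List.replicate (Fld.val (lens s) ⟨f.c, f.rs⟩) true ++ s k)))
    have hfs : ∀ g ∈ fs, FldOK k s B g := fun g hg => h g (by simp [hg])
    simp only [update_idem, update_self] at b
    have c := ih (update s k (false :: (List.replicate (Fld.val (lens s) ⟨f.c, f.rs⟩) true ++ s k)))
      (by rw [update_of_ne hk.symm, hs]) (fun g hg => (hfs g hg).update _)
    refine (a.seq (b.seq c)).of_eq ?_ ?_
    · rw [flatMap_val_update hfs]
      simp [encNat_eq]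
    · simp only [List.map_cons, List.sum_cons, Fld.cost]
      omega

theorem runs_numsBwd {k : Reg} {B : ℕ} (hk : k ≠ .m .tmp) (fs : List (Fld Reg)) (s : Stacks)
    (hs : s (.m .tmp) = []) (h : ∀ f ∈ fs, FldOK k s B f) :
    Runs (numsBwd k fs) s (update s k
      ((fs.flatMap fun f => encNat (f.val (lens s))) ++ s k))
      ((fs.map (Fld.cost B)).sum + 1) := by
  induction fs generalizing s with
  | nil => exact (Runs.of_exec (Exec.skip s)).of_eq (by simp) (by simp)
  | cons f fs ih =>
    have hfs : ∀ g ∈ fs, FldOK k s B g := fun g hg => h g (by simp [hg])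
    have a := ih s hs hfs
    have b := Runs.of_exec (Exec.push k false (update s k
      ((fs.flatMap fun f => encNat (f.val (lens s))) ++ s k)))
    simp only [update_idem, update_self] at b
    have hf := (h f (by simp)).update (false :: ((fs.flatMap fun f => encNat (f.val (lens s))) ++ s k))
    have c := runs_pushVal hk f.c f.rs _ (by rw [update_of_ne hk.symm, hs])
      (fun r hr => (hf r hr).1) (fun r hr => (hf r hr).2.1) (fun r hr => (hf r hr).2.2)
    refine (a.seq (b.seq c)).of_eq ?_ ?_
    · have e := (h f (by simp)).val_update
        (false :: ((fs.flatMap fun f => encNat (f.val (lens s))) ++ s k))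
      simp only [update_idem, update_self, List.flatMap_cons, encNat_eq]
      simp only [encNat_eq] at e
      erw [e]
      simp
    · simp only [List.map_cons, List.sum_cons, Fld.cost]
      omega

/-- Append the entry of a gate to the reversed output. -/
def emitFwd (g : GateF Reg) : RProg :=
  seq (push (.m .fwd) true) (seq (pushN (.m .fwd) g.tag) (seq (push (.m .fwd) false)
    (numsFwd (.m .fwd) g.fields)))

/-- Put the entry of a gate in front of the stack of gates to be undone. -/
def emitBwd (g : GateF Reg) : RProg :=
  seq (numsBwd (.m .bwd) g.fields) (seq (push (.m .bwd) false) (seq (pushN (.m .bwd) g.tag)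
    (push (.m .bwd) true)))

/-- The stack `fwd` contains the output backwards, its most recent bit on top. The pieces of a code
word are therefore pushed in reading order. -/
theorem runs_emitFwd {B : ℕ} (g : GateF Reg) (s : Stacks) (hs : s (.m .tmp) = [])
    (h : ∀ f ∈ g.fields, FldOK (.m .fwd) s B f) :
    Runs (emitFwd g) s (update s (.m .fwd) ((entryCode (g.toQ (lens s))).reverse ++ s (.m .fwd)))
      (g.cost B) := by
  have a := Runs.of_exec (Exec.push (.m .fwd) true s)
  have b := Runs.of_exec (exec_pushN (.m .fwd) g.tag (update s (.m .fwd) (true :: s (.m .fwd))))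
  simp only [update_idem, update_self] at b
  have c := Runs.of_exec (Exec.push (.m .fwd) false (update s (.m .fwd)
    (List.replicate g.tag true ++ true :: s (.m .fwd))))
  simp only [update_idem, update_self] at c
  have d := runs_numsFwd (B := B) (k := .m .fwd) (by simp) g.fields
    (update s (.m .fwd) (false :: (List.replicate g.tag true ++ true :: s (.m .fwd))))
    (by simpa using hs) (fun f hf => (h f hf).update _)
  refine (a.seq (b.seq (c.seq d))).of_eq ?_ ?_
  · rw [flatMap_val_update h, entryCode_toQ]
    simp [encNat_eq]
  · simp only [GateF.cost]
    omega

/-- Here the pieces are pushed last to first, so `bwd` read from the top lists the most recent gate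
first: the code of the inverse of the gate list emitted so far. -/
theorem runs_emitBwd {B : ℕ} (g : GateF Reg) (s : Stacks) (hs : s (.m .tmp) = [])
    (h : ∀ f ∈ g.fields, FldOK (.m .bwd) s B f) :
    Runs (emitBwd g) s (update s (.m .bwd) (entryCode (g.toQ (lens s)) ++ s (.m .bwd)))
      (g.cost B) := by
  have a := runs_numsBwd (B := B) (k := .m .bwd) (by simp) g.fields s hs h
  have b := Runs.of_exec (Exec.push (.m .bwd) false (update s (.m .bwd)
    ((g.fields.flatMap fun f => encNat (f.val (lens s))) ++ s (.m .bwd))))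
  simp only [update_idem, update_self] at b
  have c := Runs.of_exec (exec_pushN (.m .bwd) g.tag (update s (.m .bwd)
    (false :: ((g.fields.flatMap fun f => encNat (f.val (lens s))) ++ s (.m .bwd)))))
  simp only [update_idem, update_self] at c
  have d := Runs.of_exec (Exec.push (.m .bwd) true (update s (.m .bwd) (List.replicate g.tag true ++
    (false :: ((g.fields.flatMap fun f => encNat (f.val (lens s))) ++ s (.m .bwd))))))
  simp only [update_idem, update_self] at d
  refine (a.seq (b.seq (c.seq d))).of_eq ?_ ?_
  · rw [entryCode_toQ]
    simp [encNat_eq]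
  · simp only [GateF.cost]
    omega

end Prog

end QMABalance

/-! ### Total parsers for lists of numbers and lists of Boolean gates -/

namespace QMABalance

open Function

theorem parseNat_snd_length_le (l : List Bool) : (parseNat l).2.length ≤ l.length := by
  have := parseNat_length l
  omega

/-- Read a list of numbers off a string. -/
def parseNats : List Bool → List ℕ × List Bool
  | [] => ([], [])
  | false :: l => ([], l)
  | true :: l =>
    ((parseNat l).1 :: (parseNats (parseNat l).2).1, (parseNats (parseNat l).2).2)
termination_by l => l.length
decreasing_by all_goals simpa using Nat.lt_succ_of_le (parseNat_snd_length_le l)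

/-- Read a gate off a string; every tag other than `0` and `1` is taken for a disjunction. -/
def parseGate (l : List Bool) : BoolGate × List Bool :=
  let t := parseNat l
  let a := parseNat t.2
  if t.1 = 0 then (.not a.1, a.2)
  else
    let b := parseNat a.2
    if t.1 = 1 then (.and a.1 b.1, b.2) else (.or a.1 b.1, b.2)

theorem parseGate_snd_length_le (l : List Bool) : (parseGate l).2.length ≤ l.length := by
  have h1 := parseNat_snd_length_le l
  have h2 := parseNat_snd_length_le (parseNat l).2
  have h3 := parseNat_snd_length_le (parseNat (parseNat l).2).2
  simp only [parseGate]
  split_ifs <;> simp only <;> omega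

/-- Read a list of gates off a string. -/
def parseGates : List Bool → List BoolGate × List Bool
  | [] => ([], [])
  | false :: l => ([], l)
  | true :: l =>
    ((parseGate l).1 :: (parseGates (parseGate l).2).1, (parseGates (parseGate l).2).2)
termination_by l => l.length
decreasing_by all_goals simpa using Nat.lt_succ_of_le (parseGate_snd_length_le l)

theorem parseNats_encList (ns : List ℕ) (l : List Bool) :
    parseNats (encList encNat ns ++ l) = (ns, l) := by
  induction ns with
  | nil => simp [encList, parseNats]
  | cons n ns ih => simp [encList, parseNats, parseNat_encNat, ih]

theorem parseGate_encBoolGate (g : BoolGate) (l : List Bool) :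
    parseGate (encBoolGate g ++ l) = (g, l) := by
  cases g <;> simp [encBoolGate, parseGate, parseNat_encNat]

theorem parseGates_encList (gs : List BoolGate) (l : List Bool) :
    parseGates (encList encBoolGate gs ++ l) = (gs, l) := by
  induction gs with
  | nil => simp [encList, parseGates]
  | cons n ns ih => simp [encList, parseGates, parseGate_encBoolGate, ih]

/-! ### A language for emitting families of tests -/

/-- An instruction: append a gate to the current list, or end the list and test the qubit `q`. -/
inductive Item
  | gate (g : QGate)
  | mark (q : ℕ)

/-- Programs that emit instructions. The loops set the registers `idx i`, `arg i`, `arg' i`. -/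
inductive Cmd
  | nop
  | gate (g : GateF DReg)
  | mark (f : Fld DReg)
  | seq (c c' : Cmd)
  /-- Loop over the numbers below a bound. -/
  | forLen (i : Fin 4) (f : Fld DReg) (c : Cmd)
  /-- Loop over the positions of the ones among the binary digits. -/
  | forBits (i : Fin 4) (f : Fld DReg) (c : Cmd)
  /-- Loop over a list of numbers. -/
  | forNats (i : Fin 4) (r : DReg) (c : Cmd)
  /-- Loop over a list of Boolean gates. -/
  | forGates (i : Fin 4) (r : DReg) (cn ca co : Cmd)

abbrev Env := DReg → List Bool

def Env.len (e : Env) : DReg → ℕ := fun r => (e r).length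

/-- Store a number in unary. -/
def Env.set (e : Env) (r : DReg) (n : ℕ) : Env := update e r (List.replicate n true)

namespace Cmd

/-- The instructions emitted for the positions `k, k + 1, …` of a list of numbers. -/
def natsSem (e : Env) (i : Fin 4) (sem : Env → List Item) : ℕ → List ℕ → List Item
  | _, [] => []
  | k, n :: ns => sem ((e.set (.idx i) k).set (.arg i) n) ++ natsSem e i sem (k + 1) ns

/-- The instructions emitted for one Boolean gate. -/
def gateSem (e : Env) (i : Fin 4) (sn sa so : Env → List Item) : BoolGate → List Item
  | .not a => sn (e.set (.arg i) a)
  | .and a b => sa ((e.set (.arg i) a).set (.arg' i) b)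
  | .or a b => so ((e.set (.arg i) a).set (.arg' i) b)

/-- The instructions emitted for the positions `k, k + 1, …` of a list of Boolean gates. -/
def gatesSem (e : Env) (i : Fin 4) (sn sa so : Env → List Item) : ℕ → List BoolGate → List Item
  | _, [] => []
  | k, g :: gs => gateSem (e.set (.idx i) k) i sn sa so g ++ gatesSem e i sn sa so (k + 1) gs

/-- The instructions emitted by a command. -/
def sem : Cmd → Env → List Item
  | nop, _ => []
  | gate g, e => [.gate (g.toQ e.len)]
  | mark f, e => [.mark (f.val e.len)]
  | seq c c', e => c.sem e ++ c'.sem e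
  | forLen i f c, e =>
    (List.range' 0 (f.val e.len)).flatMap fun k => c.sem (e.set (.idx i) k)
  | forBits i f c, e => (List.range' 0 (f.val e.len)).flatMap fun k =>
      if (f.val e.len).testBit k then c.sem (e.set (.idx i) k) else []
  | forNats i r c, e => natsSem e i c.sem 0 (parseNats (e r)).1
  | forGates i r cn ca co, e => gatesSem e i cn.sem ca.sem co.sem 0 (parseGates (e r)).1

/-- Nested loops have increasing levels. -/
def WF : Cmd → ℕ → Prop
  | nop, _ => True
  | gate _, _ => True
  | mark _, _ => True
  | seq c c', d => c.WF d ∧ c'.WF d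
  | forLen i _ c, d => d ≤ i ∧ c.WF (i + 1)
  | forBits i _ c, d => d ≤ i ∧ c.WF (i + 1)
  | forNats i _ c, d => d ≤ i ∧ c.WF (i + 1)
  | forGates i _ cn ca co, d => d ≤ i ∧ cn.WF (i + 1) ∧ ca.WF (i + 1) ∧ co.WF (i + 1)

end Cmd

/-- The registers that describe the output so far. -/
structure Out where
  fwd : List Bool
  bwd : List Bool
  cnt : List Bool

/-- Execute an instruction; `N` is the number of the first test qubit. -/
def Item.step (N : ℕ) (o : Out) : Item → Out
  | .gate g => ⟨(entryCode g).reverse ++ o.fwd, entryCode g ++ o.bwd, o.cnt⟩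
  | .mark q => ⟨o.bwd.reverse ++
      ((entryCode (.ccx (N + o.cnt.length) q (N + o.cnt.length + 1))).reverse ++ o.fwd), [],
      true :: o.cnt⟩

def runItems (N : ℕ) (is : List Item) (o : Out) : Out := is.foldl (Item.step N) o

theorem runItems_append (N : ℕ) (is js : List Item) (o : Out) :
    runItems N (is ++ js) o = runItems N js (runItems N is o) := by
  simp [runItems]

/-- Only a mark lengthens the counter, and by one. A bound for the number of instructions is thus a
bound for the counter at all times, which controls the cost of the record gates. -/
theorem runItems_cnt_length (N : ℕ) (is : List Item) (o : Out) :
    (runItems N is o).cnt.length ≤ o.cnt.length + is.length := by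
  induction is generalizing o with
  | nil => simp [runItems]
  | cons i is ih =>
    have := ih (i.step N o)
    simp only [runItems, List.foldl_cons, List.length_cons] at this ⊢
    cases i <;> simp only [Item.step, List.length_cons] at this ⊢ <;> omega

namespace Stacks

def out (s : Stacks) : Out := ⟨s (.m .fwd), s (.m .bwd), s (.m .cnt)⟩

def env (s : Stacks) : Env := fun r => s (.d r)

/-- These three stacks are all that a command changes in the end; every loop register is restored.
-/
def put (s : Stacks) (o : Out) : Stacks :=
  update (update (update s (.m .fwd) o.fwd) (.m .bwd) o.bwd) (.m .cnt) o.cnt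

/-- The number of the first test qubit. -/
def base (s : Stacks) : ℕ := 1 + 11 * (s (.d .len)).length

@[simp] theorem out_put (s : Stacks) (o : Out) : (s.put o).out = o := by
  simp [out, put]

@[simp] theorem put_d (s : Stacks) (o : Out) (r : DReg) : s.put o (.d r) = s (.d r) := by
  simp [put]

@[simp] theorem put_loop (s : Stacks) (o : Out) (i : Fin 4) :
    s.put o (.m (.loop i)) = s (.m (.loop i)) := by
  simp [put]

@[simp] theorem put_scratch (s : Stacks) (o : Out) (i : Fin 4) :
    s.put o (.m (.scratch i)) = s (.m (.scratch i)) := by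
  simp [put]

@[simp] theorem put_tmp (s : Stacks) (o : Out) : s.put o (.m .tmp) = s (.m .tmp) := by
  simp [put]

@[simp] theorem put_half (s : Stacks) (o : Out) : s.put o (.m .half) = s (.m .half) := by
  simp [put]

@[simp] theorem put_tag (s : Stacks) (o : Out) : s.put o (.m .tag) = s (.m .tag) := by
  simp [put]

@[simp] theorem put_fwd (s : Stacks) (o : Out) : s.put o (.m .fwd) = o.fwd := by
  simp [put]

@[simp] theorem put_bwd (s : Stacks) (o : Out) : s.put o (.m .bwd) = o.bwd := by
  simp [put]

@[simp] theorem put_cnt (s : Stacks) (o : Out) : s.put o (.m .cnt) = o.cnt := by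
  simp [put]

@[simp] theorem put_inn (s : Stacks) (o : Out) : s.put o (.m .inn) = s (.m .inn) := by
  simp [put]

@[simp] theorem put_out (s : Stacks) (o : Out) : s.put o (.m .out) = s (.m .out) := by
  simp [put]

@[simp] theorem env_put (s : Stacks) (o : Out) : (s.put o).env = s.env := by
  funext r; simp [env]

@[simp] theorem base_put (s : Stacks) (o : Out) : (s.put o).base = s.base := by
  simp [base]

theorem put_out_self (s : Stacks) : s.put s.out = s := by
  simp [put, out]

@[simp] theorem put_put (s : Stacks) (o o' : Out) : (s.put o).put o' = s.put o' := by
  funext r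
  rcases r with r | r
  · cases r <;> simp
  · simp

@[simp] theorem env_update_m (s : Stacks) (r : MReg) (l : List Bool) :
    env (update s (.m r) l) = s.env := by
  funext q; simp [env]

@[simp] theorem env_update_d (s : Stacks) (r : DReg) (l : List Bool) :
    env (update s (.d r) l) = update s.env r l := by
  funext q; simp [env, update_apply]

/-- The registers of the loops from level `d` on are empty. -/
structure Clean (d : ℕ) (s : Stacks) : Prop where
  tmp : s (.m .tmp) = []
  half : s (.m .half) = []
  tag : s (.m .tag) = []
  loop : ∀ i : Fin 4, d ≤ i → s (.m (.loop i)) = []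
  scratch : ∀ i : Fin 4, d ≤ i → s (.m (.scratch i)) = []
  idx : ∀ i : Fin 4, d ≤ i → s (.d (.idx i)) = []
  arg : ∀ i : Fin 4, d ≤ i → s (.d (.arg i)) = []
  arg' : ∀ i : Fin 4, d ≤ i → s (.d (.arg' i)) = []

end Stacks

/-- `p` takes `s` to `s'`; its running time is `τ` up to three times the change of the length of
the stack `bwd`. -/
def Amort (p : RProg) (s s' : Stacks) (τ : ℕ) : Prop :=
  ∃ t, Prog.Exec p s s' t ∧ t + 3 * (s' (.m .bwd)).length ≤ τ + 3 * (s (.m .bwd)).length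

namespace Amort

open Prog

theorem of_runs {p : RProg} {s s' : Stacks} {τ : ℕ} (h : Runs p s s' τ)
    (hb : s' (.m .bwd) = s (.m .bwd)) : Amort p s s' τ := by
  obtain ⟨t, ht, h⟩ := h
  exact ⟨t, h, by rw [hb]; omega⟩

theorem of_exec {p : RProg} {s s' : Stacks} {τ : ℕ} (h : Exec p s s' τ)
    (hb : s' (.m .bwd) = s (.m .bwd)) : Amort p s s' τ := of_runs (.of_exec h) hb

theorem seq {p q : RProg} {s s₁ s₂ : Stacks} {a b : ℕ} (h : Amort p s s₁ a)
    (h' : Amort q s₁ s₂ b) : Amort (.seq p q) s s₂ (a + b) := by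
  obtain ⟨t, h, ht⟩ := h
  obtain ⟨t', h', ht'⟩ := h'
  exact ⟨t + t', h.seq h', by omega⟩

theorem of_eq {p : RProg} {s s' s'' : Stacks} {a b : ℕ} (h : Amort p s s' a) (e : s' = s'')
    (hab : a ≤ b) : Amort p s s'' b := by
  subst e
  obtain ⟨t, h, ht⟩ := h
  exact ⟨t, h, by omega⟩

/-- The popped stack must not be `bwd`, whose length is the potential of the amortized count. -/
theorem loop_true {k : Reg} (hk : k ≠ .m .bwd) {brk : Bool} {pf pt : RProg} {s s₁ s₂ : Stacks}
    {l : List Bool} {a b : ℕ} (hs : s k = true :: l) (h : Amort pt (update s k l) s₁ a)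
    (h' : Amort (.loop k brk pf pt) s₁ s₂ b) : Amort (.loop k brk pf pt) s s₂ (1 + a + b) := by
  obtain ⟨t, h, ht⟩ := h
  obtain ⟨t', h', ht'⟩ := h'
  rw [update_of_ne hk.symm] at ht
  exact ⟨1 + t + t', .loop_true hs h h', by omega⟩

theorem loop_nil {k : Reg} {brk : Bool} {pf pt : RProg} {s : Stacks} (hs : s k = []) :
    Amort (.loop k brk pf pt) s s 1 :=
  of_exec (.loop_nil hs) rfl

theorem loop_break {k : Reg} (hk : k ≠ .m .bwd) {pf pt : RProg} {s : Stacks} {l : List Bool}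
    (hs : s k = false :: l) : Amort (.loop k true pf pt) s (update s k l) 1 :=
  of_exec (.loop_break hs) (by rw [update_of_ne hk.symm])

theorem case_nil {k : Reg} {pe pf pt : RProg} {s s' : Stacks} {a : ℕ} (hs : s k = [])
    (h : Amort pe s s' a) : Amort (.case k pe pf pt) s s' (1 + a) := by
  obtain ⟨t, h, ht⟩ := h
  exact ⟨1 + t, .case_nil hs h, by omega⟩

theorem case_true {k : Reg} (hk : k ≠ .m .bwd) {pe pf pt : RProg} {s s' : Stacks} {l : List Bool}
    {a : ℕ} (hs : s k = true :: l) (h : Amort pt (update s k l) s' a) :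
    Amort (.case k pe pf pt) s s' (1 + a) := by
  obtain ⟨t, h, ht⟩ := h
  rw [update_of_ne hk.symm] at ht
  exact ⟨1 + t, .case_true hs h, by omega⟩

end Amort

/-! ### Translation of commands into stack programs, with cost bounds -/

namespace Cmd

open Prog

/-- The gate that records the outcome of a test. -/
def recordGate (f : Fld DReg) : GateF Reg :=
  .ccx ⟨1, List.replicate 11 (.d .len) ++ [.m .cnt]⟩ (f.map .d)
    ⟨2, List.replicate 11 (.d .len) ++ [.m .cnt]⟩

/-- Halve the unary number in `scratch i`; the remainder goes to `tag`. -/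
def halve (i : Fin 4) : RProg :=
  .seq (.loop (.m (.scratch i)) false .skip
      (.case (.m (.scratch i)) (.push (.m .tag) true) .skip (.push (.m .half) true)))
    (move (.m .half) (.m (.scratch i)))

/-- The program that emits the instructions of a command. -/
def prog : Cmd → RProg
  | nop => .skip
  | gate g => .seq (emitFwd (g.map .d)) (emitBwd (g.map .d))
  | mark f => .seq (emitFwd (recordGate f)) (.seq (move (.m .bwd) (.m .fwd)) (.push (.m .cnt) true))
  | seq c c' => .seq c.prog c'.prog
  | forLen i f c =>
    .seq (pushVal (.m (.loop i)) f.c (f.rs.map .d))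
      (.seq (.loop (.m (.loop i)) false .skip (.seq c.prog (.push (.d (.idx i)) true)))
        (clear (.d (.idx i))))
  | forBits i f c =>
    .seq (pushVal (.m (.loop i)) f.c (f.rs.map .d))
      (.seq (pushVal (.m (.scratch i)) f.c (f.rs.map .d))
        (.seq (.loop (.m (.loop i)) false .skip
          (.seq (halve i) (.seq (.case (.m .tag) .skip .skip c.prog) (.push (.d (.idx i)) true))))
          (.seq (clear (.m (.scratch i))) (clear (.d (.idx i))))))
  | forNats i r c =>
    .seq (dup (.d r) (.m (.loop i)))
      (.seq (.loop (.m (.loop i)) true .skip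
          (.seq (readNat (.m (.loop i)) (.d (.arg i))) (.seq c.prog
            (.seq (clear (.d (.arg i))) (.push (.d (.idx i)) true)))))
        (.seq (clear (.m (.loop i))) (clear (.d (.idx i)))))
  | forGates i r cn ca co =>
    .seq (dup (.d r) (.m (.loop i)))
      (.seq (.loop (.m (.loop i)) true .skip
          (.seq (readNat (.m (.loop i)) (.m .tag)) (.seq (readNat (.m (.loop i)) (.d (.arg i)))
            (.seq (.case (.m .tag) cn.prog .skip
              (.seq (readNat (.m (.loop i)) (.d (.arg' i)))
                (.case (.m .tag) ca.prog .skip (.seq (clear (.m .tag)) co.prog))))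
            (.seq (clear (.d (.arg i))) (.seq (clear (.d (.arg' i)))
              (.push (.d (.idx i)) true)))))))
        (.seq (clear (.m (.loop i))) (clear (.d (.idx i)))))

/-- Time bound, in terms of a bound `B` for the lengths of the data registers and a bound `G` for
the number of instructions. -/
def cost : Cmd → ℕ → ℕ → ℕ
  | nop, _, _ => 1
  | gate g, B, _ => 5 * g.cost B
  | mark f, B, G => (recordGate f).cost (B + G) + 2
  | seq c c', B, G => c.cost B G + c'.cost B G
  | forLen _ f c, B, G => 10 * f.cost B + f.cost B * (c.cost (f.cost B + B) G + 3)
  | forBits _ f c, B, G => 10 * f.cost B + f.cost B * (c.cost (f.cost B + B) G + 3 * f.cost B + 15)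
  | forNats _ _ c, B, G => 10 * B + 10 + B * (c.cost B G + 5 * B + 10)
  | forGates _ _ cn ca co, B, G =>
    10 * B + 10 + B * (cn.cost B G + ca.cost B G + co.cost B G + 12 * B + 20)

end Cmd

end QMABalance

/-! ### Correctness of the translation: single instructions and the body of a counting loop -/

namespace QMABalance

open Function

namespace Stacks.Clean

variable {d : ℕ} {s : Stacks}

theorem put (h : s.Clean d) (o : Out) : (s.put o).Clean d :=
  ⟨by simp [h.tmp], by simp [h.half], by simp [h.tag], fun i hi => by simp [h.loop i hi],
    fun i hi => by simp [h.scratch i hi], fun i hi => by simp [h.idx i hi],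
    fun i hi => by simp [h.arg i hi], fun i hi => by simp [h.arg' i hi]⟩

theorem mono (h : s.Clean d) {d' : ℕ} (hd : d ≤ d') : s.Clean d' :=
  ⟨h.tmp, h.half, h.tag, fun i hi => h.loop i (by omega), fun i hi => h.scratch i (by omega),
    fun i hi => h.idx i (by omega), fun i hi => h.arg i (by omega), fun i hi => h.arg' i (by omega)⟩

/-- The registers of level below `d`. -/
def _root_.QMABalance.Reg.Below (d : ℕ) : Reg → Prop
  | .m (.loop i) => (i : ℕ) < d
  | .m (.scratch i) => (i : ℕ) < d
  | .d (.idx i) => (i : ℕ) < d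
  | .d (.arg i) => (i : ℕ) < d
  | .d (.arg' i) => (i : ℕ) < d
  | _ => False

theorem update (h : s.Clean d) {r : Reg} (hr : r.Below d) (l : List Bool) :
    Clean d (Function.update s r l) := by
  have key : ∀ q : Reg, ¬ q.Below d → Function.update s r l q = s q := fun q hq =>
    update_of_ne (by rintro rfl; exact hq hr) _ _
  constructor
  · rw [key _ (by simp [Reg.Below]), h.tmp]
  · rw [key _ (by simp [Reg.Below]), h.half]
  · rw [key _ (by simp [Reg.Below]), h.tag]
  · intro i hi; rw [key _ (by simp [Reg.Below, hi]), h.loop i hi]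
  · intro i hi; rw [key _ (by simp [Reg.Below, hi]), h.scratch i hi]
  · intro i hi; rw [key _ (by simp [Reg.Below, hi]), h.idx i hi]
  · intro i hi; rw [key _ (by simp [Reg.Below, hi]), h.arg i hi]
  · intro i hi; rw [key _ (by simp [Reg.Below, hi]), h.arg' i hi]

end Stacks.Clean

/-- `p` emits the instructions `sem` of the environment, within the amortized time `cost`. -/
def Emits (p : RProg) (sem : Env → List Item) (d : ℕ) (cost : ℕ → ℕ → ℕ) : Prop :=
  ∀ (B G : ℕ) (s : Stacks), s.Clean d → (∀ r, (s (.d r)).length ≤ B) →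
    (s (.m .cnt)).length + (sem s.env).length ≤ G →
    Amort p s (s.put (runItems s.base (sem s.env) s.out)) (cost B G)

open Prog

theorem fldOK_map (k : MReg) {s : Stacks} {B : ℕ} (hB : ∀ r, (s (.d r)).length ≤ B)
    (f : Fld DReg) : FldOK (.m k) s B (f.map .d) := by
  intro r hr
  obtain ⟨q, _, rfl⟩ := List.mem_map.1 hr
  exact ⟨by simp, by simp, hB q⟩

theorem toQ_env (s : Stacks) (g : GateF DReg) : (g.map .d).toQ (lens s) = g.toQ s.env.len := by
  rw [GateF.toQ_map]; rfl

theorem val_env (s : Stacks) (f : Fld DReg) : (f.map .d).val (lens s) = f.val s.env.len := by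
  rw [Fld.val_map]; rfl

theorem emits_nop (d : ℕ) : Emits Cmd.nop.prog Cmd.nop.sem d Cmd.nop.cost := by
  intro B G s hs hB hG
  exact (Amort.of_exec (Exec.skip s) rfl).of_eq
    (by simp [Cmd.sem, runItems, Stacks.put_out_self]) le_rfl

/-- Writing the entry to `fwd` and to `bwd` costs `g.cost B` each, and `bwd` grows by at most
`g.cost B` bits, which raises the potential by three times as much. This explains the factor 5. -/
theorem emits_gate (g : GateF DReg) (d : ℕ) :
    Emits (Cmd.gate g).prog (Cmd.gate g).sem d (Cmd.gate g).cost := by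
  intro B G s hs hB hG
  have hf : ∀ f ∈ (g.map Reg.d).fields, ∀ k : MReg, FldOK (.m k) s B f := by
    intro f hf k
    have : ∃ f', f = Fld.map Reg.d f' := by
      cases g <;> simp only [GateF.fields, GateF.map, List.mem_cons, List.not_mem_nil,
        or_false] at hf <;> rcases hf with rfl | rfl | rfl <;> exact ⟨_, rfl⟩
    obtain ⟨f', rfl⟩ := this
    exact fldOK_map k hB f'
  obtain ⟨t, ht, h⟩ := (runs_emitFwd (B := B) (g.map .d) s hs.tmp fun f h => hf f h .fwd).seq
    (runs_emitBwd (B := B) (g.map .d) (update s (.m .fwd) _) (by simp [hs.tmp]) fun f h r hr => by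
      obtain ⟨f1, f2, f3⟩ := hf f h .bwd r hr
      have := (hf f h .fwd r hr).1
      exact ⟨f1, f2, by rwa [update_of_ne this]⟩)
  have e : (g.map Reg.d).toQ (lens (update s (.m .fwd)
      ((entryCode ((g.map Reg.d).toQ (lens s))).reverse ++ s (.m .fwd)))) = g.toQ s.env.len := by
    rw [toQ_env]; simp
  rw [e, toQ_env] at h
  have hl : (entryCode (g.toQ s.env.len)).length ≤ g.cost B :=
    length_entryCode_le _ _ _ fun f hf r hr => hB r
  refine ⟨t, h.of_eq ?_, ?_⟩
  · simp [Cmd.sem, runItems, Item.step, Stacks.out, Stacks.put]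
  · simp only [GateF.cost_map] at ht
    simp [Cmd.sem, runItems, Item.step, Stacks.out, Cmd.cost]
    omega

/-- Emptying `bwd` onto `fwd` takes 2|bwd| + 1 steps, and the potential 3|bwd| set aside by the
gates pays for it. The bits get reversed by the move, as the convention for `fwd` demands. The bound
is taken at `B + G` because the record gate also reads the counter. -/
theorem emits_mark (f : Fld DReg) (d : ℕ) :
    Emits (Cmd.mark f).prog (Cmd.mark f).sem d (Cmd.mark f).cost := by
  intro B G s hs hB hG
  have hB' : ∀ r, (s (.d r)).length ≤ B + G := fun r => (hB r).trans (by omega)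
  have hf : ∀ q ∈ (Cmd.recordGate f).fields, FldOK (.m .fwd) s (B + G) q := by
    intro q hq
    simp only [Cmd.recordGate, GateF.fields, List.mem_cons, List.not_mem_nil, or_false] at hq
    rcases hq with rfl | rfl | rfl
    · intro r hr
      simp only [List.mem_append, List.mem_replicate, List.mem_singleton] at hr
      rcases hr with ⟨_, rfl⟩ | rfl
      · exact ⟨by simp, by simp, hB' _⟩
      · exact ⟨by simp, by simp, by omega⟩
    · exact fldOK_map _ hB' f
    · intro r hr
      simp only [List.mem_append, List.mem_replicate, List.mem_singleton] at hr
      rcases hr with ⟨_, rfl⟩ | rfl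
      · exact ⟨by simp, by simp, hB' _⟩
      · exact ⟨by simp, by simp, by omega⟩
  have h1 := runs_emitFwd (B := B + G) (Cmd.recordGate f) s hs.tmp hf
  have e : (Cmd.recordGate f).toQ (lens s) = .ccx (s.base + (s (.m .cnt)).length) (f.val s.env.len)
      (s.base + (s (.m .cnt)).length + 1) := by
    simp only [Cmd.recordGate, GateF.toQ, val_env]
    simp only [Fld.val, lens, Stacks.base, List.map_append, List.map_replicate, List.sum_append,
      List.sum_replicate, List.map_cons, List.map_nil, List.sum_cons, List.sum_nil]
    congr 1 <;> simp <;> ring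
  rw [e] at h1
  have h2 := Runs.of_exec (exec_move (k := .m .bwd) (k' := .m .fwd) (by simp) (update s (.m .fwd)
    ((entryCode (.ccx (s.base + (s (.m .cnt)).length) (f.val s.env.len)
      (s.base + (s (.m .cnt)).length + 1))).reverse ++ s (.m .fwd))))
  obtain ⟨t, ht, h⟩ := h1.seq (h2.seq (.of_exec (.push (.m .cnt) true _)))
  refine ⟨t, h.of_eq ?_, ?_⟩
  · simp only [Cmd.sem, runItems, List.foldl_cons, List.foldl_nil, Item.step, Stacks.out, Stacks.put]
    funext r
    rcases r with r | r
    · cases r <;> simp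
    · simp
  · simp [Cmd.sem, runItems, Item.step, Stacks.out, Cmd.cost] at ht ⊢
    omega

theorem emits_seq {p q : RProg} {f g : Env → List Item} {d : ℕ} {a b : ℕ → ℕ → ℕ}
    (hp : Emits p f d a) (hq : Emits q g d b) :
    Emits (.seq p q) (fun e => f e ++ g e) d (fun B G => a B G + b B G) := by
  intro B G s hs hB hG
  simp only [List.length_append] at hG
  have h1 := hp B G s hs hB (by omega)
  have h2 := hq B G _ (hs.put (runItems s.base (f s.env) s.out)) (by simpa using hB) (by
    have := runItems_cnt_length s.base (f s.env) s.out
    simp only [Stacks.put_cnt, Stacks.env_put]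
    simp only [Stacks.out] at this ⊢
    omega)
  refine (h1.seq h2).of_eq ?_ le_rfl
  simp [runItems_append]

section Loops

variable {p : RProg} {sem : Env → List Item} {c : ℕ → ℕ → ℕ} {i : Fin 4}

theorem below_loop : Reg.Below (i + 1) (.m (.loop i)) := by simp [Reg.Below]
theorem below_scratch : Reg.Below (i + 1) (.m (.scratch i)) := by simp [Reg.Below]
theorem below_idx : Reg.Below (i + 1) (.d (.idx i)) := by simp [Reg.Below]
theorem below_arg : Reg.Below (i + 1) (.d (.arg i)) := by simp [Reg.Below]
theorem below_arg' : Reg.Below (i + 1) (.d (.arg' i)) := by simp [Reg.Below]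

/-- The invariant has `k` in the loop counter and `m` passes still to go; it is generalized over `k`
so that the induction on `m` can shift the counter. The counter is excluded from the bound on the
registers and is controlled by `k + m ≤ B` instead. -/
theorem amort_forLen_loop (hp : Emits p sem (i + 1) c) (B G m : ℕ) :
    ∀ (k : ℕ) (s : Stacks), s.Clean (i + 1) →
    s (.m (.loop i)) = List.replicate m true → s (.d (.idx i)) = List.replicate k true →
    (∀ r, r ≠ .idx i → (s (.d r)).length ≤ B) → k + m ≤ B →
    (s (.m .cnt)).length +
      ((List.range' k m).flatMap fun j => sem (s.env.set (.idx i) j)).length ≤ G →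
    Amort (.loop (.m (.loop i)) false .skip (.seq p (.push (.d (.idx i)) true))) s
      (Stacks.put (update (update s (.m (.loop i)) []) (.d (.idx i)) (List.replicate (k + m) true))
        (runItems s.base ((List.range' k m).flatMap fun j => sem (s.env.set (.idx i) j)) s.out))
      (m * (c B G + 2) + 1) := by
  induction m with
  | zero =>
    intro k s hs hl hk hB hkm hG
    refine (Amort.loop_nil hl).of_eq ?_ (by simp)
    simp only [List.range'_zero, List.flatMap_nil, runItems, List.foldl_nil, Nat.add_zero, ← hk]
    rw [← List.replicate_zero (a := true), ← hl, update_eq_self, update_eq_self,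
      Stacks.put_out_self]
  | succ m ih =>
    intro k s hs hl hk hB hkm hG
    have henv : s.env.set (.idx i) k = s.env := by
      simp only [Env.set]
      rw [← hk]
      exact update_eq_self _ _
    simp only [List.range'_succ, List.flatMap_cons, List.length_append, henv] at hG
    set s1 : Stacks := update s (.m (.loop i)) (List.replicate m true) with hs1
    have h1 := hp B G s1 (hs.update below_loop _) (by
        intro r
        by_cases hr : r = .idx i
        · subst hr; simp [hs1, hk]; omega
        · simpa [hs1] using hB r hr)
      (by simp [hs1] at hG ⊢; omega)
    have hout : s1.out = s.out := by simp [hs1, Stacks.out]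
    have henv1 : s1.env = s.env := by simp [hs1]
    have hbase : s1.base = s.base := by simp [hs1, Stacks.base]
    rw [hout, henv1, hbase] at h1
    set o := runItems s.base (sem s.env) s.out with ho
    have h2 := ih (k + 1) (update (s1.put o) (.d (.idx i)) (true :: (s1.put o) (.d (.idx i))))
      ((((hs.update below_loop _)).put o).update below_idx _) (by simp [hs1])
      (by simp [hs1, hk, List.replicate_succ]) (by
        intro r hr
        simpa [update_of_ne, hr, hs1] using hB r hr) (by omega) (by
        have := runItems_cnt_length s.base (sem s.env) s.out
        simp only [hs1, Env.set, Stacks.env_update_d, update_idem, Stacks.env_put,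
          Stacks.env_update_m, ne_eq, reduceCtorEq, not_false_eq_true, update_of_ne,
          Stacks.put_cnt] at hG ⊢
        rw [← ho] at this
        simp only [Stacks.out] at this
        omega)
    have hb2 : Stacks.base (update (s1.put o) (.d (.idx i)) (true :: (s1.put o) (.d (.idx i)))) =
        s.base := by simp [hs1, Stacks.base]
    have ho2 : Stacks.out (update (s1.put o) (.d (.idx i)) (true :: (s1.put o) (.d (.idx i)))) =
        o := by simp [Stacks.out]
    have he2 : Stacks.env (update (s1.put o) (.d (.idx i)) (true :: (s1.put o) (.d (.idx i)))) =
        s.env.set (.idx i) (k + 1) := by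
      simp [hs1, hk, Env.set, List.replicate_succ]
    rw [hb2, ho2, he2] at h2
    refine (Amort.loop_true (by simp) (by simpa [List.replicate_succ] using hl)
      (h1.seq (.of_exec (.push _ true _) (by simp))) h2).of_eq ?_ (by ring_nf; omega)
    have hset : ∀ j, (s.env.set (.idx i) (k + 1)).set (.idx i) j = s.env.set (.idx i) j := by
      intro j; simp [Env.set]
    simp only [hset, List.range'_succ, List.flatMap_cons, runItems_append, henv, ← ho]
    funext r
    rcases r with r | r
    · cases r <;> simp [hs1, update_apply]
      · split_ifs <;> rfl
    · by_cases hr : r = .idx i <;> simp [hs1, update_apply, hr]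
      omega

theorem amort_clear {k : Reg} (hk : k ≠ .m .bwd) (s : Stacks) :
    Amort (clear k) s (update s k []) (2 * (s k).length + 1) :=
  Amort.of_exec (exec_clear k s) (by rw [update_of_ne hk.symm])

end Loops

end QMABalance

/-! ### Counting loops and loops over binary digits -/

namespace QMABalance

open Function Prog

section Loops

variable {p : RProg} {sem : Env → List Item} {c : ℕ → ℕ → ℕ} {i : Fin 4}

theorem runs_pushVal_loop {s : Stacks} {B : ℕ} (k : MReg) (hk : k ≠ .tmp) (f : Fld DReg)
    (hs : s (.m .tmp) = []) (hB : ∀ r, (s (.d r)).length ≤ B) (hl : s (.m k) = []) :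
    Runs (pushVal (.m k) f.c (f.rs.map .d)) s
      (update s (.m k) (List.replicate (f.val s.env.len) true)) (f.cost B) := by
  have hok := fldOK_map k hB f
  refine (runs_pushVal (B := B) (by simpa using hk) f.c (f.rs.map .d) s hs
    (fun r hr => (hok r hr).1) (fun r hr => (hok r hr).2.1) (fun r hr => (hok r hr).2.2)).of_eq ?_ ?_
  · rw [hl, List.append_nil]
    congr 2
    exact val_env s f
  · simp only [List.length_map, Fld.cost]; omega

/-- The body is charged with the register bound `f.cost B + B`, because its loop counter may grow up
to the value of `f`, which can exceed `B`. -/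
theorem emits_forLen (hp : Emits p sem (i + 1) c) (f : Fld DReg) {d : ℕ} (hi : d ≤ i) :
    Emits (.seq (pushVal (.m (.loop i)) f.c (f.rs.map .d))
      (.seq (.loop (.m (.loop i)) false .skip (.seq p (.push (.d (.idx i)) true)))
        (clear (.d (.idx i)))))
      (fun e => (List.range' 0 (f.val e.len)).flatMap fun k => sem (e.set (.idx i) k)) d
      (fun B G => 10 * f.cost B + f.cost B * (c (f.cost B + B) G + 3)) := by
  intro B G s hs hB hG
  beta_reduce at hG ⊢
  have hv : f.val s.env.len + 3 ≤ f.cost B := Fld.val_le_cost fun r _ => hB r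
  set v := f.val s.env.len with hv'
  have h1 := Amort.of_runs (runs_pushVal_loop (.loop i) (by simp) f hs.tmp hB (hs.loop i hi))
    (by simp)
  have h2 := amort_forLen_loop hp (f.cost B + B) G v 0
    (update s (.m (.loop i)) (List.replicate v true)) ((hs.mono (by omega)).update below_loop _)
    (by simp) (by simp [hs.idx i hi]) (fun r _ => by have := hB r; simp; omega) (by omega)
    (by simpa using hG)
  have hb : Stacks.base (update s (.m (.loop i)) (List.replicate v true)) = s.base := by
    simp [Stacks.base]
  have ho : Stacks.out (update s (.m (.loop i)) (List.replicate v true)) = s.out := by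
    simp [Stacks.out]
  rw [hb, ho, Stacks.env_update_m] at h2
  have h3 := amort_clear (k := .d (.idx i)) (by simp)
  refine (h1.seq (h2.seq (h3 _))).of_eq ?_ ?_
  · funext r
    rcases r with r | r
    · cases r <;> simp [update_apply]
      rintro rfl
      rw [hs.loop _ hi]
    · by_cases hr : r = .idx i <;> simp [update_apply, hr, hs.idx i hi]
  · simp only [Stacks.put_d, update_self, List.length_replicate]
    have : v * (c (f.cost B + B) G + 2) ≤ f.cost B * (c (f.cost B + B) G + 2) :=
      Nat.mul_le_mul_right _ (by omega)
    have e : f.cost B * (c (f.cost B + B) G + 3) =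
      f.cost B * (c (f.cost B + B) G + 2) + f.cost B := by ring
    omega

/-- The ones are popped in pairs, each pair leaving a one on `half`; an unpaired one ends up in
`tag`. Hence the induction proceeds in steps of two. -/
theorem runs_halve (h : ℕ) : ∀ s : Stacks, s (.m .tag) = [] → s (.m .half) = [] →
    s (.m (.scratch i)) = List.replicate h true →
    Runs (Cmd.halve i) s (update (update s (.m .tag) (List.replicate (h % 2) true))
      (.m (.scratch i)) (List.replicate (h / 2) true)) (3 * h + 5) := by
  have main : ∀ (h : ℕ) (s : Stacks), s (.m .tag) = [] →
      s (.m (.scratch i)) = List.replicate h true →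
      Runs (.loop (.m (.scratch i)) false .skip
        (.case (.m (.scratch i)) (.push (.m .tag) true) .skip (.push (.m .half) true))) s
        (update (update (update s (.m .tag) (List.replicate (h % 2) true)) (.m (.scratch i)) [])
          (.m .half) (List.replicate (h / 2) true ++ s (.m .half))) (2 * h + 3) := by
    intro h
    induction h using Nat.strong_induction_on with
    | _ h ih =>
      intro s ht hh
      match h with
      | 0 =>
        refine (Runs.of_exec (Exec.loop_nil hh)).of_eq ?_ (by omega)
        funext r
        rcases r with r | r
        · cases r <;> simp_all [update_apply]
        · simp
      | 1 =>
        have h1 := Exec.case_nil (pf := .skip) (pt := .push (.m .half) true)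
          (show update s (.m (.scratch i)) [] (.m (.scratch i)) = [] by simp)
          (Exec.push (.m .tag) true _)
        refine (Runs.of_exec (Exec.loop_true (brk := false) (pf := .skip) (l := [])
          (by simpa using hh) h1 (Exec.loop_nil (by simp)))).of_eq ?_ (by omega)
        funext r
        rcases r with r | r
        · cases r <;> simp_all [update_apply]
        · simp
      | h + 2 =>
        obtain ⟨t, ht', h'⟩ := ih h (by omega)
          (update (update s (.m (.scratch i)) (List.replicate h true)) (.m .half)
            (true :: s (.m .half))) (by simp [ht]) (by simp)
        have hp : Exec (.case (.m (.scratch i)) (.push (.m .tag) true) .skip (.push (.m .half) true))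
            (update s (.m (.scratch i)) (List.replicate (h + 1) true))
            (update (update s (.m (.scratch i)) (List.replicate h true)) (.m .half)
            (true :: s (.m .half))) (1 + 1) := by
          have hk : update s (.m (.scratch i)) (List.replicate (h + 1) true) (.m (.scratch i)) =
              true :: List.replicate h true := by simp [List.replicate_succ]
          refine (Exec.case_true (pe := .push (.m .tag) true) (pf := .skip) hk
            (Exec.push (.m .half) true _)).of_eq ?_
          simp
        refine ⟨_, ?_, (Exec.loop_true (by simpa [List.replicate_succ] using hh) hp h').of_eq ?_⟩
        · omega
        · funext r
          rcases r with r | r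
          · cases r <;> simp [update_apply]
            · rw [List.replicate_succ']
              simp
            · split_ifs <;> rfl
          · simp
  intro s ht hf hh
  refine ((main h s ht hh).seq (.of_exec (exec_move (by simp) _))).of_eq ?_ ?_
  · funext r
    rcases r with r | r
    · cases r <;> simp [update_apply, hf]
      split_ifs <;> rfl
    · simp
  · simp [hf]
    omega

/-- Before the pass with counter `k` the scratch register holds `v / 2 ^ k`, so halving it leaves
the binary digit `k` of `v` in `tag`. The case distinction on `tag` pops that digit and leaves the
register empty again. -/
theorem amort_forBits_loop (hp : Emits p sem (i + 1) c) (B G v m : ℕ) :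
    ∀ (k : ℕ) (s : Stacks), s.Clean (i + 1) → s (.m (.loop i)) = List.replicate m true →
    s (.m (.scratch i)) = List.replicate (v / 2 ^ k) true →
    s (.d (.idx i)) = List.replicate k true →
    (∀ r, r ≠ .idx i → (s (.d r)).length ≤ B) → k + m ≤ B →
    (s (.m .cnt)).length + ((List.range' k m).flatMap fun j =>
      if v.testBit j then sem (s.env.set (.idx i) j) else []).length ≤ G →
    Amort (.loop (.m (.loop i)) false .skip
        (.seq (Cmd.halve i) (.seq (.case (.m .tag) .skip .skip p) (.push (.d (.idx i)) true)))) s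
      (Stacks.put (update (update (update s (.m (.loop i)) []) (.d (.idx i))
          (List.replicate (k + m) true)) (.m (.scratch i)) (List.replicate (v / 2 ^ (k + m)) true))
        (runItems s.base ((List.range' k m).flatMap fun j =>
          if v.testBit j then sem (s.env.set (.idx i) j) else []) s.out))
      (m * (c B G + 3 * v + 10) + 1) := by
  induction m with
  | zero =>
    intro k s hs hl hh hk hB hkm hG
    refine (Amort.loop_nil hl).of_eq ?_ (by simp)
    simp only [List.range'_zero, List.flatMap_nil, runItems, List.foldl_nil, Nat.add_zero, ← hk, ← hh]
    rw [← List.replicate_zero (a := true), ← hl, update_eq_self, update_eq_self, update_eq_self,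
      Stacks.put_out_self]
  | succ m ih =>
    intro k s hs hl hh hk hB hkm hG
    have henv : s.env.set (.idx i) k = s.env := by
      simp only [Env.set]
      rw [← hk]
      exact update_eq_self _ _
    have htb : v.testBit k = true ↔ v / 2 ^ k % 2 = 1 := by
      rw [Nat.testBit_eq_decide_div_mod_eq]; simp
    simp only [List.range'_succ, List.flatMap_cons, List.length_append, henv] at hG
    set is : List Item := if v.testBit k then sem s.env else [] with his
    set o := runItems s.base is s.out with ho
    set s1 : Stacks := update (update s (.m (.loop i)) (List.replicate m true)) (.m (.scratch i))
      (List.replicate (v / 2 ^ (k + 1)) true) with hs1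
    have hdiv : v / 2 ^ k / 2 = v / 2 ^ (k + 1) := by rw [Nat.div_div_eq_div_mul, pow_succ]
    have h0 : Amort (Cmd.halve i) (update s (.m (.loop i)) (List.replicate m true))
        (update s1 (.m .tag) (List.replicate (v / 2 ^ k % 2) true)) (3 * v + 5) := by
      refine (Amort.of_runs (runs_halve (v / 2 ^ k) (update s (.m (.loop i)) (List.replicate m true))
        (by simp [hs.tag]) (by simp [hs.half]) (by simpa using hh)) (by simp)).of_eq ?_ ?_
      · rw [hdiv, hs1, update_comm (by simp)]
      · have := Nat.div_le_self v (2 ^ k)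
        omega
    have hc1 : s1.Clean (i + 1) := ((hs.update below_loop _).update below_scratch _)
    have h1 : Amort (.case (.m .tag) .skip .skip p)
        (update s1 (.m .tag) (List.replicate (v / 2 ^ k % 2) true)) (s1.put o) (c B G + 2) := by
      by_cases hb : v / 2 ^ k % 2 = 1
      · have hb' := htb.2 hb
        have hs1' : update (update s1 (.m .tag) [true]) (.m .tag) [] = s1 := by
          rw [update_idem]
          have : s1 (.m .tag) = [] := hc1.tag
          rw [← this, update_eq_self]
        have h1 := hp B G s1 hc1 (by
            intro r
            by_cases hr : r = .idx i
            · subst hr; simp [hs1, hk]; omega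
            · simpa [hs1] using hB r hr)
          (by simp [hs1, his, hb'] at hG ⊢; omega)
        have hout : s1.out = s.out := by simp [hs1, Stacks.out]
        have henv1 : s1.env = s.env := by simp [hs1]
        have hbase : s1.base = s.base := by simp [hs1, Stacks.base]
        rw [hout, henv1, hbase] at h1
        rw [hb]
        refine (Amort.case_true (l := []) (by simp) (by simp) ?_).of_eq (s' := s1.put o) rfl
          (show 1 + c B G ≤ _ by omega)
        rw [show List.replicate 1 true = [true] from rfl, hs1', ho, his, if_pos hb']
        exact h1
      · have hb' : v.testBit k = false := by
          rw [← Bool.not_eq_true, htb]; exact hb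
        have h0 : v / 2 ^ k % 2 = 0 := by omega
        have ho' : s1.put o = s1 := by
          rw [ho, his, if_neg (by simp [hb'])]
          have : s.out = s1.out := by simp [hs1, Stacks.out]
          rw [runItems, List.foldl_nil, this, Stacks.put_out_self]
        rw [h0, ho']
        have hs1' : update s1 (.m .tag) (List.replicate 0 true) = s1 := by
          have : s1 (.m .tag) = [] := hc1.tag
          rw [List.replicate_zero, ← this, update_eq_self]
        rw [hs1']
        exact (Amort.case_nil hc1.tag (.of_exec (.skip _) rfl)).of_eq rfl (by omega)
    have h2 := ih (k + 1) (update (s1.put o) (.d (.idx i)) (true :: (s1.put o) (.d (.idx i))))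
      ((hc1.put o).update below_idx _) (by simp [hs1]) (by simp [hs1])
      (by simp [hs1, hk, List.replicate_succ]) (by
        intro r hr
        simpa [update_of_ne, hr, hs1] using hB r hr) (by omega) (by
        have := runItems_cnt_length s.base is s.out
        simp only [hs1, Env.set, Stacks.env_update_d, update_idem, Stacks.env_put,
          Stacks.env_update_m, ne_eq, reduceCtorEq, not_false_eq_true, update_of_ne,
          Stacks.put_cnt] at hG ⊢
        rw [← ho] at this
        simp only [Stacks.out] at this
        omega)
    have hb2 : Stacks.base (update (s1.put o) (.d (.idx i)) (true :: (s1.put o) (.d (.idx i)))) =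
        s.base := by simp [hs1, Stacks.base]
    have ho2 : Stacks.out (update (s1.put o) (.d (.idx i)) (true :: (s1.put o) (.d (.idx i)))) =
        o := by simp [Stacks.out]
    have he2 : Stacks.env (update (s1.put o) (.d (.idx i)) (true :: (s1.put o) (.d (.idx i)))) =
        s.env.set (.idx i) (k + 1) := by
      simp [hs1, hk, Env.set, List.replicate_succ]
    rw [hb2, ho2, he2] at h2
    refine (Amort.loop_true (by simp) (by simpa [List.replicate_succ] using hl)
      (h0.seq (h1.seq (.of_exec (.push _ true _) (by simp)))) h2).of_eq ?_ (by ring_nf; omega)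
    have hset : ∀ j, (s.env.set (.idx i) (k + 1)).set (.idx i) j = s.env.set (.idx i) j := by
      intro j; simp [Env.set]
    simp only [hset, List.range'_succ, List.flatMap_cons, runItems_append, henv, ← his, ← ho]
    funext r
    rcases r with r | r
    · cases r <;> simp [hs1, update_apply]
      · split_ifs <;> rfl
      · split_ifs
        · congr 3; omega
        · rfl
    · by_cases hr : r = .idx i <;> simp [hs1, update_apply, hr]
      omega

theorem emits_forBits (hp : Emits p sem (i + 1) c) (f : Fld DReg) {d : ℕ} (hi : d ≤ i) :
    Emits (.seq (pushVal (.m (.loop i)) f.c (f.rs.map .d))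
      (.seq (pushVal (.m (.scratch i)) f.c (f.rs.map .d))
        (.seq (.loop (.m (.loop i)) false .skip
          (.seq (Cmd.halve i) (.seq (.case (.m .tag) .skip .skip p) (.push (.d (.idx i)) true))))
          (.seq (clear (.m (.scratch i))) (clear (.d (.idx i)))))))
      (fun e => (List.range' 0 (f.val e.len)).flatMap fun k =>
        if (f.val e.len).testBit k then sem (e.set (.idx i) k) else []) d
      (fun B G => 10 * f.cost B + f.cost B * (c (f.cost B + B) G + 3 * f.cost B + 15)) := by
  intro B G s hs hB hG
  beta_reduce at hG ⊢
  have hv : f.val s.env.len + 3 ≤ f.cost B := Fld.val_le_cost fun r _ => hB r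
  have h1 := Amort.of_runs (runs_pushVal_loop (.loop i) (by simp) f hs.tmp hB (hs.loop i hi))
    (by simp)
  have h1' := Amort.of_runs (runs_pushVal_loop (s := update s (.m (.loop i))
    (List.replicate (f.val s.env.len) true)) (.scratch i) (by simp) f (by simp [hs.tmp])
    (by simpa using hB) (by simpa using hs.scratch i hi)) (by simp)
  rw [Stacks.env_update_m] at h1'
  set v := f.val s.env.len with hv'
  set s1 : Stacks := update (update s (.m (.loop i)) (List.replicate v true)) (.m (.scratch i))
    (List.replicate v true) with hs1
  have h2 := amort_forBits_loop hp (f.cost B + B) G v v 0 s1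
    (((hs.mono (by omega)).update below_loop _).update below_scratch _)
    (by simp [hs1]) (by simp [hs1]) (by simp [hs1, hs.idx i hi])
    (fun r _ => by have := hB r; simp [hs1]; omega) (by omega)
    (by simpa [hs1] using hG)
  have hb : Stacks.base s1 = s.base := by
    simp [Stacks.base, hs1]
  have ho : Stacks.out s1 = s.out := by
    simp [Stacks.out, hs1]
  have he : Stacks.env s1 = s.env := by simp [hs1]
  rw [hb, ho, he] at h2
  have h3 := amort_clear (k := .m (.scratch i)) (by simp)
  have h4 := amort_clear (k := .d (.idx i)) (by simp)
  refine (h1.seq (h1'.seq (h2.seq ((h3 _).seq (h4 _))))).of_eq ?_ ?_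
  · funext r
    rcases r with r | r
    · cases r <;> simp [update_apply, hs1]
      · split_ifs with h
        · subst h; rw [hs.loop _ hi]
        · rfl
      · split_ifs with h
        · subst h; rw [hs.scratch _ hi]
        · rfl
    · by_cases hr : r = .idx i <;> simp [update_apply, hr, hs.idx i hi, hs1]
  · have h5 : v / 2 ^ v ≤ v := Nat.div_le_self _ _
    simp only [Stacks.put_d, Stacks.put_scratch, update_self, List.length_replicate, ne_eq,
      reduceCtorEq, not_false_eq_true, update_of_ne, Nat.zero_add]
    have : v * (c (f.cost B + B) G + 3 * v + 10) ≤
        f.cost B * (c (f.cost B + B) G + 3 * f.cost B + 10) :=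
      Nat.mul_le_mul (by omega) (by omega)
    have e : f.cost B * (c (f.cost B + B) G + 3 * f.cost B + 15) =
      f.cost B * (c (f.cost B + B) G + 3 * f.cost B + 10) + 5 * f.cost B := by ring
    omega

end Loops

end QMABalance

/-! ### Loops over lists of numbers -/

namespace QMABalance

open Function Prog

theorem parseNats_length (l : List Bool) :
    (parseNats l).1.length + (parseNats l).2.length ≤ l.length := by
  induction l using parseNats.induct with
  | case1 => simp [parseNats]
  | case2 l => simp [parseNats]
  | case3 l ih =>
    have := parseNat_length l
    simp only [parseNats, List.length_cons]
    omega

theorem parseGates_length (l : List Bool) :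
    (parseGates l).1.length + (parseGates l).2.length ≤ l.length := by
  induction l using parseGates.induct with
  | case1 => simp [parseGates]
  | case2 l => simp [parseGates]
  | case3 l ih =>
    have := parseGate_snd_length_le l
    simp only [parseGates, List.length_cons]
    omega

section Loops

variable {p : RProg} {sem : Env → List Item} {c : ℕ → ℕ → ℕ} {i : Fin 4}

theorem amort_readNat {k k' : Reg} (hk : k ≠ k') (h1 : k ≠ .m .bwd) (h2 : k' ≠ .m .bwd)
    {s : Stacks} (hs : s k' = []) :
    Amort (readNat k k') s (update (update s k (parseNat (s k)).2) k'
      (List.replicate (parseNat (s k)).1 true)) (2 * (s k).length + 1) := by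
  refine (Amort.of_exec (exec_readNat hk s) (by rw [update_of_ne h2.symm, update_of_ne h1.symm])).of_eq
    (by rw [hs, List.append_nil]) ?_
  have := parseNat_length (s k)
  omega

/-- The machine loop branches exactly like the recursion of `parseNats` (end of string, end marker,
entry), so the induction follows the parser. On exit the loop register still contains the unread
rest of the string. A command discards it, whereas the analysis of the input uses this very lemma to
skip a list. -/
theorem amort_forNats_loop (hp : Emits p sem (i + 1) c) (B G : ℕ) (l : List Bool) :
    ∀ (k : ℕ) (s : Stacks), s.Clean (i + 1) → s (.m (.loop i)) = l → s (.d (.arg i)) = [] →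
    s (.d (.idx i)) = List.replicate k true →
    (∀ r, r ≠ .idx i → (s (.d r)).length ≤ B) → k + l.length ≤ B →
    (s (.m .cnt)).length + (Cmd.natsSem s.env i sem k (parseNats l).1).length ≤ G →
    Amort (.loop (.m (.loop i)) true .skip
          (.seq (readNat (.m (.loop i)) (.d (.arg i))) (.seq p
            (.seq (clear (.d (.arg i))) (.push (.d (.idx i)) true))))) s
      (Stacks.put (update (update s (.m (.loop i)) (parseNats l).2) (.d (.idx i))
          (List.replicate (k + (parseNats l).1.length) true))
        (runItems s.base (Cmd.natsSem s.env i sem k (parseNats l).1) s.out))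
      (l.length * (c B G + 4 * B + 5) + 1) := by
  induction l using parseNats.induct with
  | case1 =>
    intro k s hs hl ha hk hB hkm hG
    refine (Amort.loop_nil hl).of_eq ?_ (by simp)
    simp only [parseNats, Cmd.natsSem, runItems, List.foldl_nil, List.length_nil, Nat.add_zero, ← hk]
    rw [← hl, update_eq_self, update_eq_self, Stacks.put_out_self]
  | case2 l =>
    intro k s hs hl ha hk hB hkm hG
    refine (Amort.loop_break (by simp) hl).of_eq ?_ (by simp)
    simp only [parseNats, Cmd.natsSem, runItems, List.foldl_nil, List.length_nil, Nat.add_zero, ← hk]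
    have : s (.d (.idx i)) = update s (.m (.loop i)) l (.d (.idx i)) := by simp
    rw [this, update_eq_self]
    have : s.out = Stacks.out (update s (.m (.loop i)) l) := by simp [Stacks.out]
    rw [this, Stacks.put_out_self]
  | case3 l ih =>
    intro k s hs hl ha hk hB hkm hG
    have hln := parseNat_length l
    set n := (parseNat l).1 with hn
    set l' := (parseNat l).2 with hl'
    have henv : s.env.set (.idx i) k = s.env := by
      simp only [Env.set]
      rw [← hk]
      exact update_eq_self _ _
    simp only [parseNats, Cmd.natsSem, List.length_append, henv, ← hn, ← hl'] at hG
    simp only [List.length_cons] at hkm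
    set s1 : Stacks := update (update s (.m (.loop i)) l') (.d (.arg i)) (List.replicate n true)
      with hs1
    have h0 : Amort (readNat (.m (.loop i)) (.d (.arg i))) (update s (.m (.loop i)) l) s1
        (2 * l.length + 1) := by
      refine (amort_readNat (k := .m (.loop i)) (k' := .d (.arg i)) (by simp) (by simp) (by simp)
        (s := update s (.m (.loop i)) l) (by simpa using ha)).of_eq ?_ (by simp)
      simp [hs1, ← hn, ← hl']
    have hout : s1.out = s.out := by simp [hs1, Stacks.out]
    have henv1 : s1.env = s.env.set (.arg i) n := by simp [hs1, Env.set]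
    have hbase : s1.base = s.base := by simp [hs1, Stacks.base]
    have hc1 : s1.Clean (i + 1) := (hs.update below_loop _).update below_arg _
    have h1 := hp B G s1 hc1 (by
        intro r
        by_cases hr : r = .idx i
        · subst hr; simp [hs1, hk]; omega
        · by_cases hr' : r = .arg i
          · subst hr'; simp [hs1]; omega
          · simpa [hs1, hr'] using hB r hr)
      (by rw [henv1]; simp [hs1] at hG ⊢; omega)
    rw [hout, henv1, hbase] at h1
    set is := sem (s.env.set (.arg i) n) with his
    set o := runItems s.base is s.out with ho
    set s2 : Stacks := update (update (s1.put o) (.d (.arg i)) []) (.d (.idx i))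
      (List.replicate (k + 1) true) with hs2
    have h2 : Amort (.seq (clear (.d (.arg i))) (.push (.d (.idx i)) true)) (s1.put o) s2
        (2 * n + 1 + 1) := by
      refine ((amort_clear (by simp) _).seq (.of_exec (.push _ true _) (by simp))).of_eq ?_ ?_
      · simp [hs2, hs1, hk, List.replicate_succ]
      · simp [hs1]
    have hb2 : s2.base = s.base := by simp [hs1, hs2, Stacks.base]
    have ho2 : s2.out = o := by simp [hs2, Stacks.out]
    have he2 : s2.env = s.env.set (.idx i) (k + 1) := by
      have : update s.env (.arg i) [] = s.env := by
        rw [show ([] : List Bool) = s.env (.arg i) from ha.symm, update_eq_self]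
      simp only [hs2, hs1, Stacks.env_update_d, Stacks.env_put, Stacks.env_update_m, update_idem,
        this, Env.set]
    have hset : ∀ j m, ((s.env.set (.idx i) (k + 1)).set (.idx i) j).set (.arg i) m =
        (s.env.set (.idx i) j).set (.arg i) m := by
      intro j m; simp [Env.set]
    -- Each entry overwrites the loop counter, so its current value is irrelevant for the remaining
    -- entries.
    have hsem : ∀ j ns, Cmd.natsSem (s.env.set (.idx i) (k + 1)) i sem j ns =
        Cmd.natsSem s.env i sem j ns := by
      intro j ns
      induction ns generalizing j with
      | nil => rfl
      | cons m ns ih => simp [Cmd.natsSem, hset, ih]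
    have h3 := ih (k + 1) s2 (((hc1.put o).update below_arg _).update below_idx _)
      (by simp [hs1, hs2]) (by simp [hs2]) (by simp [hs2]) (by
        intro r hr
        by_cases hr' : r = .arg i
        · subst hr'; simp [hs2]
        · simpa [hs2, hs1, hr, hr'] using hB r hr) (by omega) (by
        have := runItems_cnt_length s.base is s.out
        rw [he2, hsem]
        simp only [hs2, ne_eq, reduceCtorEq, not_false_eq_true, update_of_ne, Stacks.put_cnt]
        rw [← ho] at this
        simp only [Stacks.out] at this
        omega)
    rw [hb2, ho2, he2, hsem] at h3
    refine (Amort.loop_true (by simp) hl (h0.seq (h1.seq h2)) h3).of_eq ?_ ?_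
    · simp only [parseNats, Cmd.natsSem, runItems_append, henv, ← hn, ← hl', ← ho, ← his]
      have ekm : k + 1 + (parseNats l').1.length = k + ((parseNats l').1.length + 1) := by omega
      funext r
      rcases r with r | r
      · cases r <;> simp [hs1, hs2, update_apply]
        · split_ifs <;> rfl
      · by_cases hr : r = .idx i
        · simp [hr, ekm]
        · by_cases hr' : r = .arg i
          · subst hr'; simp [hs2, ha]
          · simp [hs1, hs2, hr, hr']
    · have h5 : l'.length * (c B G + 4 * B + 5) ≤ l.length * (c B G + 4 * B + 5) :=
        Nat.mul_le_mul_right _ (by omega)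
      simp only [List.length_cons]
      rw [Nat.add_mul]
      omega

theorem emits_forNats (hp : Emits p sem (i + 1) c) (r : DReg) {d : ℕ} (hi : d ≤ i) :
    Emits (.seq (dup (.d r) (.m (.loop i)))
      (.seq (.loop (.m (.loop i)) true .skip
          (.seq (readNat (.m (.loop i)) (.d (.arg i))) (.seq p
            (.seq (clear (.d (.arg i))) (.push (.d (.idx i)) true)))))
        (.seq (clear (.m (.loop i))) (clear (.d (.idx i))))))
      (fun e => Cmd.natsSem e i sem 0 (parseNats (e r)).1) d
      (fun B G => 10 * B + 10 + B * (c B G + 5 * B + 10)) := by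
  intro B G s hs hB hG
  beta_reduce at hG ⊢
  have hd := Amort.of_exec (exec_dup (k := .d r) (k' := .m (.loop i)) (by simp) (by simp) (by simp)
    s hs.tmp (hs.loop i hi)) (by simp)
  set l := s (.d r) with hl
  have e : s.env r = l := rfl
  rw [e] at hG ⊢
  have hlB : l.length ≤ B := hB r
  have hlen := parseNats_length l
  set s1 : Stacks := update s (.m (.loop i)) l with hs1
  have hc1 : s1.Clean (i + 1) := (hs.mono (by omega)).update below_loop _
  have h2 := amort_forNats_loop hp B G l 0 s1 hc1 (by simp [hs1]) (by simp [hs1, hs.arg i hi])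
    (by simp [hs1, hs.idx i hi]) (fun r _ => by simpa [hs1] using hB r) (by omega)
    (by simpa [hs1] using hG)
  have hb : Stacks.base s1 = s.base := by simp [Stacks.base, hs1]
  have ho : Stacks.out s1 = s.out := by simp [Stacks.out, hs1]
  have he : Stacks.env s1 = s.env := by simp [hs1]
  rw [hb, ho, he] at h2
  have h3 := amort_clear (k := .m (.loop i)) (by simp)
  have h4 := amort_clear (k := .d (.idx i)) (by simp)
  refine (hd.seq (h2.seq ((h3 _).seq (h4 _)))).of_eq ?_ ?_
  · funext r
    rcases r with r | r
    · cases r <;> simp [update_apply, hs1]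
      split_ifs with h
      · subst h; rw [hs.loop _ hi]
      · rfl
    · by_cases hr : r = .idx i <;> simp [hr, hs.idx i hi, hs1]
  · simp only [Stacks.put_d, Stacks.put_loop, update_self, List.length_replicate, ne_eq,
      reduceCtorEq, not_false_eq_true, update_of_ne, Nat.zero_add]
    have h5 : l.length * (c B G + 4 * B + 5) ≤ B * (c B G + 5 * B + 10) :=
      Nat.mul_le_mul hlB (by omega)
    omega

end Loops

end QMABalance

/-! ### Loops over lists of Boolean gates -/

namespace QMABalance

open Function Prog

section Loops

variable {pn pa po : RProg} {sn sa so : Env → List Item} {cn ca co : ℕ → ℕ → ℕ} {i : Fin 4}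

/-- A step of the loop over Boolean gates. -/
def gateStep (pn pa po : RProg) (i : Fin 4) : RProg :=
  .seq (readNat (.m (.loop i)) (.m .tag)) (.seq (readNat (.m (.loop i)) (.d (.arg i)))
    (.seq (.case (.m .tag) pn .skip
      (.seq (readNat (.m (.loop i)) (.d (.arg' i)))
        (.case (.m .tag) pa .skip (.seq (clear (.m .tag)) po))))
    (.seq (clear (.d (.arg i))) (.seq (clear (.d (.arg' i)))
      (.push (.d (.idx i)) true)))))

/-- The tag is stored in unary and examined by popping: empty means negation, empty after one pop
means conjunction, and everything else is read as a disjunction after clearing the rest. This is the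
case distinction of `parseGate`, so program and parser agree on malformed strings as well. -/
theorem amort_gateStep (hn : Emits pn sn (i + 1) cn) (ha : Emits pa sa (i + 1) ca)
    (ho : Emits po so (i + 1) co) (B G k : ℕ) (l : List Bool) (s : Stacks) (hs : s.Clean (i + 1))
    (hl : s (.m (.loop i)) = l) (ha1 : s (.d (.arg i)) = []) (ha2 : s (.d (.arg' i)) = [])
    (hk : s (.d (.idx i)) = List.replicate k true)
    (hB : ∀ r, (s (.d r)).length ≤ B) (hlB : l.length ≤ B)
    (hG : (s (.m .cnt)).length + (Cmd.gateSem s.env i sn sa so (parseGate l).1).length ≤ G) :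
    Amort (gateStep pn pa po i) s
      (Stacks.put (update (update s (.m (.loop i)) (parseGate l).2) (.d (.idx i))
          (List.replicate (k + 1) true))
        (runItems s.base (Cmd.gateSem s.env i sn sa so (parseGate l).1) s.out))
      (cn B G + ca B G + co B G + 12 * B + 15) := by
  set t := (parseNat l).1 with ht
  set l1 := (parseNat l).2 with hl1
  set a := (parseNat l1).1 with ha'
  set l2 := (parseNat l1).2 with hl2
  set b := (parseNat l2).1 with hb'
  set l3 := (parseNat l2).2 with hl3
  have e1 := parseNat_length l
  have e2 := parseNat_length l1
  have e3 := parseNat_length l2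
  rw [← ht, ← hl1] at e1
  rw [← ha', ← hl2] at e2
  rw [← hb', ← hl3] at e3
  set s1 : Stacks := update (update (update s (.m (.loop i)) l2) (.m .tag)
    (List.replicate t true)) (.d (.arg i)) (List.replicate a true) with hs1
  have h1 : Amort (readNat (.m (.loop i)) (.m .tag)) s
      (update (update s (.m (.loop i)) l1) (.m .tag) (List.replicate t true)) (2 * B + 1) := by
    refine (amort_readNat (k := .m (.loop i)) (k' := .m .tag) (by simp) (by simp) (by simp)
      hs.tag).of_eq ?_ (by rw [hl]; omega)
    rw [hl]
  have h2 : Amort (readNat (.m (.loop i)) (.d (.arg i)))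
      (update (update s (.m (.loop i)) l1) (.m .tag) (List.replicate t true)) s1 (2 * B + 1) := by
    refine (amort_readNat (k := .m (.loop i)) (k' := .d (.arg i)) (by simp) (by simp) (by simp)
      (by simpa using ha1)).of_eq ?_ ?_
    · funext r
      rcases r with r | r
      · cases r <;> simp [hs1, update_apply, ← hl2] <;> split_ifs <;> rfl
      · simp [hs1, update_apply, ← ha']
    · simp; omega
  have henv : ∀ u, s.env = update (update s.env (.arg i) u) (.arg i) [] := by
    intro u
    rw [update_idem, show ([] : List Bool) = s.env (.arg i) from ha1.symm, update_eq_self]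
  -- The end of the step, for any data read.
  have hend : ∀ (l' : List Bool) (x y : ℕ) (o : Out), x ≤ B → y ≤ B →
      Amort (.seq (clear (.d (.arg i))) (.seq (clear (.d (.arg' i))) (.push (.d (.idx i)) true)))
        (Stacks.put (update (update (update s (.m (.loop i)) l') (.d (.arg i))
          (List.replicate x true)) (.d (.arg' i)) (List.replicate y true)) o)
        (Stacks.put (update (update s (.m (.loop i)) l') (.d (.idx i))
          (List.replicate (k + 1) true)) o) (4 * B + 3) := by
    intro l' x y o hx hy
    refine ((amort_clear (by simp) _).seq ((amort_clear (by simp) _).seq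
      (.of_exec (.push _ true _) (by simp)))).of_eq ?_ ?_
    · funext r
      rcases r with r | r
      · cases r <;> simp [update_apply]
      · by_cases hr : r = .idx i
        · subst hr; simp [hk, List.replicate_succ]
        · by_cases hr1 : r = .arg i
          · subst hr1; simp [ha1]
          · by_cases hr2 : r = .arg' i
            · subst hr2; simp [ha2]
            · simp [hr, hr1, hr2]
    · simp; omega
  have hpg : parseGate l = if t = 0 then (.not a, l2) else
      if t = 1 then (.and a b, l3) else (.or a b, l3) := rfl
  by_cases ht0 : t = 0
  · rw [if_pos ht0] at hpg
    have hs1' : s1 = update (update s (.m (.loop i)) l2) (.d (.arg i)) (List.replicate a true) := by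
      rw [hs1, ht0]
      congr 1
      rw [List.replicate_zero, ← hs.tag, update_comm (by simp), update_eq_self]
    simp only [hpg, Cmd.gateSem] at hG ⊢
    have hc : s1.Clean (i + 1) := by
      rw [hs1']; exact (hs.update below_loop _).update below_arg _
    have h3 := hn B G s1 hc (by
      intro r
      by_cases hr : r = .arg i
      · subst hr; simp [hs1]; omega
      · simpa [hs1, hr] using hB r) (by simpa [hs1, Env.set] using hG)
    have q1 : s1.out = s.out := by simp [hs1, Stacks.out]
    have q2 : s1.env = s.env.set (.arg i) a := by simp [hs1, Env.set]
    have q3 : s1.base = s.base := by simp [hs1, Stacks.base]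
    rw [q1, q2, q3] at h3
    have h4 := hend l2 a 0 (runItems s.base (sn (s.env.set (.arg i) a)) s.out) (by omega) (by omega)
    have q4 : update (update (update s (.m (.loop i)) l2) (.d (.arg i)) (List.replicate a true))
        (.d (.arg' i)) (List.replicate 0 true) = s1 := by
      rw [hs1', List.replicate_zero]
      have : (update (update s (.m (.loop i)) l2) (.d (.arg i)) (List.replicate a true))
        (.d (.arg' i)) = [] := by simp [ha2]
      rw [← this, update_eq_self]
    rw [q4] at h4
    exact (h1.seq (h2.seq ((Amort.case_nil (by simp [hs1, ht0]) h3).seq h4))).of_eq rfl (by omega)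
  · rw [if_neg ht0] at hpg
    obtain ⟨t', ht'⟩ : ∃ t', t = t' + 1 := ⟨t - 1, by omega⟩
    set s2 : Stacks := update (update (update (update s (.m (.loop i)) l3) (.m .tag)
      (List.replicate t' true)) (.d (.arg i)) (List.replicate a true)) (.d (.arg' i))
      (List.replicate b true) with hs2
    set s3 : Stacks := update (update (update s (.m (.loop i)) l3) (.d (.arg i))
      (List.replicate a true)) (.d (.arg' i)) (List.replicate b true) with hs3
    have h3 : Amort (readNat (.m (.loop i)) (.d (.arg' i)))
        (update s1 (.m .tag) (List.replicate t' true)) s2 (2 * B + 1) := by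
      refine (amort_readNat (k := .m (.loop i)) (k' := .d (.arg' i)) (by simp) (by simp) (by simp)
        (by simpa [hs1] using ha2)).of_eq ?_ ?_
      · funext r
        rcases r with r | r
        · cases r <;> simp [hs1, hs2, update_apply, ← hl3]
          split_ifs <;> rfl
        · simp [hs1, hs2, update_apply, ← hb']
      · simp [hs1]; omega
    have hc : s3.Clean (i + 1) :=
      ((hs.update below_loop _).update below_arg _).update below_arg' _
    have hB3 : ∀ r, (s3 (.d r)).length ≤ B := by
      intro r
      by_cases hr : r = .arg i
      · subst hr; simp [hs3]; omega
      · by_cases hr' : r = .arg' i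
        · subst hr'; simp [hs3]; omega
        · simpa [hs3, hr, hr'] using hB r
    have q1 : s3.out = s.out := by simp [hs3, Stacks.out]
    have q2 : s3.env = (s.env.set (.arg i) a).set (.arg' i) b := by simp [hs3, Env.set]
    have q3 : s3.base = s.base := by simp [hs3, Stacks.base]
    have htag : s1 (.m .tag) = true :: List.replicate t' true := by
      simp [hs1, ht', List.replicate_succ]
    have hs23 : ∀ u, update s2 (.m .tag) u = update s3 (.m .tag) u := by
      intro u
      funext r
      rcases r with r | r
      · cases r <;> simp [hs2, hs3, update_apply]
      · simp [hs2, hs3, update_apply]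
    have hs3t : update s3 (.m .tag) [] = s3 := by
      rw [← hc.tag, update_eq_self]
    by_cases ht1 : t = 1
    · rw [if_pos ht1] at hpg
      simp only [hpg, Cmd.gateSem] at hG ⊢
      have hs2' : s2 = s3 := by
        have : t' = 0 := by omega
        rw [← hs3t, ← hs23, hs2, this]
        simp only [List.replicate_zero]
        funext r
        rcases r with r | r
        · cases r <;> simp [update_apply]
        · simp [update_apply]
      have h4 := ha B G s3 hc hB3 (by rw [q2]; simpa [hs3] using hG)
      rw [q1, q2, q3] at h4
      rw [hs2'] at h3
      have h5 := hend l3 a b (runItems s.base (sa ((s.env.set (.arg i) a).set (.arg' i) b)) s.out)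
        (by omega) (by omega)
      rw [← hs3] at h5
      exact (h1.seq (h2.seq ((Amort.case_true (by simp) htag
        (h3.seq (Amort.case_nil hc.tag h4))).seq h5))).of_eq rfl (by omega)
    · rw [if_neg ht1] at hpg
      simp only [hpg, Cmd.gateSem] at hG ⊢
      obtain ⟨t'', ht''⟩ : ∃ t'', t' = t'' + 1 := ⟨t' - 1, by omega⟩
      have h4 := ho B G s3 hc hB3 (by rw [q2]; simpa [hs3] using hG)
      rw [q1, q2, q3] at h4
      have h5 := hend l3 a b (runItems s.base (so ((s.env.set (.arg i) a).set (.arg' i) b)) s.out)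
        (by omega) (by omega)
      rw [← hs3] at h5
      have h6 : Amort (clear (.m .tag)) (update s2 (.m .tag) (List.replicate t'' true)) s3
          (2 * B + 1) := by
        refine (amort_clear (by simp) _).of_eq ?_ ?_
        · rw [update_idem, hs23, hs3t]
        · simp; omega
      have htag2 : s2 (.m .tag) = true :: List.replicate t'' true := by
        simp [hs2, ht'', List.replicate_succ]
      exact (h1.seq (h2.seq ((Amort.case_true (by simp) htag
        (h3.seq (Amort.case_true (by simp) htag2 (h6.seq h4)))).seq h5))).of_eq rfl (by omega)

theorem amort_forGates_loop (hn : Emits pn sn (i + 1) cn) (ha : Emits pa sa (i + 1) ca)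
    (ho : Emits po so (i + 1) co) (B G : ℕ) (l : List Bool) :
    ∀ (k : ℕ) (s : Stacks), s.Clean (i + 1) → s (.m (.loop i)) = l → s (.d (.arg i)) = [] →
    s (.d (.arg' i)) = [] → s (.d (.idx i)) = List.replicate k true →
    (∀ r, r ≠ .idx i → (s (.d r)).length ≤ B) → k + l.length ≤ B →
    (s (.m .cnt)).length + (Cmd.gatesSem s.env i sn sa so k (parseGates l).1).length ≤ G →
    Amort (.loop (.m (.loop i)) true .skip (gateStep pn pa po i)) s
      (Stacks.put (update (update s (.m (.loop i)) (parseGates l).2) (.d (.idx i))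
          (List.replicate (k + (parseGates l).1.length) true))
        (runItems s.base (Cmd.gatesSem s.env i sn sa so k (parseGates l).1) s.out))
      (l.length * (cn B G + ca B G + co B G + 12 * B + 16) + 1) := by
  induction l using parseGates.induct with
  | case1 =>
    intro k s hs hl ha1 ha2 hk hB hkm hG
    refine (Amort.loop_nil hl).of_eq ?_ (by simp)
    simp only [parseGates, Cmd.gatesSem, runItems, List.foldl_nil, List.length_nil, Nat.add_zero,
      ← hk]
    rw [← hl, update_eq_self, update_eq_self, Stacks.put_out_self]
  | case2 l =>
    intro k s hs hl ha1 ha2 hk hB hkm hG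
    refine (Amort.loop_break (by simp) hl).of_eq ?_ (by simp)
    simp only [parseGates, Cmd.gatesSem, runItems, List.foldl_nil, List.length_nil, Nat.add_zero,
      ← hk]
    have : s (.d (.idx i)) = update s (.m (.loop i)) l (.d (.idx i)) := by simp
    rw [this, update_eq_self]
    have : s.out = Stacks.out (update s (.m (.loop i)) l) := by simp [Stacks.out]
    rw [this, Stacks.put_out_self]
  | case3 l ih =>
    intro k s hs hl ha1 ha2 hk hB hkm hG
    have hln := parseGate_snd_length_le l
    set g := (parseGate l).1 with hg
    set l' := (parseGate l).2 with hl'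
    have henv : s.env.set (.idx i) k = s.env := by
      simp only [Env.set]
      rw [← hk]
      exact update_eq_self _ _
    simp only [parseGates, Cmd.gatesSem, List.length_append, henv, ← hg, ← hl'] at hG
    simp only [List.length_cons] at hkm
    set s1 : Stacks := update s (.m (.loop i)) l with hs1
    have q1 : s1.out = s.out := by simp [hs1, Stacks.out]
    have q2 : s1.env = s.env := by simp [hs1]
    have q3 : s1.base = s.base := by simp [hs1, Stacks.base]
    have hc1 : s1.Clean (i + 1) := hs.update below_loop _
    have h1 := amort_gateStep hn ha ho B G k l s1 hc1 (by simp [hs1]) (by simpa [hs1] using ha1)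
      (by simpa [hs1] using ha2) (by simpa [hs1] using hk) (by
        intro r
        by_cases hr : r = .idx i
        · subst hr; simp [hs1, hk]; omega
        · simpa [hs1] using hB r hr) (by omega)
      (by rw [q2, ← hg]; simp [hs1] at hG ⊢; omega)
    rw [q1, q2, q3, ← hg, ← hl'] at h1
    set is := Cmd.gateSem s.env i sn sa so g with his
    set o := runItems s.base is s.out with ho
    set s2 : Stacks := Stacks.put (update (update s1 (.m (.loop i)) l') (.d (.idx i))
      (List.replicate (k + 1) true)) o with hs2
    have hb2 : s2.base = s.base := by simp [hs1, hs2, Stacks.base]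
    have ho2 : s2.out = o := by simp [hs2]
    have he2 : s2.env = s.env.set (.idx i) (k + 1) := by
      simp [hs2, hs1, Env.set]
    have hset : ∀ j, (s.env.set (.idx i) (k + 1)).set (.idx i) j = s.env.set (.idx i) j := by
      intro j; simp [Env.set]
    have hsem : ∀ j gs, Cmd.gatesSem (s.env.set (.idx i) (k + 1)) i sn sa so j gs =
        Cmd.gatesSem s.env i sn sa so j gs := by
      intro j gs
      induction gs generalizing j with
      | nil => rfl
      | cons m gs ih => simp [Cmd.gatesSem, hset, ih]
    have h3 := ih (k + 1) s2 (((hc1.update below_loop _).update below_idx _).put o)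
      (by simp [hs2]) (by simpa [hs2, hs1] using ha1) (by simpa [hs2, hs1] using ha2)
      (by simp [hs2]) (by
        intro r hr
        simpa [hs2, hs1, hr] using hB r hr) (by omega) (by
        have := runItems_cnt_length s.base is s.out
        rw [he2, hsem]
        simp only [hs2, ne_eq, reduceCtorEq, not_false_eq_true, update_of_ne, Stacks.put_cnt]
        rw [← ho] at this
        simp only [Stacks.out] at this
        omega)
    rw [hb2, ho2, he2, hsem] at h3
    refine (Amort.loop_true (by simp) hl h1 h3).of_eq ?_ ?_
    · simp only [parseGates, Cmd.gatesSem, runItems_append, henv, ← hg, ← hl', ← ho, ← his]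
      have ekm : k + 1 + (parseGates l').1.length = k + ((parseGates l').1.length + 1) := by omega
      funext r
      rcases r with r | r
      · cases r <;> simp [hs1, hs2, update_apply]
        split_ifs <;> rfl
      · by_cases hr : r = .idx i
        · simp [hr, ekm]
        · simp [hs1, hs2, hr]
    · have h5 : l'.length * (cn B G + ca B G + co B G + 12 * B + 16) ≤
          l.length * (cn B G + ca B G + co B G + 12 * B + 16) :=
        Nat.mul_le_mul_right _ (by omega)
      simp only [List.length_cons]
      rw [Nat.add_mul]
      omega

theorem emits_forGates (hn : Emits pn sn (i + 1) cn) (ha : Emits pa sa (i + 1) ca)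
    (hoo : Emits po so (i + 1) co) (r : DReg) {d : ℕ} (hi : d ≤ i) :
    Emits (.seq (dup (.d r) (.m (.loop i)))
      (.seq (.loop (.m (.loop i)) true .skip (gateStep pn pa po i))
        (.seq (clear (.m (.loop i))) (clear (.d (.idx i))))))
      (fun e => Cmd.gatesSem e i sn sa so 0 (parseGates (e r)).1) d
      (fun B G => 10 * B + 10 + B * (cn B G + ca B G + co B G + 12 * B + 20)) := by
  intro B G s hs hB hG
  beta_reduce at hG ⊢
  have hd := Amort.of_exec (exec_dup (k := .d r) (k' := .m (.loop i)) (by simp) (by simp) (by simp)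
    s hs.tmp (hs.loop i hi)) (by simp)
  set l := s (.d r) with hl
  have e : s.env r = l := rfl
  rw [e] at hG ⊢
  have hlB : l.length ≤ B := hB r
  have hlen := parseGates_length l
  set s1 : Stacks := update s (.m (.loop i)) l with hs1
  have hc1 : s1.Clean (i + 1) := (hs.mono (by omega)).update below_loop _
  have h2 := amort_forGates_loop hn ha hoo B G l 0 s1 hc1 (by simp [hs1])
    (by simp [hs1, hs.arg i hi]) (by simp [hs1, hs.arg' i hi])
    (by simp [hs1, hs.idx i hi]) (fun r _ => by simpa [hs1] using hB r) (by omega)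
    (by simpa [hs1] using hG)
  have hb : Stacks.base s1 = s.base := by simp [Stacks.base, hs1]
  have ho : Stacks.out s1 = s.out := by simp [Stacks.out, hs1]
  have he : Stacks.env s1 = s.env := by simp [hs1]
  rw [hb, ho, he] at h2
  have h3 := amort_clear (k := .m (.loop i)) (by simp)
  have h4 := amort_clear (k := .d (.idx i)) (by simp)
  refine (hd.seq (h2.seq ((h3 _).seq (h4 _)))).of_eq ?_ ?_
  · funext r
    rcases r with r | r
    · cases r <;> simp [update_apply, hs1]
      split_ifs with h
      · subst h; rw [hs.loop _ hi]
      · rfl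
    · by_cases hr : r = .idx i <;> simp [hr, hs.idx i hi, hs1]
  · simp only [Stacks.put_d, Stacks.put_loop, update_self, List.length_replicate, ne_eq,
      reduceCtorEq, not_false_eq_true, update_of_ne, Nat.zero_add]
    have h5 : l.length * (cn B G + ca B G + co B G + 12 * B + 16) ≤
        B * (cn B G + ca B G + co B G + 12 * B + 16) := Nat.mul_le_mul_right _ hlB
    have h6 : B * (cn B G + ca B G + co B G + 12 * B + 20) =
      B * (cn B G + ca B G + co B G + 12 * B + 16) + 4 * B := by ring
    omega

end Loops

/-- The program of a command emits the instructions of the command. -/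
theorem Cmd.emits (c : Cmd) (d : ℕ) (hc : c.WF d) : Emits c.prog c.sem d c.cost := by
  induction c generalizing d with
  | nop => exact emits_nop d
  | gate g => exact emits_gate g d
  | mark f => exact emits_mark f d
  | seq c c' ih ih' => exact emits_seq (ih d hc.1) (ih' d hc.2)
  | forLen i f c ih => exact emits_forLen (ih _ hc.2) f hc.1
  | forBits i f c ih => exact emits_forBits (ih _ hc.2) f hc.1
  | forNats i r c ih => exact emits_forNats (ih _ hc.2) r hc.1
  | forGates i r cn ca co ihn iha iho =>
    exact emits_forGates (ihn _ hc.2.1) (iha _ hc.2.2.1) (iho _ hc.2.2.2) r hc.1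

end QMABalance

namespace QMABalance

/-! ### Polynomial bounds -/

/-- A bound by a power of `n + 2`. -/
def PolyBd (f : ℕ → ℕ) : Prop := ∃ k : ℕ, ∀ n, f n ≤ (n + 2) ^ k

namespace PolyBd

variable {f g : ℕ → ℕ}

/-- The base n + 2 is at least 2, so a constant is absorbed by c ≤ 2 ^ c; for the same reason the
factor 2 in a sum costs one more exponent. -/
theorem const (c : ℕ) : PolyBd fun _ => c :=
  ⟨c, fun n => (Nat.lt_two_pow_self.le).trans (Nat.pow_le_pow_left (by omega) c)⟩

theorem id : PolyBd fun n => n := ⟨1, fun n => by simp⟩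

theorem mul (hf : PolyBd f) (hg : PolyBd g) : PolyBd fun n => f n * g n := by
  obtain ⟨k, hk⟩ := hf
  obtain ⟨l, hl⟩ := hg
  exact ⟨k + l, fun n => by rw [pow_add]; exact Nat.mul_le_mul (hk n) (hl n)⟩

theorem add (hf : PolyBd f) (hg : PolyBd g) : PolyBd fun n => f n + g n := by
  obtain ⟨k, hk⟩ := hf
  obtain ⟨l, hl⟩ := hg
  refine ⟨max k l + 1, fun n => ?_⟩
  have h1 : (n + 2) ^ k ≤ (n + 2) ^ max k l := Nat.pow_le_pow_right (by omega) (le_max_left _ _)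
  have h2 : (n + 2) ^ l ≤ (n + 2) ^ max k l := Nat.pow_le_pow_right (by omega) (le_max_right _ _)
  calc f n + g n ≤ (n + 2) ^ max k l * 2 := by linarith [hk n, hl n]
    _ ≤ (n + 2) ^ (max k l + 1) := by rw [pow_succ]; gcongr; omega

theorem pow (hf : PolyBd f) (k : ℕ) : PolyBd fun n => f n ^ k := by
  obtain ⟨l, hl⟩ := hf
  exact ⟨l * k, fun n => by rw [pow_mul]; exact Nat.pow_le_pow_left (hl n) k⟩

theorem exists_polynomial (hf : PolyBd f) : ∃ P : Polynomial ℕ, ∀ n, f n ≤ P.eval n := by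
  obtain ⟨k, hk⟩ := hf
  exact ⟨(Polynomial.X + 2) ^ k, fun n => by simpa using hk n⟩

theorem listSum {ι : Type} {F : ι → ℕ → ℕ} (l : List ι) (h : ∀ i ∈ l, PolyBd (F i)) :
    PolyBd fun n => (l.map fun i => F i n).sum := by
  induction l with
  | nil => simpa using const 0
  | cons i l ih =>
    simp only [List.map_cons, List.sum_cons]
    exact (h i (by simp)).add (ih fun j hj => h j (by simp [hj]))

end PolyBd

theorem Fld.polyBd_cost {R : Type} (f : Fld R) {B : ℕ → ℕ} (hB : PolyBd B) :
    PolyBd fun n => f.cost (B n) :=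
  (((PolyBd.const _).mul (((PolyBd.const _).mul hB).add (.const _))).add (.const _)).add (.const _)

theorem GateF.polyBd_cost {R : Type} (g : GateF R) {B : ℕ → ℕ} (hB : PolyBd B) :
    PolyBd fun n => g.cost (B n) :=
  (((PolyBd.const _).add (.const _))).add
    (.listSum (F := fun f n => Fld.cost (B n) f) _ fun f _ => f.polyBd_cost hB)

namespace Cmd

/-- The bounds `B` and `G` range over all polynomially bounded functions, because a loop hands an
enlarged register bound to its body. -/
theorem polyBd_cost (c : Cmd) : ∀ {B G : ℕ → ℕ}, PolyBd B → PolyBd G →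
    PolyBd fun n => c.cost (B n) (G n) := by
  induction c with
  | nop => exact fun _ _ => .const 1
  | gate g => exact fun hB _ => (PolyBd.const _).mul (g.polyBd_cost hB)
  | mark f => exact fun hB hG => ((recordGate f).polyBd_cost (hB.add hG)).add (.const _)
  | seq c c' h h' => exact fun hB hG => (h hB hG).add (h' hB hG)
  | forLen i f c h =>
    intro B G hB hG
    have hf := f.polyBd_cost hB
    exact ((PolyBd.const _).mul hf).add (hf.mul ((h (hf.add hB) hG).add (.const _)))
  | forBits i f c h =>
    intro B G hB hG
    have hf := f.polyBd_cost hB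
    exact ((PolyBd.const _).mul hf).add (hf.mul (((h (hf.add hB) hG).add
      ((PolyBd.const _).mul hf)).add (.const _)))
  | forNats i r c h =>
    intro B G hB hG
    exact (((PolyBd.const _).mul hB).add (.const _)).add (hB.mul (((h hB hG).add
      ((PolyBd.const _).mul hB)).add (.const _)))
  | forGates i r cn ca co hn ha ho =>
    intro B G hB hG
    exact (((PolyBd.const _).mul hB).add (.const _)).add (hB.mul (((((hn hB hG).add
      (ha hB hG)).add (ho hB hG)).add ((PolyBd.const _).mul hB)).add (.const _)))

/-- Bound for the number of instructions. -/
def count : Cmd → ℕ → ℕ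
  | nop, _ => 0
  | gate _, _ => 1
  | mark _, _ => 1
  | seq c c', B => c.count B + c'.count B
  | forLen _ f c, B => f.cost B * c.count (f.cost B + B)
  | forBits _ f c, B => f.cost B * c.count (f.cost B + B)
  | forNats _ _ c, B => B * c.count B
  | forGates _ _ cn ca co, B => B * (cn.count B + ca.count B + co.count B)

theorem polyBd_count (c : Cmd) : ∀ {B : ℕ → ℕ}, PolyBd B → PolyBd fun n => c.count (B n) := by
  induction c with
  | nop => exact fun _ => .const 0
  | gate g => exact fun _ => .const 1
  | mark f => exact fun _ => .const 1
  | seq c c' h h' => exact fun hB => (h hB).add (h' hB)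
  | forLen i f c h => exact fun hB => (f.polyBd_cost hB).mul (h ((f.polyBd_cost hB).add hB))
  | forBits i f c h => exact fun hB => (f.polyBd_cost hB).mul (h ((f.polyBd_cost hB).add hB))
  | forNats i r c h => exact fun hB => hB.mul (h hB)
  | forGates i r cn ca co hn ha ho => exact fun hB => hB.mul (((hn hB).add (ha hB)).add (ho hB))

theorem length_set_le {e : Env} {B n : ℕ} (he : ∀ r, (e r).length ≤ B) (hn : n ≤ B) (q : DReg) :
    ∀ r, (e.set q n r).length ≤ B := by
  intro r
  by_cases h : r = q
  · subst h; simpa [Env.set] using hn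
  · simpa [Env.set, h] using he r

theorem length_flatMap_range'_le {α : Type} (f : ℕ → List α) (m C : ℕ)
    (h : ∀ k < m, (f k).length ≤ C) : ((List.range' 0 m).flatMap f).length ≤ m * C := by
  rw [List.length_flatMap]
  have := List.sum_le_card_nsmul ((List.range' 0 m).map fun k => (f k).length) C (by
    intro x hx
    obtain ⟨k, hk, rfl⟩ := List.mem_map.1 hx
    exact h k (by simpa using hk))
  simpa using this

/-- This provides in advance the bound `G` for the number of instructions that the cost of a command
refers to. -/
theorem length_sem_le (c : Cmd) : ∀ (B : ℕ) (e : Env), (∀ r, (e r).length ≤ B) →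
    (c.sem e).length ≤ c.count B := by
  induction c with
  | nop => intro B e he; simp [sem, count]
  | gate g => intro B e he; simp [sem, count]
  | mark f => intro B e he; simp [sem, count]
  | seq c c' h h' =>
    intro B e he
    simp only [sem, count, List.length_append]
    exact Nat.add_le_add (h B e he) (h' B e he)
  | forLen i f c h =>
    intro B e he
    have hf := Fld.val_le_cost (f := f) (len := e.len) (B := B) fun r _ => he r
    refine (length_flatMap_range'_le _ _ (c.count (f.cost B + B)) fun k hk => h _ _ ?_).trans
      (Nat.mul_le_mul_right _ (by omega))
    exact length_set_le (fun r => (he r).trans (by omega)) (by omega) _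
  | forBits i f c h =>
    intro B e he
    have hf := Fld.val_le_cost (f := f) (len := e.len) (B := B) fun r _ => he r
    refine (length_flatMap_range'_le _ _ (c.count (f.cost B + B)) fun k hk => ?_).trans
      (Nat.mul_le_mul_right _ (by omega))
    split_ifs
    · exact h _ _ (length_set_le (fun r => (he r).trans (by omega)) (by omega) _)
    · simp
  | forNats i r c h =>
    intro B e he
    have key : ∀ (l : List Bool) (k : ℕ), k + l.length ≤ B →
        (natsSem e i c.sem k (parseNats l).1).length ≤ l.length * c.count B := by
      intro l
      induction l using parseNats.induct with
      | case1 => intro k hk; simp [parseNats, natsSem]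
      | case2 l => intro k hk; simp [parseNats, natsSem]
      | case3 l ih =>
        intro k hk
        have hl := parseNat_length l
        have h1 := ih (k + 1) (by simp at hk; omega)
        have h2 := h B ((e.set (.idx i) k).set (.arg i) (parseNat l).1)
          (length_set_le (length_set_le he (by omega) _) (by simp at hk; omega) _)
        have h3 : (parseNat l).2.length * c.count B ≤ l.length * c.count B :=
          Nat.mul_le_mul_right _ (by omega)
        simp only [parseNats, natsSem, List.length_append, List.length_cons]
        linarith
    exact (key _ 0 (by simpa using he r)).trans (Nat.mul_le_mul_right _ (he r))
  | forGates i r cn ca co hn ha ho =>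
    intro B e he
    have key : ∀ (l : List Bool) (k : ℕ), k + l.length ≤ B →
        (gatesSem e i cn.sem ca.sem co.sem k (parseGates l).1).length ≤
          l.length * (cn.count B + ca.count B + co.count B) := by
      intro l
      induction l using parseGates.induct with
      | case1 => intro k hk; simp [parseGates, gatesSem]
      | case2 l => intro k hk; simp [parseGates, gatesSem]
      | case3 l ih =>
        intro k hk
        have hl := parseGate_snd_length_le l
        have h1 := ih (k + 1) (by simp at hk; omega)
        have h2 : (gateSem (e.set (.idx i) k) i cn.sem ca.sem co.sem (parseGate l).1).length ≤
            cn.count B + ca.count B + co.count B := by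
          have e0 := parseNat_length l
          have e1 := parseNat_length (parseNat l).2
          have e2 := parseNat_length (parseNat (parseNat l).2).2
          have e3 := length_set_le he (n := k) (by omega) (.idx i)
          have e4 := length_set_le e3 (n := (parseNat (parseNat l).2).1)
            (by simp at hk; omega) (.arg i)
          have e5 := length_set_le e4 (n := (parseNat (parseNat (parseNat l).2).2).1)
            (by simp at hk; omega) (.arg' i)
          have := hn B _ e4
          have := ha B _ e5
          have := ho B _ e5
          simp only [parseGate]
          split_ifs <;> simp only [gateSem] <;> omega
        have h3 := Nat.mul_le_mul_right (cn.count B + ca.count B + co.count B) hl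
        simp only [parseGates, gatesSem, List.length_append, List.length_cons]
        linarith
    exact (key _ 0 (by simpa using he r)).trans (Nat.mul_le_mul_right _ (he r))

end Cmd

end QMABalance

namespace QMABalance

open Function Prog

/-! ### Reading the input -/

/-- A step pushes at most one bit. Running times therefore bound stack heights, and the final
clean-up needs no separate account of lengths. -/
theorem Prog.Exec.length_le {K : Type} [DecidableEq K] {p : Prog K} {s s' : K → List Bool} {t : ℕ}
    (h : Exec p s s' t) (k : K) : (s' k).length ≤ (s k).length + t := by
  have pop : ∀ {s : K → List Bool} {b l} {q : K}, s q = b :: l →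
      (update s q l k).length ≤ (s k).length := by
    intro s b l q hq
    by_cases e : k = q
    · subst e; simp [hq]
    · simp [e]
  induction h with
  | skip => omega
  | push q b s =>
    by_cases e : k = q
    · subst e; simp
    · simp [e]
  | seq _ _ h1 h2 => omega
  | case_nil _ _ h => omega
  | case_false hq _ h => have := pop hq; omega
  | case_true hq _ h => have := pop hq; omega
  | loop_nil => omega
  | loop_break hq => have := pop hq; omega
  | loop_false hq _ _ h h' => have := pop hq; omega
  | loop_true hq _ _ h h' => have := pop hq; omega

theorem Runs.length_le {p : RProg} {s s' : Stacks} {T : ℕ} (h : Runs p s s' T) (k : Reg) :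
    (s' k).length ≤ (s k).length + T := by
  obtain ⟨t, ht, h⟩ := h
  exact (h.length_le k).trans (by omega)

/-- The stacks during the analysis of the input. -/
def readStacks (x l : List Bool) (e : Env) : Stacks
  | .m .inn => x
  | .m (.loop i) => if i = 0 then l else []
  | .m _ => []
  | .d r => e r

section Read

variable (x l : List Bool) (e : Env)

theorem update_readStacks_loop (l' : List Bool) :
    update (readStacks x l e) (.m (.loop 0)) l' = readStacks x l' e := by
  funext r
  rcases r with r | r
  · by_cases h : r = .loop 0
    · subst h; simp [readStacks]
    · rw [update_of_ne (by simpa using h)]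
      cases r <;> simp_all [readStacks]
  · simp [readStacks]

theorem update_readStacks_inn (l' : List Bool) :
    update (readStacks x l e) (.m .inn) l' = readStacks l' l e := by
  funext r
  rcases r with r | r
  · by_cases h : r = .inn
    · subst h; simp [readStacks]
    · rw [update_of_ne (by simpa using h)]
      cases r <;> simp_all [readStacks]
  · simp [readStacks]

theorem update_readStacks_d (r : DReg) (l' : List Bool) :
    update (readStacks x l e) (.d r) l' = readStacks x l (update e r l') := by
  funext q
  rcases q with q | q
  · cases q <;> simp [readStacks]
  · simp [readStacks, update_apply]

theorem readStacks_loop : readStacks x l e (.m (.loop 0)) = l := rfl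

theorem readStacks_d (r : DReg) : readStacks x l e (.d r) = e r := rfl

theorem runs_read_nat {B : ℕ} (r : DReg) (hr : e r = []) (hB : l.length ≤ B) :
    Runs (readNat (.m (.loop 0)) (.d r)) (readStacks x l e)
      (readStacks x (parseNat l).2 (e.set r (parseNat l).1)) (2 * B + 1) := by
  refine (Runs.of_exec (exec_readNat (by simp) _)).of_eq ?_ ?_
  · simp only [readStacks_loop, readStacks_d, update_readStacks_loop, update_readStacks_d, hr,
      List.append_nil, Env.set]
  · have := parseNat_length l
    simp only [readStacks_loop]
    omega

theorem runs_read_copy {B : ℕ} (r : DReg) (hr : e r = []) (hB : l.length ≤ B) :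
    Runs (dup (.m (.loop 0)) (.d r)) (readStacks x l e)
      (readStacks x l (update e r l)) (5 * B + 2) := by
  refine (Runs.of_exec (exec_dup (by simp) (by simp) (by simp) _ rfl hr)).of_eq ?_ ?_
  · rw [readStacks_loop, update_readStacks_d]
  · rw [readStacks_loop]; omega

theorem clean_readStacks (h1 : ∀ i, e (.arg i) = []) (h2 : ∀ i, e (.arg' i) = [])
    (h3 : ∀ i, e (.idx i) = []) : (readStacks x l e).Clean 1 := by
  refine ⟨rfl, rfl, rfl, fun i hi => ?_, fun i hi => rfl, fun i _ => h3 i, fun i _ => h1 i,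
    fun i _ => h2 i⟩
  fin_cases i
  · simp at hi
  all_goals rfl

/-- Skip the code of a list of gates. -/
def skipGates : RProg :=
  .seq (.loop (.m (.loop 0)) true .skip (gateStep .skip .skip .skip 0)) (clear (.d (.idx 0)))

/-- Skip the code of a list of numbers. -/
def skipNats : RProg :=
  .seq (.loop (.m (.loop 0)) true .skip
    (.seq (readNat (.m (.loop 0)) (.d (.arg 0))) (.seq .skip
      (.seq (clear (.d (.arg 0))) (.push (.d (.idx 0)) true))))) (clear (.d (.idx 0)))

/-- With `bwd` empty at the start no potential is available, and what remains at the end only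
improves the bound. -/
theorem _root_.QMABalance.Amort.toRuns {p : RProg} {s s' : Stacks} {τ : ℕ} (h : Amort p s s' τ)
    (hb : s (.m .bwd) = []) : Runs p s s' τ := by
  obtain ⟨t, h, ht⟩ := h
  exact ⟨t, by rw [hb] at ht; simp at ht; omega, h⟩

theorem gatesSem_nop (e : Env) (i : Fin 4) (k : ℕ) (gs : List BoolGate) :
    Cmd.gatesSem e i (fun _ => []) (fun _ => []) (fun _ => []) k gs = [] := by
  induction gs generalizing k with
  | nil => rfl
  | cons g gs ih => cases g <;> simp [Cmd.gatesSem, Cmd.gateSem, ih]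

theorem natsSem_nop (e : Env) (i : Fin 4) (k : ℕ) (ns : List ℕ) :
    Cmd.natsSem e i (fun _ => []) k ns = [] := by
  induction ns generalizing k with
  | nil => rfl
  | cons n ns ih => simp [Cmd.natsSem, ih]

/-- Skipping a list is the loop over gates with bodies that do nothing: no instruction is emitted,
and the loop register is left with the rest of the string. -/
theorem runs_read_skipGates {B : ℕ} (h1 : ∀ i, e (.arg i) = []) (h2 : ∀ i, e (.arg' i) = [])
    (h3 : ∀ i, e (.idx i) = []) (hB : ∀ r, (e r).length ≤ B) (hl : l.length ≤ B) :
    Runs skipGates (readStacks x l e) (readStacks x (parseGates l).2 e)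
      (B * (12 * B + 21) + 2) := by
  have hn := emits_nop 1
  have h := amort_forGates_loop (i := 0) hn hn hn B 0 l 0 (readStacks x l e)
    (clean_readStacks x l e h1 h2 h3) rfl (h1 0) (h2 0) (h3 0) (fun r _ => hB r) (by simpa using hl)
    (by erw [gatesSem_nop]; rfl)
  have := (h.seq (amort_clear (k := .d (.idx 0)) (by simp) _)).toRuns rfl
  refine this.of_eq ?_ ?_
  · erw [gatesSem_nop]
    simp only [runItems, List.foldl_nil, update_readStacks_loop, update_readStacks_d]
    rw [show Stacks.out (readStacks x l e) = Stacks.out (readStacks x (parseGates l).2 (update e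
      (.idx 0) (List.replicate (0 + (parseGates l).1.length) true))) from rfl, Stacks.put_out_self,
      update_readStacks_d, update_idem, ← h3 0, update_eq_self]
  · have := parseGates_length l
    have h5 : l.length * (12 * B + 19) ≤ B * (12 * B + 19) := Nat.mul_le_mul_right _ hl
    simp only [Cmd.cost, Stacks.put_d, update_self, List.length_replicate]
    nlinarith

theorem runs_read_skipNats {B : ℕ} (h1 : ∀ i, e (.arg i) = []) (h2 : ∀ i, e (.arg' i) = [])
    (h3 : ∀ i, e (.idx i) = []) (hB : ∀ r, (e r).length ≤ B) (hl : l.length ≤ B) :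
    Runs skipNats (readStacks x l e) (readStacks x (parseNats l).2 e)
      (B * (12 * B + 21) + 2) := by
  have h := amort_forNats_loop (i := 0) (emits_nop 1) B 0 l 0 (readStacks x l e)
    (clean_readStacks x l e h1 h2 h3) rfl (h1 0) (h3 0) (fun r _ => hB r) (by simpa using hl)
    (by erw [natsSem_nop]; rfl)
  have := (h.seq (amort_clear (k := .d (.idx 0)) (by simp) _)).toRuns rfl
  refine this.of_eq ?_ ?_
  · erw [natsSem_nop]
    simp only [runItems, List.foldl_nil, update_readStacks_loop, update_readStacks_d]
    rw [show Stacks.out (readStacks x l e) = Stacks.out (readStacks x (parseNats l).2 (update e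
      (.idx 0) (List.replicate (0 + (parseNats l).1.length) true))) from rfl, Stacks.put_out_self,
      update_readStacks_d, update_idem, ← h3 0, update_eq_self]
  · have := parseNats_length l
    have h5 : l.length * (4 * B + 6) ≤ B * (4 * B + 6) := Nat.mul_le_mul_right _ hl
    simp only [Cmd.cost, Stacks.put_d, update_self, List.length_replicate]
    nlinarith

/-- Store the difference of two numbers. -/
def subLen (r r' q : DReg) : RProg :=
  .seq (addLen (.d r) (.d q)) (.seq (addLen (.d r') (.m .tag))
    (.loop (.m .tag) false .skip (.case (.d q) .skip .skip .skip)))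

theorem runs_subLen {B : ℕ} {r r' q : DReg} (hr : r ≠ q) (hr' : r' ≠ q) (hq : e q = [])
    (h : (e r).length ≤ B) (h' : (e r').length ≤ B) :
    Runs (subLen r r' q) (readStacks x l e)
      (readStacks x l (e.set q ((e r).length - (e r').length))) (13 * B + 5) := by
  -- When the minuend is exhausted, the inner case distinction pops nothing. The loop thus computes
  -- the truncated difference.
  have main : ∀ (b a : ℕ) (s : Stacks), s (.m .tag) = List.replicate b true →
      s (.d q) = List.replicate a true →
      Exec (.loop (.m .tag) false .skip (.case (.d q) .skip .skip .skip)) s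
        (update (update s (.m .tag) []) (.d q) (List.replicate (a - b) true)) (3 * b + 1) := by
    intro b
    induction b with
    | zero =>
      intro a s ht ha
      refine (Exec.loop_nil ht).of_eq ?_
      simp only [List.replicate_zero] at ht
      rw [← ht, update_eq_self, Nat.sub_zero, ← ha, update_eq_self]
    | succ b ih =>
      intro a s ht ha
      rw [show 3 * (b + 1) + 1 = 1 + (1 + 1) + (3 * b + 1) by ring]
      cases a with
      | zero =>
        have h0 := ih 0 (update s (.m .tag) (List.replicate b true)) (by simp) (by simpa using ha)
        refine (Exec.loop_true (l := List.replicate b true) ht (.case_nil (by simpa using ha)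
          (.skip _)) h0).of_eq (by simp)
      | succ a =>
        have h0 := ih a (update (update s (.m .tag) (List.replicate b true)) (.d q)
          (List.replicate a true)) (by simp) (by simp)
        refine (Exec.loop_true (l := List.replicate b true) ht (.case_true
          (l := List.replicate a true) (by simpa [List.replicate_succ] using ha) (.skip _)) h0).of_eq ?_
        funext k
        by_cases h1 : k = .d q <;> by_cases h2 : k = .m .tag <;> simp [h1, h2]
  have a1 := exec_addLen (k := .d r) (k' := .d q) (by simpa using hr) (by simp) (by simp)
    (readStacks x l e) rfl
  have a2 := exec_addLen (k := .d r') (k' := .m .tag) (by simp) (by simp) (by simp)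
    (readStacks x l (e.set q (e r).length)) rfl
  have a3 := main (e r').length (e r).length (update (readStacks x l (e.set q (e r).length))
    (.m .tag) (List.replicate (e r').length true)) (by simp) (by simp [readStacks, Env.set])
  simp only [readStacks_d, hq, List.append_nil, update_readStacks_d] at a1
  have e1 : Env.set e q (e r).length r' = e r' := by simp [Env.set, hr']
  simp only [readStacks_d, e1] at a2
  rw [show readStacks x l (e.set q (e r).length) (.m .tag) = [] from rfl, List.append_nil] at a2
  refine ⟨_, ?_, (a1.seq (a2.seq a3)).of_eq ?_⟩
  · omega
  · funext k
    rcases k with k | k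
    · by_cases h : k = .tag
      · subst h; simp [readStacks]
      · cases k <;> simp_all [readStacks]
    · by_cases h : k = q <;> simp [readStacks, Env.set, h]

/-- Multiply the number in `q` by the number in `r`. -/
def mulLen (r q : DReg) : RProg :=
  .seq (move (.d q) (.m .half)) (.loop (.m .half) false .skip (addLen (.d r) (.d q)))

theorem runs_mulLen {r q : DReg} (hr : r ≠ q) (m : ℕ) (hq : e q = List.replicate m true) :
    Runs (mulLen r q) (readStacks x l e)
      (readStacks x l (e.set q (m * (e r).length))) (m * (5 * (e r).length + 5) + 2) := by
  have main : ∀ (b : ℕ) (s : Stacks), s (.m .half) = List.replicate b true → s (.m .tmp) = [] →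
      Exec (.loop (.m .half) false .skip (addLen (.d r) (.d q))) s
        (update (update s (.m .half) []) (.d q)
          (List.replicate (b * (s (.d r)).length) true ++ s (.d q)))
        (b * (5 * (s (.d r)).length + 3) + 1) := by
    intro b
    induction b with
    | zero =>
      intro s ht _
      refine (Exec.loop_nil ht).of_eq ?_ |>.of_eq rfl |> fun h => by simpa using h
      simp only [List.replicate_zero] at ht
      simp [← ht]
    | succ b ih =>
      intro s ht hs
      have h1 := exec_addLen (k := .d r) (k' := .d q) (by simpa using hr) (by simp) (by simp)
        (update s (.m .half) (List.replicate b true)) (by simpa using hs)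
      have h2 := ih _ (by simp) (by simpa using hs) |> fun h => Exec.loop_true (brk := false)
        (pf := .skip) (l := List.replicate b true) ht h1 h
      have e1 : (Reg.d r) ≠ .d q := by simpa using hr
      simp only [update_of_ne e1, ne_eq, reduceCtorEq, not_false_eq_true, update_of_ne] at h2
      rw [show (b + 1) * (5 * (s (.d r)).length + 3) + 1 = 1 + (5 * (s (.d r)).length + 2) +
        (b * (5 * (s (.d r)).length + 3) + 1) by ring]
      refine h2.of_eq ?_
      funext k
      by_cases h1 : k = .d q
      · subst h1
        simp [← List.append_assoc, Nat.add_mul]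
      · by_cases h2 : k = .m .half <;> simp [h1, h2]
  have a1 := exec_move (k := .d q) (k' := .m .half) (by simp) (readStacks x l e)
  have a2 := main m (update (update (readStacks x l e) (.d q) []) (.m .half)
    (List.replicate m true)) (by simp) rfl
  rw [show readStacks x l e (.m .half) = [] from rfl, readStacks_d, hq, List.append_nil,
    List.reverse_replicate] at a1
  have e1 : (update (update (readStacks x l e) (.d q) []) (.m .half)
    (List.replicate m true)) (.d r) = e r := by simp [readStacks, hr]
  rw [e1] at a2
  refine ⟨_, ?_, (a1.seq a2).of_eq ?_⟩
  · rw [List.length_replicate]; nlinarith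
  · funext k
    rcases k with k | k
    · by_cases h : k = .half
      · subst h; simp [readStacks]
      · cases k <;> simp_all [readStacks]
    · by_cases h : k = q <;> simp [readStacks, Env.set, h]

/-- Store a power. -/
def powLen (r q : DReg) : ℕ → RProg
  | 0 => .push (.d q) true
  | k + 1 => .seq (powLen r q k) (mulLen r q)

theorem runs_powLen {r q : DReg} (hr : r ≠ q) (hq : e q = []) (k : ℕ) :
    Runs (powLen r q k) (readStacks x l e) (readStacks x l (e.set q ((e r).length ^ k)))
      (k * ((e r).length + 2) ^ (k + 5) + 1) := by
  induction k with
  | zero =>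
    refine (Runs.of_exec (Exec.push _ true _)).of_eq ?_ (by omega)
    simp [update_readStacks_d, readStacks_d, hq, Env.set]
  | succ k ih =>
    have h := runs_mulLen x l (e.set q ((e r).length ^ k)) hr ((e r).length ^ k)
      (by simp [Env.set])
    have e1 : e.set q ((e r).length ^ k) r = e r := by simp [Env.set, hr]
    rw [e1] at h
    refine (ih.seq h).of_eq ?_ ?_
    · simp [Env.set, pow_succ]
    · set n := (e r).length
      have h1 : n ^ k ≤ (n + 2) ^ k := Nat.pow_le_pow_left (by omega) k
      have h2 : n ^ k * (5 * n + 5) + 2 ≤ (n + 2) ^ (k + 6) := by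
        have h3 : 1 ≤ (n + 2) ^ k := Nat.one_le_pow _ _ (by omega)
        have h4 : n ^ k * (5 * n + 5) ≤ (n + 2) ^ k * (5 * n + 5) := Nat.mul_le_mul_right _ h1
        have h5 : 5 * n + 7 ≤ (n + 2) ^ 6 := by
          have : (n + 2) ^ 6 ≥ (n + 2) * 2 ^ 5 := by
            rw [pow_succ' (n + 2) 5]; gcongr; omega
          omega
        calc _ ≤ (n + 2) ^ k * (5 * n + 7) := by nlinarith
          _ ≤ (n + 2) ^ k * (n + 2) ^ 6 := Nat.mul_le_mul_left _ h5
          _ = _ := by rw [← pow_add]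
      have h6 : (n + 2) ^ (k + 5) ≤ (n + 2) ^ (k + 6) := Nat.pow_le_pow_right (by omega) (by omega)
      have h7 : k * (n + 2) ^ (k + 5) ≤ k * (n + 2) ^ (k + 6) := Nat.mul_le_mul_left _ h6
      rw [show k + 1 + 5 = k + 6 by ring, Nat.add_mul]
      omega

end Read

end QMABalance

namespace QMABalance

open Function Prog

/-! ### The machine that writes the verification circuits -/

/-- The instructions for a list of tests; a test consists of gates and the number of a qubit. -/
def testItems (Ts : List (List QGate × ℕ)) : List Item :=
  Ts.flatMap fun T => T.1.map .gate ++ [.mark T.2]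

/-- The gates that carry out tests one after the other. The outcome of the first `t` tests is stored
in qubit `N + t`. -/
def testGates (N : ℕ) : ℕ → List (List QGate × ℕ) → List QGate
  | _, [] => []
  | t, T :: Ts => T.1 ++ .ccx (N + t) T.2 (N + t + 1) :: (T.1.reverse ++ testGates N (t + 1) Ts)

/-- The verification circuit for a list of tests of a witness of `W` qubits. -/
def testCircuit (W : ℕ) (Ts : List (List QGate × ℕ)) : QCircuit where
  witness := W
  ancilla := Ts.length + 1
  gates := .x (1 + W) :: (testGates (1 + W) 0 Ts ++ [.cnot (1 + W + Ts.length) 0])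

theorem Fld.val_replicate_append {R : Type} (len : R → ℕ) (c m : ℕ) (r : R) (rs : List R) :
    Fld.val len ⟨c, List.replicate m r ++ rs⟩ = m * len r + Fld.val len ⟨c, rs⟩ := by
  simp [Fld.val]
  omega

theorem Fld.val_replicate {R : Type} (len : R → ℕ) (c m : ℕ) (r : R) :
    Fld.val len ⟨c, List.replicate m r⟩ = m * len r + c := by
  simp [Fld.val]
  omega

theorem encList_encQGate (gs : List QGate) :
    encList encQGate gs = gs.flatMap entryCode ++ [false] := by
  induction gs with
  | nil => rfl
  | cons g gs ih => simp [encList, ih, entryCode]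

theorem runItems_gates (N : ℕ) (U : List QGate) (o : Out) : runItems N (U.map .gate) o =
    ⟨(U.flatMap entryCode).reverse ++ o.fwd, U.reverse.flatMap entryCode ++ o.bwd, o.cnt⟩ := by
  induction U generalizing o with
  | nil => rfl
  | cons g U ih =>
    have := ih (Item.step N o (.gate g))
    simp only [runItems, List.map_cons, List.foldl_cons] at this ⊢
    rw [this]
    simp [Item.step]

/-- A mark empties the undo stack, so consecutive tests do not interfere. What it appends is the
Toffoli gate followed by the gates of the test in reverse order; the length of the counter is the
index of the test qubit that holds the previous outcome. -/
theorem runItems_testItems (N : ℕ) (Ts : List (List QGate × ℕ)) (o : Out) (ho : o.bwd = []) :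
    runItems N (testItems Ts) o = ⟨((testGates N o.cnt.length Ts).flatMap entryCode).reverse ++ o.fwd,
      [], List.replicate Ts.length true ++ o.cnt⟩ := by
  induction Ts generalizing o with
  | nil =>
    obtain ⟨a, b, c⟩ := o
    subst ho
    simp [testItems, runItems, testGates]
  | cons T Ts ih =>
    have e : testItems (T :: Ts) = T.1.map .gate ++ ([.mark T.2] ++ testItems Ts) := by
      simp [testItems]
    have h := ih (runItems N [.mark T.2] (runItems N (T.1.map .gate) o)) rfl
    rw [e, runItems_append, runItems_append, h, runItems_gates]
    simp [runItems, Item.step, testGates, ho, List.replicate_succ']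

section Input

variable (k : ℕ) (x : List Bool)

/-- The bit string behind the number `n`. -/
def restBits : List Bool := (parseNat x).2

/-- The bit string behind the degree bound. -/
def restDeg : List Bool := (parseNat (restBits x)).2

/-- The bit string behind the number of inputs of the first circuit. -/
def restAdjIn : List Bool := (parseNat (restDeg x)).2

/-- The bit string behind the gates of the first circuit. -/
def restAdjGates : List Bool := (parseGates (restAdjIn x)).2

/-- The bit string behind the first circuit. -/
def restAdjOuts : List Bool := (parseNats (restAdjGates x)).2

/-- The bit string behind the number of inputs of the second circuit. -/
def restSgnIn : List Bool := (parseNat (restAdjOuts x)).2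

/-- The bit string behind the gates of the second circuit. -/
def restSgnGates : List Bool := (parseGates (restSgnIn x)).2

/-- The data registers that are prepared for an input. -/
def inputEnv : Env
  | .len => List.replicate x.length true
  | .bits => List.replicate (parseNat x).1 true
  | .deg => List.replicate (parseNat (restBits x)).1 true
  | .adjIn => List.replicate (parseNat (restDeg x)).1 true
  | .adjGates => restAdjIn x
  | .adjOuts => restAdjGates x
  | .sgnIn => List.replicate (parseNat (restAdjOuts x)).1 true
  | .sgnGates => restSgnIn x
  | .sgnOuts => restSgnGates x
  | .free => List.replicate (x.length - (parseNat x).1) true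
  | .rounds => List.replicate (x.length ^ k) true
  | _ => []

/-- The order in which the registers are prepared. -/
def DReg.rank : DReg → ℕ
  | .len => 0
  | .bits => 1
  | .deg => 2
  | .adjIn => 3
  | .adjGates => 4
  | .adjOuts => 5
  | .sgnIn => 6
  | .sgnGates => 7
  | .sgnOuts => 8
  | .free => 9
  | .rounds => 10
  | _ => 11

/-- The first `j` registers are prepared. -/
def stageEnv (j : ℕ) : Env := fun r => if r.rank < j then inputEnv k x r else []

theorem DReg.rank_inj {r q : DReg} (h : r.rank = q.rank) (hr : r.rank < 11) : r = q := by
  cases r <;> cases q <;> simp [rank] at h hr ⊢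

theorem stageEnv_succ {r : DReg} {j : ℕ} (h : r.rank = j) (hj : j < 11) :
    update (stageEnv k x j) r (inputEnv k x r) = stageEnv k x (j + 1) := by
  funext q
  by_cases hq : q = r
  · subst hq; simp [stageEnv, h]
  · have : q.rank ≠ j := fun hqj => hq (DReg.rank_inj (hqj.trans h.symm) (by omega))
    simp only [stageEnv, update_of_ne hq]
    congr 1
    simp only [eq_iff_iff]
    omega

theorem stageEnv_last : stageEnv k x 11 = inputEnv k x := by
  funext r
  cases r <;> simp [stageEnv, DReg.rank, inputEnv]

theorem stageEnv_eq_nil {r : DReg} {j : ℕ} (h : j ≤ r.rank) : stageEnv k x j r = [] :=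
  if_neg (by omega)

theorem stageEnv_eq {r : DReg} {j : ℕ} (h : r.rank < j) : stageEnv k x j r = inputEnv k x r :=
  if_pos h

theorem length_rest_le : (restBits x).length ≤ x.length ∧ (restDeg x).length ≤ x.length ∧
    (restAdjIn x).length ≤ x.length ∧ (restAdjGates x).length ≤ x.length ∧
    (restAdjOuts x).length ≤ x.length ∧ (restSgnIn x).length ≤ x.length ∧
    (restSgnGates x).length ≤ x.length := by
  have h1 := parseNat_length x
  have h2 := parseNat_length (restBits x)
  have h3 := parseNat_length (restDeg x)
  have h4 := parseGates_length (restAdjIn x)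
  have h5 := parseNats_length (restAdjGates x)
  have h6 := parseNat_length (restAdjOuts x)
  have h7 := parseGates_length (restSgnIn x)
  simp only [restBits, restDeg, restAdjIn, restAdjGates, restAdjOuts, restSgnIn,
    restSgnGates] at *
  omega

theorem length_inputEnv_le (r : DReg) (hr : r ≠ .rounds) : (inputEnv k x r).length ≤ x.length := by
  obtain ⟨h1, h2, h3, h4, h5, h6, h7⟩ := length_rest_le x
  have e1 := parseNat_length x
  have e2 := parseNat_length (restBits x)
  have e3 := parseNat_length (restDeg x)
  have e4 := parseNat_length (restAdjOuts x)
  cases r <;> simp [inputEnv] <;> first | omega | exact absurd rfl hr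

theorem length_stageEnv_le (j : ℕ) (hj : j ≤ 10) (r : DReg) :
    (stageEnv k x j r).length ≤ x.length := by
  unfold stageEnv
  split_ifs with h
  · exact length_inputEnv_le k x r (by rintro rfl; simp [DReg.rank] at h; omega)
  · simp

theorem single_inn : single (.m .inn) x = readStacks x [] (stageEnv k x 0) := by
  funext r
  rcases r with r | r
  · cases r <;> simp [single, readStacks]
  · simp [single, readStacks, stageEnv]

/-- Analyse the input. -/
def readInput : RProg :=
  .seq (addLen (.m .inn) (.d .len)) <| .seq (dup (.m .inn) (.m (.loop 0))) <|
  .seq (clear (.m .inn)) <| .seq (readNat (.m (.loop 0)) (.d .bits)) <|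
  .seq (readNat (.m (.loop 0)) (.d .deg)) <| .seq (readNat (.m (.loop 0)) (.d .adjIn)) <|
  .seq (dup (.m (.loop 0)) (.d .adjGates)) <| .seq skipGates <|
  .seq (dup (.m (.loop 0)) (.d .adjOuts)) <| .seq skipNats <|
  .seq (readNat (.m (.loop 0)) (.d .sgnIn)) <| .seq (dup (.m (.loop 0)) (.d .sgnGates)) <|
  .seq skipGates <| .seq (dup (.m (.loop 0)) (.d .sgnOuts)) <| .seq (clear (.m (.loop 0))) <|
  .seq (subLen .len .bits .free) (powLen .len .rounds k)

/-- Time to analyse an input of length `n`. -/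
def readTime (n : ℕ) : ℕ :=
  3 * (n * (12 * n + 21)) + 60 * n + 60 + k * (n + 2) ^ (k + 5)

/-- Each phase fills the register of the next rank, and `stageEnv` describes the state in between.
All parsers are total, so this holds for every bit string, not just for encodings. -/
theorem runs_readInput : Runs (readInput k) (single (.m .inn) x)
    (readStacks [] [] (inputEnv k x))
    (readTime k x.length) := by
  obtain ⟨h1, h2, h3, h4, h5, h6, h7⟩ := length_rest_le x
  have le := length_stageEnv_le k x
  obtain ⟨B, hB⟩ : ∃ B, x.length = B := ⟨_, rfl⟩
  rw [hB] at h1 h2 h3 h4 h5 h6 h7 le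
  simp only [readTime, hB]
  have nil : ∀ {j : ℕ} {r : DReg}, j ≤ r.rank → stageEnv k x j r = [] := stageEnv_eq_nil k x
  have a1 : Runs (addLen (.m .inn) (.d .len)) (single (.m .inn) x)
      (readStacks x [] (stageEnv k x 1)) (5 * B + 2) := by
    rw [single_inn k x]
    refine (Runs.of_exec (exec_addLen (by simp) (by simp) (by simp) _ rfl)).of_eq ?_
      (by rw [← hB]; rfl)
    rw [update_readStacks_d, readStacks_d, nil (by simp [DReg.rank]), List.append_nil]
    exact congrArg _ (stageEnv_succ k x (r := .len) rfl (by omega))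
  have a2 : Runs (dup (.m .inn) (.m (.loop 0))) (readStacks x [] (stageEnv k x 1))
      (readStacks x x (stageEnv k x 1)) (5 * B + 2) := by
    refine (Runs.of_exec (exec_dup (by simp) (by simp) (by simp) _ rfl rfl)).of_eq ?_
      (by rw [← hB]; rfl)
    rw [update_readStacks_loop]; rfl
  have a3 : Runs (clear (.m .inn)) (readStacks x x (stageEnv k x 1))
      (readStacks [] x (stageEnv k x 1)) (2 * B + 1) := by
    refine (Runs.of_exec (exec_clear _ _)).of_eq ?_ (by rw [← hB]; rfl)
    rw [update_readStacks_inn]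
  have rd : ∀ (r : DReg) (j : ℕ) (l : List Bool), r.rank = j → j < 11 → l.length ≤ B →
      inputEnv k x r = List.replicate (parseNat l).1 true →
      Runs (readNat (.m (.loop 0)) (.d r)) (readStacks [] l (stageEnv k x j))
        (readStacks [] (parseNat l).2 (stageEnv k x (j + 1))) (2 * B + 1) := by
    intro r j l hr hj hl h
    refine (runs_read_nat [] l _ r (nil hr.ge) hl).of_eq ?_ le_rfl
    rw [Env.set, ← h, stageEnv_succ k x hr hj]
  -- A list register receives the entire rest of the input. No cut is needed, since each loop over
  -- the register stops at the end marker of its list.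
  have cp : ∀ (r : DReg) (j : ℕ) (l : List Bool), r.rank = j → j < 11 → l.length ≤ B →
      inputEnv k x r = l →
      Runs (dup (.m (.loop 0)) (.d r)) (readStacks [] l (stageEnv k x j))
        (readStacks [] l (stageEnv k x (j + 1))) (5 * B + 2) := by
    intro r j l hr hj hl h
    refine (runs_read_copy [] l _ r (nil hr.ge) hl).of_eq ?_ le_rfl
    nth_rw 1 [← h]
    rw [← h, stageEnv_succ k x hr hj]
  have a4 := rd .bits 1 x rfl (by omega) hB.le rfl
  have a5 := rd .deg 2 (restBits x) rfl (by omega) h1 rfl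
  have a6 := rd .adjIn 3 (restDeg x) rfl (by omega) h2 rfl
  have a7 := cp .adjGates 4 (restAdjIn x) rfl (by omega) h3 rfl
  have sk : ∀ j ≤ 10, ∀ l : List Bool, l.length ≤ B →
      Runs skipGates (readStacks [] l (stageEnv k x j))
        (readStacks [] (parseGates l).2 (stageEnv k x j)) (B * (12 * B + 21) + 2) :=
    fun j hj l hl => runs_read_skipGates [] l _ (fun i => nil (by simp [DReg.rank]; omega))
      (fun i => nil (by simp [DReg.rank]; omega)) (fun i => nil (by simp [DReg.rank]; omega))
      (le j hj) hl
  have a8 := sk 5 (by omega) (restAdjIn x) h3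
  have a9 := cp .adjOuts 5 (restAdjGates x) rfl (by omega) h4 rfl
  have a10 := runs_read_skipNats [] (restAdjGates x) (stageEnv k x 6)
    (fun i => nil (by simp [DReg.rank]))
    (fun i => nil (by simp [DReg.rank])) (fun i => nil (by simp [DReg.rank]))
    (le 6 (by omega)) h4
  have a11 := rd .sgnIn 6 (restAdjOuts x) rfl (by omega) h5 rfl
  have a12 := cp .sgnGates 7 (restSgnIn x) rfl (by omega) h6 rfl
  have a13 := sk 8 (by omega) (restSgnIn x) h6
  have a14 := cp .sgnOuts 8 (restSgnGates x) rfl (by omega) h7 rfl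
  have a15 : Runs (clear (.m (.loop 0))) (readStacks [] (restSgnGates x) (stageEnv k x 9))
      (readStacks [] [] (stageEnv k x 9)) (2 * B + 1) := by
    refine (Runs.of_exec (exec_clear _ _)).of_eq ?_ ?_
    · rw [update_readStacks_loop]
    · rw [readStacks_loop]; omega
  have a16 : Runs (subLen .len .bits .free) (readStacks [] [] (stageEnv k x 9))
      (readStacks [] [] (stageEnv k x 10)) (13 * B + 5) := by
    refine (runs_subLen [] [] _ (by simp) (by simp) (nil (j := 9) le_rfl) (le 9 (by omega) _)
      (le 9 (by omega) _)).of_eq ?_ le_rfl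
    rw [← stageEnv_succ k x (r := .free) (j := 9) rfl (by omega), stageEnv_eq k x (by simp [DReg.rank]),
      stageEnv_eq k x (by simp [DReg.rank])]
    simp [inputEnv, Env.set]
  have a17 : Runs (powLen .len .rounds k) (readStacks [] [] (stageEnv k x 10))
      (readStacks [] [] (inputEnv k x)) (k * (B + 2) ^ (k + 5) + 1) := by
    refine (runs_powLen [] [] _ (r := .len) (q := .rounds) (by simp) (nil (j := 10) le_rfl) k).of_eq ?_ ?_
    · rw [← stageEnv_last, ← stageEnv_succ k x (r := .rounds) (j := 10) rfl (by omega),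
        stageEnv_eq k x (by simp [DReg.rank])]
      simp [inputEnv, Env.set]
    · rw [stageEnv_eq k x (by simp [DReg.rank])]
      simp [inputEnv, hB]
  have b1 := a14.seq (a15.seq (a16.seq a17))
  have b2 := a9.seq (a10.seq (a11.seq (a12.seq (a13.seq b1))))
  have b3 := a1.seq (a2.seq (a3.seq (a4.seq (a5.seq (a6.seq (a7.seq (a8.seq b2)))))))
  refine b3.mono ?_
  clear * -
  omega

end Input

/-- Empty several stacks. -/
def clearList : List Reg → RProg
  | [] => .skip
  | r :: rs => .seq (clear r) (clearList rs)

theorem runs_clearList {B : ℕ} (rs : List Reg) (s : Stacks) (hB : ∀ r, (s r).length ≤ B) :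
    Runs (clearList rs) s (fun r => if r ∈ rs then [] else s r) (rs.length * (2 * B + 1) + 1) := by
  induction rs generalizing s with
  | nil => exact (Runs.of_exec (Exec.skip s)).of_eq (by simp) (by simp)
  | cons q rs ih =>
    have h1 := Runs.of_exec (exec_clear q s)
    have h2 := ih (update s q []) (fun r => by
      by_cases h : r = q
      · subst h; simp
      · simpa [h] using hB r)
    refine (h1.seq h2).of_eq ?_ ?_
    · funext r
      by_cases h : r = q
      · subst h; simp
      · simp [h]
    · have := hB q
      simp only [List.length_cons, Nat.add_mul]
      omega

/-- Write the circuit once the gates are known, and clean up. -/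
noncomputable def writeOut : RProg :=
  .seq (.seq (.push (.m .fwd) false) (move (.m .fwd) (.m .out))) <|
  .seq (.seq (.push (.m .out) false) (pushVal (.m .out) 1 [.m .cnt])) <|
  .seq (.seq (.push (.m .out) false) (pushVal (.m .out) 0 (List.replicate 11 (.d .len))))
    (clearList ((Finset.univ.erase (.m .out)).toList))

/-- The output stack is filled from its end: the end marker, the gates, the number of ancillas, and
finally the size of the witness. There is one more ancilla than tests, since the first test qubit
records that no test has failed yet. -/
theorem runs_writeOut {B : ℕ} (s : Stacks) (hs : s (.m .tmp) = []) (ho : s (.m .out) = [])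
    (hB : ∀ r, (s r).length ≤ B) :
    Runs writeOut s (single (.m .out) (encNat (11 * (s (.d .len)).length) ++
        (encNat ((s (.m .cnt)).length + 1) ++ ((s (.m .fwd)).reverse ++ [false]))))
      ((Fintype.card Reg + 1) * (200 * B + 200)) := by
  have b1 := Runs.of_exec (Exec.push (.m .fwd) false s)
  have b2 := Runs.of_exec (exec_move (k := .m .fwd) (k' := .m .out) (by simp)
    (update s (.m .fwd) (false :: s (.m .fwd))))
  have b12 := (b1.seq b2).of_eq (s'' := update (update s (.m .fwd) []) (.m .out)
    ((s (.m .fwd)).reverse ++ [false])) (b := 2 * B + 4)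
    (by simp [ho]) (by
      have := hB (.m .fwd)
      simp; omega)
  set s2 : Stacks := update (update s (.m .fwd) []) (.m .out) ((s (.m .fwd)).reverse ++ [false])
    with hs2
  have b3 := Runs.of_exec (Exec.push (.m .out) false s2)
  have b4 := runs_pushVal (B := B) (k := .m .out) (by simp) 1 [.m .cnt]
    (update s2 (.m .out) (false :: s2 (.m .out))) (by simp [hs2, hs]) (by simp) (by simp)
    (by simpa [hs2] using hB (.m .cnt))
  have b34 : Runs _ s2 (update s2 (.m .out) (encNat ((s (.m .cnt)).length + 1) ++
    s2 (.m .out))) (5 * B + 5) := (b3.seq b4).of_eq (by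
      simp [encNat_eq, Fld.val, lens, hs2, Nat.add_comm]) (by simp; omega)
  set s4 : Stacks := update s2 (.m .out) (encNat ((s (.m .cnt)).length + 1) ++
    s2 (.m .out)) with hs4
  have b5 := Runs.of_exec (Exec.push (.m .out) false s4)
  have b6 := runs_pushVal (B := B) (k := .m .out) (by simp) 0 (List.replicate 11 (.d .len))
    (update s4 (.m .out) (false :: s4 (.m .out))) (by simp [hs4, hs2, hs])
    (by simp [List.mem_replicate]) (by simp [List.mem_replicate])
    (by
      intro r hr
      rw [List.eq_of_mem_replicate hr]
      simpa [hs4, hs2] using hB (.d .len))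
  have b56 : Runs _ s4 (update s4 (.m .out) (encNat (11 * (s (.d .len)).length) ++
    s4 (.m .out))) (55 * B + 30) := (b5.seq b6).of_eq (by
      rw [Fld.val_replicate]; simp [encNat_eq, lens, hs4, hs2]) (by simp; omega)
  set s6 : Stacks := update s4 (.m .out) (encNat (11 * (s (.d .len)).length) ++
    s4 (.m .out)) with hs6
  have hall := (b12.seq (b34.seq b56))
  -- The three writing phases take at most 62 B + 39 steps, so every stack has at most 63 B + 39
  -- bits afterwards.
  have h7 : ∀ r, (s6 r).length ≤ 63 * B + 39 := fun r => by
    have := hall.length_le r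
    have := hB r
    omega
  have b7 := runs_clearList (Finset.univ.erase (.m .out)).toList s6 h7
  refine (b12.seq (b34.seq (b56.seq b7))).of_eq ?_ ?_
  · funext r
    by_cases hr : r = .m .out
    · subst hr; simp [single, hs6, hs4, hs2]
    · simp [single, hr]
  · have hc : (Finset.univ.erase (Reg.m .out)).toList.length ≤ Fintype.card Reg := by
      rw [Finset.length_toList]; exact (Finset.card_erase_le).trans (by simp)
    have := Nat.mul_le_mul_right (2 * (63 * B + 39) + 1) hc
    nlinarith

/-- The gate that initialises the first test qubit. -/
def firstGate : GateF Reg := .x ⟨1, List.replicate 11 (.d .len)⟩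

/-- The gate that copies the last test qubit to the output. -/
def lastGate : GateF Reg := .cnot ⟨1, List.replicate 11 (.d .len) ++ [.m .cnt]⟩ ⟨0, []⟩

/-- Bound for the lengths of the data registers. -/
def dataBound (k n : ℕ) : ℕ := n + n ^ k

/-- Time to read the input and to emit all gates. -/
def emitTime (k : ℕ) (c : Cmd) (n : ℕ) : ℕ :=
  readTime k n + (firstGate.cost (dataBound k n) +
    (c.cost (dataBound k n) (c.count (dataBound k n)) +
      lastGate.cost (dataBound k n + c.count (dataBound k n))))

theorem polyBd_dataBound (k : ℕ) : PolyBd (dataBound k) := PolyBd.id.add (PolyBd.id.pow k)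

theorem polyBd_emitTime (k : ℕ) (c : Cmd) : PolyBd (emitTime k c) := by
  have pB := polyBd_dataBound k
  have pG : PolyBd fun n => c.count (dataBound k n) := c.polyBd_count pB
  have pT0 : PolyBd (readTime k) := (((PolyBd.const _).mul (PolyBd.id.mul (((PolyBd.const _).mul
    PolyBd.id).add (.const _)))).add ((PolyBd.const _).mul .id) |>.add (.const _)).add
    ((PolyBd.const _).mul ((PolyBd.id.add (.const 2)).pow _))
  exact pT0.add ((firstGate.polyBd_cost pB).add ((c.polyBd_cost pB pG).add
    (lastGate.polyBd_cost (pB.add pG))))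

/-- The program that writes the verification circuit. -/
noncomputable def writer (k : ℕ) (c : Cmd) : RProg :=
  .seq (.seq (readInput k) (.seq (emitFwd firstGate) (.seq c.prog (emitFwd lastGate)))) writeOut

theorem runs_writer (k : ℕ) (c : Cmd) (hc : c.WF 0) (x : List Bool)
    (Ts : List (List QGate × ℕ)) (h : c.sem (inputEnv k x) = testItems Ts) :
    Runs (writer k c) (single (.m .inn) x)
      (single (.m .out) (encQCircuit (testCircuit (11 * x.length) Ts)))
      (emitTime k c x.length +
        (Fintype.card Reg + 1) * (200 * (x.length + emitTime k c x.length) + 200)) := by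
  set n := x.length with hn
  set e := inputEnv k x with he
  have heB : ∀ r, (e r).length ≤ dataBound k n := by
    intro r
    by_cases hr : r = .rounds
    · subst hr; simp [he, inputEnv, dataBound, hn]
    · exact (length_inputEnv_le k x r hr).trans (Nat.le_add_right _ _)
  have a0 := runs_readInput k x
  have a1 := runs_emitFwd (B := dataBound k n) firstGate (readStacks [] [] e) rfl (by
    intro f hf r hr
    simp only [firstGate, GateF.fields, List.mem_singleton] at hf
    subst hf
    rw [List.eq_of_mem_replicate hr]
    exact ⟨by simp, by simp, heB .len⟩)
  set s1 : Stacks := update (readStacks [] [] e) (.m .fwd)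
    ((entryCode (firstGate.toQ (lens (readStacks [] [] e)))).reverse ++
      readStacks [] [] e (.m .fwd)) with hs1
  have env1 : Stacks.env s1 = e := by simp only [hs1, Stacks.env_update_m]; rfl
  have clean0 : (readStacks [] [] e).Clean 0 :=
    ⟨rfl, rfl, rfl, fun i _ => by simp [readStacks], fun i _ => rfl, fun i _ => rfl,
      fun i _ => rfl, fun i _ => rfl⟩
  have clean1 : s1.Clean 0 :=
    ⟨rfl, rfl, rfl, fun i _ => by simp [hs1, readStacks], fun i _ => rfl, fun i _ => rfl,
      fun i _ => rfl, fun i _ => rfl⟩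
  have lenG : (c.sem e).length ≤ c.count (dataBound k n) := c.length_sem_le _ e heB
  have a2 := (c.emits 0 hc (dataBound k n) (c.count (dataBound k n)) s1 clean1 (fun r => by simpa [hs1, readStacks] using heB r) (by
    rw [env1]; simpa [hs1, readStacks] using lenG)).toRuns (by simp [hs1, readStacks])
  rw [env1, h, runItems_testItems _ _ _ rfl] at a2
  have base1 : s1.base = 1 + 11 * n := by simp [Stacks.base, hs1, readStacks, he, inputEnv, hn]
  have hfirst : firstGate.toQ (lens (readStacks [] [] e)) = .x (1 + 11 * n) := by
    rw [firstGate, GateF.toQ, Fld.val_replicate]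
    simp [lens, readStacks, he, inputEnv, hn, Nat.add_comm]
  -- Every test contributes at least its mark, so the bound for the instructions is also one for the
  -- tests.
  have hTs : Ts.length ≤ c.count (dataBound k n) := by
    rw [h] at lenG
    refine le_trans ?_ lenG
    rw [testItems, List.length_flatMap]
    have := List.card_nsmul_le_sum (Ts.map fun T => (T.1.map Item.gate ++
      [Item.mark T.2]).length) 1 (by
      intro m hm
      obtain ⟨T, _, rfl⟩ := List.mem_map.1 hm
      simp)
    simpa using this
  set s2 : Stacks := s1.put ⟨((testGates s1.base s1.out.cnt.length Ts).flatMap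
    entryCode).reverse ++ s1.out.fwd, [], List.replicate Ts.length true ++ s1.out.cnt⟩ with hs2
  have len2 : s2 (.d .len) = List.replicate n true := by
    simp [hs2, hs1, readStacks, he, inputEnv, hn]
  have cnt2 : s2 (.m .cnt) = List.replicate Ts.length true := by
    simp [hs2, hs1, readStacks, Stacks.out]
  have a3 := runs_emitFwd (B := dataBound k n + c.count (dataBound k n)) lastGate s2 (by simp [hs2, hs1, readStacks]) (by
    intro f hf r hr
    simp only [lastGate, GateF.fields, List.mem_cons, List.not_mem_nil, or_false] at hf
    rcases hf with rfl | rfl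
    · simp only [List.mem_append, List.mem_singleton] at hr
      rcases hr with hr | rfl
      · rw [List.eq_of_mem_replicate hr]
        refine ⟨by simp, by simp, ?_⟩
        rw [len2, List.length_replicate]
        simp only [dataBound]
        omega
      · refine ⟨by simp, by simp, ?_⟩
        rw [cnt2, List.length_replicate]
        omega
    · simp at hr)
  set s3 : Stacks := update s2 (.m .fwd) ((entryCode (lastGate.toQ (lens s2))).reverse ++
    s2 (.m .fwd)) with hs3
  have hlast : lastGate.toQ (lens s2) = .cnot (1 + 11 * n + Ts.length) 0 := by
    rw [lastGate, GateF.toQ, Fld.val_replicate_append]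
    simp [Fld.val, lens, len2, cnt2]
    omega
  have a : Runs _ _ s3 (emitTime k c n) := a0.seq (a1.seq (a2.seq a3))
  -- At the start the only nonempty stack is the input, of length n, so no stack exceeds n plus the
  -- time spent so far.
  have a4 := runs_writeOut (B := n + emitTime k c n) s3 (by simp [hs3, hs2, hs1, readStacks])
    (by simp [hs3, hs2, hs1, readStacks]) (fun r => (a.length_le r).trans (by
      by_cases hr : r = .m .inn
      · subst hr; simp [single, hn]
      · simp [single, hr]))
  refine (a.seq a4).of_eq (congrArg _ ?_) le_rfl
  have h3 : s3 (.d .len) = List.replicate n true := by rw [← len2]; simp [hs3]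
  have h4 : s3 (.m .cnt) = List.replicate Ts.length true := by rw [← cnt2]; simp [hs3]
  have h5 : s1.out.cnt = [] := by simp [Stacks.out, hs1, readStacks]
  have h6 : s1.out.fwd = (entryCode (.x (1 + 11 * n))).reverse := by
    simp [Stacks.out, hs1, readStacks, hfirst]
  have h7 : (s3 (.m .fwd)).reverse = (testCircuit (11 * n) Ts).gates.flatMap entryCode := by
    rw [hs3, update_self, hlast]
    simp [hs2, base1, h5, h6, testCircuit]
  rw [h3, h4, h7, encQCircuit, encList_encQGate, List.length_replicate, List.length_replicate]
  rfl

/-- A family of tests that is emitted by a command gives circuits that a Turing machine writes in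
polynomial time. -/
theorem polyTime_testCircuit (k : ℕ) (c : Cmd) (hc : c.WF 0)
    (tests : List Bool → List (List QGate × ℕ))
    (h : ∀ x, c.sem (inputEnv k x) = testItems (tests x)) :
    Nonempty (Turing.TM2ComputableInPolyTime (id : List Bool → List Bool) encQCircuit
      fun x => testCircuit (11 * x.length) (tests x)) := by
  have pT := polyBd_emitTime k c
  obtain ⟨P, hP⟩ := (pT.add ((PolyBd.const (Fintype.card Reg + 1)).mul (((PolyBd.const 200).mul
    (PolyBd.id.add pT)).add (.const 200)))).exists_polynomial
  refine polyTime_of_exec (writer k c) (.m .inn) (.m .out) encQCircuit _ P fun x => ?_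
  obtain ⟨t, ht, he⟩ := runs_writer k c hc x (tests x) (h x)
  exact ⟨t, ht.trans (hP _), he⟩

end QMABalance

namespace QMABalance

open Function

/-! ### Gates as self-inverse isometries -/

/-- The squared norm of a state vector. -/
noncomputable def nsq {N : ℕ} (ψ : QState N) : ℝ := ∑ b, ‖ψ b‖ ^ 2

namespace QGate

/-- The gate is its own inverse (all gates but `t` are). -/
def SelfInverse (g : QGate) : Prop := ∀ a, g ≠ .t a

/-- The action of a classical gate on bit strings. -/
def flip (N : ℕ) (g : QGate) (b : Fin N → Bool) : Fin N → Bool :=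
  match g with
  | .x a => if h : a < N then update b ⟨a, h⟩ (!b ⟨a, h⟩) else b
  | .h _ => b
  | .t _ => b
  | .cnot a c =>
    if h : a < N ∧ c < N ∧ a ≠ c then
      update b ⟨c, h.2.1⟩ (xor (b ⟨c, h.2.1⟩) (b ⟨a, h.1⟩)) else b
  | .ccx a c d =>
    if h : a < N ∧ c < N ∧ d < N ∧ a ≠ c ∧ a ≠ d ∧ c ≠ d then
      update b ⟨d, h.2.2.1⟩ (xor (b ⟨d, h.2.2.1⟩) (b ⟨a, h.1⟩ && b ⟨c, h.2.1⟩)) else b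

/-- The gate permutes the computational basis. -/
def Classical : QGate → Prop
  | .h _ => False
  | .t _ => False
  | _ => True

theorem flip_flip (N : ℕ) (g : QGate) (b : Fin N → Bool) : g.flip N (g.flip N b) = b := by
  cases g with
  | x a =>
    simp only [flip]
    split_ifs with h <;> simp
  | h a => rfl
  | t a => rfl
  | cnot a c =>
    simp only [flip]
    split_ifs with h
    · have : (⟨a, h.1⟩ : Fin N) ≠ ⟨c, h.2.1⟩ := by simpa using h.2.2
      simp [this]
    · rfl
  | ccx a c d =>
    simp only [flip]
    split_ifs with h
    · have h1 : (⟨a, h.1⟩ : Fin N) ≠ ⟨d, h.2.2.1⟩ := by simpa using h.2.2.2.2.1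
      have h2 : (⟨c, h.2.1⟩ : Fin N) ≠ ⟨d, h.2.2.1⟩ := by simpa using h.2.2.2.2.2
      simp [h1, h2]
    · rfl

theorem apply_classical {N : ℕ} {g : QGate} (hg : g.Classical) (ψ : QState N) (b : Fin N → Bool) :
    g.apply N ψ b = ψ (g.flip N b) := by
  cases g with
  | x a => simp only [apply, flip]; split_ifs <;> rfl
  | h a => exact hg.elim
  | t a => exact hg.elim
  | cnot a c => simp only [apply, flip]; split_ifs <;> rfl
  | ccx a c d => simp only [apply, flip]; split_ifs <;> rfl

theorem apply_h {N a : ℕ} (h : a < N) (ψ : QState N) (b : Fin N → Bool) :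
    (QGate.h a).apply N ψ b = ((Real.sqrt 2 : ℝ) : ℂ)⁻¹ *
        (ψ (update b ⟨a, h⟩ false) + (if b ⟨a, h⟩ then -1 else 1) * ψ (update b ⟨a, h⟩ true)) := by
  simp only [apply, dif_pos h]

theorem apply_sub {N : ℕ} (g : QGate) (ψ φ : QState N) :
    g.apply N (ψ - φ) = g.apply N ψ - g.apply N φ := by
  cases g with
  | h a =>
    by_cases h : a < N
    · funext b
      simp only [Pi.sub_apply, apply_h h]
      ring
    · simp only [apply, dif_neg h]
  | t a =>
    simp only [apply]
    split_ifs
    · funext b; simp only [Pi.sub_apply]; ring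
    · rfl
  | x a => funext b; simp only [Pi.sub_apply, apply_classical (g := .x a) trivial]
  | cnot a c => funext b; simp only [Pi.sub_apply, apply_classical (g := .cnot a c) trivial]
  | ccx a c d => funext b; simp only [Pi.sub_apply, apply_classical (g := .ccx a c d) trivial]

theorem sqrt_two_inv_mul_self : (((Real.sqrt 2 : ℝ) : ℂ)⁻¹) * (((Real.sqrt 2 : ℝ) : ℂ)⁻¹) = 1 / 2 := by
  rw [← mul_inv, ← Complex.ofReal_mul, Real.mul_self_sqrt (by norm_num)]
  norm_num

theorem apply_apply {N : ℕ} {g : QGate} (hg : g.SelfInverse) (ψ : QState N) :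
    g.apply N (g.apply N ψ) = ψ := by
  have key : ∀ g : QGate, g.Classical → g.apply N (g.apply N ψ) = ψ := by
    intro g hg
    funext b
    rw [apply_classical hg, apply_classical hg, flip_flip]
  cases g with
  | h a =>
    by_cases h : a < N
    · funext b
      rw [apply_h h, apply_h h, apply_h h]
      simp only [update_self, update_idem, Bool.false_eq_true, if_false, if_true]
      have e := sqrt_two_inv_mul_self
      cases hb : b ⟨a, h⟩
      · have : update b ⟨a, h⟩ false = b := by rw [← hb, update_eq_self]
        rw [this]
        simp only [Bool.false_eq_true, if_false]
        linear_combination (2 * ψ b) * e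
      · have : update b ⟨a, h⟩ true = b := by rw [← hb, update_eq_self]
        rw [this]
        simp only [if_true]
        linear_combination (2 * ψ b) * e
    · simp only [apply, dif_neg h]
  | t a => exact (hg a rfl).elim
  | x a => exact key _ trivial
  | cnot a c => exact key _ trivial
  | ccx a c d => exact key _ trivial

/-- Classical gates permute the basis. For the Hadamard gate the strings are paired by flipping the
bit in question, and the parallelogram law gives the claim on each pair. -/
theorem nsq_apply {N : ℕ} {g : QGate} (hg : g.SelfInverse) (ψ : QState N) :
    nsq (g.apply N ψ) = nsq ψ := by
  have key : ∀ g : QGate, g.Classical → nsq (g.apply N ψ) = nsq ψ := by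
    intro g hg
    simp only [nsq, apply_classical hg]
    exact Equiv.sum_comp ⟨g.flip N, g.flip N, flip_flip N g, flip_flip N g⟩ fun b => ‖ψ b‖ ^ 2
  cases g with
  | h a =>
    by_cases h : a < N
    · have fl : ∀ F : (Fin N → Bool) → ℝ, ∑ b, F (update b ⟨a, h⟩ (!b ⟨a, h⟩)) = ∑ b, F b := by
        intro F
        refine Equiv.sum_comp ⟨fun b => update b ⟨a, h⟩ (!b ⟨a, h⟩),
          fun b => update b ⟨a, h⟩ (!b ⟨a, h⟩), fun b => by simp, fun b => by simp⟩ F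
      have par : ∀ u v : ℂ, ‖((Real.sqrt 2 : ℝ) : ℂ)⁻¹ * (u + 1 * v)‖ ^ 2 +
          ‖((Real.sqrt 2 : ℝ) : ℂ)⁻¹ * (u + -1 * v)‖ ^ 2 = ‖u‖ ^ 2 + ‖v‖ ^ 2 := by
        intro u v
        have h2 : ‖((Real.sqrt 2 : ℝ) : ℂ)⁻¹‖ ^ 2 = 1 / 2 := by
          rw [norm_inv, Complex.norm_real, inv_pow, Real.norm_eq_abs, sq_abs,
            Real.sq_sqrt (by norm_num)]
          norm_num
        have := parallelogram_law_with_norm ℝ u v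
        rw [norm_mul, norm_mul, mul_pow, mul_pow, h2, one_mul, neg_one_mul, ← sub_eq_add_neg]
        nlinarith
      have main : ∀ b, ‖(QGate.h a).apply N ψ b‖ ^ 2 +
          ‖(QGate.h a).apply N ψ (update b ⟨a, h⟩ (!b ⟨a, h⟩))‖ ^ 2 =
          ‖ψ b‖ ^ 2 + ‖ψ (update b ⟨a, h⟩ (!b ⟨a, h⟩))‖ ^ 2 := by
        intro b
        rw [apply_h h, apply_h h]
        simp only [update_self, update_idem]
        cases hb : b ⟨a, h⟩
        · have : update b ⟨a, h⟩ false = b := by rw [← hb, update_eq_self]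
          simpa [this] using par (ψ b) (ψ (update b ⟨a, h⟩ true))
        · have : update b ⟨a, h⟩ true = b := by rw [← hb, update_eq_self]
          have := par (ψ (update b ⟨a, h⟩ false)) (ψ b)
          rw [add_comm, add_comm (‖ψ b‖ ^ 2)]
          simpa [‹update b ⟨a, h⟩ true = b›] using this
      -- Summation over all strings counts every pair twice on both sides.
      have s := Finset.sum_congr rfl fun b (_ : b ∈ Finset.univ) => main b
      rw [Finset.sum_add_distrib, Finset.sum_add_distrib,
        fl fun b => ‖(QGate.h a).apply N ψ b‖ ^ 2, fl fun b => ‖ψ b‖ ^ 2] at s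
      simp only [nsq]
      linarith
    · simp only [apply, dif_neg h]
  | t a => exact (hg a rfl).elim
  | x a => exact key _ trivial
  | cnot a c => exact key _ trivial
  | ccx a c d => exact key _ trivial

end QGate

/-- Apply a list of gates. -/
noncomputable def runGates (N : ℕ) (U : List QGate) (ψ : QState N) : QState N :=
  U.foldl (fun ψ g => g.apply N ψ) ψ

section RunGates

variable {N : ℕ}

theorem runGates_append (U U' : List QGate) (ψ : QState N) :
    runGates N (U ++ U') ψ = runGates N U' (runGates N U ψ) := by
  simp [runGates]

theorem runGates_cons (g : QGate) (U : List QGate) (ψ : QState N) :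
    runGates N (g :: U) ψ = runGates N U (g.apply N ψ) := rfl

theorem runGates_sub (U : List QGate) (ψ φ : QState N) :
    runGates N U (ψ - φ) = runGates N U ψ - runGates N U φ := by
  induction U generalizing ψ φ with
  | nil => rfl
  | cons g U ih => simp only [runGates_cons, QGate.apply_sub, ih]

theorem runGates_zero (U : List QGate) : runGates N U 0 = 0 := by
  simpa using runGates_sub U (0 : QState N) 0

theorem nsq_runGates {U : List QGate} (hU : ∀ g ∈ U, g.SelfInverse) (ψ : QState N) :
    nsq (runGates N U ψ) = nsq ψ := by
  induction U generalizing ψ with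
  | nil => rfl
  | cons g U ih =>
    rw [runGates_cons, ih fun g hg => hU g (by simp [hg]), QGate.nsq_apply (hU g (by simp))]

theorem runGates_reverse {U : List QGate} (hU : ∀ g ∈ U, g.SelfInverse) (ψ : QState N) :
    runGates N U.reverse (runGates N U ψ) = ψ := by
  induction U generalizing ψ with
  | nil => rfl
  | cons g U ih =>
    rw [List.reverse_cons, runGates_append, runGates_cons, runGates_cons,
      ih fun g hg => hU g (by simp [hg])]
    exact QGate.apply_apply (hU g (by simp)) ψ

end RunGates

/-! ### Tests as projections -/

/-- Keep the amplitudes of the bit strings in which bit `q` is set. -/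
def keep {N : ℕ} (q : ℕ) (ψ : QState N) : QState N :=
  fun b => if ∃ h : q < N, b ⟨q, h⟩ = true then ψ b else 0

/-- The unnormalized state after a passed test. -/
noncomputable def testProj (N : ℕ) (T : List QGate × ℕ) (ψ : QState N) : QState N :=
  runGates N T.1.reverse (keep T.2 (runGates N T.1 ψ))

section TestProj

variable {N : ℕ} {T : List QGate × ℕ}

theorem keep_sub (q : ℕ) (ψ φ : QState N) : keep q (ψ - φ) = keep q ψ - keep q φ := by
  funext b
  simp only [keep, Pi.sub_apply]
  split_ifs <;> simp

theorem testProj_sub (ψ φ : QState N) :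
    testProj N T (ψ - φ) = testProj N T ψ - testProj N T φ := by
  simp only [testProj, runGates_sub, keep_sub]

theorem sub_testProj (hT : ∀ g ∈ T.1, g.SelfInverse) (ψ : QState N) :
    ψ - testProj N T ψ = runGates N T.1.reverse
      (runGates N T.1 ψ - keep T.2 (runGates N T.1 ψ)) := by
  rw [runGates_sub, runGates_reverse hT, testProj]

/-- Undoing the gates is an isometry, so the rejected mass may be read off before the uncomputation.
-/
theorem nsq_sub_testProj (hT : ∀ g ∈ T.1, g.SelfInverse) (ψ : QState N) :
    nsq (ψ - testProj N T ψ) =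
      ∑ b, if ∃ h : T.2 < N, b ⟨T.2, h⟩ = true then 0 else ‖runGates N T.1 ψ b‖ ^ 2 := by
  rw [sub_testProj hT, nsq_runGates fun g hg => hT g (by simpa using hg)]
  refine Finset.sum_congr rfl fun b _ => ?_
  simp only [Pi.sub_apply, keep]
  split_ifs <;> simp

/-- Pythagoras: after the gates of the test the kept and the discarded amplitudes sit on disjoint
sets of strings, and the gates preserve norms in both directions. -/
theorem nsq_testProj_add (hT : ∀ g ∈ T.1, g.SelfInverse) (ψ : QState N) :
    nsq (testProj N T ψ) + nsq (ψ - testProj N T ψ) = nsq ψ := by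
  rw [nsq_sub_testProj hT, testProj, nsq_runGates fun g hg => hT g (by simpa using hg)]
  rw [← nsq_runGates hT ψ]
  simp only [nsq, ← Finset.sum_add_distrib]
  refine Finset.sum_congr rfl fun b _ => ?_
  simp only [keep]
  split_ifs <;> simp

theorem testProj_eq_self (hT : ∀ g ∈ T.1, g.SelfInverse) (ψ : QState N)
    (h : ∀ b, ¬ (∃ h : T.2 < N, b ⟨T.2, h⟩ = true) → runGates N T.1 ψ b = 0) :
    testProj N T ψ = ψ := by
  have : keep T.2 (runGates N T.1 ψ) = runGates N T.1 ψ := by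
    funext b
    simp only [keep]
    split_ifs with hb
    · rfl
    · exact (h b hb).symm
  rw [testProj, this, runGates_reverse hT]

end TestProj

/-- The state after all tests have been passed. -/
noncomputable def testProjs (N : ℕ) (Ts : List (List QGate × ℕ)) (ψ : QState N) : QState N :=
  Ts.foldl (fun ψ T => testProj N T ψ) ψ

end QMABalance

namespace QMABalance

open Function

/-! ### The acceptance probability of a test circuit -/

namespace QGate

/-- The gate is not `t`, and it acts on the first `W` qubits only. -/
def On (W : ℕ) : QGate → Prop
  | .x a => a < W
  | .h a => a < W
  | .t _ => False
  | .cnot a c => a < W ∧ c < W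
  | .ccx a c d => a < W ∧ c < W ∧ d < W

/-- Increase all qubit numbers by one. -/
def shift : QGate → QGate
  | .x a => .x (1 + a)
  | .h a => .h (1 + a)
  | .t a => .t (1 + a)
  | .cnot a c => .cnot (1 + a) (1 + c)
  | .ccx a c d => .ccx (1 + a) (1 + c) (1 + d)

theorem On.selfInverse {W : ℕ} {g : QGate} (h : g.On W) : g.SelfInverse := by
  rintro a rfl
  exact h

end QGate

/-- The tests with qubit numbers shifted past the output qubit. -/
def shiftTest (T : List QGate × ℕ) : List QGate × ℕ := (T.1.map QGate.shift, 1 + T.2)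

section Slice

variable {W N : ℕ}

/-- The bit string composed of witness bits and other bits. -/
def joinBits (N : ℕ) (a : Fin W → Bool) (c : ℕ → Bool) : Fin N → Bool := fun i =>
  if h : 1 ≤ (i : ℕ) ∧ (i : ℕ) < 1 + W then a ⟨i - 1, by omega⟩ else c i

/-- The amplitudes with given values of the qubits outside of the witness. -/
def slice (Φ : QState N) (c : ℕ → Bool) : QState W := fun a => Φ (joinBits N a c)

theorem joinBits_witness (a : Fin W → Bool) (c : ℕ → Bool) {j : ℕ} (hj : j < W) (h : 1 + j < N) :
    joinBits N a c ⟨1 + j, h⟩ = a ⟨j, hj⟩ := by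
  simp [joinBits, hj]

theorem joinBits_other (a : Fin W → Bool) (c : ℕ → Bool) {j : ℕ} (hj : j = 0 ∨ 1 + W ≤ j) (h : j < N) :
    joinBits N a c ⟨j, h⟩ = c j := by
  simp only [joinBits]
  rw [dif_neg (by omega)]

theorem update_joinBits_witness (a : Fin W → Bool) (c : ℕ → Bool) {j : ℕ} (hj : j < W)
    (h : 1 + j < N) (v : Bool) :
    update (joinBits N a c) ⟨1 + j, h⟩ v = joinBits N (update a ⟨j, hj⟩ v) c := by
  funext i
  by_cases hi : i = ⟨1 + j, h⟩
  · subst hi; simp [joinBits_witness _ _ hj]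
  · rw [update_of_ne hi]
    simp only [joinBits]
    split_ifs with h1
    · rw [update_of_ne]
      intro e
      apply hi
      ext
      have := congrArg Fin.val e
      simp only at this ⊢
      omega
    · rfl

theorem update_joinBits_other (a : Fin W → Bool) (c : ℕ → Bool) {j : ℕ} (hj : j = 0 ∨ 1 + W ≤ j)
    (h : j < N) (v : Bool) :
    update (joinBits N a c) ⟨j, h⟩ v = joinBits N a (update c j v) := by
  funext i
  by_cases hi : i = ⟨j, h⟩
  · subst hi; rw [joinBits_other _ _ hj]; simp
  · rw [update_of_ne hi]
    simp only [joinBits]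
    split_ifs with h1
    · rfl
    · rw [update_of_ne]
      intro e
      exact hi (Fin.ext e)

/-- A gate on witness qubits neither reads nor changes the other bits. It therefore acts on every
slice as it would on a state of the witness alone. -/
theorem slice_apply_shift (hN : 1 + W ≤ N) {g : QGate} (hg : g.On W) (Φ : QState N)
    (c : ℕ → Bool) : slice (W := W) (g.shift.apply N Φ) c = g.apply W (slice Φ c) := by
  funext a
  cases g with
  | x p =>
    have hp : p < W := hg
    have hp' : 1 + p < N := by omega
    simp only [slice, QGate.shift, QGate.apply, dif_pos hp, dif_pos hp']
    rw [joinBits_witness _ _ hp, update_joinBits_witness _ _ hp]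
  | h p =>
    have hp : p < W := hg
    have hp' : 1 + p < N := by omega
    simp only [slice, QGate.shift, QGate.apply, dif_pos hp, dif_pos hp']
    rw [joinBits_witness _ _ hp, update_joinBits_witness _ _ hp, update_joinBits_witness _ _ hp]
  | t p => exact hg.elim
  | cnot p q =>
    obtain ⟨hp, hq⟩ : p < W ∧ q < W := hg
    have hp' : 1 + p < N := by omega
    have hq' : 1 + q < N := by omega
    by_cases e : p = q
    · simp [slice, QGate.shift, QGate.apply, e]
    · have e' : 1 + p ≠ 1 + q := by omega
      simp only [slice, QGate.shift, QGate.apply]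
      rw [dif_pos ⟨hp', hq', e'⟩, dif_pos ⟨hp, hq, e⟩, joinBits_witness _ _ hp,
        joinBits_witness _ _ hq, update_joinBits_witness _ _ hq]
  | ccx p q r =>
    obtain ⟨hp, hq, hr⟩ : p < W ∧ q < W ∧ r < W := hg
    have hp' : 1 + p < N := by omega
    have hq' : 1 + q < N := by omega
    have hr' : 1 + r < N := by omega
    by_cases e : p ≠ q ∧ p ≠ r ∧ q ≠ r
    · have e' : 1 + p ≠ 1 + q ∧ 1 + p ≠ 1 + r ∧ 1 + q ≠ 1 + r := by omega
      simp only [slice, QGate.shift, QGate.apply]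
      rw [dif_pos ⟨hp', hq', hr', e'⟩, dif_pos ⟨hp, hq, hr, e⟩, joinBits_witness _ _ hp,
        joinBits_witness _ _ hq, joinBits_witness _ _ hr, update_joinBits_witness _ _ hr]
    · have e' : ¬ (1 + p ≠ 1 + q ∧ 1 + p ≠ 1 + r ∧ 1 + q ≠ 1 + r) := by omega
      simp only [slice, QGate.shift, QGate.apply]
      rw [dif_neg fun h => e' h.2.2.2, dif_neg fun h => e h.2.2.2]
      rfl

theorem slice_runGates (hN : 1 + W ≤ N) {U : List QGate} (hU : ∀ g ∈ U, g.On W) (Φ : QState N)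
    (c : ℕ → Bool) :
    slice (W := W) (runGates N (U.map QGate.shift) Φ) c = runGates W U (slice Φ c) := by
  induction U generalizing Φ with
  | nil => rfl
  | cons g U ih =>
    rw [List.map_cons, runGates_cons, runGates_cons, ih fun g hg => hU g (by simp [hg]),
      slice_apply_shift hN (hU g (by simp))]

/-- The effect of the gate that records the outcome of a test. -/
theorem slice_record {o q o' : ℕ} (ho : 1 + W ≤ o) (ho' : 1 + W ≤ o') (hoo : o ≠ o') (hoN : o < N)
    (hoN' : o' < N) (hq : q < W) (Φ : QState N) (c : ℕ → Bool) :
    slice (W := W) ((QGate.ccx o (1 + q) o').apply N Φ) c = if c o then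
      keep q (slice Φ (update c o' (!c o'))) + (slice Φ c - keep q (slice Φ c)) else slice Φ c := by
  funext a
  have hqN : 1 + q < N := by omega
  simp only [slice, QGate.apply]
  rw [dif_pos ⟨hoN, hqN, hoN', by omega, hoo, by omega⟩, joinBits_witness _ _ hq,
    joinBits_other _ _ (.inr ho), joinBits_other _ _ (.inr ho'),
    update_joinBits_other _ _ (.inr ho')]
  cases c o
  · simp [slice]
  · cases h : a ⟨q, hq⟩ <;> simp [slice, keep, h, hq]

/-- The bits outside of the witness after `t` passed tests. -/
def passed (W t : ℕ) : ℕ → Bool := fun i => decide (1 + W ≤ i ∧ i ≤ 1 + W + t)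

/-- The shape of the state after `t` tests. -/
structure Chain (W t : ℕ) (Φ : QState N) (ψ : QState W) : Prop where
  passed : slice Φ (passed W t) = ψ
  out : ∀ c : ℕ → Bool, c 0 = true → slice (W := W) Φ c = 0
  fresh : ∀ c j, 1 + W + t < j → j < N → c j = true → slice (W := W) Φ c = 0
  mono : ∀ c j, 1 + W < j → j < N → c j = true → c (j - 1) = false → slice (W := W) Φ c = 0

/-- The field `passed` of `Chain` describes the branch in which all tests so far have succeeded,
`out` and `fresh` say that the output qubit and later test qubits are still zero, and `mono` says
that the ones among the test qubits form an initial segment. By `key` a slice is unchanged if test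
qubit t is off, as the gates and their reversal cancel. If it is on, the new slice consists of the
passed part of the slice with the next test qubit flipped and the rejected part of the slice itself.
All four conditions follow from this formula. -/
theorem Chain.step {t : ℕ} {Φ : QState N} {ψ : QState W} (h : Chain W t Φ ψ)
    (hN : 1 + W + (t + 1) < N) {T : List QGate × ℕ} (hT : ∀ g ∈ T.1, g.On W) (hq : T.2 < W) :
    Chain W (t + 1) (runGates N ((shiftTest T).1 ++ .ccx (1 + W + t) (shiftTest T).2 (1 + W + t + 1) ::
      (shiftTest T).1.reverse) Φ) (testProj W T ψ) := by
  have hN' : 1 + W ≤ N := by omega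
  have key : ∀ c : ℕ → Bool, slice (W := W) (runGates N ((shiftTest T).1 ++
      .ccx (1 + W + t) (shiftTest T).2 (1 + W + t + 1) :: (shiftTest T).1.reverse) Φ) c =
      if c (1 + W + t) then testProj W T (slice Φ (update c (1 + W + t + 1) (!c (1 + W + t + 1)))) +
        (slice Φ c - testProj W T (slice Φ c)) else slice Φ c := by
    intro c
    have e : (shiftTest T).1.reverse = T.1.reverse.map QGate.shift := by simp [shiftTest]
    rw [runGates_append, runGates_cons, e, slice_runGates hN' fun g hg => hT g (by simpa using hg)]
    rw [show (shiftTest T).2 = 1 + T.2 from rfl, slice_record (by omega) (by omega) (by omega)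
      (by omega) (by omega) hq]
    rw [show (shiftTest T).1 = T.1.map QGate.shift from rfl, slice_runGates hN' hT,
      slice_runGates hN' hT]
    split_ifs
    · rw [sub_testProj fun g hg => (hT g hg).selfInverse]
      have add : ∀ u v : QState W, runGates W T.1.reverse (u + v) =
          runGates W T.1.reverse u + runGates W T.1.reverse v := by
        intro u v
        have := runGates_sub T.1.reverse u (-v)
        have h0 := runGates_sub T.1.reverse 0 v
        rw [sub_neg_eq_add] at this
        rw [runGates_zero, zero_sub, zero_sub] at h0
        rw [this, h0, sub_neg_eq_add]
      rw [add]
      rfl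
    · rw [runGates_reverse fun g hg => (hT g hg).selfInverse]
  have p0 : testProj W T (0 : QState W) = 0 := by simpa using testProj_sub (T := T) (0 : QState W) 0
  refine ⟨?_, ?_, ?_, ?_⟩
  -- Flipping the last one of the string for t + 1 passed tests yields the string for t. The
  -- rejected part comes from a slice that vanishes by `fresh`.
  · rw [key, if_pos (by simp [QMABalance.passed])]
    have e : update (QMABalance.passed W (t + 1)) (1 + W + t + 1)
        (!QMABalance.passed W (t + 1) (1 + W + t + 1)) = QMABalance.passed W t := by
      funext i
      by_cases hi : i = 1 + W + t + 1
      · subst hi; simp [QMABalance.passed]; omega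
      · rw [update_of_ne hi]
        simp only [QMABalance.passed, decide_eq_decide]
        omega
    rw [e, h.passed, h.fresh (QMABalance.passed W (t + 1)) (1 + W + t + 1) (by omega) (by omega)
      (by simp [QMABalance.passed]; omega), p0, sub_zero, add_zero]
  · intro c hc
    rw [key, h.out c hc, h.out (update c _ _) (by rw [update_of_ne (by omega), hc]), p0]
    simp
  · intro c j hj hjN hc
    rw [key, h.fresh c j (by omega) hjN hc, h.fresh (update c _ _) j (by omega) hjN
      (by rw [update_of_ne (by omega), hc]), p0]
    simp
  · intro c j hj hjN hc hc'
    rw [key, h.mono c j hj hjN hc hc', p0]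
    split_ifs with ho
    · have : slice (W := W) Φ (update c (1 + W + t + 1) (!c (1 + W + t + 1))) = 0 := by
        by_cases h1 : j = 1 + W + t + 1
        · subst h1
          rw [show 1 + W + t + 1 - 1 = 1 + W + t by omega, ho] at hc'
          exact absurd hc' (by simp)
        · by_cases h2 : 1 + W + t < j
          · exact h.fresh _ j h2 hjN (by rw [update_of_ne h1, hc])
          · exact h.mono _ j hj hjN (by rw [update_of_ne h1, hc])
              (by rw [update_of_ne (by omega), hc'])
      rw [this, p0]
      simp
    · rfl

theorem Chain.run {Ts : List (List QGate × ℕ)} (hT : ∀ T ∈ Ts, (∀ g ∈ T.1, g.On W) ∧ T.2 < W) :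
    ∀ {t : ℕ} {Φ : QState N} {ψ : QState W}, Chain W t Φ ψ → 1 + W + (t + Ts.length) < N →
      Chain W (t + Ts.length) (runGates N (testGates (1 + W) t (Ts.map shiftTest)) Φ)
        (testProjs W Ts ψ) := by
  induction Ts with
  | nil => intro t Φ ψ h _; simpa [testGates, runGates, testProjs] using h
  | cons T Ts ih =>
    intro t Φ ψ h hN
    simp only [List.length_cons] at hN ⊢
    have h1 := h.step (by omega) (hT T (by simp)).1 (hT T (by simp)).2
    have h2 := ih (fun T hT' => hT T (by simp [hT'])) h1 (by omega)
    rw [← runGates_append] at h2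
    simp only [List.map_cons, testGates]
    rw [show t + (Ts.length + 1) = t + 1 + Ts.length by omega]
    simpa [testProjs] using h2

end Slice

/-- The gate `x` sets the first test qubit, turning the initial state into the state in which all of
zero tests have been passed. -/
theorem slice_startState (C : QCircuit) (w : QState C.witness) (hA : 0 < C.ancilla) :
    Chain C.witness 0 ((QGate.x (1 + C.witness)).apply C.width (C.startState w)) w := by
  have hw : 1 + C.witness < C.width := by unfold QCircuit.width; omega
  have key : ∀ c : ℕ → Bool, slice (W := C.witness)
      ((QGate.x (1 + C.witness)).apply C.width (C.startState w)) c =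
      slice (C.startState w) (update c (1 + C.witness) (!c (1 + C.witness))) := by
    intro c
    funext a
    simp only [slice, QGate.apply, dif_pos hw]
    rw [joinBits_other _ _ (.inr le_rfl), update_joinBits_other _ _ (.inr le_rfl)]
  have start : ∀ c : ℕ → Bool, slice (W := C.witness) (C.startState w) c =
      if ∀ i, i < C.width → i = 0 ∨ C.witness < i → c i = false then w else 0 := by
    intro c
    funext a
    simp only [slice, QCircuit.startState]
    by_cases h : ∀ i, i < C.width → i = 0 ∨ C.witness < i → c i = false
    · rw [if_pos h, if_pos]
      · congr 1
        funext j
        rw [joinBits_witness]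
      · intro i hi
        rw [← Fin.eta i i.isLt, joinBits_other _ _ (by omega)]
        exact h i i.isLt hi
    · rw [if_neg h, if_neg]
      · rfl
      · intro h'
        apply h
        intro i hi hi'
        have := h' ⟨i, hi⟩ hi'
        rwa [joinBits_other _ _ (by omega)] at this
  have zero : ∀ (c : ℕ → Bool) (i : ℕ), i < C.width → (i = 0 ∨ 1 + C.witness < i) → c i = true →
      slice (W := C.witness) ((QGate.x (1 + C.witness)).apply C.width (C.startState w)) c = 0 := by
    intro c i hi hi' hc
    rw [key, start, if_neg]
    intro h
    have := h i hi (by omega)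
    rw [update_of_ne (by omega), hc] at this
    exact absurd this (by simp)
  refine ⟨?_, fun c hc => zero c 0 (by omega) (.inl rfl) hc,
    fun c j hj hjN hc => zero c j hjN (.inr (by omega)) hc,
    fun c j hj hjN hc _ => zero c j hjN (.inr (by omega)) hc⟩
  rw [key, start, if_pos]
  intro i _ hi
  by_cases h : i = 1 + C.witness
  · subst h; simp [passed]
  · rw [update_of_ne h]
    simp only [passed, decide_eq_false_iff_not]
    omega

/-- The acceptance probability is the squared norm of what the tests leave over. -/
theorem acceptProb_testCircuit (W : ℕ) (Ts : List (List QGate × ℕ))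
    (hT : ∀ T ∈ Ts, (∀ g ∈ T.1, g.On W) ∧ T.2 < W) (w : QState W) :
    (testCircuit W (Ts.map shiftTest)).acceptProb w = nsq (testProjs W Ts w) := by
  set C := testCircuit W (Ts.map shiftTest) with hC
  have hwid : C.width = 1 + W + (Ts.length + 1) := by simp [hC, testCircuit, QCircuit.width]
  have h0 : Chain W 0 ((QGate.x (1 + W)).apply C.width (C.startState w)) w :=
    slice_startState C w (by simp [hC, testCircuit])
  have h := Chain.run hT h0 (by omega)
  rw [Nat.zero_add] at h
  set Φ := runGates C.width (testGates (1 + W) 0 (Ts.map shiftTest))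
    ((QGate.x (1 + W)).apply C.width (C.startState w)) with hΦ
  have hout : 1 + W + Ts.length < C.width := by omega
  have h00 : 0 < C.width := by omega
  have hfin : C.finalState w = (QGate.cnot (1 + W + Ts.length) 0).apply C.width Φ := by
    have : C.gates = .x (1 + W) :: (testGates (1 + W) 0 (Ts.map shiftTest) ++
      [.cnot (1 + W + Ts.length) 0]) := by simp [hC, testCircuit]
    unfold QCircuit.finalState
    rw [this, List.foldl_cons, List.foldl_append]
    rfl
  have val : ∀ (a : Fin W → Bool) (c : ℕ → Bool), C.finalState w (joinBits C.width a c) =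
      slice Φ (update c 0 (xor (c 0) (c (1 + W + Ts.length)))) a := by
    intro a c
    rw [hfin]
    simp only [QGate.apply]
    rw [dif_pos ⟨hout, h00, by omega⟩, joinBits_other _ _ (.inl rfl),
      joinBits_other _ _ (.inr (by omega)), update_joinBits_other _ _ (.inl rfl)]
    rfl
  -- The strings that contribute to acceptance: output qubit and all test qubits one, arbitrary
  -- witness bits. All other strings with output one have amplitude zero.
  set e : (Fin W → Bool) → (Fin C.width → Bool) := fun a =>
    joinBits C.width a (update (passed W Ts.length) 0 true) with he
  have hinj : Function.Injective e := by
    intro a a' haa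
    funext j
    have := congrFun haa ⟨1 + j, by omega⟩
    simpa [he, joinBits_witness _ _ j.isLt] using this
  unfold QCircuit.acceptProb nsq
  symm
  refine Fintype.sum_of_injective e hinj _ _ ?_ ?_
  · intro b hb
    split_ifs with hb0
    · -- Every other bit string violates one of the conditions on the shape of the state.
      set c : ℕ → Bool := fun i => if h : i < C.width then b ⟨i, h⟩ else false with hc
      have hcb : ∀ i : Fin C.width, c i = b i := fun i => by simp [hc]
      set a : Fin W → Bool := fun j => b ⟨1 + j, by omega⟩ with ha
      have hbj : b = joinBits C.width a c := by
        funext i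
        by_cases hi : 1 ≤ (i : ℕ) ∧ (i : ℕ) < 1 + W
        · simp only [joinBits, dif_pos hi, ha]
          congr 1
          ext
          simp only
          omega
        · simp only [joinBits, dif_neg hi, hcb]
      have hc0 : c 0 = true := by rw [← hb0]; exact hcb ⟨0, h00⟩
      suffices hz : slice (W := W) Φ (update c 0 (xor (c 0) (c (1 + W + Ts.length)))) = 0 by
        rw [hbj, val, hz]; simp
      rw [hc0]
      by_cases hT1 : c (1 + W + Ts.length) = true
      · by_cases hall : ∀ j, 1 + W ≤ j → j ≤ 1 + W + Ts.length → c j = true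
        · exfalso
          apply hb
          refine ⟨a, ?_⟩
          rw [hbj, he]
          funext i
          simp only [joinBits]
          split_ifs with hi
          · rfl
          · by_cases hi0 : (i : ℕ) = 0
            · rw [hi0, update_self, hc0]
            · rw [update_of_ne hi0, hall i (by omega) (by omega)]
              simp only [passed, decide_eq_true_eq]
              omega
        -- Descending from the last test qubit, which is one, some test qubit is one while its
        -- predecessor is zero; `mono` excludes this.
        · have : ∃ j, 1 + W < j ∧ j ≤ 1 + W + Ts.length ∧ c j = true ∧ c (j - 1) = false := by
            by_contra hno
            push Not at hno
            apply hall
            intro j hj1 hj2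
            obtain ⟨d, rfl⟩ : ∃ d, 1 + W + Ts.length - d = j := ⟨1 + W + Ts.length - j, by omega⟩
            induction d with
            | zero => exact hT1
            | succ d ih =>
              have := hno (1 + W + Ts.length - d) (by omega) (by omega) (ih (by omega) (by omega))
              rw [show 1 + W + Ts.length - d - 1 = 1 + W + Ts.length - (d + 1) by omega] at this
              simpa using this
          obtain ⟨j, h1, h2, h3, h4⟩ := this
          exact h.mono _ j h1 (by omega) (by rw [update_of_ne (by omega), h3])
            (by rw [update_of_ne (by omega), h4])
      -- If the last test qubit is zero, the copying gate changed nothing and the output was one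
      -- before it, against `out`.
      · exact h.out _ (by simp [hT1])
    · rfl
  · intro a
    have h1 : e a ⟨0, h00⟩ = true := by
      rw [he]
      simp only
      rw [joinBits_other _ _ (.inl rfl), update_self]
    rw [if_pos h1, he]
    simp only
    rw [val]
    have h2 : passed W Ts.length (1 + W + Ts.length) = true := by simp [passed]
    have h3 : passed W Ts.length 0 = false := by simp [passed]
    rw [update_self, update_of_ne (by omega), h2, update_idem]
    simp only [Bool.xor_self]
    rw [← h3, update_eq_self, h.passed]

end QMABalance

namespace QMABalance

open Function

/-! ### Reversible classical computation on blocks of qubits -/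

/-- The blocks into which the witness qubits are divided. -/
inductive Blk
  | A | B | C | D | Z | Y | Y' | c | t | s | r
  deriving DecidableEq

/-- The position of a block in the layout. -/
def Blk.num : Blk → ℕ
  | .A => 0
  | .B => 1
  | .C => 2
  | .D => 3
  | .Z => 4
  | .Y => 5
  | .Y' => 6
  | .c => 7
  | .t => 8
  | .s => 9
  | .r => 10

/-- The number of qubit `k` of a block. -/
def loc (a : Blk) (k : ℕ) : ℕ := 11 * k + a.num

theorem Blk.num_lt (a : Blk) : a.num < 11 := by cases a <;> decide

theorem Blk.num_inj {a b : Blk} (h : a.num = b.num) : a = b := by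
  cases a <;> cases b <;> first | rfl | exact absurd h (by decide)

@[simp] theorem loc_inj {a b : Blk} {k l : ℕ} : loc a k = loc b l ↔ a = b ∧ k = l := by
  have h1 := a.num_lt
  have h2 := b.num_lt
  constructor
  · intro h
    simp only [loc] at h
    exact ⟨Blk.num_inj (by omega), by omega⟩
  · rintro ⟨rfl, rfl⟩; rfl

/-- Interleaving the blocks makes qubit numbers independent of the block size, which enters only as
the bound for the position in a block. -/
theorem loc_lt {a : Blk} {k X : ℕ} : loc a k < 11 * X ↔ k < X := by
  have := a.num_lt
  simp only [loc]
  omega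

/-- The bits of all blocks. -/
abbrev Mem := Blk → ℕ → Bool

/-- Set a bit. -/
def Mem.set (F : Mem) (a : Blk) (k : ℕ) (v : Bool) : Mem := update F a (update (F a) k v)

theorem Mem.set_apply (F : Mem) (a : Blk) (k : ℕ) (v : Bool) (b : Blk) (j : ℕ) :
    F.set a k v b j = if b = a ∧ j = k then v else F b j := by
  by_cases h : b = a
  · subst h
    by_cases h' : j = k
    · subst h'; simp [Mem.set]
    · simp [Mem.set, h']
  · simp [Mem.set, h]

/-- Classical reversible gates on the bits of the blocks. -/
inductive MGate
  | x (a : Blk) (k : ℕ)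
  | cnot (a : Blk) (k : ℕ) (b : Blk) (l : ℕ)
  | ccx (a : Blk) (k : ℕ) (b : Blk) (l : ℕ) (d : Blk) (m : ℕ)

namespace MGate

def toQ : MGate → QGate
  | x a k => .x (loc a k)
  | cnot a k b l => .cnot (loc a k) (loc b l)
  | ccx a k b l d m => .ccx (loc a k) (loc b l) (loc d m)

/-- The effect of a gate. -/
def step (F : Mem) : MGate → Mem
  | x a k => F.set a k (!F a k)
  | cnot a k b l => F.set b l (xor (F b l) (F a k))
  | ccx a k b l d m => F.set d m (xor (F d m) (F a k && F b l))

/-- The gate acts on different bits with numbers below `X`. -/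
def OK (X : ℕ) : MGate → Prop
  | x _ k => k < X
  | cnot a k b l => k < X ∧ l < X ∧ ¬(a = b ∧ k = l)
  | ccx a k b l d m => k < X ∧ l < X ∧ m < X ∧ ¬(a = b ∧ k = l) ∧ ¬(a = d ∧ k = m) ∧ ¬(b = d ∧ l = m)

theorem OK.on {X : ℕ} {g : MGate} (h : g.OK X) : g.toQ.On (11 * X) := by
  cases g with
  | x a k => exact loc_lt.2 h
  | cnot a k b l => exact ⟨loc_lt.2 h.1, loc_lt.2 h.2.1⟩
  | ccx a k b l d m => exact ⟨loc_lt.2 h.1, loc_lt.2 h.2.1, loc_lt.2 h.2.2.1⟩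

theorem step_step {X : ℕ} {g : MGate} (h : g.OK X) (F : Mem) : step (step F g) g = F := by
  funext b j
  cases g with
  | x a k =>
    simp only [step, Mem.set_apply]
    by_cases h1 : b = a ∧ j = k
    · rw [if_pos h1, h1.1, h1.2]; simp
    · rw [if_neg h1, if_neg h1]
  | cnot a k c l =>
    have h2 : ¬(a = c ∧ k = l) := h.2.2
    simp only [step, Mem.set_apply]
    by_cases h1 : b = c ∧ j = l
    · rw [if_pos h1, h1.1, h1.2]; simp [h2]
    · rw [if_neg h1, if_neg h1]
  | ccx a k c l d m =>
    have h2 : ¬(a = d ∧ k = m) := h.2.2.2.2.1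
    have h3 : ¬(c = d ∧ l = m) := h.2.2.2.2.2
    simp only [step, Mem.set_apply]
    by_cases h1 : b = d ∧ j = m
    · rw [if_pos h1, h1.1, h1.2]; simp [h2, h3]
    · rw [if_neg h1, if_neg h1]

end MGate

/-- The effect of a list of gates. -/
def exec (Ps : List MGate) (F : Mem) : Mem := Ps.foldl MGate.step F

theorem exec_append (Ps Qs : List MGate) (F : Mem) : exec (Ps ++ Qs) F = exec Qs (exec Ps F) := by
  simp [exec]

theorem exec_cons (g : MGate) (Ps : List MGate) (F : Mem) :
    exec (g :: Ps) F = exec Ps (g.step F) := rfl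

@[simp] theorem exec_nil (F : Mem) : exec [] F = F := rfl

theorem exec_reverse {X : ℕ} {Ps : List MGate} (h : ∀ g ∈ Ps, g.OK X) (F : Mem) :
    exec Ps.reverse (exec Ps F) = F := by
  induction Ps generalizing F with
  | nil => rfl
  | cons g Ps ih =>
    rw [List.reverse_cons, exec_append, exec_cons, exec_cons,
      ih fun g hg => h g (by simp [hg])]
    exact MGate.step_step (h g (by simp)) F

theorem exec_reverse' {X : ℕ} {Ps : List MGate} (h : ∀ g ∈ Ps, g.OK X) (F : Mem) :
    exec Ps (exec Ps.reverse F) = F := by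
  simpa using exec_reverse (X := X) (Ps := Ps.reverse) (fun g hg => h g (by simpa using hg)) F

/-- The bit string of the witness qubits with the given bits in the blocks. -/
def pack (X : ℕ) (F : Mem) : Fin (11 * X) → Bool := fun i =>
  match (i : ℕ) % 11 with
  | 0 => F .A (i / 11)
  | 1 => F .B (i / 11)
  | 2 => F .C (i / 11)
  | 3 => F .D (i / 11)
  | 4 => F .Z (i / 11)
  | 5 => F .Y (i / 11)
  | 6 => F .Y' (i / 11)
  | 7 => F .c (i / 11)
  | 8 => F .t (i / 11)
  | 9 => F .s (i / 11)
  | _ => F .r (i / 11)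

/-- The bits in the blocks for a bit string of the witness qubits. -/
def unpack {X : ℕ} (b : Fin (11 * X) → Bool) : Mem := fun a k =>
  if h : loc a k < 11 * X then b ⟨loc a k, h⟩ else false

section Pack

variable {X : ℕ}

theorem pack_loc (F : Mem) (a : Blk) (k : ℕ) (h : loc a k < 11 * X) :
    pack X F ⟨loc a k, h⟩ = F a k := by
  have h1 : loc a k % 11 = a.num := by
    have := a.num_lt
    simp only [loc]
    omega
  have h2 : loc a k / 11 = k := by
    have := a.num_lt
    simp only [loc]
    omega
  simp only [pack, h1, h2]
  cases a <;> rfl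

theorem exists_loc (i : Fin (11 * X)) : ∃ a k, ∃ h : loc a k < 11 * X, i = ⟨loc a k, h⟩ := by
  have key : ∃ a : Blk, a.num = (i : ℕ) % 11 := by
    have : (i : ℕ) % 11 < 11 := Nat.mod_lt _ (by norm_num)
    interval_cases (i : ℕ) % 11
    exacts [⟨.A, rfl⟩, ⟨.B, rfl⟩, ⟨.C, rfl⟩, ⟨.D, rfl⟩, ⟨.Z, rfl⟩, ⟨.Y, rfl⟩, ⟨.Y', rfl⟩, ⟨.c, rfl⟩,
      ⟨.t, rfl⟩, ⟨.s, rfl⟩, ⟨.r, rfl⟩]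
  obtain ⟨a, ha⟩ := key
  have e : loc a (i / 11) = i := by simp only [loc]; omega
  exact ⟨a, i / 11, by rw [e]; exact i.isLt, Fin.ext e.symm⟩

theorem pack_unpack (b : Fin (11 * X) → Bool) : pack X (unpack b) = b := by
  funext i
  obtain ⟨a, k, h, rfl⟩ := exists_loc i
  rw [pack_loc]
  simp [unpack, h]

/-- A `Mem` has unboundedly many bits per block, of which only those below X exist as qubits.
Identities of basis strings are therefore identities of memories up to position X. -/
theorem pack_eq_iff {F F' : Mem} : pack X F = pack X F' ↔ ∀ a, ∀ k < X, F a k = F' a k := by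
  constructor
  · intro h a k hk
    have := congrFun h ⟨loc a k, loc_lt.2 hk⟩
    rwa [pack_loc, pack_loc] at this
  · intro h
    funext i
    obtain ⟨a, k, hk, rfl⟩ := exists_loc i
    rw [pack_loc, pack_loc]
    exact h a k (loc_lt.1 hk)

theorem update_pack (F : Mem) (a : Blk) (k : ℕ) (h : loc a k < 11 * X) (v : Bool) :
    update (pack X F) ⟨loc a k, h⟩ v = pack X (F.set a k v) := by
  funext i
  obtain ⟨b, j, hj, rfl⟩ := exists_loc i
  rw [pack_loc, Mem.set_apply]
  by_cases e : b = a ∧ j = k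
  · obtain ⟨rfl, rfl⟩ := e; simp
  · rw [if_neg e, update_of_ne, pack_loc]
    intro h'
    exact e (loc_inj.1 (congrArg Fin.val h'))

theorem apply_pack {g : MGate} (hg : g.OK X) (ψ : QState (11 * X)) (F : Mem) :
    g.toQ.apply (11 * X) ψ (pack X F) = ψ (pack X (g.step F)) := by
  cases g with
  | x a k =>
    have h1 : loc a k < 11 * X := loc_lt.2 hg
    simp only [MGate.toQ, QGate.apply, dif_pos h1, pack_loc, update_pack, MGate.step]
  | cnot a k b l =>
    have h1 : loc a k < 11 * X ∧ loc b l < 11 * X ∧ loc a k ≠ loc b l :=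
      ⟨loc_lt.2 hg.1, loc_lt.2 hg.2.1, by simpa using hg.2.2⟩
    simp only [MGate.toQ, QGate.apply, dif_pos h1, pack_loc, update_pack, MGate.step]
  | ccx a k b l d m =>
    have h1 : loc a k < 11 * X ∧ loc b l < 11 * X ∧ loc d m < 11 * X ∧ loc a k ≠ loc b l ∧
        loc a k ≠ loc d m ∧ loc b l ≠ loc d m :=
      ⟨loc_lt.2 hg.1, loc_lt.2 hg.2.1, loc_lt.2 hg.2.2.1, by simpa using hg.2.2.2.1,
        by simpa using hg.2.2.2.2.1, by simpa using hg.2.2.2.2.2⟩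
    simp only [MGate.toQ, QGate.apply, dif_pos h1, pack_loc, update_pack, MGate.step]

theorem apply_h_pack (a : Blk) (k : ℕ) (hk : k < X) (ψ : QState (11 * X)) (F : Mem) :
    (QGate.h (loc a k)).apply (11 * X) ψ (pack X F) = ((Real.sqrt 2 : ℝ) : ℂ)⁻¹ *
      (ψ (pack X (F.set a k false)) + (if F a k then -1 else 1) * ψ (pack X (F.set a k true))) := by
  rw [QGate.apply_h (loc_lt.2 hk), update_pack, update_pack, pack_loc]

/-- Bit strings are moved forward by classical gates. -/
theorem runGates_exec {Ps : List MGate} (h : ∀ g ∈ Ps, g.OK X) (ψ : QState (11 * X)) (F : Mem) :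
    runGates (11 * X) (Ps.map MGate.toQ) ψ (pack X (exec Ps F)) = ψ (pack X F) := by
  induction Ps generalizing ψ F with
  | nil => rfl
  | cons g Ps ih =>
    rw [List.map_cons, runGates_cons, exec_cons, ih fun g hg => h g (by simp [hg]),
      apply_pack (h g (by simp)), MGate.step_step (h g (by simp))]

theorem runGates_pack {Ps : List MGate} (h : ∀ g ∈ Ps, g.OK X) (ψ : QState (11 * X)) (F : Mem) :
    runGates (11 * X) (Ps.map MGate.toQ) ψ (pack X F) = ψ (pack X (exec Ps.reverse F)) := by
  rw [← runGates_exec h ψ (exec Ps.reverse F), exec_reverse' h]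

/-- Admissible gates read and write only below X, so computing on memories is well defined on basis
strings. -/
theorem pack_exec {Ps : List MGate} (h : ∀ g ∈ Ps, g.OK X) {F F' : Mem} (e : pack X F = pack X F') :
    pack X (exec Ps F) = pack X (exec Ps F') := by
  induction Ps generalizing F F' with
  | nil => exact e
  | cons g Ps ih =>
    refine ih (fun g hg => h g (by simp [hg])) ?_
    have hg := h g (by simp)
    rw [pack_eq_iff] at e ⊢
    intro b j hj
    cases g with
    | x a k => simp only [MGate.step, Mem.set_apply, e a k hg, e b j hj]
    | cnot a k c l =>
      simp only [MGate.step, Mem.set_apply, e a k hg.1, e c l hg.2.1, e b j hj]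
    | ccx a k c l d m =>
      simp only [MGate.step, Mem.set_apply, e a k hg.1, e c l hg.2.1, e d m hg.2.2.1, e b j hj]

end Pack

/-- A classical test keeps the bit strings for which it computes `true`. -/
theorem testProj_classical {X : ℕ} {Ps : List MGate} (h : ∀ g ∈ Ps, g.OK X) {a : Blk} {k : ℕ}
    (hk : k < X) (ψ : QState (11 * X)) (F : Mem) :
    testProj (11 * X) (Ps.map MGate.toQ, loc a k) ψ (pack X F) =
      if exec Ps F a k = true then ψ (pack X F) else 0 := by
  have e : (Ps.map MGate.toQ).reverse = Ps.reverse.map MGate.toQ := by simp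
  rw [testProj, e, runGates_pack fun g hg => h g (by simpa using hg), List.reverse_reverse]
  simp only [keep]
  rw [runGates_exec h]
  simp [loc_lt, hk, pack_loc]

end QMABalance

namespace QMABalance

open Function

/-! ### Building blocks of the tests -/

/-- Add the bits of block `a` whose numbers are listed in `os` to block `b`, from position
`off + k` on. -/
def copyBits (a b : Blk) (off : ℕ) : ℕ → List ℕ → List MGate
  | _, [] => []
  | k, o :: os => .cnot a o b (off + k) :: copyBits a b off (k + 1) os

theorem exec_copyBits {a b : Blk} (hab : a ≠ b) (off : ℕ) (os : List ℕ) : ∀ (k : ℕ) (F : Mem),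
    exec (copyBits a b off k os) F = update F b fun j =>
      xor (F b j) (decide (off + k ≤ j ∧ j < off + k + os.length) && F a (os.getD (j - (off + k)) 0)) := by
  induction os with
  | nil =>
    intro k F
    have : ∀ j, decide (off + k ≤ j ∧ j < off + k + ([] : List ℕ).length) = false := by
      intro j; simp
    simp only [copyBits, exec_nil, this, Bool.false_and, Bool.xor_false]
    exact (update_eq_self b F).symm
  | cons o os ih =>
    intro k F
    rw [copyBits, exec_cons, ih]
    funext d j
    by_cases hd : d = b
    · subst hd
      simp only [update_self, MGate.step, Mem.set_apply, true_and, hab, false_and, if_false]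
      rcases lt_trichotomy j (off + k) with h | rfl | h
      · have h1 : ¬(off + (k + 1) ≤ j ∧ j < off + (k + 1) + os.length) := by omega
        have h2 : ¬(off + k ≤ j ∧ j < off + k + (o :: os).length) := by omega
        rw [decide_eq_false h1, decide_eq_false h2, if_neg h.ne]
        simp
      · simp
      · obtain ⟨i, rfl⟩ := Nat.exists_eq_add_of_lt h
        have h1 : (off + (k + 1) ≤ off + k + i + 1 ∧ off + k + i + 1 < off + (k + 1) + os.length) ↔
          (off + k ≤ off + k + i + 1 ∧ off + k + i + 1 < off + k + (o :: os).length) := by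
          simp only [List.length_cons]; omega
        have h2 : off + k + i + 1 - (off + (k + 1)) = i := by omega
        have h3 : off + k + i + 1 - (off + k) = i + 1 := by omega
        have h4 : off + k + i + 1 ≠ off + k := by omega
        rw [h2, h3, if_neg h4, List.getD_cons_succ, decide_eq_decide.2 h1]
    · simp [hd, MGate.step, Mem.set_apply]

/-- Add the first `n` bits of block `a` to block `b`, from position `off` on. -/
def copyRange (a b : Blk) (off n : ℕ) : List MGate :=
  (List.range' 0 n).flatMap fun k => [.cnot a k b (off + k)]

theorem copyRange_eq (a b : Blk) (off n : ℕ) :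
    copyRange a b off n = copyBits a b off 0 (List.range' 0 n) := by
  have : ∀ n k, (List.range' k n).flatMap (fun k => [MGate.cnot a k b (off + k)]) =
      copyBits a b off k (List.range' k n) := by
    intro n
    induction n with
    | zero => intro k; rfl
    | succ n ih => intro k; simp [List.range'_succ, copyBits, ih]
  exact this n 0

theorem exec_copyRange {a b : Blk} (hab : a ≠ b) (off n : ℕ) (F : Mem) :
    exec (copyRange a b off n) F = update F b fun j =>
      xor (F b j) (decide (off ≤ j ∧ j < off + n) && F a (j - off)) := by
  rw [copyRange_eq, exec_copyBits hab]
  congr 1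
  funext j
  simp only [Nat.add_zero, List.length_range']
  by_cases h : off ≤ j ∧ j < off + n
  · have : j - off < n := by omega
    simp [h, this]
  · simp [h]

/-- Compute in block `d` the conjunctions of the negated bits of block `a`. -/
def chain (a d : Blk) (n : ℕ) : List MGate :=
  .x d 0 :: (List.range' 0 n).flatMap fun k => [.x a k, .ccx d k a k d (k + 1), .x a k]

/-- Bit k + 1 of the chain is bit k and the negation of bit k of block `a`; the negations around the
Toffoli gate leave `a` intact. The last bit of the chain then says whether the first n bits of `a`
all vanish. -/
theorem exec_chain {a d : Blk} (had : a ≠ d) (n : ℕ) (F : Mem) (hF : F d = fun _ => false) :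
    exec (chain a d n) F = update F d fun j => decide (j ≤ n ∧ ∀ i < j, F a i = false) := by
  have step : ∀ (k : ℕ) (G : Mem), exec [.x a k, .ccx d k a k d (k + 1), .x a k] G =
      G.set d (k + 1) (xor (G d (k + 1)) (G d k && !G a k)) := by
    intro k G
    funext b j
    simp only [exec, List.foldl_cons, List.foldl_nil, MGate.step, Mem.set_apply, had, had.symm,
      false_and, if_false, and_self, if_true]
    by_cases h1 : b = a ∧ j = k
    · obtain ⟨rfl, rfl⟩ := h1
      simp [had]
    · simp [h1]
  have main : ∀ m, exec (.x d 0 :: (List.range' 0 m).flatMap fun k =>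
      [.x a k, .ccx d k a k d (k + 1), .x a k]) F =
      update F d fun j => decide (j ≤ m ∧ ∀ i < j, F a i = false) := by
    intro m
    induction m with
    | zero =>
      funext b j
      simp only [List.range'_zero, List.flatMap_nil, exec_cons, exec_nil, MGate.step, Mem.set_apply]
      by_cases hb : b = d
      · subst hb
        by_cases hj : j = 0
        · subst hj; simp [hF]
        · simp [hF, hj]
      · simp [hb]
    | succ m ih =>
      rw [List.range'_concat, List.flatMap_append, ← List.cons_append, exec_append, ih]
      simp only [Nat.zero_add, Nat.one_mul, List.flatMap_cons, List.flatMap_nil, List.append_nil]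
      rw [step]
      funext b j
      simp only [Mem.set_apply]
      by_cases hb : b = d
      · subst hb
        by_cases hj : j = m + 1
        · subst hj
          simp only [update_self, update_of_ne had, and_self, if_true, le_refl, true_and]
          have h0 : ¬(m + 1 ≤ m ∧ ∀ i < m + 1, F a i = false) := by omega
          have h2 : (∀ i < m + 1, F a i = false) ↔ (∀ i < m, F a i = false) ∧ F a m = false := by
            constructor
            · exact fun h => ⟨fun i hi => h i (by omega), h m (by omega)⟩
            · rintro ⟨h, h'⟩ i hi
              rcases Nat.lt_succ_iff_lt_or_eq.1 hi with h3 | rfl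
              · exact h i h3
              · exact h'
          rw [decide_eq_false h0, Bool.false_xor]
          cases hm : F a m <;> simp only [h2, hm] <;> simp
        · simp only [hj, and_false, if_false, update_self, decide_eq_decide]
          have : j ≤ m ↔ j ≤ m + 1 := by omega
          rw [this]
      · simp [hb]
  exact main n

/-- Store a number in bits `n, n + 1, …` of block `a` if the control bit is off and of block `b` if
it is on. -/
def loadIndex (a b : Blk) (n l : ℕ) : List MGate :=
  (List.range' 0 l).flatMap fun k =>
    if l.testBit k then [.x a (n + k), .cnot .c 0 a (n + k), .cnot .c 0 b (n + k)] else []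

/-- The `x` gate together with the first `cnot` adds the negated control bit to `a`, and the second
`cnot` adds the control bit to `b`. Looping over the positions below l reaches every one among the
binary digits of l, because l < 2 ^ l. -/
theorem exec_loadIndex {a b : Blk} (hab : a ≠ b) (ha : a ≠ .c) (hb : b ≠ .c) (n l : ℕ) (F : Mem) :
    exec (loadIndex a b n l) F =
      update (update F a fun j => xor (F a j) (decide (n ≤ j) && l.testBit (j - n) && !F .c 0)) b
        fun j => xor (F b j) (decide (n ≤ j) && l.testBit (j - n) && F .c 0) := by
  have main : ∀ m, exec ((List.range' 0 m).flatMap fun k =>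
      if l.testBit k then [.x a (n + k), .cnot .c 0 a (n + k), .cnot .c 0 b (n + k)] else []) F =
      update (update F a fun j => xor (F a j)
          (decide (n ≤ j ∧ j < n + m) && l.testBit (j - n) && !F .c 0)) b
        fun j => xor (F b j) (decide (n ≤ j ∧ j < n + m) && l.testBit (j - n) && F .c 0) := by
    intro m
    induction m with
    | zero =>
      have : ∀ j, decide (n ≤ j ∧ j < n + 0) = false := by intro j; simp
      simp only [List.range'_zero, List.flatMap_nil, exec_nil, this, Bool.false_and, Bool.xor_false]
      funext d j
      by_cases h1 : d = b
      · subst h1; simp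
      · by_cases h2 : d = a
        · subst h2; simp [hab]
        · simp [h1, h2]
    | succ m ih =>
      rw [List.range'_concat, List.flatMap_append, exec_append, ih]
      simp only [Nat.zero_add, Nat.one_mul, List.flatMap_cons, List.flatMap_nil, List.append_nil]
      have hm : ∀ j, j ≠ n + m → decide (n ≤ j ∧ j < n + m) = decide (n ≤ j ∧ j < n + (m + 1)) := by
        intro j hj
        rw [decide_eq_decide]
        omega
      have h0 : decide (n ≤ n + m ∧ n + m < n + m) = false := by simp
      have h1 : decide (n ≤ n + m ∧ n + m < n + (m + 1)) = true := by simp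
      funext d j
      split_ifs with hl
      · simp only [exec, List.foldl_cons, List.foldl_nil, MGate.step, Mem.set_apply]
        by_cases hdb : d = b
        · subst hdb
          by_cases hj : j = n + m
          · subst hj
            cases hc : F .c 0 <;> simp [hab.symm, ha.symm, hb.symm, hl, hc]
          · simp [hj, hm j hj, hab.symm, -Bool.decide_and]
        · by_cases hda : d = a
          · subst hda
            by_cases hj : j = n + m
            · subst hj
              cases hc : F .c 0 <;> simp [hab, ha.symm, hb.symm, hl, hc]
            · simp [hj, hm j hj, hab, -Bool.decide_and]
          · simp [hda, hdb]
      · simp only [exec_nil]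
        by_cases hdb : d = b
        · subst hdb
          by_cases hj : j = n + m
          · subst hj; simp [hl]
          · simp [hm j hj, -Bool.decide_and]
        · by_cases hda : d = a
          · subst hda
            by_cases hj : j = n + m
            · subst hj; simp [hl, hdb]
            · simp [hm j hj, hdb, -Bool.decide_and]
          · simp [hda, hdb]
  rw [loadIndex, main]
  have : ∀ j, (decide (n ≤ j ∧ j < n + l) && l.testBit (j - n)) =
      (decide (n ≤ j) && l.testBit (j - n)) := by
    intro j
    by_cases h : n ≤ j ∧ j < n + l
    · simp [h]
    · by_cases h' : n ≤ j
      · have : l.testBit (j - n) = false := by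
          apply Nat.testBit_eq_false_of_lt
          exact lt_of_le_of_lt (by omega : l ≤ j - n) Nat.lt_two_pow_self
        simp [this]
      · simp [h']
  simp only [this]

/-- Exchange the first `n` bits of two blocks if the control bit is on. -/
def swapBits (a b : Blk) (n : ℕ) : List MGate :=
  (List.range' 0 n).flatMap fun k => [.cnot b k a k, .ccx .c 0 a k b k, .cnot b k a k]

/-- A controlled exchange by three additions: b is added to a, under the control a is added to b,
and b is added to a again. -/
theorem exec_swapBits {a b : Blk} (hab : a ≠ b) (ha : a ≠ .c) (hb : b ≠ .c) (n : ℕ) (F : Mem) :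
    exec (swapBits a b n) F =
      update (update F a fun j => if j < n ∧ F .c 0 = true then F b j else F a j) b
        fun j => if j < n ∧ F .c 0 = true then F a j else F b j := by
  induction n with
  | zero =>
    funext d j
    by_cases h1 : d = b
    · subst h1; simp [swapBits]
    · by_cases h2 : d = a
      · subst h2; simp [swapBits, hab]
      · simp [swapBits, h1, h2]
  | succ n ih =>
    rw [swapBits, List.range'_concat, List.flatMap_append, exec_append]
    rw [swapBits] at ih
    rw [ih]
    simp only [Nat.zero_add, Nat.one_mul, List.flatMap_cons, List.flatMap_nil, List.append_nil,
      exec, List.foldl_cons, List.foldl_nil, MGate.step]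
    have hm : ∀ j, j ≠ n → (j < n ↔ j < n + 1) := by intro j hj; omega
    funext d j
    simp only [Mem.set_apply]
    by_cases hdb : d = b
    · subst hdb
      by_cases hj : j = n
      · subst hj
        cases hc : F .c 0 <;> cases hx : F a j <;> cases hy : F d j <;>
          simp [hab, hab.symm, ha.symm, hb.symm, hc, hx, hy]
      · simp [hj, hm j hj, hab.symm]
    · by_cases hda : d = a
      · subst hda
        by_cases hj : j = n
        · subst hj
          cases hc : F .c 0 <;> cases hx : F d j <;> cases hy : F b j <;>
            simp [hab, hab.symm, ha.symm, hb.symm, hc, hx, hy]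
        · simp [hj, hm j hj, hab]
      · simp [hda, hdb]

/-- Add the value of a Boolean gate to bit `w` of block `a`. -/
def evalGate (a : Blk) (w : ℕ) : BoolGate → List MGate
  | .not p => [.cnot a p a w, .x a w]
  | .and p q => [.cnot a q .t 0, .ccx a p .t 0 a w, .cnot a q .t 0]
  | .or p q => [.cnot a p a w, .cnot a q a w, .cnot a q .t 0, .ccx a p .t 0 a w, .cnot a q .t 0]

/-- Evaluate a list of Boolean gates on the bits of block `a`. -/
def evalGates (a : Blk) (I : ℕ) : ℕ → List BoolGate → List MGate
  | _, [] => []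
  | k, g :: gs => evalGate a (I + k) g ++ evalGates a I (k + 1) gs

/-- The second operand passes through the temporary bit, so that the Toffoli gate acts on three
different qubits even if both operands are the same wire. A disjunction is computed as p + q + pq
modulo 2. -/
theorem exec_evalGate {a : Blk} (ha : a ≠ .t) (g : BoolGate) (F : Mem) (ws : List Bool)
    (ht : F .t 0 = false) (hF : F a = fun j => ws.getD j false) (hg : g.ReadsBelow ws.length) :
    exec (evalGate a ws.length g) F = update F a fun j => (ws ++ [g.eval ws]).getD j false := by
  have app : ∀ j v, (ws ++ [v]).getD j false =
      if j = ws.length then v else ws.getD j false := by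
    intro j v
    rcases lt_trichotomy j ws.length with h | rfl | h
    · rw [if_neg h.ne, List.getD_append _ _ _ _ h]
    · simp
    · rw [if_neg h.ne', List.getD_eq_default _ _ (by simp; omega),
        List.getD_eq_default _ _ (by omega)]
  have hw : F a ws.length = false := by rw [hF]; simp
  funext d j
  have hev : ∀ p, F a p = ws.getD p false := fun p => by rw [hF]
  cases g with
  | not p =>
    have hp : p ≠ ws.length := (show p < ws.length from hg).ne
    simp only [evalGate, exec, List.foldl_cons, List.foldl_nil, MGate.step, Mem.set_apply,
      BoolGate.eval]
    by_cases hd : d = a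
    · subst hd
      rw [update_self, app]
      by_cases hj : j = ws.length
      · subst hj
        simp only [hw, ← hev]
        simp
      · simp [hj, hev]
    · simp [hd]
  | and p q =>
    have hp : p ≠ ws.length := (show p < ws.length ∧ q < ws.length from hg).1.ne
    have hq : q ≠ ws.length := (show p < ws.length ∧ q < ws.length from hg).2.ne
    simp only [evalGate, exec, List.foldl_cons, List.foldl_nil, MGate.step, Mem.set_apply,
      BoolGate.eval, ha, ha.symm, false_and, if_false, and_self, if_true, ht]
    by_cases hd : d = a
    · subst hd
      rw [update_self, app]
      by_cases hj : j = ws.length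
      · subst hj
        simp only [hw, ← hev]
        simp [ha]
      · simp [hj, hev, ha]
    · by_cases hd' : d = .t
      · subst hd'
        by_cases hj : j = 0
        · subst hj; simp [hd, ht, hq]
        · simp [hd, hj]
      · simp [hd, hd']
  | or p q =>
    have hp : p ≠ ws.length := (show p < ws.length ∧ q < ws.length from hg).1.ne
    have hq : q ≠ ws.length := (show p < ws.length ∧ q < ws.length from hg).2.ne
    simp only [evalGate, exec, List.foldl_cons, List.foldl_nil, MGate.step, Mem.set_apply,
      BoolGate.eval, ha, ha.symm, false_and, if_false, and_self, if_true, ht]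
    by_cases hd : d = a
    · subst hd
      rw [update_self, app]
      by_cases hj : j = ws.length
      · subst hj
        simp only [hw, ← hev]
        cases h1 : F d p <;> cases h2 : F d q <;> simp [ha, hp, hq, h1, h2]
      · simp [hj, hev, ha]
    · by_cases hd' : d = .t
      · subst hd'
        by_cases hj : j = 0
        · subst hj; simp [hd, ht, hq]
        · simp [hd, hj]
      · simp [hd, hd']

/-- The values of all wires. -/
def wireList (gs : List BoolGate) (input : List Bool) : List Bool :=
  gs.foldl (fun w g => w ++ [g.eval w]) input

theorem exec_evalGates {a : Blk} (ha : a ≠ .t) (I : ℕ) (gs : List BoolGate) :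
    ∀ (k : ℕ) (ws : List Bool) (F : Mem), ws.length = I + k → F .t 0 = false →
    (F a = fun j => ws.getD j false) →
    (∀ (i : ℕ) (h : i < gs.length), (gs[i]).ReadsBelow (I + k + i)) →
    exec (evalGates a I k gs) F = update F a fun j => (wireList gs ws).getD j false := by
  induction gs with
  | nil =>
    intro k ws F hl ht hF hr
    simp only [evalGates, exec_nil, wireList, List.foldl_nil, ← hF]
    exact (update_eq_self a F).symm
  | cons g gs ih =>
    intro k ws F hl ht hF hr
    rw [evalGates, exec_append, ← hl, exec_evalGate ha g F ws ht hF (by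
      have := hr 0 (by simp); rw [hl]; simpa using this)]
    rw [ih (k + 1) (ws ++ [g.eval ws]) _ (by simp [hl]; omega) (by simp [ha.symm, ht]) (by simp)
      (fun i hi => by
        have := hr (i + 1) (by simpa using hi)
        rw [show I + (k + 1) + i = I + k + (i + 1) by omega]
        simpa using this)]
    rw [update_idem]
    rfl

end QMABalance

namespace QMABalance

open Function

/-! ### Which qubits the building blocks use -/

namespace MGate

/-- The blocks on which a gate acts. -/
def blocks : MGate → List Blk
  | x a _ => [a]
  | cnot a _ b _ => [a, b]
  | ccx a _ b _ d _ => [a, b, d]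

/-- The block that a gate changes. -/
def target : MGate → Blk
  | x a _ => a
  | cnot _ _ b _ => b
  | ccx _ _ _ _ d _ => d

theorem step_of_target_ne {g : MGate} {a : Blk} (h : g.target ≠ a) (F : Mem) :
    g.step F a = F a := by
  funext j
  cases g <;> simp only [step, target, Mem.set_apply] at h ⊢ <;> simp [h.symm]

theorem step_set {g : MGate} {a : Blk} (h : a ∉ g.blocks) (F : Mem) (k : ℕ) (v : Bool) :
    g.step (F.set a k v) = (g.step F).set a k v := by
  funext b j
  cases g with
  | x p i =>
    simp only [blocks, List.mem_singleton] at h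
    have h' : ¬ p = a := fun e => h e.symm
    simp only [step, Mem.set_apply]
    by_cases e : b = p ∧ j = i
    · simp [e, h']
    · simp [e]
  | cnot p i q l =>
    simp only [blocks, List.mem_cons, List.not_mem_nil, or_false, not_or] at h
    have h1 : ¬ p = a := fun e => h.1 e.symm
    have h2 : ¬ q = a := fun e => h.2 e.symm
    simp only [step, Mem.set_apply]
    by_cases e : b = q ∧ j = l
    · simp [e, h1, h2]
    · simp [e]
  | ccx p i q l d m =>
    simp only [blocks, List.mem_cons, List.not_mem_nil, or_false, not_or] at h
    have h1 : ¬ p = a := fun e => h.1 e.symm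
    have h2 : ¬ q = a := fun e => h.2.1 e.symm
    have h3 : ¬ d = a := fun e => h.2.2 e.symm
    simp only [step, Mem.set_apply]
    by_cases e : b = d ∧ j = m
    · simp [e, h1, h2, h3]
    · simp [e]

end MGate

theorem exec_of_target_ne {Ps : List MGate} {a : Blk} (h : ∀ g ∈ Ps, g.target ≠ a) (F : Mem) :
    exec Ps F a = F a := by
  induction Ps generalizing F with
  | nil => rfl
  | cons g Ps ih =>
    rw [exec_cons, ih fun g hg => h g (by simp [hg]), MGate.step_of_target_ne (h g (by simp))]

theorem exec_set {Ps : List MGate} {a : Blk} (h : ∀ g ∈ Ps, a ∉ g.blocks) (F : Mem) (k : ℕ)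
    (v : Bool) : exec Ps (F.set a k v) = (exec Ps F).set a k v := by
  induction Ps generalizing F with
  | nil => rfl
  | cons g Ps ih =>
    rw [exec_cons, MGate.step_set (h g (by simp)), ih fun g hg => h g (by simp [hg]), exec_cons]

/-- The gates act on different bits below `X`, use only the blocks in `as` and change only the
blocks in `bs`. -/
def UsesOnly (X : ℕ) (as bs : List Blk) (Ps : List MGate) : Prop :=
  ∀ g ∈ Ps, g.OK X ∧ g.blocks ⊆ as ∧ g.target ∈ bs

namespace UsesOnly

variable {X : ℕ} {as bs : List Blk} {Ps Qs : List MGate}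

theorem mono (h : UsesOnly X as bs Ps) {as' bs' : List Blk} (ha : as ⊆ as') (hb : bs ⊆ bs') :
    UsesOnly X as' bs' Ps :=
  fun g hg => ⟨(h g hg).1, List.Subset.trans (h g hg).2.1 ha, hb (h g hg).2.2⟩

theorem append (h : UsesOnly X as bs Ps) (h' : UsesOnly X as bs Qs) :
    UsesOnly X as bs (Ps ++ Qs) := by
  intro g hg
  rcases List.mem_append.1 hg with hg | hg
  · exact h g hg
  · exact h' g hg

theorem copyBits {a b : Blk} (hab : a ≠ b) (off : ℕ) (os : List ℕ) (ho : ∀ o ∈ os, o < X) :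
    ∀ k, off + k + os.length ≤ X → UsesOnly X [a, b] [b] (copyBits a b off k os) := by
  induction os with
  | nil => intro k _ g hg; simp [QMABalance.copyBits] at hg
  | cons o os ih =>
    intro k hk g hg
    simp only [List.length_cons] at hk
    simp only [QMABalance.copyBits, List.mem_cons] at hg
    rcases hg with rfl | hg
    · exact ⟨⟨ho o (by simp), by omega, by simp [hab]⟩, by simp [MGate.blocks], by simp [MGate.target]⟩
    · exact ih (fun o h => ho o (by simp [h])) (k + 1) (by omega) g hg

theorem copyRange {a b : Blk} (hab : a ≠ b) (off n : ℕ) (h : off + n ≤ X) :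
    UsesOnly X [a, b] [b] (copyRange a b off n) := by
  rw [copyRange_eq]
  refine copyBits hab off _ (fun o ho => ?_) 0 (by simpa using h)
  have := (List.mem_range'_1.1 ho).2
  omega

theorem chain {a d : Blk} (had : a ≠ d) (n : ℕ) (h : n + 1 ≤ X) :
    UsesOnly X [a, d] [a, d] (chain a d n) := by
  intro g hg
  simp only [QMABalance.chain, List.mem_cons, List.mem_flatMap, List.mem_range'_1,
    List.not_mem_nil, or_false] at hg
  rcases hg with rfl | ⟨k, hk, rfl | rfl | rfl⟩
  · exact ⟨by simp [MGate.OK]; omega, by simp [MGate.blocks], by simp [MGate.target]⟩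
  · exact ⟨by simp [MGate.OK]; omega, by simp [MGate.blocks], by simp [MGate.target]⟩
  · exact ⟨by simp [MGate.OK, had, had.symm]; omega, by simp [MGate.blocks], by simp [MGate.target]⟩
  · exact ⟨by simp [MGate.OK]; omega, by simp [MGate.blocks], by simp [MGate.target]⟩

theorem loadIndex {a b : Blk} (ha : a ≠ .c) (hb : b ≠ .c) (n w l : ℕ) (hl : l < 2 ^ w)
    (h : n + w ≤ X) : UsesOnly X [.c, a, b] [a, b] (loadIndex a b n l) := by
  intro g hg
  simp only [QMABalance.loadIndex, List.mem_flatMap] at hg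
  obtain ⟨k, hk, hg⟩ := hg
  split_ifs at hg with hb
  -- A one among the binary digits of l lies below w because l < 2 ^ w; so position n + k stays
  -- inside the block.
  · have hkw : k < w := by
      by_contra hkw
      have := Nat.testBit_eq_false_of_lt (lt_of_lt_of_le hl (Nat.pow_le_pow_right (by omega)
        (not_lt.1 hkw)))
      rw [this] at hb
      exact absurd hb (by simp)
    simp only [List.mem_cons, List.not_mem_nil, or_false] at hg
    rcases hg with rfl | rfl | rfl
    · exact ⟨by simp [MGate.OK]; omega, by simp [MGate.blocks], by simp [MGate.target]⟩
    · exact ⟨by simp [MGate.OK, ha.symm]; omega, by simp [MGate.blocks], by simp [MGate.target]⟩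
    · exact ⟨⟨by omega, by omega, fun e => by exact absurd e.1.symm (by assumption)⟩,
        by simp [MGate.blocks], by simp [MGate.target]⟩
  · simp at hg

theorem swapBits {a b : Blk} (hab : a ≠ b) (ha : a ≠ .c) (hb : b ≠ .c) (n : ℕ) (h : n ≤ X) :
    UsesOnly X [.c, a, b] [a, b] (swapBits a b n) := by
  intro g hg
  simp only [QMABalance.swapBits, List.mem_cons, List.mem_flatMap, List.mem_range'_1,
    List.not_mem_nil, or_false] at hg
  obtain ⟨k, hk, rfl | rfl | rfl⟩ := hg
  · exact ⟨by simp [MGate.OK, hab.symm]; omega, by simp [MGate.blocks], by simp [MGate.target]⟩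
  · exact ⟨by simp [MGate.OK, hab, ha.symm, hb.symm]; omega, by simp [MGate.blocks],
      by simp [MGate.target]⟩
  · exact ⟨by simp [MGate.OK, hab.symm]; omega, by simp [MGate.blocks], by simp [MGate.target]⟩

theorem evalGates {a : Blk} (ha : a ≠ .t) (I : ℕ) (gs : List BoolGate) :
    ∀ k, (∀ (i : ℕ) (h : i < gs.length), (gs[i]).ReadsBelow (I + k + i)) → I + k + gs.length ≤ X →
      UsesOnly X [a, .t] [a, .t] (evalGates a I k gs) := by
  induction gs with
  | nil => intro k _ _ g hg; simp [QMABalance.evalGates] at hg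
  | cons g gs ih =>
    intro k hr hk
    simp only [List.length_cons] at hk
    refine append ?_ (ih (k + 1) (fun i hi => ?_) (by omega))
    · have h0 := hr 0 (by simp)
      simp only [List.getElem_cons_zero, Nat.add_zero] at h0
      intro f hf
      cases g with
      | not p =>
        have hp : p < I + k := h0
        simp only [evalGate, List.mem_cons, List.not_mem_nil, or_false] at hf
        rcases hf with rfl | rfl
        · exact ⟨by simp [MGate.OK]; omega, by simp [MGate.blocks], by simp [MGate.target]⟩
        · exact ⟨by simp [MGate.OK]; omega, by simp [MGate.blocks], by simp [MGate.target]⟩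
      | and p q =>
        obtain ⟨hp, hq⟩ : p < I + k ∧ q < I + k := h0
        simp only [evalGate, List.mem_cons, List.not_mem_nil, or_false] at hf
        rcases hf with rfl | rfl | rfl
        · exact ⟨by simp [MGate.OK, ha]; omega, by simp [MGate.blocks], by simp [MGate.target]⟩
        · exact ⟨by simp [MGate.OK, ha, ha.symm]; omega, by simp [MGate.blocks],
            by simp [MGate.target]⟩
        · exact ⟨by simp [MGate.OK, ha]; omega, by simp [MGate.blocks], by simp [MGate.target]⟩
      | or p q =>
        obtain ⟨hp, hq⟩ : p < I + k ∧ q < I + k := h0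
        simp only [evalGate, List.mem_cons, List.not_mem_nil, or_false] at hf
        rcases hf with rfl | rfl | rfl | rfl | rfl
        · exact ⟨by simp [MGate.OK]; omega, by simp [MGate.blocks], by simp [MGate.target]⟩
        · exact ⟨by simp [MGate.OK]; omega, by simp [MGate.blocks], by simp [MGate.target]⟩
        · exact ⟨by simp [MGate.OK, ha]; omega, by simp [MGate.blocks], by simp [MGate.target]⟩
        · exact ⟨by simp [MGate.OK, ha, ha.symm]; omega, by simp [MGate.blocks],
            by simp [MGate.target]⟩
        · exact ⟨by simp [MGate.OK, ha]; omega, by simp [MGate.blocks], by simp [MGate.target]⟩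
    · have := hr (i + 1) (by simpa using hi)
      rw [show I + (k + 1) + i = I + k + (i + 1) by omega]
      simpa using this

end UsesOnly

/-! ### The tests -/

namespace Input

variable (I : Input) (X : ℕ)

/-- The test that a bit is zero. -/
def _root_.QMABalance.zeroTest (a : Blk) (k : ℕ) : List QGate × ℕ := ([.x (loc a k)], loc a k)

/-- The tests that all bits are zero, except for the first `n` bits of the first block. -/
def zeroTests : List (List QGate × ℕ) :=
  ((List.range' 0 X).flatMap fun k => [Blk.B, .C, .D, .Z, .Y, .Y', .c, .t, .s, .r].map fun a =>
    zeroTest a k) ++ (List.range' 0 (X - I.n)).map fun k => zeroTest .A (I.n + k)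

/-- Check whether the neighbour lists begin with `0` and `1`. -/
def vertexGates : List MGate :=
  evalGates .A I.adj.numInputs 0 I.adj.gates ++ (copyRange .A .B 0 I.n ++ ([.x .B I.n] ++
  (evalGates .B I.adj.numInputs 0 I.adj.gates ++ (copyBits .A .D 0 0 I.adj.outputs ++
  (copyBits .B .D I.n 0 I.adj.outputs ++ ([.x .D I.n] ++ (chain .D .Z (2 * I.n) ++
  [.x .Z (2 * I.n)])))))))

def vertexTest : List QGate × ℕ := (I.vertexGates.map MGate.toQ, loc .Z (2 * I.n))

/-- Replace a vertex in block `A` by an edge: the vertex is the beginning or the end of the edge,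
according to the control bit. -/
def edgeGates (l m : ℕ) : List MGate :=
  loadIndex .A .B I.n l ++ (loadIndex .B .A I.n m ++
  (evalGates .A I.adj.numInputs 0 I.adj.gates ++ (copyBits .A .B 0 0 I.adj.outputs ++
  (evalGates .B I.adj.numInputs 0 I.adj.gates ++ swapBits .A .B X))))

/-- Check whether blocks `A` and `B` describe an edge, and compute its sign. -/
def compareGates : List MGate :=
  copyBits .A .D 0 0 I.adj.outputs ++ (copyRange .B .D 0 I.n ++
  (copyBits .B .D I.n 0 I.adj.outputs ++ (copyRange .A .D I.n I.n ++
  (chain .A .Y I.n ++ (chain .B .Y' I.n ++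
  ([.cnot .Y I.n .D (2 * I.n), .cnot .Y' I.n .D (2 * I.n + 1)] ++ (chain .D .Z (2 * I.n + 2) ++
  (copyRange .A .C 0 I.adj.numInputs ++ (evalGates .C I.sgn.numInputs 0 I.sgn.gates ++
  copyBits .C .s 0 0 I.sgn.outputs)))))))))

/-- Reject if the control bit and the sign bit of an edge differ. -/
def decideGates : List MGate :=
  [.cnot .s 0 .c 0, .ccx .Z (2 * I.n + 2) .c 0 .r 0, .x .r 0]

/-- The test that the amplitudes at the two ends of an edge agree up to the sign of the edge. -/
def pairTest (l m : ℕ) : List QGate × ℕ :=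
  (.h (loc .c 0) :: ((I.edgeGates X l m ++ I.compareGates).map MGate.toQ ++
    .h (loc .c 0) :: I.decideGates.map MGate.toQ), loc .r 0)

/-- One round of tests. -/
def roundTests : List (List QGate × ℕ) :=
  I.zeroTests X ++ (I.vertexTest :: (List.range' 0 I.S).flatMap fun l =>
    (List.range' 0 I.S).map fun m => I.pairTest X l m)

/-- The circuits are well-formed and fit into blocks of size `X`. -/
structure Fits : Prop where
  adj_wellFormed : I.adj.WellFormed
  adj_inputs : I.adj.numInputs = I.n + I.idxBits
  adj_outputs : I.adj.outputs.length = I.n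
  sgn_wellFormed : I.sgn.WellFormed
  sgn_inputs : I.sgn.numInputs = I.n + I.idxBits
  sgn_outputs : I.sgn.outputs.length = 1
  two_le_S : 2 ≤ I.S
  adj_le : I.adj.numInputs + I.adj.gates.length ≤ X
  sgn_le : I.sgn.numInputs + I.sgn.gates.length ≤ X
  n_le : 2 * I.n + 3 ≤ X

namespace Fits

variable {I X}

theorem _root_.QMABalance.Input.lt_two_pow_idxBits {l : ℕ} (hl : l < I.S) : l < 2 ^ I.idxBits :=
  hl.trans_le (Nat.le_pow_clog (by norm_num) _)

/-- At least one index bit exists, and position 1 of a neighbour list can be queried in the vertex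
test. -/
theorem idxBits_pos (h : I.Fits X) : 0 < I.idxBits := Nat.clog_pos (by norm_num) h.two_le_S

theorem usesOnly_evalAdj (h : I.Fits X) {a : Blk} (ha : a ≠ .t) :
    UsesOnly X [a, .t] [a, .t] (evalGates a I.adj.numInputs 0 I.adj.gates) :=
  .evalGates ha _ _ 0 (fun i hi => by simpa using h.adj_wellFormed.1 i hi) (by simpa using h.adj_le)

theorem usesOnly_evalSgn (h : I.Fits X) {a : Blk} (ha : a ≠ .t) :
    UsesOnly X [a, .t] [a, .t] (evalGates a I.sgn.numInputs 0 I.sgn.gates) :=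
  .evalGates ha _ _ 0 (fun i hi => by simpa using h.sgn_wellFormed.1 i hi) (by simpa using h.sgn_le)

theorem usesOnly_copyAdj (h : I.Fits X) {a b : Blk} (hab : a ≠ b) (off : ℕ) (ho : off ≤ I.n) :
    UsesOnly X [a, b] [b] (copyBits a b off 0 I.adj.outputs) :=
  .copyBits hab _ _ (fun o h' => (h.adj_wellFormed.2 o h').trans_le h.adj_le) 0 (by
    have := h.adj_outputs
    have := h.n_le
    omega)

theorem usesOnly_vertexGates (h : I.Fits X) :
    UsesOnly X [.A, .B, .D, .Z, .t] [.A, .B, .D, .Z, .t] I.vertexGates := by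
  have hn := h.n_le
  have hx : ∀ (a : Blk) (k : ℕ), k < X → a ∈ [Blk.A, .B, .D, .Z, .t] →
      UsesOnly X [.A, .B, .D, .Z, .t] [.A, .B, .D, .Z, .t] [.x a k] := by
    intro a k hk ha g hg
    rw [List.mem_singleton] at hg
    subst hg
    exact ⟨hk, by simpa [MGate.blocks] using ha, ha⟩
  refine ((h.usesOnly_evalAdj (a := .A) (by decide)).mono (by decide) (by decide)).append ?_
  refine ((UsesOnly.copyRange (by decide) 0 I.n (by omega)).mono (by decide) (by decide)).append ?_
  refine (hx _ _ (by omega) (by decide)).append ?_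
  refine ((h.usesOnly_evalAdj (a := .B) (by decide)).mono (by decide) (by decide)).append ?_
  refine ((h.usesOnly_copyAdj (by decide) 0 (by omega)).mono (by decide) (by decide)).append ?_
  refine ((h.usesOnly_copyAdj (by decide) _ le_rfl).mono (by decide) (by decide)).append ?_
  refine (hx _ _ (by omega) (by decide)).append ?_
  refine ((UsesOnly.chain (by decide) _ (by omega)).mono (by decide) (by decide)).append ?_
  exact hx _ _ (by omega) (by decide)

/-- The control block is among the blocks used but not among those changed; the interference on the
control bit depends on this. -/
theorem usesOnly_edgeGates (h : I.Fits X) {l m : ℕ} (hl : l < I.S) (hm : m < I.S) :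
    UsesOnly X [.A, .B, .c, .t] [.A, .B, .t] (I.edgeGates X l m) := by
  have hn := h.n_le
  have h1 := h.adj_inputs
  have h2 := h.adj_le
  refine ((UsesOnly.loadIndex (by decide) (by decide) _ _ _ (I.lt_two_pow_idxBits hl) (by omega)).mono
    (by decide) (by decide)).append ?_
  refine ((UsesOnly.loadIndex (by decide) (by decide) _ _ _ (I.lt_two_pow_idxBits hm) (by omega)).mono
    (by decide) (by decide)).append ?_
  refine ((h.usesOnly_evalAdj (a := .A) (by decide)).mono (by decide) (by decide)).append ?_
  refine ((h.usesOnly_copyAdj (by decide) 0 (by omega)).mono (by decide) (by decide)).append ?_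
  refine ((h.usesOnly_evalAdj (a := .B) (by decide)).mono (by decide) (by decide)).append ?_
  exact (UsesOnly.swapBits (by decide) (by decide) (by decide) _ le_rfl).mono (by decide) (by decide)

/-- Neither the control block nor the verdict block occurs, so the comparison acts identically on
both values of the control bit. -/
theorem usesOnly_compareGates (h : I.Fits X) : UsesOnly X [.A, .B, .C, .D, .Z, .Y, .Y', .t, .s]
    [.A, .B, .C, .D, .Z, .Y, .Y', .t, .s] I.compareGates := by
  have hn := h.n_le
  have h1 := h.adj_inputs
  have h2 := h.adj_le
  refine ((h.usesOnly_copyAdj (by decide) 0 (by omega)).mono (by decide) (by decide)).append ?_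
  refine ((UsesOnly.copyRange (by decide) 0 I.n (by omega)).mono (by decide) (by decide)).append ?_
  refine ((h.usesOnly_copyAdj (by decide) _ le_rfl).mono (by decide) (by decide)).append ?_
  refine ((UsesOnly.copyRange (by decide) I.n I.n (by omega)).mono (by decide) (by decide)).append ?_
  refine ((UsesOnly.chain (by decide) _ (by omega)).mono (by decide) (by decide)).append ?_
  refine ((UsesOnly.chain (by decide) _ (by omega)).mono (by decide) (by decide)).append ?_
  refine UsesOnly.append (fun g hg => ?_) ?_
  · simp only [List.mem_cons, List.not_mem_nil, or_false] at hg
    rcases hg with rfl | rfl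
    · exact ⟨by simp [MGate.OK]; omega, by simp [MGate.blocks], by simp [MGate.target]⟩
    · exact ⟨by simp [MGate.OK]; omega, by simp [MGate.blocks], by simp [MGate.target]⟩
  refine ((UsesOnly.chain (by decide) _ (by omega)).mono (by decide) (by decide)).append ?_
  refine ((UsesOnly.copyRange (by decide) 0 _ (by omega)).mono (by decide) (by decide)).append ?_
  refine ((h.usesOnly_evalSgn (a := .C) (by decide)).mono (by decide) (by decide)).append ?_
  refine (UsesOnly.copyBits (by decide) _ _ (fun o h' =>
    (h.sgn_wellFormed.2 o h').trans_le h.sgn_le) 0 ?_).mono (by decide) (by decide)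
  have := h.sgn_outputs
  omega

theorem ok_decideGates (h : I.Fits X) : ∀ g ∈ I.decideGates, g.OK X := by
  have hn := h.n_le
  intro g hg
  simp only [decideGates, List.mem_cons, List.not_mem_nil, or_false] at hg
  rcases hg with rfl | rfl | rfl <;> simp [MGate.OK] <;> omega

end Fits

end Input

end QMABalance

namespace QMABalance

open Function

/-! ### Evaluation of the tests on vertices -/

theorem getD_toBits (w k j : ℕ) : (toBits w k).getD j false = (decide (j < w) && k.testBit j) := by
  simp only [toBits, List.getD_eq_getElem?_getD, List.getElem?_ofFn]
  split_ifs with h <;> simp [h]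

theorem getD_toBits_of_lt {w k : ℕ} (hk : k < 2 ^ w) (j : ℕ) :
    (toBits w k).getD j false = k.testBit j := by
  rw [getD_toBits]
  by_cases h : j < w
  · simp [h]
  · have := Nat.testBit_eq_false_of_lt (hk.trans_le (Nat.pow_le_pow_right (by omega) (not_lt.1 h)))
    simp [this]

theorem testBit_ofBits (l : List Bool) (k : ℕ) : (ofBits l).testBit k = l.getD k false := by
  induction l generalizing k with
  | nil => simp [ofBits]
  | cons b l ih =>
    cases k with
    | zero => simp [ofBits, Nat.testBit_bit_zero]
    | succ k =>
      have : ofBits (b :: l) = Nat.bit b (ofBits l) := rfl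
      rw [this, Nat.testBit_bit_succ, ih]
      simp

theorem ofBits_lt (l : List Bool) : ofBits l < 2 ^ l.length := by
  refine Nat.lt_pow_two_of_testBit _ fun i hi => ?_
  rw [testBit_ofBits, List.getD_eq_default _ _ hi]

theorem eq_of_testBit_lt {n a b : ℕ} (ha : a < 2 ^ n) (hb : b < 2 ^ n)
    (h : ∀ k < n, a.testBit k = b.testBit k) : a = b := by
  refine Nat.eq_of_testBit_eq fun k => ?_
  by_cases hk : k < n
  · exact h k hk
  · have e := Nat.pow_le_pow_right (n := 2) (by omega) (not_lt.1 hk)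
    rw [Nat.testBit_eq_false_of_lt (ha.trans_le e), Nat.testBit_eq_false_of_lt (hb.trans_le e)]

/-- The input survives on the first wires. After an evaluation the name and the index can be read
again, and no copy has to be kept elsewhere. -/
theorem wireList_eq_append (gs : List BoolGate) (ws : List Bool) :
    ∃ vs : List Bool, vs.length = gs.length ∧ wireList gs ws = ws ++ vs := by
  induction gs generalizing ws with
  | nil => exact ⟨[], rfl, by simp [wireList]⟩
  | cons g gs ih =>
    obtain ⟨vs, h1, h2⟩ := ih (ws ++ [g.eval ws])
    refine ⟨g.eval ws :: vs, by simp [h1], ?_⟩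
    rw [wireList, List.foldl_cons]
    exact h2.trans (by simp)

/-- The memory in which only the first two blocks and the control bit are in use. -/
def memOf (f g : ℕ → Bool) (v : Bool) : Mem
  | .A => f
  | .B => g
  | .c => fun k => k == 0 && v
  | _ => fun _ => false

theorem update_memOf_A (f g f' : ℕ → Bool) (v : Bool) : update (memOf f g v) .A f' = memOf f' g v := by
  funext a
  cases a <;> simp [memOf]

theorem update_memOf_B (f g g' : ℕ → Bool) (v : Bool) : update (memOf f g v) .B g' = memOf f g' v := by
  funext a
  cases a <;> simp [memOf]

theorem memOf_set_c (f g : ℕ → Bool) (v v' : Bool) : (memOf f g v).set .c 0 v' = memOf f g v' := by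
  funext a k
  rw [Mem.set_apply]
  cases a <;> simp [memOf]
  by_cases h : k = 0
  · simp [h]
  · rw [show (k == 0) = false by simpa using h]
    simp [h]

namespace Input

variable (I : Input)

/-- The inputs of the circuits on a vertex and a position. -/
def inputBits (i l : ℕ) : List Bool := toBits I.n i ++ toBits I.idxBits l

/-- The wires of the first circuit. -/
def adjWires (i l : ℕ) : ℕ → Bool := fun j => (wireList I.adj.gates (I.inputBits i l)).getD j false

/-- The wires of the second circuit. -/
def sgnWires (i l : ℕ) : ℕ → Bool := fun j => (wireList I.sgn.gates (I.inputBits i l)).getD j false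

theorem length_inputBits (i l : ℕ) : (I.inputBits i l).length = I.n + I.idxBits := by
  simp [inputBits, toBits]

theorem getD_inputBits {i l : ℕ} (hi : i < 2 ^ I.n) (hl : l < 2 ^ I.idxBits) (j : ℕ) :
    (I.inputBits i l).getD j false = xor (i.testBit j) (decide (I.n ≤ j) && l.testBit (j - I.n)) := by
  have hlen : (toBits I.n i).length = I.n := by simp [toBits]
  by_cases h : j < I.n
  · rw [inputBits, List.getD_append _ _ _ _ (by omega), getD_toBits_of_lt hi]
    have : ¬ I.n ≤ j := by omega
    simp [this]
  · rw [inputBits, List.getD_append_right _ _ _ _ (by omega), hlen, getD_toBits_of_lt hl,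
      Nat.testBit_eq_false_of_lt (hi.trans_le (Nat.pow_le_pow_right (by omega) (not_lt.1 h)))]
    simp [not_lt.1 h]

variable {I} {X : ℕ}

theorem adjWires_of_lt {i l j : ℕ} (hj : j < I.n + I.idxBits) :
    I.adjWires i l j = (I.inputBits i l).getD j false := by
  obtain ⟨vs, _, h⟩ := wireList_eq_append I.adj.gates (I.inputBits i l)
  rw [adjWires, h, List.getD_append _ _ _ _ (by rwa [length_inputBits])]

theorem adjWires_name {i l j : ℕ} (hi : i < 2 ^ I.n) (hj : j < I.n) :
    I.adjWires i l j = i.testBit j := by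
  rw [adjWires_of_lt (by omega), inputBits, List.getD_append _ _ _ _ (by simpa [toBits] using hj),
    getD_toBits_of_lt hi]

theorem adjValue_lt (h : I.Fits X) (i l : ℕ) : I.adjValue i l < 2 ^ I.n := by
  have := ofBits_lt (I.adj.eval (toBits I.n i ++ toBits I.idxBits l))
  have e : (I.adj.eval (toBits I.n i ++ toBits I.idxBits l)).length = I.n := by
    simp [BoolCircuit.eval, h.adj_outputs]
  rwa [e] at this

theorem adjWires_output (h : I.Fits X) {i l k : ℕ} (hk : k < I.n) :
    I.adjWires i l (I.adj.outputs.getD k 0) = (I.adjValue i l).testBit k := by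
  rw [adjValue, testBit_ofBits]
  have hk' : k < I.adj.outputs.length := by rw [h.adj_outputs]; exact hk
  rw [BoolCircuit.eval, List.getD_eq_getElem _ _ hk', List.getD_eq_getElem _ _ (by simpa using hk'),
    List.getElem_map]
  rfl

/-- The controlled exchange moves only positions below X. It exchanges entire wire functions because
these vanish from X on. -/
theorem adjWires_of_ge (h : I.Fits X) {i l j : ℕ} (hj : X ≤ j) : I.adjWires i l j = false := by
  obtain ⟨vs, h1, h2⟩ := wireList_eq_append I.adj.gates (I.inputBits i l)
  rw [adjWires, h2, List.getD_eq_default]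
  have := h.adj_le
  rw [List.length_append, length_inputBits, h1, ← h.adj_inputs]
  omega

theorem exec_evalAdj (h : I.Fits X) {a : Blk} (ha : a ≠ .t) (F : Mem) (ht : F .t 0 = false)
    {i l : ℕ} (hF : F a = fun j => (I.inputBits i l).getD j false) :
    exec (evalGates a I.adj.numInputs 0 I.adj.gates) F = update F a (I.adjWires i l) :=
  exec_evalGates ha _ _ 0 (I.inputBits i l) F (by rw [length_inputBits, h.adj_inputs]; rfl) ht hF
    fun i hi => by simpa using h.adj_wellFormed.1 i hi

theorem exec_evalSgn (h : I.Fits X) {a : Blk} (ha : a ≠ .t) (F : Mem) (ht : F .t 0 = false)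
    {i l : ℕ} (hF : F a = fun j => (I.inputBits i l).getD j false) :
    exec (evalGates a I.sgn.numInputs 0 I.sgn.gates) F = update F a (I.sgnWires i l) :=
  exec_evalGates ha _ _ 0 (I.inputBits i l) F (by rw [length_inputBits, h.sgn_inputs]; rfl) ht hF
    fun i hi => by simpa using h.sgn_wellFormed.1 i hi

/-- Block `A` is evaluated at the given name, the neighbour found is copied to `B` and evaluated
there, and the blocks are exchanged if the control bit is on. In either case `A` ends up with the
beginning of the edge at position l and `B` with its end at position m. The two ends of an edge, one
with control off and the other with control on, thus lead to memories that differ in the control bit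
only. -/
theorem exec_edgeGates (h : I.Fits X) {i l m : ℕ} (hi : i < 2 ^ I.n) (hl : l < I.S) (hm : m < I.S)
    (v : Bool) : exec (I.edgeGates X l m) (memOf i.testBit (fun _ => false) v) =
      if v then memOf (I.adjWires (I.adjValue i m) l) (I.adjWires i m) true
      else memOf (I.adjWires i l) (I.adjWires (I.adjValue i l) m) false := by
  have hl' := I.lt_two_pow_idxBits hl
  have hm' := I.lt_two_pow_idxBits hm
  -- Position p is queried at the given name and position q at the neighbour found; the control bit
  -- decides which of l and m is which.
  obtain ⟨p, hp⟩ : ∃ p, p = if v then m else l := ⟨_, rfl⟩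
  obtain ⟨q, hq⟩ : ∃ q, q = if v then l else m := ⟨_, rfl⟩
  have hp' : p < 2 ^ I.idxBits := by rw [hp]; split_ifs <;> assumption
  have hq' : q < 2 ^ I.idxBits := by rw [hq]; split_ifs <;> assumption
  have e1 : exec (loadIndex .B .A I.n m) (exec (loadIndex .A .B I.n l)
      (memOf i.testBit (fun _ => false) v)) =
      memOf (fun j => (I.inputBits i p).getD j false)
        (fun j => decide (I.n ≤ j) && q.testBit (j - I.n)) v := by
    have inner := exec_loadIndex (a := .A) (b := .B) (by decide) (by decide) (by decide) I.n l
      (memOf i.testBit (fun _ => false) v)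
    rw [update_memOf_A, update_memOf_B] at inner
    rw [inner, exec_loadIndex (by decide) (by decide) (by decide), update_memOf_B, update_memOf_A]
    simp only [getD_inputBits I hi hp']
    cases v <;> simp [memOf, hp, hq]
  rw [edgeGates, exec_append, exec_append, e1, exec_append,
    exec_evalAdj h (by decide) _ rfl (i := i) (l := p) rfl, update_memOf_A, exec_append,
    exec_copyBits (by decide), update_memOf_B]
  have e2 : (fun j => xor (memOf (I.adjWires i p) (fun j => decide (I.n ≤ j) && q.testBit (j - I.n)) v
      .B j) (decide (0 + 0 ≤ j ∧ j < 0 + 0 + I.adj.outputs.length) && memOf (I.adjWires i p)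
        (fun j => decide (I.n ≤ j) && q.testBit (j - I.n)) v .A
        (I.adj.outputs.getD (j - (0 + 0)) 0))) =
      fun j => (I.inputBits (I.adjValue i p) q).getD j false := by
    funext j
    rw [getD_inputBits I (adjValue_lt h i p) hq', h.adj_outputs, Bool.xor_comm]
    congr 1
    simp only [Nat.add_zero, Nat.zero_le, true_and, Nat.zero_add, Nat.sub_zero, memOf]
    by_cases hj : j < I.n
    · simp only [hj, decide_true, Bool.true_and]
      exact adjWires_output h hj
    · rw [Nat.testBit_eq_false_of_lt ((adjValue_lt h i p).trans_le
        (Nat.pow_le_pow_right (by omega) (not_lt.1 hj)))]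
      simp [hj]
  rw [e2, exec_append, exec_evalAdj h (by decide) _ rfl (i := I.adjValue i p) (l := q) rfl,
    update_memOf_B, exec_swapBits (by decide) (by decide) (by decide), update_memOf_A,
    update_memOf_B]
  cases v
  · simp [memOf, hp, hq]
  -- Beyond X both wire functions vanish, so the exchange of the first X bits is an exchange of the
  -- functions.
  · have sw : ∀ f g : ℕ → Bool, (∀ j, X ≤ j → f j = false) → (∀ j, X ≤ j → g j = false) →
        (fun j => if j < X then f j else g j) = f := by
      intro f g hf hg
      funext j
      split_ifs with hj
      · rfl
      · rw [hf j (not_lt.1 hj), hg j (not_lt.1 hj)]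
    have z1 : ∀ j, X ≤ j → I.adjWires i p j = false := fun j hj => adjWires_of_ge h hj
    have z2 : ∀ j, X ≤ j → I.adjWires (I.adjValue i p) q j = false := fun j hj => adjWires_of_ge h hj
    simp only [memOf, beq_self_eq_true, Bool.and_self, and_true, if_true] at hp hq ⊢
    rw [sw _ _ z2 z1, sw _ _ z1 z2, hp, hq]

/-- Block `D` collects the bitwise differences of adj(a, l) and b and of adj(b, m) and a, and two
more bits saying whether a or b is zero; the chain in `Z` tests whether all of them vanish. Zero
must be excluded explicitly: it is the placeholder in the lists of vertices, while its own marked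
list 0, 1, 2, … may contain the name of a vertex. The sign circuit runs in `C` on a copy of the
input found in `A`. -/
theorem exec_compareGates (h : I.Fits X) {a b l m : ℕ} (ha : a < 2 ^ I.n) (hb : b < 2 ^ I.n)
    (hl : l < I.S) (hm : m < I.S) (v : Bool) :
    (exec I.compareGates (memOf (I.adjWires a l) (I.adjWires b m) v) .Z (2 * I.n + 2) = true ↔
      I.adjValue a l = b ∧ I.adjValue b m = a ∧ a ≠ 0 ∧ b ≠ 0) ∧
    exec I.compareGates (memOf (I.adjWires a l) (I.adjWires b m) v) .s 0 =
      (I.sgnValue a l).getD 0 false ∧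
    exec I.compareGates (memOf (I.adjWires a l) (I.adjWires b m) v) .A = I.adjWires a l := by
  have hl' := I.lt_two_pow_idxBits hl
  have hm' := I.lt_two_pow_idxBits hm
  set F0 := memOf (I.adjWires a l) (I.adjWires b m) v with hF0
  have hA : F0 .A = I.adjWires a l := rfl
  have hB : F0 .B = I.adjWires b m := rfl
  rw [compareGates, exec_append, exec_copyBits (by decide)]
  set F1 := update F0 .D _ with hF1
  rw [exec_append, exec_copyRange (by decide)]
  set F2 := update F1 .D _ with hF2
  rw [exec_append, exec_copyBits (by decide)]
  set F3 := update F2 .D _ with hF3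
  rw [exec_append, exec_copyRange (by decide)]
  set F4 := update F3 .D _ with hF4
  rw [exec_append, exec_chain (by decide) _ _ (by simp [hF4, hF3, hF2, hF1, hF0, memOf])]
  set F5 := update F4 .Y _ with hF5
  rw [exec_append, exec_chain (by decide) _ _ (by simp [hF5, hF4, hF3, hF2, hF1, hF0, memOf])]
  set F6 := update F5 .Y' _ with hF6
  rw [exec_append]
  set F7 := exec [MGate.cnot .Y I.n .D (2 * I.n), .cnot .Y' I.n .D (2 * I.n + 1)] F6 with hF7
  have ne : ∀ d : Blk, d ≠ .D → F7 d = F6 d := by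
    intro d hd
    funext j
    simp [hF7, exec, MGate.step, Mem.set_apply, hd]
  rw [exec_append, exec_chain (by decide) _ _ (by
    rw [ne _ (by decide)]; simp [hF6, hF5, hF4, hF3, hF2, hF1, hF0, memOf])]
  set F8 := update F7 .Z _ with hF8
  rw [exec_append, exec_copyRange (by decide)]
  set F9 := update F8 .C _ with hF9
  -- The first wires of `A` still carry the name a and the index l, so copying them prepares the
  -- input of the sign circuit.
  have hC : F9 .C = fun j => (I.inputBits a l).getD j false := by
    rw [hF9, update_self]
    funext j
    have e1 : F8 .C j = false := by
      rw [hF8, update_of_ne (by decide), ne _ (by decide)]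
      simp [hF6, hF5, hF4, hF3, hF2, hF1, hF0, memOf]
    have e2 : F8 .A = I.adjWires a l := by
      rw [hF8, update_of_ne (by decide), ne _ (by decide)]
      simp [hF6, hF5, hF4, hF3, hF2, hF1, hF0, memOf]
    rw [e1, e2, h.adj_inputs]
    by_cases hj : j < I.n + I.idxBits
    · rw [Nat.sub_zero, adjWires_of_lt hj]; simp [hj]
    · rw [List.getD_eq_default _ _ (by rw [length_inputBits]; omega)]; simp [hj]
  rw [exec_append, exec_evalSgn h (by decide) F9 (by
    rw [hF9, update_of_ne (by decide), hF8, update_of_ne (by decide), ne _ (by decide)]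
    simp [hF6, hF5, hF4, hF3, hF2, hF1, hF0, memOf]) hC]
  rw [exec_copyBits (by decide)]
  refine ⟨?_, ?_, ?_⟩
  · rw [update_of_ne (by decide), update_of_ne (by decide), hF9, update_of_ne (by decide), hF8,
      update_self]
    have hY : F6 .Y I.n = decide (a = 0) := by
      simp only [hF6, hF5, ne_eq, reduceCtorEq, not_false_eq_true, update_of_ne, update_self,
        le_refl, true_and, decide_eq_decide]
      have : F4 .A = I.adjWires a l := by simp [hF4, hF3, hF2, hF1, hA]
      rw [this]
      constructor
      · intro hz
        refine eq_of_testBit_lt ha (by positivity) fun k hk => ?_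
        rw [Nat.zero_testBit, ← hz k hk, adjWires_name ha hk]
      · rintro rfl k hk
        rw [adjWires_name ha hk, Nat.zero_testBit]
    have hY' : F6 .Y' I.n = decide (b = 0) := by
      simp only [hF6, hF5, ne_eq, reduceCtorEq, not_false_eq_true, update_of_ne, update_self,
        le_refl, true_and, decide_eq_decide]
      have : F4 .B = I.adjWires b m := by simp [hF4, hF3, hF2, hF1, hB]
      rw [this]
      constructor
      · intro hz
        refine eq_of_testBit_lt hb (by positivity) fun k hk => ?_
        rw [Nat.zero_testBit, ← hz k hk, adjWires_name hb hk]
      · rintro rfl k hk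
        rw [adjWires_name hb hk, Nat.zero_testBit]
    -- The first n bits compare adj(a, l) with b, the next n bits compare adj(b, m) with a.
    have hD4 : ∀ j, F4 .D j = xor
        (decide (j < I.n) && xor (I.adjWires a l (I.adj.outputs.getD j 0)) (I.adjWires b m j))
        (decide (I.n ≤ j ∧ j < 2 * I.n) && xor (I.adjWires b m (I.adj.outputs.getD (j - I.n) 0))
          (I.adjWires a l (j - I.n))) := by
      intro j
      simp only [hF4, hF3, hF2, hF1, update_self, ne_eq, reduceCtorEq, not_false_eq_true,
        update_of_ne, hA, hB, h.adj_outputs, Nat.add_zero, Nat.zero_le, true_and, Nat.zero_add,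
        Nat.sub_zero]
      have : F0 .D j = false := rfl
      rw [this]
      have e : (I.n ≤ j ∧ j < I.n + I.n) ↔ (I.n ≤ j ∧ j < 2 * I.n) := by omega
      rw [decide_eq_decide.2 e]
      cases decide (j < I.n) <;> cases decide (I.n ≤ j ∧ j < 2 * I.n) <;> simp
    have hD7 : ∀ j, F7 .D j = xor (F4 .D j) (xor (decide (j = 2 * I.n) && decide (a = 0))
        (decide (j = 2 * I.n + 1) && decide (b = 0))) := by
      intro j
      have e : F6 .D = F4 .D := by simp [hF6, hF5]
      simp only [hF7, exec, List.foldl_cons, List.foldl_nil, MGate.step, Mem.set_apply, reduceCtorEq,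
        false_and, if_false, hY, hY', e, true_and]
      by_cases h1 : j = 2 * I.n + 1
      · subst h1; simp
      · by_cases h2 : j = 2 * I.n
        · subst h2; simp
        · simp [h1, h2]
    rw [decide_eq_true_iff]
    constructor
    · rintro ⟨-, hz⟩
      have z : ∀ j < 2 * I.n + 2, F7 .D j = false := hz
      refine ⟨?_, ?_, ?_, ?_⟩
      · refine eq_of_testBit_lt (adjValue_lt h a l) hb fun k hk => ?_
        have := z k (by omega)
        rw [hD7, hD4, adjWires_output h hk, adjWires_name hb hk] at this
        have h1 : ¬(I.n ≤ k ∧ k < 2 * I.n) := by omega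
        have h2 : k ≠ 2 * I.n := by omega
        have h3 : k ≠ 2 * I.n + 1 := by omega
        simpa [hk, h1, h2, h3, not_le.2 hk] using this
      · refine eq_of_testBit_lt (adjValue_lt h b m) ha fun k hk => ?_
        have := z (I.n + k) (by omega)
        rw [hD7, hD4, show I.n + k - I.n = k by omega, adjWires_output h hk,
          adjWires_name ha hk] at this
        have h1 : I.n ≤ I.n + k ∧ I.n + k < 2 * I.n := by omega
        have h2 : I.n + k ≠ 2 * I.n := by omega
        have h3 : I.n + k ≠ 2 * I.n + 1 := by omega
        have h4 : ¬ I.n + k < I.n := by omega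
        simpa [h1.2, h2, h3, h4] using this
      · have := z (2 * I.n) (by omega)
        rw [hD7, hD4] at this
        have h1 : ¬ 2 * I.n < I.n := by omega
        simpa [h1] using this
      · have := z (2 * I.n + 1) (by omega)
        rw [hD7, hD4] at this
        have h1 : ¬ 2 * I.n + 1 < I.n := by omega
        simpa [h1] using this
    · rintro ⟨e1, e2, e3, e4⟩
      refine ⟨le_rfl, fun j hj => ?_⟩
      rw [hD7, hD4]
      simp only [e3, e4, decide_false, Bool.and_false, Bool.xor_false]
      by_cases h1 : j < I.n
      · have h2 : ¬(I.n ≤ j ∧ j < 2 * I.n) := by omega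
        rw [adjWires_output h h1, e1, adjWires_name hb h1, decide_eq_false h2]
        simp
      · by_cases h2 : I.n ≤ j ∧ j < 2 * I.n
        · rw [decide_eq_false h1, adjWires_output (i := b) (l := m) h (show j - I.n < I.n by omega),
            e2, adjWires_name (i := a) ha (show j - I.n < I.n by omega)]
          simp
        · rw [decide_eq_false h1, decide_eq_false h2]
          simp
  · have e1 : (update F9 .C (I.sgnWires a l)) .s 0 = false := by
      rw [update_of_ne (by decide), hF9, update_of_ne (by decide), hF8, update_of_ne (by decide),
        ne _ (by decide)]
      simp [hF6, hF5, hF4, hF3, hF2, hF1, hF0, memOf]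
    rw [update_self, e1, update_self, h.sgn_outputs]
    obtain ⟨o, ho⟩ := List.length_eq_one_iff.1 h.sgn_outputs
    rw [sgnValue, BoolCircuit.eval, ho]
    simp [sgnWires, wireList, inputBits]
  · rw [update_of_ne (by decide), update_of_ne (by decide), hF9, update_of_ne (by decide), hF8,
      update_of_ne (by decide), ne _ (by decide)]
    simp [hF6, hF5, hF4, hF3, hF2, hF1, hA]

/-- The vertex test recognizes the marked lists. -/
theorem exec_vertexGates (h : I.Fits X) {i : ℕ} (hi : i < 2 ^ I.n) (hn : 0 < I.n) :
    exec I.vertexGates (memOf i.testBit (fun _ => false) false) .Z (2 * I.n) = true ↔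
      ¬(I.adjValue i 0 = 0 ∧ I.adjValue i 1 = 1) := by
  have h0 : 0 < 2 ^ I.idxBits := by positivity
  have h1 : 1 < 2 ^ I.idxBits := Nat.one_lt_two_pow h.idxBits_pos.ne'
  have one : ∀ k, (1 : ℕ).testBit k = decide (k = 0) := fun k => by
    rw [show (1 : ℕ) = 2 ^ 0 from rfl, Nat.testBit_two_pow]
    simp [eq_comm]
  have i0 : (fun j => i.testBit j) = fun j => (I.inputBits i 0).getD j false := by
    funext j
    rw [getD_inputBits I hi h0]
    simp
  rw [vertexGates, exec_append, exec_evalAdj h (by decide) _ rfl (i := i) (l := 0) i0,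
    update_memOf_A, exec_append, exec_copyRange (by decide), update_memOf_B, exec_append]
  -- Bit n is the lowest index bit. With the index zero so far, flipping this bit asks for position
  -- 1.
  have e1 : exec [.x .B I.n] (memOf (I.adjWires i 0) (fun j => xor (memOf (I.adjWires i 0)
      (fun _ => false) false .B j) (decide (0 ≤ j ∧ j < 0 + I.n) &&
        memOf (I.adjWires i 0) (fun _ => false) false .A (j - 0))) false) =
      memOf (I.adjWires i 0) (fun j => (I.inputBits i 1).getD j false) false := by
    rw [← update_memOf_B (I.adjWires i 0) (fun j => xor (memOf (I.adjWires i 0)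
      (fun _ => false) false .B j) (decide (0 ≤ j ∧ j < 0 + I.n) &&
        memOf (I.adjWires i 0) (fun _ => false) false .A (j - 0)))
        (fun j => (I.inputBits i 1).getD j false)]
    simp only [exec, List.foldl_cons, List.foldl_nil, MGate.step, Mem.set]
    congr 1
    funext j
    rw [getD_inputBits I hi h1, one]
    by_cases hj : j = I.n
    · subst hj
      rw [Nat.testBit_eq_false_of_lt hi]
      simp [memOf]
    · rw [update_of_ne hj]
      by_cases hj' : j < I.n
      · have : ¬ I.n ≤ j := by omega
        simp [memOf, hj', adjWires_name hi hj', this]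
      · rw [Nat.testBit_eq_false_of_lt (hi.trans_le (Nat.pow_le_pow_right (by omega)
          (not_lt.1 hj')))]
        have : j - I.n ≠ 0 := by omega
        simp [memOf, hj', this]
  rw [e1, exec_append, exec_evalAdj h (by decide) _ rfl (i := i) (l := 1) rfl, update_memOf_B]
  set F0 := memOf (I.adjWires i 0) (I.adjWires i 1) false with hF0
  have hA : F0 .A = I.adjWires i 0 := rfl
  have hB : F0 .B = I.adjWires i 1 := rfl
  rw [exec_append, exec_copyBits (by decide)]
  set F1 := update F0 .D _ with hF1
  rw [exec_append, exec_copyBits (by decide)]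
  set F2 := update F1 .D _ with hF2
  rw [exec_append]
  -- Bit n of `D` is the lowest bit of adj(i, 1). Flipping it compares that number with 1, while the
  -- first half compares adj(i, 0) with 0.
  set F3 := exec [MGate.x .D I.n] F2 with hF3
  have ne : ∀ d : Blk, d ≠ .D → F3 d = F2 d := by
    intro d hd
    funext j
    simp [hF3, exec, MGate.step, Mem.set_apply, hd]
  rw [exec_append, exec_chain (by decide) _ _ (by
    rw [ne _ (by decide)]; simp [hF2, hF1, hF0, memOf])]
  have hD2 : ∀ j, F2 .D j = xor (decide (j < I.n) && I.adjWires i 0 (I.adj.outputs.getD j 0))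
      (decide (I.n ≤ j ∧ j < 2 * I.n) && I.adjWires i 1 (I.adj.outputs.getD (j - I.n) 0)) := by
    intro j
    simp only [hF2, hF1, update_self, ne_eq, reduceCtorEq, not_false_eq_true,
      update_of_ne, hA, hB, h.adj_outputs, Nat.add_zero, Nat.zero_le, true_and, Nat.zero_add,
      Nat.sub_zero]
    have : F0 .D j = false := rfl
    rw [this, ← two_mul, Bool.false_xor]
  have hD3 : ∀ j, F3 .D j = xor (F2 .D j) (decide (j = I.n)) := by
    intro j
    simp only [hF3, exec, List.foldl_cons, List.foldl_nil, MGate.step, Mem.set_apply, true_and]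
    by_cases hj : j = I.n
    · subst hj; simp
    · simp [hj]
  simp only [exec, List.foldl_cons, List.foldl_nil, MGate.step, Mem.set_apply, and_self, if_true,
    update_self, Bool.not_eq_true', decide_eq_false_iff_not, le_refl, true_and]
  refine not_congr ⟨fun hz => ⟨?_, ?_⟩, ?_⟩
  · refine eq_of_testBit_lt (adjValue_lt h i 0) (by positivity) fun k hk => ?_
    have := hz k (by omega)
    rw [hD3, hD2, adjWires_output h hk] at this
    have h2 : ¬ k = I.n := by omega
    simpa [hk, h2, not_le.2 hk] using this
  · refine eq_of_testBit_lt (adjValue_lt h i 1) (Nat.one_lt_two_pow hn.ne') fun k hk => ?_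
    have := hz (I.n + k) (by omega)
    rw [hD3, hD2, show I.n + k - I.n = k by omega, adjWires_output h hk] at this
    have h1 : I.n + k < 2 * I.n := by omega
    have h4 : ¬ I.n + k < I.n := by omega
    rw [one]
    simpa [h1, h4] using this
  · rintro ⟨z0, z1⟩ j hj
    rw [hD3, hD2]
    by_cases h1 : j < I.n
    · rw [adjWires_output h h1, z0]
      have h2 : ¬ j = I.n := by omega
      simp [h2, not_le.2 h1]
    · rw [adjWires_output h (show j - I.n < I.n by omega), z1, one]
      have h2 : I.n ≤ j ∧ j < 2 * I.n := by omega
      have h3 : j - I.n = 0 ↔ j = I.n := by omega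
      simp [h1, h2.1, h2.2, h3]

end Input

end QMABalance

namespace QMABalance

open Function

/-! ### The pair tests -/

/-- The basis vector of a vertex. -/
def vert (X i : ℕ) : Fin (11 * X) → Bool := pack X (memOf i.testBit (fun _ => false) false)

/-- The state is supported on vertices in `V`. -/
def SupportedOn {X : ℕ} (V : Finset ℕ) (ψ : QState (11 * X)) : Prop :=
  ∀ b, ψ b ≠ 0 → ∃ i ∈ V, b = vert X i

theorem vert_inj {X n i j : ℕ} (hn : n ≤ X) (hi : i < 2 ^ n) (hj : j < 2 ^ n)
    (h : vert X i = vert X j) : i = j :=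
  eq_of_testBit_lt hi hj fun k hk => pack_eq_iff.1 h .A k (hk.trans_le hn)

namespace Input

variable {I : Input} {X : ℕ}

/-- The sign of an edge, as a complex number. -/
def sg (I : Input) (i l : ℕ) : ℂ := if (I.sgnValue i l).getD 0 false then -1 else 1

/-- Positions `l` and `m` refer to the two directions of an edge at `i`. -/
def Flagged (I : Input) (l m i : ℕ) : Prop :=
  i ≠ 0 ∧ I.adjValue i l ≠ 0 ∧ I.adjValue (I.adjValue i l) m = i

/-- The memory after the comparison. -/
def edgeMem (I : Input) (l m i j : ℕ) (v : Bool) : Mem :=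
  exec I.compareGates (memOf (I.adjWires i l) (I.adjWires j m) v)

/-- The comparison does not involve the control block and hence commutes with setting the control
bit. -/
theorem edgeMem_set (h : I.Fits X) (l m i j : ℕ) (v v' : Bool) :
    (I.edgeMem l m i j v).set .c 0 v' = I.edgeMem l m i j v' := by
  rw [edgeMem, ← exec_set fun g hg hc => ?_, memOf_set_c, edgeMem]
  have := (h.usesOnly_compareGates g hg).2.1 hc
  revert this
  decide

theorem edgeMem_r (h : I.Fits X) (l m i j : ℕ) (v : Bool) : I.edgeMem l m i j v .r 0 = false := by
  rw [edgeMem, exec_of_target_ne fun g hg hr => ?_]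
  · rfl
  · have := (h.usesOnly_compareGates g hg).2.2
    rw [hr] at this
    revert this
    decide

theorem ok_edgeCompare (h : I.Fits X) {l m : ℕ} (hl : l < I.S) (hm : m < I.S) :
    ∀ g ∈ I.edgeGates X l m ++ I.compareGates, g.OK X := by
  intro g hg
  rcases List.mem_append.1 hg with hg | hg
  · exact (h.usesOnly_edgeGates hl hm g hg).1
  · exact (h.usesOnly_compareGates g hg).1

theorem exec_edgeCompare_false (h : I.Fits X) {l m i : ℕ} (hi : i < 2 ^ I.n) (hl : l < I.S)
    (hm : m < I.S) : exec (I.edgeGates X l m ++ I.compareGates) (memOf i.testBit (fun _ => false) false) =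
      I.edgeMem l m i (I.adjValue i l) false := by
  rw [exec_append, exec_edgeGates h hi hl hm]
  rfl

/-- With the control on, the given name is the end of the edge and its m-th neighbour the beginning.
-/
theorem exec_edgeCompare_true (h : I.Fits X) {l m i : ℕ} (hi : i < 2 ^ I.n) (hl : l < I.S)
    (hm : m < I.S) : exec (I.edgeGates X l m ++ I.compareGates) (memOf i.testBit (fun _ => false) true) =
      I.edgeMem l m (I.adjValue i m) i true := by
  rw [exec_append, exec_edgeGates h hi hl hm]
  rfl

theorem exec_edgeCompare_reverse_c (h : I.Fits X) {l m : ℕ} (hl : l < I.S) (hm : m < I.S) (F : Mem) :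
    exec (I.edgeGates X l m ++ I.compareGates).reverse F .c = F .c := by
  refine exec_of_target_ne (fun g hg hc => ?_) F
  rw [List.mem_reverse, List.mem_append] at hg
  rcases hg with hg | hg
  · have := (h.usesOnly_edgeGates hl hm g hg).2.2
    rw [hc] at this
    revert this
    decide
  · have := (h.usesOnly_compareGates g hg).2.2
    rw [hc] at this
    revert this
    decide

theorem on_pairTest (h : I.Fits X) {l m : ℕ} (hl : l < I.S) (hm : m < I.S) :
    (∀ g ∈ (I.pairTest X l m).1, g.On (11 * X)) ∧ (I.pairTest X l m).2 < 11 * X := by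
  have hX : 0 < X := by have := h.n_le; omega
  refine ⟨fun g hg => ?_, loc_lt.2 hX⟩
  simp only [pairTest, List.mem_cons, List.mem_append, List.mem_map] at hg
  rcases hg with rfl | ⟨g, hg, rfl⟩ | rfl | ⟨g, hg, rfl⟩
  · exact loc_lt.2 hX
  · exact (ok_edgeCompare h hl hm g (List.mem_append.2 hg)).on
  · exact loc_lt.2 hX
  · exact (h.ok_decideGates g hg).on

theorem vert_c {i : ℕ} (hX : 0 < X) : vert X i ⟨loc .c 0, loc_lt.2 hX⟩ = false := by
  rw [vert, pack_loc]
  rfl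

/-- The amplitudes before the measurement. -/
theorem runGates_pairTest (h : I.Fits X) {l m : ℕ} (hl : l < I.S) (hm : m < I.S) {V : Finset ℕ}
    {ψ : QState (11 * X)} (hψ : SupportedOn V ψ) (G : Mem) :
    runGates (11 * X) (I.pairTest X l m).1 ψ (pack X (exec I.decideGates G)) =
      1 / 2 * (ψ (pack X (exec (I.edgeGates X l m ++ I.compareGates).reverse (G.set .c 0 false) |>.set
          .c 0 false)) + (if G .c 0 then -1 else 1) *
        ψ (pack X (exec (I.edgeGates X l m ++ I.compareGates).reverse (G.set .c 0 true) |>.set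
          .c 0 false))) := by
  have hX : 0 < X := by have := h.n_le; omega
  -- On the support of ψ the control bit is zero. The first Hadamard gate thus distributes each
  -- amplitude evenly over both values of that bit.
  have h0 : ∀ F : Mem, (QGate.h (loc .c 0)).apply (11 * X) ψ (pack X F) =
      ((Real.sqrt 2 : ℝ) : ℂ)⁻¹ * ψ (pack X (F.set .c 0 false)) := by
    intro F
    rw [apply_h_pack _ _ hX]
    have : ψ (pack X (F.set .c 0 true)) = 0 := by
      by_contra hne
      obtain ⟨i, _, hi⟩ := hψ _ hne
      have := congrFun hi ⟨loc .c 0, loc_lt.2 hX⟩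
      rw [vert_c hX, pack_loc, Mem.set_apply] at this
      simp at this
    rw [this, mul_zero, add_zero]
  rw [pairTest, runGates_cons, runGates_append, runGates_cons, runGates_exec h.ok_decideGates,
    apply_h_pack _ _ hX, runGates_pack (ok_edgeCompare h hl hm), runGates_pack (ok_edgeCompare h hl hm),
    h0, h0, ← QGate.sqrt_two_inv_mul_self]
  ring

/-- The memory `G` is that of the edge, with the control bit opposite to the sign bit. Its two
preimages under the reversible computation, for control off and on, are the vertices i and j. The
Hadamard gate combines their amplitudes with the sign given by `G .c 0`, which is minus for a
positive edge and plus for a negative one. The two factors 1/√2 make up the 1/2. -/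
theorem runGates_pairTest_edge (h : I.Fits X) {l m : ℕ} (hl : l < I.S) (hm : m < I.S) {V : Finset ℕ}
    {ψ : QState (11 * X)} (hψ : SupportedOn V ψ) {i j : ℕ} (hi : i < 2 ^ I.n) (hj : j < 2 ^ I.n)
    (hij : I.adjValue i l = j) (hji : I.adjValue j m = i) {G : Mem}
    (hG : pack X (G.set .c 0 false) = pack X (I.edgeMem l m i j false))
    (hc : G .c 0 = !(I.sgnValue i l).getD 0 false) :
    runGates (11 * X) (I.pairTest X l m).1 ψ (pack X (exec I.decideGates G)) =
      1 / 2 * (ψ (vert X i) - I.sg i l * ψ (vert X j)) := by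
  have ok := ok_edgeCompare h hl hm
  have okr : ∀ g ∈ (I.edgeGates X l m ++ I.compareGates).reverse, g.OK X :=
    fun g hg => ok g (List.mem_reverse.1 hg)
  have hX : 0 < X := by have := h.n_le; omega
  have hG' : pack X (G.set .c 0 true) = pack X (I.edgeMem l m i j true) := by
    rw [← edgeMem_set h l m i j false true]
    rw [pack_eq_iff] at hG ⊢
    intro a k hk
    have := hG a k hk
    simp only [Mem.set_apply] at this ⊢
    split_ifs with e
    · rfl
    · rwa [if_neg e] at this
  have setc : ∀ F F' : Mem, pack X F = pack X F' →
      pack X (F.set .c 0 false) = pack X (F'.set .c 0 false) := by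
    intro F F' e
    rw [← update_pack _ _ _ (loc_lt.2 hX), e, update_pack]
  have e1 : pack X ((exec (I.edgeGates X l m ++ I.compareGates).reverse (G.set .c 0 false)).set
      .c 0 false) = vert X i := by
    rw [setc _ _ (pack_exec okr hG), ← hij, ← exec_edgeCompare_false h hi hl hm, exec_reverse ok,
      memOf_set_c]
    rfl
  have e2 : pack X ((exec (I.edgeGates X l m ++ I.compareGates).reverse (G.set .c 0 true)).set
      .c 0 false) = vert X j := by
    rw [setc _ _ (pack_exec okr hG'), ← hji, ← exec_edgeCompare_true h hj hl hm, exec_reverse ok,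
      memOf_set_c]
    rfl
  rw [runGates_pairTest h hl hm hψ, e1, e2, hc, sg]
  cases (I.sgnValue i l).getD 0 false <;> simp <;> ring

theorem exec_decideGates_r (F : Mem) :
    exec I.decideGates F .r 0 = !(xor (F .r 0) (F .Z (2 * I.n + 2) && xor (F .c 0) (F .s 0))) := by
  simp [decideGates, exec, MGate.step, Mem.set_apply]

theorem exec_decideGates_A (F : Mem) : exec I.decideGates F .A = F .A := by
  refine exec_of_target_ne (fun g hg => ?_) F
  simp only [decideGates, List.mem_cons, List.not_mem_nil, or_false] at hg
  rcases hg with rfl | rfl | rfl <;> simp [MGate.target]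

/-- A pair test passes all amplitudes that agree across the edges. -/
theorem testProj_pairTest_eq (h : I.Fits X) {l m : ℕ} (hl : l < I.S) (hm : m < I.S) {V : Finset ℕ}
    (hV : ∀ i ∈ V, i < 2 ^ I.n) {ψ : QState (11 * X)} (hψ : SupportedOn V ψ)
    (hb : ∀ i j, i < 2 ^ I.n → j < 2 ^ I.n → i ≠ 0 → j ≠ 0 → I.adjValue i l = j → I.adjValue j m = i →
      ψ (vert X i) = I.sg i l * ψ (vert X j)) :
    testProj (11 * X) (I.pairTest X l m) ψ = ψ := by
  have hn := h.n_le
  have hX : 0 < X := by omega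
  have ok := ok_edgeCompare h hl hm
  have hon := on_pairTest h hl hm
  refine testProj_eq_self (fun g hg => (hon.1 g hg).selfInverse) ψ fun b hbr => ?_
  set H : Mem := unpack b with hH
  -- The string is parametrized by the memory before the decision gates, because the amplitudes are
  -- known in these terms.
  set G : Mem := exec I.decideGates.reverse H with hG
  have ebG : b = pack X (exec I.decideGates G) := by
    rw [hG, exec_reverse' h.ok_decideGates, hH, pack_unpack]
  have hr : exec I.decideGates G .r 0 = false := by
    rw [Bool.eq_false_iff]
    intro e
    refine hbr ⟨loc_lt.2 hX, ?_⟩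
    rw [ebG]
    exact (pack_loc _ _ _ _).trans e
  -- If the memory is that of i and j, a negative verdict forces the flag to be set and the control
  -- bit to differ from the sign. The amplitude is then the difference across an edge, which
  -- vanishes by assumption.
  have key : ∀ i j, i < 2 ^ I.n → j < 2 ^ I.n →
      pack X (G.set .c 0 false) = pack X (I.edgeMem l m i j false) →
      runGates (11 * X) (I.pairTest X l m).1 ψ (pack X (exec I.decideGates G)) = 0 := by
    intro i j hi hj e
    have e' := pack_eq_iff.1 e
    have cmp := exec_compareGates h hi hj hl hm false
    have hr' : G .r 0 = false := by
      have := e' .r 0 hX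
      rwa [edgeMem_r h, Mem.set_apply, if_neg (by simp)] at this
    have hs : G .s 0 = (I.sgnValue i l).getD 0 false := by
      have := e' .s 0 hX
      rwa [Mem.set_apply, if_neg (by simp), edgeMem, cmp.2.1] at this
    have hz : G .Z (2 * I.n + 2) = exec I.compareGates (memOf (I.adjWires i l) (I.adjWires j m) false)
        .Z (2 * I.n + 2) := by
      have := e' .Z (2 * I.n + 2) (by omega)
      rwa [Mem.set_apply, if_neg (by simp), edgeMem] at this
    rw [exec_decideGates_r, hr', hs] at hr
    simp only [Bool.false_xor, Bool.not_eq_false', Bool.and_eq_true] at hr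
    rw [hz, cmp.1] at hr
    obtain ⟨⟨hij, hji, hi0, hj0⟩, hc⟩ := hr
    have hc' : G .c 0 = !(I.sgnValue i l).getD 0 false := by
      revert hc
      cases G .c 0 <;> cases (I.sgnValue i l).getD 0 false <;> simp
    rw [runGates_pairTest_edge h hl hm hψ hi hj hij hji e hc', hb i j hi hj hi0 hj0 hij hji]
    ring
  -- If undoing the computation leads to a vertex string, then the memory is the image of that
  -- vertex. The control bit, which the computation never changes, has to be treated separately.
  have cset : ∀ (v : Bool) (i : ℕ), i ∈ V →
      pack X ((exec (I.edgeGates X l m ++ I.compareGates).reverse (G.set .c 0 v)).set .c 0 false) =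
        vert X i →
      pack X (G.set .c 0 v) = pack X (exec (I.edgeGates X l m ++ I.compareGates)
        (memOf i.testBit (fun _ => false) v)) := by
    intro v i _ e
    rw [← exec_reverse' ok (G.set .c 0 v)]
    refine pack_exec ok ?_
    have e' := pack_eq_iff.1 (e : _ = pack X _)
    rw [pack_eq_iff]
    intro a k hk
    by_cases hak : a = .c ∧ k = 0
    · obtain ⟨rfl, rfl⟩ := hak
      rw [exec_edgeCompare_reverse_c h hl hm, Mem.set_apply]
      simp [memOf]
    · have := e' a k hk
      rw [Mem.set_apply, if_neg hak] at this
      rw [this, ← memOf_set_c _ _ v false, Mem.set_apply, if_neg hak]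
  rw [ebG]
  by_contra hne
  have : ψ (pack X ((exec (I.edgeGates X l m ++ I.compareGates).reverse (G.set .c 0 false)).set
      .c 0 false)) ≠ 0 ∨ ψ (pack X ((exec (I.edgeGates X l m ++ I.compareGates).reverse
      (G.set .c 0 true)).set .c 0 false)) ≠ 0 := by
    by_contra hh
    push Not at hh
    rw [runGates_pairTest h hl hm hψ, hh.1, hh.2] at hne
    simp at hne
  rcases this with h1 | h1
  · obtain ⟨i, hiV, hi⟩ := hψ _ h1
    have e := cset false i hiV hi
    rw [exec_edgeCompare_false h (hV i hiV) hl hm] at e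
    exact hne (key i _ (hV i hiV) (adjValue_lt h i l) e)
  · obtain ⟨j, hjV, hj⟩ := hψ _ h1
    have e := cset true j hjV hj
    rw [exec_edgeCompare_true h (hV j hjV) hl hm] at e
    -- In this branch the vertex is the end of the edge, so the beginning is its m-th neighbour.
    refine hne (key (I.adjValue j m) j (adjValue_lt h j m) (hV j hjV) ?_)
    rw [← edgeMem_set h l m _ j true false]
    rw [pack_eq_iff] at e ⊢
    intro a k hk
    have := e a k hk
    simp only [Mem.set_apply] at this ⊢
    split_ifs with hak
    · rfl
    · rwa [if_neg hak] at this

open Classical in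
/-- A pair test detects amplitudes that differ across the edges. -/
theorem sum_le_nsq_sub_pairTest (h : I.Fits X) {l m : ℕ} (hl : l < I.S) (hm : m < I.S)
    {V : Finset ℕ} (hV : ∀ i ∈ V, i < 2 ^ I.n) {ψ : QState (11 * X)} (hψ : SupportedOn V ψ) :
    ∑ i ∈ V with I.Flagged l m i, 1 / 4 * ‖ψ (vert X i) - I.sg i l * ψ (vert X (I.adjValue i l))‖ ^ 2 ≤
      nsq (ψ - testProj (11 * X) (I.pairTest X l m) ψ) := by
  have hn := h.n_le
  have hX : 0 < X := by omega
  have hon := on_pairTest h hl hm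
  rw [nsq_sub_testProj fun g hg => (hon.1 g hg).selfInverse]
  -- For each flagged vertex i this memory leads to one rejected string, the one with the control
  -- bit opposite to the sign. The strings are different for different i since block `A` still shows
  -- the name; the remaining rejected strings are dropped as nonnegative terms.
  set G : ℕ → Mem := fun i => (I.edgeMem l m i (I.adjValue i l) false).set .c 0
    (!(I.sgnValue i l).getD 0 false) with hG
  have hGA : ∀ i ∈ V, exec I.decideGates (G i) .A = I.adjWires i l := by
    intro i hi
    have cmp := exec_compareGates h (hV i hi) (adjValue_lt h i l) hl hm false
    rw [exec_decideGates_A]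
    funext k
    rw [hG]
    simp only [Mem.set_apply]
    rw [if_neg (by simp), edgeMem, cmp.2.2]
  have inj : ∀ i ∈ V, ∀ j ∈ V, pack X (exec I.decideGates (G i)) = pack X (exec I.decideGates (G j)) →
      i = j := by
    intro i hi j hj e
    refine eq_of_testBit_lt (hV i hi) (hV j hj) fun k hk => ?_
    have := pack_eq_iff.1 e .A k (by omega)
    rwa [hGA i hi, hGA j hj, adjWires_name (hV i hi) hk, adjWires_name (hV j hj) hk] at this
  calc _ = ∑ i ∈ V with I.Flagged l m i, (fun b : Fin (11 * X) → Bool =>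
        if ∃ h : (I.pairTest X l m).2 < 11 * X, b ⟨(I.pairTest X l m).2, h⟩ = true then (0 : ℝ)
          else ‖runGates (11 * X) (I.pairTest X l m).1 ψ b‖ ^ 2)
        (pack X (exec I.decideGates (G i))) := by
        refine Finset.sum_congr rfl fun i hi => ?_
        obtain ⟨hiV, hi0, hj0, hji⟩ := Finset.mem_filter.1 hi
        have cmp := exec_compareGates h (hV i hiV) (adjValue_lt h i l) hl hm false
        have e1 : exec I.decideGates (G i) .r 0 = false := by
          have er := edgeMem_r h l m i (I.adjValue i l) false
          rw [exec_decideGates_r, hG]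
          simp only [Mem.set_apply, and_true, reduceCtorEq, if_true, if_false, false_and]
          rw [er, edgeMem, cmp.2.1, cmp.1.2 ⟨rfl, hji, hi0, hj0⟩]
          cases (I.sgnValue i l).getD 0 false <;> simp
        have e2 : ¬ ∃ h : (I.pairTest X l m).2 < 11 * X,
            pack X (exec I.decideGates (G i)) ⟨(I.pairTest X l m).2, h⟩ = true := by
          rintro ⟨h', e⟩
          have := (pack_loc _ _ _ h').symm.trans e
          rw [e1] at this
          exact absurd this (by simp)
        simp only [if_neg e2]
        rw [runGates_pairTest_edge h hl hm hψ (hV i hiV) (adjValue_lt h i l) rfl hji]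
        · rw [norm_mul, mul_pow]
          norm_num
        · congr 1
          funext a k
          simp only [hG, Mem.set_apply]
          split_ifs with e
          · obtain ⟨rfl, rfl⟩ := e
            have := congrFun (congrFun (edgeMem_set h l m i (I.adjValue i l) false false) .c) 0
            rw [← this, Mem.set_apply]
            simp
          · rfl
        · simp [hG, Mem.set_apply]
    _ = ∑ b ∈ ({i ∈ V | I.Flagged l m i}).image fun i => pack X (exec I.decideGates (G i)),
        (if ∃ h : (I.pairTest X l m).2 < 11 * X, b ⟨(I.pairTest X l m).2, h⟩ = true then (0 : ℝ)
          else ‖runGates (11 * X) (I.pairTest X l m).1 ψ b‖ ^ 2) := by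
        rw [Finset.sum_image fun i hi j hj e =>
          inj i (Finset.mem_filter.1 hi).1 j (Finset.mem_filter.1 hj).1 e]
    _ ≤ _ := by
        have := Finset.sum_le_univ_sum_of_nonneg (s := ({i ∈ V | I.Flagged l m i}).image
          fun i => pack X (exec I.decideGates (G i)))
          (f := fun b : Fin (11 * X) → Bool =>
        if ∃ h : (I.pairTest X l m).2 < 11 * X, b ⟨(I.pairTest X l m).2, h⟩ = true then (0 : ℝ)
          else ‖runGates (11 * X) (I.pairTest X l m).1 ψ b‖ ^ 2) (fun b => by
            split_ifs
            · exact le_rfl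
            · positivity)
        convert this

end Input

end QMABalance

namespace QMABalance

open Function

/-! ### The projection onto the vertices -/

theorem testProjs_append {N : ℕ} (Ts Ts' : List (List QGate × ℕ)) (ψ : QState N) :
    testProjs N (Ts ++ Ts') ψ = testProjs N Ts' (testProjs N Ts ψ) := by
  simp [testProjs]

theorem testProjs_cons {N : ℕ} (T : List QGate × ℕ) (Ts : List (List QGate × ℕ)) (ψ : QState N) :
    testProjs N (T :: Ts) ψ = testProjs N Ts (testProj N T ψ) := rfl

/-- A test keeps strings whose test bit is one after its gates; the flip makes it keep zeros. -/
theorem testProj_zeroTest {X : ℕ} (a : Blk) {k : ℕ} (hk : k < X) (ψ : QState (11 * X))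
    (b : Fin (11 * X) → Bool) :
    testProj (11 * X) (zeroTest a k) ψ b = if unpack b a k = false then ψ b else 0 := by
  have := testProj_classical (X := X) (Ps := [.x a k]) (fun g hg => by
    rw [List.mem_singleton] at hg; subst hg; exact hk) (a := a) hk ψ (unpack b)
  rw [pack_unpack] at this
  simpa [exec, MGate.step, Mem.set_apply, zeroTest, MGate.toQ] using this

theorem testProjs_zeroTest {X : ℕ} (L : List (Blk × ℕ)) (hL : ∀ x ∈ L, x.2 < X) (ψ : QState (11 * X))
    (b : Fin (11 * X) → Bool) :
    testProjs (11 * X) (L.map fun x => zeroTest x.1 x.2) ψ b =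
      if ∀ x ∈ L, unpack b x.1 x.2 = false then ψ b else 0 := by
  induction L generalizing ψ with
  | nil => simp [testProjs]
  | cons x L ih =>
    rw [List.map_cons, testProjs_cons, ih fun y hy => hL y (by simp [hy]),
      testProj_zeroTest _ (hL x (by simp))]
    simp only [List.forall_mem_cons]
    by_cases h1 : unpack b x.1 x.2 = false
    · rw [if_pos h1]
      exact if_congr ⟨fun h => ⟨h1, h⟩, fun h => h.2⟩ rfl rfl
    · simp [h1]

namespace Input

variable {I : Input} {X : ℕ}

/-- The bits that are tested to be zero. -/
def zeroBits (I : Input) (X : ℕ) : List (Blk × ℕ) :=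
  ((List.range' 0 X).flatMap fun k => [Blk.B, .C, .D, .Z, .Y, .Y', .c, .t, .s, .r].map fun a =>
    (a, k)) ++ (List.range' 0 (X - I.n)).map fun k => (.A, I.n + k)

theorem zeroTests_eq : I.zeroTests X = (I.zeroBits X).map fun x => zeroTest x.1 x.2 := by
  simp [zeroTests, zeroBits, List.map_flatMap]

theorem mem_zeroBits {a : Blk} {k : ℕ} (hk : k < X) :
    (a, k) ∈ I.zeroBits X ↔ a ≠ .A ∨ I.n ≤ k := by
  simp only [zeroBits, List.mem_append, List.mem_flatMap, List.mem_range'_1, List.mem_map,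
    Prod.mk.injEq]
  constructor
  · rintro (⟨k', -, a', ha', rfl, rfl⟩ | ⟨k', -, rfl, rfl⟩)
    · left; rintro rfl; revert ha'; decide
    · right; omega
  · rintro h
    by_cases ha : a = .A
    · subst ha
      right
      have : I.n ≤ k := by simpa using h
      exact ⟨k - I.n, by omega, rfl, by omega⟩
    · left
      exact ⟨k, by omega, a, by cases a <;> simp at ha ⊢, rfl, rfl⟩

theorem lt_of_mem_zeroBits (hn : I.n ≤ X) {x : Blk × ℕ} (hx : x ∈ I.zeroBits X) : x.2 < X := by
  simp only [zeroBits, List.mem_append, List.mem_flatMap, List.mem_range'_1, List.mem_map] at hx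
  rcases hx with ⟨k, hk, a, -, rfl⟩ | ⟨k, hk, rfl⟩
  · dsimp only; omega
  · dsimp only; omega

/-- If only the first n bits of block `A` are free, a string is determined by the number these bits
spell out. -/
theorem forall_zeroBits_iff (hn : I.n ≤ X) (b : Fin (11 * X) → Bool) :
    (∀ x ∈ I.zeroBits X, unpack b x.1 x.2 = false) ↔ ∃ i < 2 ^ I.n, b = vert X i := by
  constructor
  · intro h
    refine ⟨ofBits (List.ofFn fun k : Fin I.n => unpack b .A k), ?_, ?_⟩
    · simpa using ofBits_lt (List.ofFn fun k : Fin I.n => unpack b .A k)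
    · conv_lhs => rw [← pack_unpack b]
      rw [vert, pack_eq_iff]
      intro a k hk
      by_cases hz : a ≠ .A ∨ I.n ≤ k
      · rw [h (a, k) ((mem_zeroBits hk).2 hz)]
        symm
        rcases hz with ha | ha
        · cases a <;> simp [memOf] at ha ⊢
        · cases a <;> simp [memOf, testBit_ofBits, ha]
      · push Not at hz
        obtain ⟨rfl, hkn⟩ := hz
        simp [memOf, testBit_ofBits, hkn]
  · rintro ⟨i, hi, rfl⟩ ⟨a, k⟩ hx
    have hk := lt_of_mem_zeroBits hn hx
    rw [unpack, dif_pos (loc_lt.2 hk), vert, pack_loc]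
    rcases (mem_zeroBits hk).1 hx with ha | ha
    · cases a <;> simp [memOf] at ha ⊢
    · cases a <;> simp [memOf]
      exact Nat.testBit_eq_false_of_lt (hi.trans_le (Nat.pow_le_pow_right (by omega) ha))

open Classical in
/-- The zero tests and the vertex test project onto the span of the vertices. -/
theorem testProjs_vertex (h : I.Fits X) (hn : 0 < I.n) {V : Finset ℕ} (hV : ∀ i ∈ V, i < 2 ^ I.n)
    (hmark : ∀ i < 2 ^ I.n, i ∈ V ↔ ¬(I.adjValue i 0 = 0 ∧ I.adjValue i 1 = 1))
    (ψ : QState (11 * X)) (b : Fin (11 * X) → Bool) :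
    testProjs (11 * X) (I.zeroTests X ++ [I.vertexTest]) ψ b =
      if ∃ i ∈ V, b = vert X i then ψ b else 0 := by
  have hle := h.n_le
  have hz : ∀ b, testProjs (11 * X) (I.zeroTests X) ψ b =
      if ∃ i < 2 ^ I.n, b = vert X i then ψ b else 0 := by
    intro b
    rw [zeroTests_eq, testProjs_zeroTest _ fun x hx => lt_of_mem_zeroBits (by omega) hx]
    simp only [forall_zeroBits_iff (show I.n ≤ X by omega)]
  have hcl := testProj_classical (fun g hg => (h.usesOnly_vertexGates g hg).1) (a := .Z)
    (k := 2 * I.n) (by omega) (testProjs (11 * X) (I.zeroTests X) ψ)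
  rw [testProjs_append]
  change testProj (11 * X) I.vertexTest _ b = _
  by_cases hb : ∃ i < 2 ^ I.n, b = vert X i
  · obtain ⟨i, hi, rfl⟩ := hb
    rw [vertexTest]
    have := hcl (memOf i.testBit (fun _ => false) false)
    rw [vert, this, ← vert, hz, if_pos (show ∃ j < 2 ^ I.n, vert X i = vert X j from ⟨i, hi, rfl⟩)]
    refine if_congr ((exec_vertexGates h hi hn).trans ((hmark i hi).symm.trans
      ⟨fun hiV => ⟨i, hiV, rfl⟩, ?_⟩)) rfl rfl
    rintro ⟨j, hj, e⟩
    rwa [vert_inj (show I.n ≤ X by omega) hi (hV j hj) e]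
  · have h1 : ¬ ∃ i ∈ V, b = vert X i := fun ⟨i, hi, e⟩ => hb ⟨i, hV i hi, e⟩
    have := hcl (unpack b)
    rw [pack_unpack, hz, if_neg hb] at this
    rw [vertexTest, this, if_neg h1]
    simp

theorem on_zeroTests (hn : I.n ≤ X) : ∀ T ∈ I.zeroTests X, (∀ g ∈ T.1, g.On (11 * X)) ∧ T.2 < 11 * X := by
  intro T hT
  rw [zeroTests_eq, List.mem_map] at hT
  obtain ⟨x, hx, rfl⟩ := hT
  have := lt_of_mem_zeroBits hn hx
  refine ⟨fun g hg => ?_, loc_lt.2 this⟩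
  rw [zeroTest, List.mem_singleton] at hg
  subst hg
  exact loc_lt.2 this

theorem on_roundTests (h : I.Fits X) :
    ∀ T ∈ I.roundTests X, (∀ g ∈ T.1, g.On (11 * X)) ∧ T.2 < 11 * X := by
  have hle := h.n_le
  intro T hT
  simp only [roundTests, List.mem_append, List.mem_cons, List.mem_flatMap, List.mem_map,
    List.mem_range'_1] at hT
  rcases hT with hT | rfl | ⟨l, hl, m, hm, rfl⟩
  · exact on_zeroTests (by omega) T hT
  · refine ⟨fun g hg => ?_, loc_lt.2 (by omega)⟩
    obtain ⟨g, hg', rfl⟩ := List.mem_map.1 hg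
    exact (h.usesOnly_vertexGates g hg').1.on
  · exact on_pairTest h (by omega) (by omega)

end Input

/-! ### Sequences of projections -/

theorem sum_range_eq {M : Type*} [AddCommMonoid M] (f : ℕ → M) (n : ℕ) :
    ∑ i ∈ Finset.range n, f i = ((List.range n).map f).sum := rfl

section Sequence

variable {N : ℕ}

theorem nsq_nonneg (ψ : QState N) : 0 ≤ nsq ψ := Finset.sum_nonneg fun _ _ => by positivity

theorem sqrt_nsq_add_le (ψ φ : QState N) : √(nsq (ψ + φ)) ≤ √(nsq ψ) + √(nsq φ) := by
  have e : ∀ χ : QState N, √(nsq χ) = ‖(WithLp.toLp 2 χ : EuclideanSpace ℂ (Fin N → Bool))‖ := by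
    intro χ
    rw [EuclideanSpace.norm_eq]
    rfl
  rw [e, e, e, WithLp.toLp_add]
  exact norm_add_le _ _

theorem nsq_testProj_le {T : List QGate × ℕ} (hT : ∀ g ∈ T.1, g.SelfInverse) (ψ : QState N) :
    nsq (testProj N T ψ) ≤ nsq ψ := by
  have := nsq_testProj_add hT ψ
  have := nsq_nonneg (ψ - testProj N T ψ)
  linarith

theorem nsq_sub_testProj_le {T : List QGate × ℕ} (hT : ∀ g ∈ T.1, g.SelfInverse) (ψ : QState N) :
    nsq (ψ - testProj N T ψ) ≤ nsq ψ := by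
  have := nsq_testProj_add hT ψ
  have := nsq_nonneg (testProj N T ψ)
  linarith

theorem nsq_testProjs_le {Ts : List (List QGate × ℕ)} (hT : ∀ T ∈ Ts, ∀ g ∈ T.1, g.SelfInverse)
    (ψ : QState N) : nsq (testProjs N Ts ψ) ≤ nsq ψ := by
  induction Ts generalizing ψ with
  | nil => exact le_rfl
  | cons T Ts ih =>
    exact (ih (fun T hT' => hT T (by simp [hT'])) _).trans (nsq_testProj_le (hT T (by simp)) ψ)

/-- The total change of a state in a sequence of tests. -/
noncomputable def drift (N : ℕ) : List (List QGate × ℕ) → QState N → ℝ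
  | [], _ => 0
  | T :: Ts, ψ => √(nsq (ψ - testProj N T ψ)) + drift N Ts (testProj N T ψ)

theorem drift_nonneg (Ts : List (List QGate × ℕ)) (ψ : QState N) : 0 ≤ drift N Ts ψ := by
  induction Ts generalizing ψ with
  | nil => exact le_rfl
  | cons T Ts ih => exact add_nonneg (Real.sqrt_nonneg _) (ih _)

/-- For a later projection P and the first projection P₀, (1 − P)ψ is the sum of (1 − P)(ψ − P₀ψ)
and (1 − P)P₀ψ. The first summand is at most as long as ψ − P₀ψ, and the second is treated
inductively. A test that would reject much of the initial state must do so within the sequence,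
unless earlier tests have already moved the state. -/
theorem sqrt_nsq_sub_le_drift {Ts : List (List QGate × ℕ)} (hT : ∀ T ∈ Ts, ∀ g ∈ T.1, g.SelfInverse)
    (ψ : QState N) {T : List QGate × ℕ} (h : T ∈ Ts) : √(nsq (ψ - testProj N T ψ)) ≤ drift N Ts ψ := by
  induction Ts generalizing ψ with
  | nil => simp at h
  | cons T₀ Ts ih =>
    rw [drift]
    rcases List.mem_cons.1 h with rfl | h
    · exact le_add_of_nonneg_right (drift_nonneg _ _)
    · have e : ψ - testProj N T ψ = (ψ - testProj N T₀ ψ - testProj N T (ψ - testProj N T₀ ψ)) +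
          (testProj N T₀ ψ - testProj N T (testProj N T₀ ψ)) := by
        rw [testProj_sub]; abel
      rw [e]
      refine (sqrt_nsq_add_le _ _).trans (add_le_add ?_ ?_)
      · exact Real.sqrt_le_sqrt (nsq_sub_testProj_le (hT T (by simp [h])) _)
      · exact ih (fun T hT' => hT T (by simp [hT'])) _ h

/-- By Pythagoras the squared change in one test is the squared norm lost in it, and these losses
telescope. Cauchy–Schwarz for the sum of the changes gives the factor equal to the number of tests.
-/
theorem drift_sq_le {Ts : List (List QGate × ℕ)} (hT : ∀ T ∈ Ts, ∀ g ∈ T.1, g.SelfInverse)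
    (ψ : QState N) : drift N Ts ψ ^ 2 ≤ Ts.length * (nsq ψ - nsq (testProjs N Ts ψ)) := by
  induction Ts generalizing ψ with
  | nil => simp [drift]
  | cons T Ts ih =>
    have ih' := ih (fun T hT' => hT T (by simp [hT'])) (testProj N T ψ)
    have hadd := nsq_testProj_add (hT T (by simp)) ψ
    have hle := nsq_testProjs_le (fun T hT' => hT T (List.mem_cons_of_mem _ hT')) (testProj N T ψ)
    rw [drift, testProjs_cons, List.length_cons]
    push_cast
    set d := √(nsq (ψ - testProj N T ψ)) with hd
    have hd2 : d ^ 2 = nsq (ψ - testProj N T ψ) := Real.sq_sqrt (nsq_nonneg _)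
    set D := drift N Ts (testProj N T ψ)
    set M : ℝ := (Ts.length : ℝ)
    have hM : 0 ≤ M := Nat.cast_nonneg _
    set Δ := nsq (testProj N T ψ) - nsq (testProjs N Ts (testProj N T ψ)) with hΔ
    have hΔ0 : 0 ≤ Δ := by linarith
    -- With M remaining tests, D² ≤ MΔ yields (2dD)² ≤ 4Md²Δ ≤ (Md² + Δ)².
    have key : 2 * d * D ≤ M * d ^ 2 + Δ := by
      refine abs_le_of_sq_le_sq' ?_ (by positivity) |>.2
      nlinarith [sq_nonneg (M * d ^ 2 - Δ), mul_le_mul_of_nonneg_left ih' (sq_nonneg d)]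
    have : nsq ψ - nsq (testProjs N Ts (testProj N T ψ)) = d ^ 2 + Δ := by rw [hd2, hΔ]; linarith
    rw [this]
    nlinarith

/-- If a sequence of tests hardly decreases the norm, then all tests nearly preserve the state. -/
theorem sum_nsq_sub_testProj_le {Ts : List (List QGate × ℕ)}
    (hT : ∀ T ∈ Ts, ∀ g ∈ T.1, g.SelfInverse) (ψ : QState N) :
    (Ts.map fun T => nsq (ψ - testProj N T ψ)).sum ≤
      (Ts.length : ℝ) ^ 2 * (nsq ψ - nsq (testProjs N Ts ψ)) := by
  have h : ∀ x ∈ Ts.map fun T => nsq (ψ - testProj N T ψ), x ≤ drift N Ts ψ ^ 2 := by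
    intro x hx
    obtain ⟨T, hT', rfl⟩ := List.mem_map.1 hx
    rw [← Real.sq_sqrt (nsq_nonneg (ψ - testProj N T ψ))]
    exact pow_le_pow_left₀ (Real.sqrt_nonneg _) (sqrt_nsq_sub_le_drift hT ψ hT') 2
  have := List.sum_le_card_nsmul _ _ h
  rw [List.length_map, nsmul_eq_mul] at this
  refine this.trans ?_
  rw [sq (Ts.length : ℝ), mul_assoc]
  exact mul_le_mul_of_nonneg_left (drift_sq_le hT ψ) (Nat.cast_nonneg _)

theorem nsq_testProjs_iterate_le {Ts : List (List QGate × ℕ)} {q : ℝ} (hq : 0 ≤ q)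
    (h : ∀ ψ : QState N, nsq (testProjs N Ts ψ) ≤ q * nsq ψ) (R : ℕ) (ψ : QState N) :
    nsq (testProjs N (List.replicate R Ts).flatten ψ) ≤ q ^ R * nsq ψ := by
  induction R generalizing ψ with
  | zero => simp [testProjs]
  | succ R ih =>
    rw [List.replicate_succ, List.flatten_cons, testProjs_append, pow_succ, mul_assoc]
    exact (ih _).trans (mul_le_mul_of_nonneg_left (h ψ) (pow_nonneg hq R))

theorem testProjs_iterate_eq {Ts : List (List QGate × ℕ)} {ψ : QState N}
    (h : testProjs N Ts ψ = ψ) (R : ℕ) : testProjs N (List.replicate R Ts).flatten ψ = ψ := by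
  induction R with
  | zero => rfl
  | succ R ih => rw [List.replicate_succ, List.flatten_cons, testProjs_append, h, ih]

theorem testProjs_eq_self {Ts : List (List QGate × ℕ)} {ψ : QState N}
    (h : ∀ T ∈ Ts, testProj N T ψ = ψ) : testProjs N Ts ψ = ψ := by
  induction Ts with
  | nil => rfl
  | cons T Ts ih => rw [testProjs_cons, h T (by simp), ih fun T hT => h T (by simp [hT])]

end Sequence

namespace Input

variable {I : Input} {X : ℕ}

theorem roundTests_eq : I.roundTests X = (I.zeroTests X ++ [I.vertexTest]) ++
    (List.range' 0 I.S).flatMap fun l => (List.range' 0 I.S).map fun m => I.pairTest X l m := by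
  simp [roundTests]

/-- A state that is supported on the vertices and agrees across the edges passes all tests. -/
theorem testProjs_roundTests_eq (h : I.Fits X) (hn : 0 < I.n) {V : Finset ℕ}
    (hV : ∀ i ∈ V, i < 2 ^ I.n)
    (hmark : ∀ i < 2 ^ I.n, i ∈ V ↔ ¬(I.adjValue i 0 = 0 ∧ I.adjValue i 1 = 1))
    {ψ : QState (11 * X)} (hψ : SupportedOn V ψ)
    (hb : ∀ i j l m, i < 2 ^ I.n → j < 2 ^ I.n → l < I.S → m < I.S → i ≠ 0 → j ≠ 0 →
      I.adjValue i l = j → I.adjValue j m = i → ψ (vert X i) = I.sg i l * ψ (vert X j)) :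
    testProjs (11 * X) (I.roundTests X) ψ = ψ := by
  have e : testProjs (11 * X) (I.zeroTests X ++ [I.vertexTest]) ψ = ψ := by
    funext b
    rw [testProjs_vertex h hn hV hmark]
    split_ifs with hx
    · rfl
    · by_contra hne
      exact hx (hψ b (Ne.symm hne))
  rw [roundTests_eq, testProjs_append, e]
  refine testProjs_eq_self fun T hT => ?_
  simp only [List.mem_flatMap, List.mem_map, List.mem_range'_1] at hT
  obtain ⟨l, hl, m, hm, rfl⟩ := hT
  have hl' : l < I.S := by omega
  have hm' : m < I.S := by omega
  exact testProj_pairTest_eq h hl' hm' hV hψ fun i j hi hj hi0 hj0 => hb i j l m hi hj hl' hm' hi0 hj0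

theorem _root_.QMABalance.nsq_of_supportedOn {n : ℕ} (hn : n ≤ X) {V : Finset ℕ}
    (hV : ∀ i ∈ V, i < 2 ^ n) {ψ : QState (11 * X)} (hψ : SupportedOn V ψ) :
    nsq ψ = ∑ i ∈ V, ‖ψ (vert X i)‖ ^ 2 := by
  classical
  rw [← Finset.sum_image (f := fun b => ‖ψ b‖ ^ 2) fun i hi j hj e =>
    vert_inj hn (hV i hi) (hV j hj) e, nsq]
  refine (Finset.sum_subset (Finset.subset_univ _) fun b _ hb => ?_).symm
  by_contra hne
  obtain ⟨i, hi, e⟩ := hψ b (fun e => hne (by rw [e]; simp))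
  exact hb (Finset.mem_image.2 ⟨i, hi, e.symm⟩)

open Classical in
/-- One round decreases the norm if the amplitudes disagree across the edges. -/
theorem nsq_testProjs_roundTests_le (h : I.Fits X) (hn : 0 < I.n) {V : Finset ℕ}
    (hV : ∀ i ∈ V, i < 2 ^ I.n)
    (hmark : ∀ i < 2 ^ I.n, i ∈ V ↔ ¬(I.adjValue i 0 = 0 ∧ I.adjValue i 1 = 1)) {ε : ℝ}
    (hε : ∀ f : ℕ → ℂ, ε * ∑ i ∈ V, ‖f i‖ ^ 2 ≤ ∑ l ∈ Finset.range I.S, ∑ m ∈ Finset.range I.S,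
      ∑ i ∈ V with I.Flagged l m i, 1 / 4 * ‖f i - I.sg i l * f (I.adjValue i l)‖ ^ 2)
    (hε1 : ε ≤ (I.S : ℝ) ^ 4) (ψ : QState (11 * X)) :
    nsq (testProjs (11 * X) (I.roundTests X) ψ) ≤ (1 - ε / (I.S : ℝ) ^ 4) * nsq ψ := by
  have hle := h.n_le
  have hS := h.two_le_S
  rw [roundTests_eq, testProjs_append]
  have hself : ∀ T ∈ I.roundTests X, ∀ g ∈ T.1, g.SelfInverse :=
    fun T hT g hg => ((on_roundTests h T hT).1 g hg).selfInverse
  rw [roundTests_eq] at hself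
  set Φ := testProjs (11 * X) (I.zeroTests X ++ [I.vertexTest]) ψ with hΦ
  have hsup : SupportedOn V Φ := by
    intro b hb
    rw [hΦ, testProjs_vertex h hn hV hmark] at hb
    by_contra hne
    rw [if_neg hne] at hb
    exact hb rfl
  have hnsq := nsq_of_supportedOn (show I.n ≤ X by omega) hV hsup
  set Ts := (List.range' 0 I.S).flatMap fun l => (List.range' 0 I.S).map fun m => I.pairTest X l m
    with hTs
  -- The sequence has S² pair tests, and the lemma on sequences loses the square of this number:
  -- hence S⁴.
  have hlen : (Ts.length : ℝ) = (I.S : ℝ) ^ 2 := by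
    rw [hTs, List.length_flatMap]
    simp [sq]
  have seq := sum_nsq_sub_testProj_le (fun T hT => hself T (List.mem_append_right _ hT)) Φ
  have hsum : ∑ l ∈ Finset.range I.S, ∑ m ∈ Finset.range I.S,
      nsq (Φ - testProj (11 * X) (I.pairTest X l m) Φ) =
      (Ts.map fun T => nsq (Φ - testProj (11 * X) T Φ)).sum := by
    rw [hTs, List.map_flatMap, ← List.range_eq_range', List.flatMap_def, List.sum_flatten,
      List.map_map, ← sum_range_eq]
    refine Finset.sum_congr rfl fun l _ => ?_
    rw [Function.comp_apply, List.map_map, ← sum_range_eq]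
    rfl
  have low : ε * nsq Φ ≤ (Ts.map fun T => nsq (Φ - testProj (11 * X) T Φ)).sum := by
    rw [hnsq, ← hsum]
    refine (hε fun i => Φ (vert X i)).trans ?_
    refine Finset.sum_le_sum fun l hl => Finset.sum_le_sum fun m hm => ?_
    exact sum_le_nsq_sub_pairTest h (Finset.mem_range.1 hl) (Finset.mem_range.1 hm) hV hsup
  have hS0 : (0 : ℝ) < (I.S : ℝ) ^ 4 := by positivity
  rw [hlen, ← pow_mul, show 2 * 2 = 4 from rfl] at seq
  have step : nsq (testProjs (11 * X) Ts Φ) ≤ (1 - ε / (I.S : ℝ) ^ 4) * nsq Φ := by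
    have := low.trans seq
    rw [sub_mul, one_mul, div_mul_eq_mul_div, le_sub_comm, div_le_iff₀' hS0]
    linarith
  -- The zero tests and the vertex test do not increase the norm, and the contraction factor is
  -- nonnegative because ε ≤ S⁴.
  refine step.trans (mul_le_mul_of_nonneg_left ?_ ?_)
  · exact nsq_testProjs_le (fun T hT => hself T (List.mem_append_left _ hT)) ψ
  · rw [sub_nonneg, div_le_one hS0]
    exact hε1

end Input

end QMABalance

namespace QMABalance

/-! ### The signed Laplacian and balanced components -/

namespace SignedGraph

variable {V : Type}

open Classical in
/-- The sign of an edge as a real number, and zero for other pairs of vertices. -/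
noncomputable def edgeSign (G : SignedGraph V) (i j : V) : ℝ :=
  if h : G.graph.Adj i j then ((G.sign ⟨s(i, j), h⟩ : ℤˣ) : ℤ) else 0

variable {G : SignedGraph V}

theorem edgeSign_comm (i j : V) : G.edgeSign i j = G.edgeSign j i := by
  unfold edgeSign
  by_cases h : G.graph.Adj i j
  · have e : (⟨s(i, j), h⟩ : G.graph.edgeSet) = ⟨s(j, i), h.symm⟩ := Subtype.ext Sym2.eq_swap
    rw [dif_pos h, dif_pos h.symm, e]
  · rw [dif_neg h, dif_neg fun h' => h h'.symm]

theorem edgeSign_mul_self {i j : V} (h : G.graph.Adj i j) : G.edgeSign i j * G.edgeSign i j = 1 := by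
  rw [edgeSign, dif_pos h]
  rcases Int.units_eq_one_or (G.sign ⟨s(i, j), h⟩) with e | e <;> simp [e]

/-- A vector that is balanced across all edges and is not zero yields a balanced component. -/
theorem hasBalancedComponent_of_eigenvector {x : V → ℝ} (hx : x ≠ 0)
    (h : ∀ i j, G.graph.Adj i j → x i = G.edgeSign i j * x j) : G.HasBalancedComponent := by
  obtain ⟨i₀, hi₀⟩ := Function.ne_iff.1 hx
  have step : ∀ i j, G.graph.Adj i j → x i ≠ 0 → x j ≠ 0 := by
    intro i j hij hi hj
    rw [h i j hij, hj, mul_zero] at hi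
    exact hi rfl
  have reach : ∀ j, G.graph.Reachable i₀ j → x j ≠ 0 := by
    intro j hj
    induction (SimpleGraph.reachable_iff_reflTransGen _ _).1 hj with
    | refl => exact hi₀
    | tail hb hbc ih => exact step _ _ hbc (ih ((SimpleGraph.reachable_iff_reflTransGen _ _).2 hb))
  -- On the component of i₀ no entry vanishes, so the vertices with positive entry and those with
  -- negative entry form the required partition.
  refine ⟨G.graph.connectedComponentMk i₀, {v | 0 < x v}, fun u v huv => ?_⟩
  have huv' : G.graph.Adj u v := huv
  have hu : x u ≠ 0 := reach _ (SimpleGraph.ConnectedComponent.exact u.2).symm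
  have hv : x v ≠ 0 := reach _ (SimpleGraph.ConnectedComponent.exact v.2).symm
  have hs : (G.induce (G.graph.connectedComponentMk i₀).supp).sign ⟨s(u, v), huv⟩ =
      G.sign ⟨s((u : V), (v : V)), huv'⟩ := rfl
  have hxs := h u v huv'
  rw [edgeSign, dif_pos huv'] at hxs
  rw [hs]
  simp only [Set.mem_ofPred_eq]
  rcases Int.units_eq_one_or (G.sign ⟨s((u : V), (v : V)), huv'⟩) with e | e
  · rw [e] at hxs ⊢
    simp only [Units.val_one, Int.cast_one, one_mul] at hxs
    rw [hxs]
    simp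
  · rw [e] at hxs ⊢
    simp only [Units.val_neg, Units.val_one, Int.cast_neg, Int.cast_one, neg_mul, one_mul] at hxs
    refine ⟨fun hiff => ?_, fun _ => rfl⟩
    rw [hxs] at hiff
    exfalso
    rcases lt_or_gt_of_ne hv with h' | h'
    · exact absurd (hiff.1 (by linarith)) (by linarith)
    · exact absurd (hiff.2 h') (by linarith)

section Fintype

variable [Fintype V]

open Classical in
theorem laplacian_apply (i j : V) :
    G.laplacian i j = (if i = j then (G.deg i : ℝ) else 0) - G.edgeSign i j := by
  rw [laplacian, Matrix.of_apply]
  by_cases h : i = j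
  · subst h
    simp [edgeSign]
  · rw [if_neg h, if_neg h, edgeSign]
    split_ifs <;> simp

theorem laplacian_isHermitian : G.laplacian.IsHermitian := by
  classical
  refine Matrix.IsHermitian.ext fun i j => ?_
  rw [laplacian_apply, laplacian_apply, edgeSign_comm j i]
  by_cases h : i = j
  · subst h; simp
  · simp [h, Ne.symm h]

open Classical in
-- Expanding the squares and using s² = 1, the pure terms give the degrees and the mixed terms the
-- off-diagonal entries. Every edge occurs in both orientations, which accounts for the factor 2.
theorem two_mul_dotProduct_laplacian (x : V → ℝ) : 2 * (x ⬝ᵥ G.laplacian.mulVec x) =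
    ∑ i, ∑ j, if G.graph.Adj i j then (x i - G.edgeSign i j * x j) ^ 2 else 0 := by
  have e : ∀ i j, (if G.graph.Adj i j then (x i - G.edgeSign i j * x j) ^ 2 else 0) =
      (if G.graph.Adj i j then x i ^ 2 else 0) + (if G.graph.Adj j i then x j ^ 2 else 0) -
        2 * (x i * (G.edgeSign i j * x j)) := by
    intro i j
    by_cases h : G.graph.Adj i j
    · rw [if_pos h, if_pos h, if_pos h.symm]
      linear_combination x j ^ 2 * edgeSign_mul_self h
    · rw [if_neg h, if_neg h, if_neg fun h' => h h'.symm, edgeSign, dif_neg h]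
      ring
  have d : ∑ i, ∑ j, (if G.graph.Adj i j then x i ^ 2 else 0) = ∑ i, (G.deg i : ℝ) * x i ^ 2 := by
    refine Finset.sum_congr rfl fun i _ => ?_
    rw [← Finset.sum_filter, Finset.sum_const, nsmul_eq_mul, deg, ← SimpleGraph.card_neighborFinset_eq_degree,
      SimpleGraph.neighborFinset_eq_filter]
  simp only [e, Finset.sum_sub_distrib, Finset.sum_add_distrib]
  rw [Finset.sum_comm (f := fun i j => if G.graph.Adj j i then x j ^ 2 else 0), d]
  simp only [dotProduct, Matrix.mulVec, laplacian_apply, sub_mul, Finset.sum_sub_distrib, ite_mul,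
    zero_mul, Finset.sum_ite_eq, Finset.mem_univ, if_true, mul_sub]
  rw [show (∑ i, (G.deg i : ℝ) * x i ^ 2) = ∑ i, x i * ((G.deg i : ℝ) * x i) from
    Finset.sum_congr rfl fun i _ => by ring]
  simp only [← Finset.mul_sum]
  ring

open Classical in
/-- The smallest eigenvalue bounds the quadratic form from below. -/
theorem IsSmallestEigenvalue.le {inst : DecidableEq V} {μ : ℝ} (h : G.IsSmallestEigenvalue μ) (x : V → ℝ) :
    2 * μ * ∑ i, x i ^ 2 ≤
      ∑ i, ∑ j, if G.graph.Adj i j then (x i - G.edgeSign i j * x j) ^ 2 else 0 := by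
  rw [← two_mul_dotProduct_laplacian]
  have hB : (G.laplacian - μ • (1 : Matrix V V ℝ)).IsHermitian :=
    laplacian_isHermitian.sub (by
      refine Matrix.IsHermitian.ext fun i j => ?_
      simp [Matrix.one_apply, eq_comm])
  have hpos : (G.laplacian - μ • (1 : Matrix V V ℝ)).PosSemidef := by
    rw [hB.posSemidef_iff_eigenvalues_nonneg]
    intro j
    -- An eigenvalue λ of L − μ is an eigenvalue λ + μ of L, so minimality of μ gives λ ≥ 0.
    have ev := hB.mulVec_eigenvectorBasis j
    rw [Matrix.sub_mulVec, Matrix.smul_mulVec, Matrix.one_mulVec, sub_eq_iff_eq_add, ← add_smul] at ev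
    have : μ ≤ hB.eigenvalues j + μ := by
      refine h.2 ?_
      refine Module.End.hasEigenvalue_of_hasEigenvector (x := (hB.eigenvectorBasis j : V → ℝ))
        ⟨Module.End.mem_eigenspace_iff.2 ?_, ?_⟩
      · rw [Matrix.toLin'_apply]
        exact ev
      · intro h0
        refine hB.eigenvectorBasis.toBasis.ne_zero j ?_
        ext k
        simpa using congrFun h0 k
    simpa using this
  have := hpos.dotProduct_mulVec_nonneg x
  rw [Matrix.sub_mulVec, Matrix.smul_mulVec, Matrix.one_mulVec, dotProduct_sub, dotProduct_smul,
    star_trivial, smul_eq_mul] at this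
  have e : x ⬝ᵥ x = ∑ i, x i ^ 2 := Finset.sum_congr rfl fun i _ => by ring
  rw [e] at this
  linarith

/-- For an eigenvector with eigenvalue zero the quadratic form vanishes, and with it every one of
its nonnegative summands. -/
theorem IsSmallestEigenvalue.hasBalancedComponent {inst : DecidableEq V}
    (h : G.IsSmallestEigenvalue 0) : G.HasBalancedComponent := by
  classical
  obtain ⟨x, hx⟩ := h.1.exists_hasEigenvector
  have hLx : G.laplacian.mulVec x = 0 := by
    have := Module.End.mem_eigenspace_iff.1 hx.1
    rwa [Matrix.toLin'_apply, zero_smul] at this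
  refine hasBalancedComponent_of_eigenvector hx.2 fun i j hij => ?_
  have e := two_mul_dotProduct_laplacian (G := G) x
  rw [hLx, dotProduct_zero, mul_zero] at e
  have n : ∀ i j, 0 ≤ if G.graph.Adj i j then (x i - G.edgeSign i j * x j) ^ 2 else 0 := by
    intro i j
    split_ifs <;> positivity
  have e1 := (Finset.sum_eq_zero_iff_of_nonneg fun i _ => Finset.sum_nonneg fun j _ => n i j).1 e.symm
    i (Finset.mem_univ _)
  have e2 := (Finset.sum_eq_zero_iff_of_nonneg fun j _ => n i j).1 e1 j (Finset.mem_univ _)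
  rw [if_pos hij] at e2
  exact sub_eq_zero.1 (pow_eq_zero_iff two_ne_zero |>.1 e2)

end Fintype

/-- A balanced component carries a vector with entries of modulus one that is balanced across all
edges. -/
theorem HasBalancedComponent.exists_vector (h : G.HasBalancedComponent) :
    ∃ x : V → ℝ, x ≠ 0 ∧ ∀ i j, G.graph.Adj i j → x i = G.edgeSign i j * x j := by
  classical
  obtain ⟨c, A, hA⟩ := h
  obtain ⟨i₀, hi₀⟩ := c.nonempty_supp
  refine ⟨fun i => if h : i ∈ c.supp then (if (⟨i, h⟩ : c.supp) ∈ A then 1 else -1) else 0, ?_, ?_⟩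
  · refine Function.ne_iff.2 ⟨i₀, ?_⟩
    simp only [dif_pos hi₀, Pi.zero_apply]
    split_ifs <;> norm_num
  · intro i j hij
    have hc : i ∈ c.supp ↔ j ∈ c.supp := by
      rw [SimpleGraph.ConnectedComponent.mem_supp_iff, SimpleGraph.ConnectedComponent.mem_supp_iff,
        SimpleGraph.ConnectedComponent.connectedComponentMk_eq_of_adj hij]
    by_cases hi : i ∈ c.supp
    · have hj := hc.1 hi
      have := hA ⟨i, hi⟩ ⟨j, hj⟩ hij
      have hs : (G.induce c.supp).sign ⟨s((⟨i, hi⟩ : c.supp), ⟨j, hj⟩), hij⟩ =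
        G.sign ⟨s(i, j), hij⟩ := rfl
      rw [hs] at this
      simp only [dif_pos hi, dif_pos hj, edgeSign, dif_pos hij]
      by_cases h1 : (⟨i, hi⟩ : c.supp) ∈ A <;> by_cases h2 : (⟨j, hj⟩ : c.supp) ∈ A
      · rw [this.1 (by simp [h1, h2])]; simp [h1, h2]
      · rw [this.2 (by simp [h1, h2])]; simp [h1, h2]
      · rw [this.2 (by simp [h1, h2])]; simp [h1, h2]
      · rw [this.1 (by simp [h1, h2])]; simp [h1, h2]
    · have hj : j ∉ c.supp := fun h => hi (hc.2 h)
      simp only [dif_neg hi, dif_neg hj, mul_zero]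

end SignedGraph

end QMABalance

namespace QMABalance

/-! ### Sparse access and the tests -/

namespace Input

namespace Implements

variable {I : Input} {V : Finset ℕ} {G : SignedGraph V}

theorem n_pos (h : I.Implements V G) : 0 < I.n := by
  obtain ⟨i, hi⟩ := h.nonempty
  have := h.vertex_range i hi
  by_contra hn
  rw [Nat.eq_zero_of_not_pos hn, pow_zero] at this
  omega

theorem lt_two_pow (h : I.Implements V G) : ∀ i ∈ V, i < 2 ^ I.n := fun i hi => (h.vertex_range i hi).2

theorem exists_adj_of_ne_zero (h : I.Implements V G) (v : V) {l : ℕ} (hl : l < I.S)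
    (h0 : I.adjValue v l ≠ 0) : ∃ u : V, G.graph.Adj v u ∧ I.adjValue v l = u := by
  by_cases hd : l < G.deg v
  · obtain ⟨e, he⟩ := h.adj_neighbour v
    exact ⟨e ⟨l, hd⟩, (e ⟨l, hd⟩).2, he ⟨l, hd⟩⟩
  · exact absurd (h.adj_end v l (not_lt.1 hd) hl) h0

theorem exists_position (h : I.Implements V G) {v u : V} (hvu : G.graph.Adj v u) :
    ∃ l < I.S, I.adjValue v l = u := by
  obtain ⟨e, he⟩ := h.adj_neighbour v
  refine ⟨e.symm ⟨u, hvu⟩, (e.symm ⟨u, hvu⟩).isLt.trans_le (h.deg_le v), ?_⟩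
  rw [he, Equiv.apply_symm_apply]

/-- A vertex with a neighbour has a nonzero entry at position 0; an isolated vertex has 0 at
position 1. So the prefix 0, 1 of a marked list never occurs for a vertex. Position 1 exists because
S ≥ 2. -/
theorem mem_iff (h : I.Implements V G) : ∀ i < 2 ^ I.n,
    i ∈ V ↔ ¬(I.adjValue i 0 = 0 ∧ I.adjValue i 1 = 1) := by
  intro i hi
  have hS := h.two_le_S
  constructor
  · rintro hiV ⟨h0, h1⟩
    have hd : G.deg ⟨i, hiV⟩ = 0 := by
      by_contra hd
      obtain ⟨e, he⟩ := h.adj_neighbour ⟨i, hiV⟩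
      have := he ⟨0, Nat.pos_of_ne_zero hd⟩
      have hpos := (h.vertex_range _ (e ⟨0, Nat.pos_of_ne_zero hd⟩ : V).2).1
      rw [← this] at hpos
      simp only at hpos
      omega
    have := h.adj_end ⟨i, hiV⟩ 1 (by omega) (by omega)
    simp only at this
    omega
  · intro hne
    by_contra hiV
    exact hne ⟨h.adj_marked i hi hiV 0 (by omega), h.adj_marked i hi hiV 1 (by omega)⟩

theorem sg_eq (h : I.Implements V G) {v u : V} (hvu : G.graph.Adj v u) {l : ℕ} (hl : l < I.S)
    (e : I.adjValue v l = u) : I.sg v l = (G.edgeSign v u : ℂ) := by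
  rw [sg, h.sgn_edge v u hvu l hl e, SignedGraph.edgeSign, dif_pos hvu]
  rcases Int.units_eq_one_or (G.sign ⟨s(v, u), hvu⟩) with e | e
  · rw [e]
    simp
  · rw [e]
    simp

/-- A vector on the vertices as a state. -/
theorem exists_state {X : ℕ} (h : I.Implements V G) (hX : I.n ≤ X) (x : V → ℂ) :
    ∃ ψ : QState (11 * X), SupportedOn V ψ ∧ ∀ v : V, ψ (vert X v) = x v := by
  classical
  refine ⟨fun b => if hb : ∃ v : V, b = vert X v then x hb.choose else 0, fun b hb => ?_, fun v => ?_⟩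
  · by_contra hne
    refine hb (dif_neg ?_)
    rintro ⟨v, rfl⟩
    exact hne ⟨v, v.2, rfl⟩
  · have hv : ∃ u : V, vert X v = vert X u := ⟨v, rfl⟩
    have : hv.choose = v := Subtype.ext (vert_inj hX (h.lt_two_pow _ (hv.choose).2) (h.lt_two_pow _ v.2)
      hv.choose_spec.symm)
    exact (dif_pos hv).trans (by rw [this])

/-- If there is a balanced component, then some state passes all tests. -/
theorem exists_passing {X : ℕ} (h : I.Implements V G) (hf : I.Fits X) (hG : G.HasBalancedComponent) :
    ∃ ψ : QState (11 * X), nsq ψ = 1 ∧ testProjs (11 * X) (I.roundTests X) ψ = ψ := by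
  -- The witness is this vector divided by its Euclidean norm √K.
  obtain ⟨x, hx0, hx⟩ := hG.exists_vector
  have hn := hf.n_le
  set K : ℝ := ∑ v, x v ^ 2 with hK
  have hKpos : 0 < K := by
    obtain ⟨v, hv⟩ := Function.ne_iff.1 hx0
    have hv' : x v ≠ 0 := hv
    exact Finset.sum_pos' (fun v _ => sq_nonneg _) ⟨v, Finset.mem_univ _, by positivity⟩
  obtain ⟨ψ, hψ, hψx⟩ := h.exists_state (X := X) (by omega) fun v => ((x v / √K : ℝ) : ℂ)
  refine ⟨ψ, ?_, testProjs_roundTests_eq hf h.n_pos h.lt_two_pow h.mem_iff hψ ?_⟩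
  · rw [nsq_of_supportedOn (show I.n ≤ X by omega) h.lt_two_pow hψ, ← Finset.sum_coe_sort]
    simp only [hψx, Complex.norm_real, Real.norm_eq_abs, sq_abs, div_pow, Real.sq_sqrt hKpos.le]
    rw [← Finset.sum_div]
    exact div_self hKpos.ne'
  · intro i j l m hi hj hl hm hi0 hj0 hij hji
    by_cases hiV : i ∈ V
    · obtain ⟨u, hvu, hu⟩ := h.exists_adj_of_ne_zero ⟨i, hiV⟩ hl (by simpa [hij] using hj0)
      have hju : j = u := hij.symm.trans hu
      have e1 := hψx ⟨i, hiV⟩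
      have e2 := hψx u
      simp only at e1
      rw [hju, e1, e2, h.sg_eq (v := ⟨i, hiV⟩) hvu hl hu, hx _ _ hvu, mul_div_assoc]
      push_cast
      ring
    -- If j were a vertex, its nonzero entry i would be a neighbour and hence a vertex. So neither
    -- is one, and both amplitudes vanish.
    · have hjV : j ∉ V := by
        intro hjV
        obtain ⟨u, -, hu⟩ := h.exists_adj_of_ne_zero ⟨j, hjV⟩ hm (by simpa [hji] using hi0)
        exact hiV (by rw [← hji]; simp only at hu; rw [hu]; exact u.2)
      have z : ∀ k < 2 ^ I.n, k ∉ V → ψ (vert X k) = 0 := by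
        intro k hk hkV
        by_contra hne
        obtain ⟨k', hk', e⟩ := hψ _ hne
        rw [vert_inj (show I.n ≤ X by omega) hk (h.lt_two_pow _ hk') e] at hkV
        exact hkV hk'
      rw [z i hi hiV, z j hj hjV, mul_zero]

open Classical in
/-- The rejection probabilities of the pair tests bound the quadratic form of the Laplacian. -/
theorem sum_adj_le (h : I.Implements V G) (f : ℕ → ℂ) :
    ∑ v : V, ∑ u : V, (if G.graph.Adj v u then 1 / 4 * ‖f v - G.edgeSign v u * f u‖ ^ 2 else 0) ≤
      ∑ l ∈ Finset.range I.S, ∑ m ∈ Finset.range I.S,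
        ∑ i ∈ V with I.Flagged l m i, 1 / 4 * ‖f i - I.sg i l * f (I.adjValue i l)‖ ^ 2 := by
  -- Each oriented edge receives a pair of positions at which its ends list each other. Only one
  -- such pair is needed; flagged triples beyond these increase the right-hand side.
  have pos : ∀ p : V × V, ∃ q : ℕ × ℕ, G.graph.Adj p.1 p.2 → q.1 < I.S ∧ q.2 < I.S ∧
      I.adjValue p.1 q.1 = p.2 ∧ I.adjValue p.2 q.2 = p.1 := by
    intro p
    by_cases hp : G.graph.Adj p.1 p.2
    · obtain ⟨l, hl, h1⟩ := h.exists_position hp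
      obtain ⟨m, hm, h2⟩ := h.exists_position hp.symm
      exact ⟨(l, m), fun _ => ⟨hl, hm, h1, h2⟩⟩
    · exact ⟨(0, 0), fun h => absurd h hp⟩
  choose q hq using pos
  set g : ℕ × ℕ × ℕ → ℝ := fun t => if I.Flagged t.1 t.2.1 t.2.2 then
    1 / 4 * ‖f t.2.2 - I.sg t.2.2 t.1 * f (I.adjValue t.2.2 t.1)‖ ^ 2 else 0 with hg
  have rhs : ∑ l ∈ Finset.range I.S, ∑ m ∈ Finset.range I.S,
      ∑ i ∈ V with I.Flagged l m i, 1 / 4 * ‖f i - I.sg i l * f (I.adjValue i l)‖ ^ 2 =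
      ∑ t ∈ Finset.range I.S ×ˢ Finset.range I.S ×ˢ V, g t := by
    rw [Finset.sum_product]
    refine Finset.sum_congr rfl fun l _ => ?_
    rw [Finset.sum_product]
    refine Finset.sum_congr rfl fun m _ => ?_
    rw [Finset.sum_filter]
  set φ : V × V → ℕ × ℕ × ℕ := fun p => ((q p).1, (q p).2, (p.1 : ℕ)) with hφ
  set P : Finset (V × V) := Finset.univ.filter fun p => G.graph.Adj p.1 p.2 with hP
  have adj : ∀ p ∈ P, G.graph.Adj p.1 p.2 := fun p hp => (Finset.mem_filter.1 hp).2
  have lhs : ∑ v : V, ∑ u : V, (if G.graph.Adj v u then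
      1 / 4 * ‖f v - G.edgeSign v u * f u‖ ^ 2 else 0) = ∑ p ∈ P, g (φ p) := by
    rw [← Fintype.sum_prod_type', hP, ← Finset.sum_filter]
    refine Finset.sum_congr rfl fun p hp => ?_
    have hp' := adj p hp
    obtain ⟨h1, h2, h3, h4⟩ := hq p hp'
    have fl : I.Flagged (q p).1 (q p).2 (p.1 : ℕ) :=
      ⟨(h.vertex_range _ p.1.2).1.ne', by rw [h3]; exact (h.vertex_range _ p.2.2).1.ne', by rw [h3, h4]⟩
    simp only [hg, hφ]
    rw [if_pos fl, h3, h.sg_eq hp' h1 h3]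
  rw [rhs, lhs, ← Finset.sum_image (f := g) (g := φ)]
  · refine Finset.sum_le_sum_of_subset_of_nonneg ?_ fun t _ _ => ?_
    · intro t ht
      obtain ⟨p, hp, rfl⟩ := Finset.mem_image.1 ht
      obtain ⟨h1, h2, -, -⟩ := hq p (adj p hp)
      simp only [hφ, Finset.mem_product, Finset.mem_range]
      exact ⟨h1, h2, p.1.2⟩
    · simp only [hg]
      split_ifs <;> positivity
  -- The beginning of an edge and the position of its end determine the end, so different oriented
  -- edges give different triples.
  · intro p hp p' hp' e
    simp only [hφ, Prod.mk.injEq] at e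
    have e1 : p.1 = p'.1 := Subtype.ext e.2.2
    have h3 := (hq p (adj p hp)).2.2.1
    have h3' := (hq p' (adj p' hp')).2.2.1
    refine Prod.ext e1 (Subtype.ext ?_)
    rw [← h3, ← h3', e1, e.1]

open Classical in
-- The Laplacian is real, so the bound applies to real and imaginary parts separately. The constant
-- μ/2 is a quarter of the 2μ belonging to the sum over both orientations.
theorem mul_sum_le_of_isSmallestEigenvalue {μ : ℝ} (hμ : G.IsSmallestEigenvalue μ) (f : ℕ → ℂ) :
    μ / 2 * ∑ i ∈ V, ‖f i‖ ^ 2 ≤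
      ∑ v : V, ∑ u : V, (if G.graph.Adj v u then 1 / 4 * ‖f v - G.edgeSign v u * f u‖ ^ 2 else 0) := by
  have h1 := hμ.le fun v => (f v).re
  have h2 := hμ.le fun v => (f v).im
  have e : ∀ z : ℂ, ‖z‖ ^ 2 = z.re ^ 2 + z.im ^ 2 := by
    intro z
    rw [Complex.sq_norm, Complex.normSq_apply]
    ring
  have e' : ∀ v u : V, (if G.graph.Adj v u then 1 / 4 * ‖f v - G.edgeSign v u * f u‖ ^ 2 else 0) =
      1 / 4 * ((if G.graph.Adj v u then ((f v).re - G.edgeSign v u * (f u).re) ^ 2 else 0) +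
      (if G.graph.Adj v u then ((f v).im - G.edgeSign v u * (f u).im) ^ 2 else 0)) := by
    intro v u
    split_ifs
    · rw [e]
      simp
    · simp
  simp only [e', ← Finset.mul_sum, Finset.sum_add_distrib]
  rw [← Finset.sum_coe_sort V]
  simp only [e, Finset.sum_add_distrib]
  linarith

/-- If there is no balanced component, then every round of tests decreases the norm. -/
theorem nsq_testProjs_rounds_le {X : ℕ} (h : I.Implements V G) (hf : I.Fits X) {μ ε : ℝ}
    (hμ : G.IsSmallestEigenvalue μ) (hε : ε ≤ μ / 2) (hε1 : ε ≤ 1) (R : ℕ)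
    (ψ : QState (11 * X)) :
    nsq (testProjs (11 * X) (List.replicate R (I.roundTests X)).flatten ψ) ≤
      (1 - ε / (I.S : ℝ) ^ 4) ^ R * nsq ψ := by
  have hS : (1 : ℝ) ≤ (I.S : ℝ) ^ 4 := one_le_pow₀ (by exact_mod_cast (by have := hf.two_le_S; omega))
  refine nsq_testProjs_iterate_le ?_ (fun ψ => nsq_testProjs_roundTests_le hf h.n_pos h.lt_two_pow
    h.mem_iff (fun f => ?_) (hε1.trans hS) ψ) R ψ
  · rw [sub_nonneg, div_le_one (by linarith)]
    exact hε1.trans hS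
  · refine le_trans ?_ (h.sum_adj_le f)
    refine le_trans (mul_le_mul_of_nonneg_right hε ?_) (mul_sum_le_of_isSmallestEigenvalue hμ f)
    exact Finset.sum_nonneg fun _ _ => by positivity

end Implements

end Input

end QMABalance

namespace QMABalance

open Function

/-! ### The command that emits the tests -/

namespace Fld

/-- A register. -/
def reg (r : DReg) : Fld DReg := ⟨0, [r]⟩

/-- A constant. -/
def const (c : ℕ) : Fld DReg := ⟨c, []⟩

def add (f g : Fld DReg) : Fld DReg := ⟨f.c + g.c, f.rs ++ g.rs⟩

/-- The number of a bit in a block, shifted by one for the output qubit. -/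
def qubit (a : Blk) (f : Fld DReg) : Fld DReg :=
  ⟨1 + (11 * f.c + a.num), f.rs.flatMap fun r => List.replicate 11 r⟩

variable (len : DReg → ℕ)

@[simp] theorem val_reg (r : DReg) : (reg r).val len = len r := by simp [reg, val]

@[simp] theorem val_const (c : ℕ) : (const c).val len = c := by simp [const, val]

@[simp] theorem val_add (f g : Fld DReg) : (add f g).val len = f.val len + g.val len := by
  simp only [add, val, List.map_append, List.sum_append]
  omega

@[simp] theorem val_qubit (a : Blk) (f : Fld DReg) : (qubit a f).val len = 1 + loc a (f.val len) := by
  obtain ⟨c, rs⟩ := f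
  simp only [qubit, val, loc]
  have : ((rs.flatMap fun r => List.replicate 11 r).map len).sum = 11 * (rs.map len).sum := by
    induction rs with
    | nil => rfl
    | cons r rs ih =>
      rw [List.flatMap_cons, List.map_append, List.sum_append, ih]
      simp
      ring
  rw [this]
  ring

end Fld

@[simp] theorem Env.len_set (e : Env) (r q : DReg) (n : ℕ) :
    (e.set r n).len q = if q = r then n else e.len q := by
  by_cases h : q = r
  · subst h; simp [Env.len, Env.set]
  · simp [Env.len, Env.set, h]

/-- The registers of a field are not changed by the innermost loops. -/
def Fld.Stable (f : Fld DReg) : Prop := ∀ r ∈ f.rs, r ≠ .idx 3 ∧ r ≠ .arg 3 ∧ r ≠ .arg' 3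

theorem Fld.Stable.val_set {f : Fld DReg} (hf : f.Stable) (e : Env) {r : DReg}
    (hr : r = .idx 3 ∨ r = .arg 3 ∨ r = .arg' 3) (n : ℕ) : f.val (e.set r n).len = f.val e.len := by
  simp only [Fld.val]
  congr 2
  refine List.map_congr_left fun q hq => ?_
  rw [Env.len_set, if_neg]
  rintro rfl
  have := hf q hq
  tauto

namespace Cmd

/-- The items for classical gates. -/
def gateItems (Ps : List MGate) : List Item := Ps.map fun g => .gate g.toQ.shift

theorem gateItems_append (Ps Qs : List MGate) : gateItems (Ps ++ Qs) = gateItems Ps ++ gateItems Qs := by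
  simp [gateItems]

theorem gateItems_flatMap (l : List ℕ) (f : ℕ → List MGate) :
    gateItems (l.flatMap f) = l.flatMap fun k => gateItems (f k) := by
  simp [gateItems, List.map_flatMap]

def x (a : Blk) (f : Fld DReg) : Cmd := .gate (.x (.qubit a f))

def cnot (a : Blk) (f : Fld DReg) (b : Blk) (g : Fld DReg) : Cmd :=
  .gate (.cnot (.qubit a f) (.qubit b g))

def ccx (a : Blk) (f : Fld DReg) (b : Blk) (g : Fld DReg) (d : Blk) (h : Fld DReg) : Cmd :=
  .gate (.ccx (.qubit a f) (.qubit b g) (.qubit d h))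

variable (e : Env)

theorem sem_x (a : Blk) (f : Fld DReg) : (x a f).sem e = gateItems [.x a (f.val e.len)] := by
  simp [x, sem, gateItems, GateF.toQ, MGate.toQ, QGate.shift]

theorem sem_cnot (a : Blk) (f : Fld DReg) (b : Blk) (g : Fld DReg) :
    (cnot a f b g).sem e = gateItems [.cnot a (f.val e.len) b (g.val e.len)] := by
  simp [cnot, sem, gateItems, GateF.toQ, MGate.toQ, QGate.shift]

theorem sem_ccx (a : Blk) (f : Fld DReg) (b : Blk) (g : Fld DReg) (d : Blk) (h : Fld DReg) :
    (ccx a f b g d h).sem e =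
      gateItems [.ccx a (f.val e.len) b (g.val e.len) d (h.val e.len)] := by
  simp [ccx, sem, gateItems, GateF.toQ, MGate.toQ, QGate.shift]

/-- The loop variable of the innermost loop. -/
def pos : Fld DReg := .reg (.idx 3)

def copyBits (a b : Blk) (off : Fld DReg) (r : DReg) : Cmd :=
  .forNats 3 r (cnot a (.reg (.arg 3)) b (off.add pos))

theorem sem_copyBits (a b : Blk) {off : Fld DReg} (h : off.Stable) (r : DReg) :
    (copyBits a b off r).sem e =
      gateItems (QMABalance.copyBits a b (off.val e.len) 0 (parseNats (e r)).1) := by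
  have main : ∀ (ns : List ℕ) (k : ℕ), natsSem e 3 (cnot a (.reg (.arg 3)) b (off.add pos)).sem k ns =
      gateItems (QMABalance.copyBits a b (off.val e.len) k ns) := by
    intro ns
    induction ns with
    | nil => intro k; rfl
    | cons n ns ih =>
      intro k
      rw [natsSem, ih, sem_cnot, QMABalance.copyBits]
      simp [gateItems, pos, h.val_set]
  exact main _ 0

def copyRange (a b : Blk) (off f : Fld DReg) : Cmd := .forLen 3 f (cnot a pos b (off.add pos))

theorem sem_copyRange (a b : Blk) {off : Fld DReg} (h : off.Stable) (f : Fld DReg) :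
    (copyRange a b off f).sem e =
      gateItems (QMABalance.copyRange a b (off.val e.len) (f.val e.len)) := by
  rw [copyRange, sem, QMABalance.copyRange, gateItems_flatMap]
  refine List.flatMap_congr fun k _ => ?_
  simp [sem_cnot, pos, h.val_set]

def chain (a d : Blk) (f : Fld DReg) : Cmd :=
  .seq (x d (.const 0)) (.forLen 3 f (.seq (x a pos) (.seq (ccx d pos a pos d (pos.add (.const 1)))
    (x a pos))))

theorem sem_chain (a d : Blk) (f : Fld DReg) :
    (chain a d f).sem e = gateItems (QMABalance.chain a d (f.val e.len)) := by
  rw [chain, sem, sem, QMABalance.chain, ← List.singleton_append, gateItems_append, gateItems_flatMap,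
    sem_x, Fld.val_const]
  congr 1
  refine List.flatMap_congr fun k _ => ?_
  simp only [sem, sem_x, sem_ccx, ← gateItems_append]
  simp [pos]

def loadIndex (a b : Blk) (off f : Fld DReg) : Cmd :=
  .forBits 3 f (.seq (x a (off.add pos)) (.seq (cnot .c (.const 0) a (off.add pos))
    (cnot .c (.const 0) b (off.add pos))))

theorem sem_loadIndex (a b : Blk) {off : Fld DReg} (h : off.Stable) (f : Fld DReg) :
    (loadIndex a b off f).sem e =
      gateItems (QMABalance.loadIndex a b (off.val e.len) (f.val e.len)) := by
  rw [loadIndex, sem, QMABalance.loadIndex, gateItems_flatMap]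
  refine List.flatMap_congr fun k _ => ?_
  split_ifs
  · simp only [sem, sem_x, sem_cnot, ← gateItems_append]
    simp [pos, h.val_set]
  · rfl

def swapBits (a b : Blk) (f : Fld DReg) : Cmd :=
  .forLen 3 f (.seq (cnot b pos a pos) (.seq (ccx .c (.const 0) a pos b pos) (cnot b pos a pos)))

theorem sem_swapBits (a b : Blk) (f : Fld DReg) :
    (swapBits a b f).sem e = gateItems (QMABalance.swapBits a b (f.val e.len)) := by
  rw [swapBits, sem, QMABalance.swapBits, gateItems_flatMap]
  refine List.flatMap_congr fun k _ => ?_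
  simp only [sem, sem_ccx, sem_cnot, ← gateItems_append]
  simp [pos]

def evalGates (a : Blk) (f : Fld DReg) (r : DReg) : Cmd :=
  .forGates 3 r
    (.seq (cnot a (.reg (.arg 3)) a (f.add pos)) (x a (f.add pos)))
    (.seq (cnot a (.reg (.arg' 3)) .t (.const 0)) (.seq
      (ccx a (.reg (.arg 3)) .t (.const 0) a (f.add pos)) (cnot a (.reg (.arg' 3)) .t (.const 0))))
    (.seq (cnot a (.reg (.arg 3)) a (f.add pos)) (.seq (cnot a (.reg (.arg' 3)) a (f.add pos))
      (.seq (cnot a (.reg (.arg' 3)) .t (.const 0)) (.seq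
      (ccx a (.reg (.arg 3)) .t (.const 0) a (f.add pos)) (cnot a (.reg (.arg' 3)) .t (.const 0))))))

theorem sem_evalGates (a : Blk) {f : Fld DReg} (h : f.Stable) (r : DReg) :
    (evalGates a f r).sem e =
      gateItems (QMABalance.evalGates a (f.val e.len) 0 (parseGates (e r)).1) := by
  suffices main : ∀ (gs : List BoolGate) (k : ℕ), gatesSem e 3
      (.seq (cnot a (.reg (.arg 3)) a (f.add pos)) (x a (f.add pos)) : Cmd).sem
      (.seq (cnot a (.reg (.arg' 3)) .t (.const 0)) (.seq
        (ccx a (.reg (.arg 3)) .t (.const 0) a (f.add pos)) (cnot a (.reg (.arg' 3)) .t (.const 0))) : Cmd).sem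
      (.seq (cnot a (.reg (.arg 3)) a (f.add pos)) (.seq (cnot a (.reg (.arg' 3)) a (f.add pos))
        (.seq (cnot a (.reg (.arg' 3)) .t (.const 0)) (.seq
        (ccx a (.reg (.arg 3)) .t (.const 0) a (f.add pos)) (cnot a (.reg (.arg' 3)) .t (.const 0))))) : Cmd).sem
      k gs = gateItems (QMABalance.evalGates a (f.val e.len) k gs) from main _ 0
  intro gs
  induction gs with
  | nil => intro k; rfl
  | cons g gs ih =>
    intro k
    rw [gatesSem, ih, QMABalance.evalGates, gateItems_append]
    congr 1
    cases g <;> simp only [gateSem, sem, sem_x, sem_ccx, sem_cnot, ← gateItems_append, evalGate] <;>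
      simp [pos, h.val_set]

/-- Emit commands one after the other. -/
def seqs : List Cmd → Cmd
  | [] => .nop
  | c :: cs => .seq c (seqs cs)

def vertexGates : Cmd :=
  seqs [evalGates .A (.reg .adjIn) .adjGates, copyRange .A .B (.const 0) (.reg .bits),
    x .B (.reg .bits), evalGates .B (.reg .adjIn) .adjGates, copyBits .A .D (.const 0) .adjOuts,
    copyBits .B .D (.reg .bits) .adjOuts, x .D (.reg .bits),
    chain .D .Z ((Fld.reg .bits).add (.reg .bits)), x .Z ((Fld.reg .bits).add (.reg .bits))]

def edgeGates : Cmd :=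
  seqs [loadIndex .A .B (.reg .bits) (.reg (.idx 1)), loadIndex .B .A (.reg .bits) (.reg (.idx 2)),
    evalGates .A (.reg .adjIn) .adjGates, copyBits .A .B (.const 0) .adjOuts,
    evalGates .B (.reg .adjIn) .adjGates, swapBits .A .B (.reg .len)]

def compareGates : Cmd :=
  seqs [copyBits .A .D (.const 0) .adjOuts, copyRange .B .D (.const 0) (.reg .bits),
    copyBits .B .D (.reg .bits) .adjOuts, copyRange .A .D (.reg .bits) (.reg .bits),
    chain .A .Y (.reg .bits), chain .B .Y' (.reg .bits),
    cnot .Y (.reg .bits) .D ((Fld.reg .bits).add (.reg .bits)),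
    cnot .Y' (.reg .bits) .D (((Fld.reg .bits).add (.reg .bits)).add (.const 1)),
    chain .D .Z (((Fld.reg .bits).add (.reg .bits)).add (.const 2)),
    copyRange .A .C (.const 0) (.reg .adjIn), evalGates .C (.reg .sgnIn) .sgnGates,
    copyBits .C .s (.const 0) .sgnOuts]

def decideGates : Cmd :=
  seqs [cnot .s (.const 0) .c (.const 0),
    ccx .Z (((Fld.reg .bits).add (.reg .bits)).add (.const 2)) .c (.const 0) .r (.const 0),
    x .r (.const 0)]

def markBit (a : Blk) (f : Fld DReg) : Cmd := .mark (.qubit a f)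

def zeroTest (a : Blk) (f : Fld DReg) : Cmd := .seq (x a f) (markBit a f)

def zeroTests : Cmd :=
  .seq (.forLen 3 (.reg .len) (seqs ([Blk.B, .C, .D, .Z, .Y, .Y', .c, .t, .s, .r].map fun a =>
    zeroTest a pos))) (.forLen 3 (.reg .free) (zeroTest .A ((Fld.reg .bits).add pos)))

def vertexTest : Cmd := .seq vertexGates (markBit .Z ((Fld.reg .bits).add (.reg .bits)))

def pairTest : Cmd :=
  seqs [.gate (.h (.qubit .c (.const 0))), edgeGates, compareGates, .gate (.h (.qubit .c (.const 0))),
    decideGates, markBit .r (.const 0)]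

/-- One round of tests. -/
def roundTests : Cmd :=
  .seq zeroTests (.seq vertexTest (.forLen 1 (.reg .deg) (.forLen 2 (.reg .deg) pairTest)))

/-- All tests. -/
def allTests : Cmd := .forLen 0 (.reg .rounds) roundTests

/-- Level 0 counts the rounds, levels 1 and 2 carry the positions l and m of a pair test, and all
innermost loops share level 3. -/
theorem wf_allTests : allTests.WF 0 := by
  refine ⟨Nat.zero_le _, ⟨?_, ?_, ?_⟩⟩
  · simp [zeroTests, zeroTest, markBit, seqs, WF, x]
  · simp [vertexTest, vertexGates, markBit, seqs, WF, x, cnot, ccx, evalGates, copyBits, copyRange,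
      chain]
  · simp [pairTest, edgeGates, compareGates, decideGates, markBit, seqs, WF, x, cnot, ccx, evalGates,
      copyBits, copyRange, chain, loadIndex, swapBits]

end Cmd

/-- The registers describe an input. -/
structure Env.Reads (e : Env) (I : Input) (X : ℕ) : Prop where
  len : e.len .len = X
  bits : e.len .bits = I.n
  deg : e.len .deg = I.S
  adjIn : e.len .adjIn = I.adj.numInputs
  adjGates : (parseGates (e .adjGates)).1 = I.adj.gates
  adjOuts : (parseNats (e .adjOuts)).1 = I.adj.outputs
  sgnIn : e.len .sgnIn = I.sgn.numInputs
  sgnGates : (parseGates (e .sgnGates)).1 = I.sgn.gates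
  sgnOuts : (parseNats (e .sgnOuts)).1 = I.sgn.outputs
  free : e.len .free = X - I.n

namespace Env.Reads

variable {e : Env} {I : Input} {X : ℕ}

theorem set_idx (h : e.Reads I X) (i : Fin 4) (n : ℕ) : (e.set (.idx i) n).Reads I X := by
  have : ∀ r : DReg, r ≠ .idx i → (e.set (.idx i) n) r = e r := fun r hr => by simp [Env.set, hr]
  have l : ∀ r : DReg, r ≠ .idx i → (e.set (.idx i) n).len r = e.len r := fun r hr => by simp [hr]
  exact ⟨(l _ (by simp)).trans h.len, (l _ (by simp)).trans h.bits, (l _ (by simp)).trans h.deg,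
    (l _ (by simp)).trans h.adjIn, by rw [this _ (by simp), h.adjGates],
    by rw [this _ (by simp), h.adjOuts], (l _ (by simp)).trans h.sgnIn,
    by rw [this _ (by simp), h.sgnGates], by rw [this _ (by simp), h.sgnOuts],
    (l _ (by simp)).trans h.free⟩

theorem stable_const (c : ℕ) : (Fld.const c).Stable := by intro r hr; simp [Fld.const] at hr

theorem stable_bits : (Fld.reg .bits).Stable := by
  intro r hr; simp only [Fld.reg, List.mem_singleton] at hr; subst hr; simp

theorem stable_adjIn : (Fld.reg .adjIn).Stable := by
  intro r hr; simp only [Fld.reg, List.mem_singleton] at hr; subst hr; simp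

theorem stable_sgnIn : (Fld.reg .sgnIn).Stable := by
  intro r hr; simp only [Fld.reg, List.mem_singleton] at hr; subst hr; simp

open Cmd

theorem sem_vertexGates (h : e.Reads I X) : Cmd.vertexGates.sem e = gateItems I.vertexGates := by
  simp only [Cmd.vertexGates, seqs, sem, Input.vertexGates, gateItems_append, sem_evalGates e _ stable_adjIn,
    sem_copyRange e _ _ (stable_const _), sem_x, sem_copyBits e _ _ (stable_const _),
    sem_copyBits e _ _ stable_bits, sem_chain, Fld.val_reg, Fld.val_const, Fld.val_add, h.bits, h.adjIn,
    h.adjGates, h.adjOuts, List.append_nil, two_mul]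

theorem sem_edgeGates (h : e.Reads I X) : Cmd.edgeGates.sem e =
    gateItems (I.edgeGates X (e.len (.idx 1)) (e.len (.idx 2))) := by
  simp only [Cmd.edgeGates, seqs, sem, Input.edgeGates, gateItems_append, sem_evalGates e _ stable_adjIn,
    sem_loadIndex e _ _ stable_bits, sem_copyBits e _ _ (stable_const _), sem_swapBits, Fld.val_reg,
    Fld.val_const, h.bits, h.adjIn, h.adjGates, h.adjOuts, h.len, List.append_nil]

theorem sem_compareGates (h : e.Reads I X) : Cmd.compareGates.sem e = gateItems I.compareGates := by
  have e2 : ∀ a b : MGate, gateItems [a, b] = gateItems [a] ++ gateItems [b] := fun _ _ => rfl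
  simp only [Cmd.compareGates, seqs, sem, Input.compareGates, gateItems_append,
    sem_evalGates e _ stable_sgnIn, sem_copyRange e _ _ (stable_const _), sem_copyRange e _ _ stable_bits,
    sem_cnot, sem_copyBits e _ _ (stable_const _), sem_copyBits e _ _ stable_bits, sem_chain,
    Fld.val_reg, Fld.val_const, Fld.val_add, h.bits, h.adjIn, h.sgnIn, h.sgnGates, h.sgnOuts, h.adjOuts,
    List.append_nil, two_mul, e2, List.append_assoc]

theorem sem_decideGates (h : e.Reads I X) : Cmd.decideGates.sem e = gateItems I.decideGates := by
  have e2 : ∀ a b c : MGate, gateItems [a, b, c] = gateItems [a] ++ (gateItems [b] ++ gateItems [c]) :=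
    fun _ _ _ => rfl
  simp only [Cmd.decideGates, seqs, sem, Input.decideGates, sem_cnot, sem_ccx, sem_x,
    Fld.val_reg, Fld.val_const, Fld.val_add, h.bits, List.append_nil, two_mul, e2]

/-- The items of tests whose qubits are shifted by one. -/
def _root_.QMABalance.shiftItems (Ts : List (List QGate × ℕ)) : List Item := testItems (Ts.map shiftTest)

theorem shiftItems_append (Ts Ts' : List (List QGate × ℕ)) :
    shiftItems (Ts ++ Ts') = shiftItems Ts ++ shiftItems Ts' := by
  simp [shiftItems, testItems]

theorem shiftItems_cons (T : List QGate × ℕ) (Ts : List (List QGate × ℕ)) :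
    shiftItems (T :: Ts) = shiftItems [T] ++ shiftItems Ts := shiftItems_append [T] Ts

theorem shiftItems_flatMap (l : List ℕ) (f : ℕ → List (List QGate × ℕ)) :
    shiftItems (l.flatMap f) = l.flatMap fun k => shiftItems (f k) := by
  induction l with
  | nil => rfl
  | cons k l ih => rw [List.flatMap_cons, shiftItems_append, ih, List.flatMap_cons]

theorem shiftItems_map (l : List ℕ) (f : ℕ → List QGate × ℕ) :
    shiftItems (l.map f) = l.flatMap fun k => shiftItems [f k] := by
  rw [← shiftItems_flatMap]
  congr 1
  induction l with
  | nil => rfl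
  | cons k l ih => simp [ih]

theorem sem_markBit (a : Blk) (f : Fld DReg) : (markBit a f).sem e = [.mark (1 + loc a (f.val e.len))] := by
  simp [markBit, sem]

theorem sem_zeroTest (a : Blk) (f : Fld DReg) :
    (Cmd.zeroTest a f).sem e = shiftItems [QMABalance.zeroTest a (f.val e.len)] := by
  simp [Cmd.zeroTest, sem, sem_x, sem_markBit, shiftItems, testItems, shiftTest, QMABalance.zeroTest,
    gateItems, MGate.toQ]

theorem sem_zeroTests (h : e.Reads I X) : Cmd.zeroTests.sem e = shiftItems (I.zeroTests X) := by
  have hs : ∀ (bs : List Blk) (f : Fld DReg) (e : Env), (seqs (bs.map fun a => Cmd.zeroTest a f)).sem e =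
      shiftItems (bs.map fun a => QMABalance.zeroTest a (f.val e.len)) := by
    intro bs f e
    induction bs with
    | nil => rfl
    | cons a bs ih =>
      rw [List.map_cons, seqs, sem, ih, List.map_cons, shiftItems_cons, sem_zeroTest]
  rw [Cmd.zeroTests, sem, sem, sem, Input.zeroTests, shiftItems_append, shiftItems_flatMap,
    shiftItems_map, Fld.val_reg, Fld.val_reg, h.len, h.free]
  refine congrArg₂ (· ++ ·) ?_ ?_
  · refine List.flatMap_congr fun k _ => ?_
    rw [hs]
    simp [pos]
  · refine List.flatMap_congr fun k _ => ?_
    rw [sem_zeroTest, Fld.val_add, Fld.val_reg]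
    simp [pos, h.bits]

theorem sem_vertexTest (h : e.Reads I X) : Cmd.vertexTest.sem e = shiftItems [I.vertexTest] := by
  rw [Cmd.vertexTest, sem, h.sem_vertexGates, sem_markBit, Fld.val_add, Fld.val_reg, h.bits]
  simp [shiftItems, testItems, shiftTest, Input.vertexTest, gateItems, two_mul]

theorem sem_pairTest (h : e.Reads I X) : Cmd.pairTest.sem e =
    shiftItems [I.pairTest X (e.len (.idx 1)) (e.len (.idx 2))] := by
  rw [Cmd.pairTest]
  simp only [seqs, sem, h.sem_edgeGates, h.sem_compareGates, h.sem_decideGates, sem_markBit]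
  have hh : ∀ a, (QGate.h a).shift = .h (1 + a) := fun _ => rfl
  simp [shiftItems, testItems, shiftTest, Input.pairTest, gateItems, GateF.toQ, hh, Function.comp_def]

/-- The loop counters of levels 1 and 2 are the positions of the pair test; overwriting counters
does not affect the registers that describe the input. -/
theorem sem_roundTests (h : e.Reads I X) : Cmd.roundTests.sem e = shiftItems (I.roundTests X) := by
  rw [Cmd.roundTests, sem, sem, h.sem_zeroTests, h.sem_vertexTest, Input.roundTests, shiftItems_append,
    shiftItems_cons I.vertexTest (List.flatMap _ _), shiftItems_flatMap, sem, Fld.val_reg, h.deg]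
  refine congrArg (shiftItems _ ++ ·) (congrArg (shiftItems _ ++ ·) ?_)
  refine List.flatMap_congr fun l _ => ?_
  rw [sem, shiftItems_map, Fld.val_reg, (h.set_idx 1 l).deg]
  refine List.flatMap_congr fun m _ => ?_
  rw [((h.set_idx 1 l).set_idx 2 m).sem_pairTest]
  simp

theorem sem_allTests (h : e.Reads I X) : Cmd.allTests.sem e =
    shiftItems (List.replicate (e.len .rounds) (I.roundTests X)).flatten := by
  rw [Cmd.allTests, sem, Fld.val_reg]
  have : ∀ (R j : ℕ), ((List.range' j R).flatMap fun k => Cmd.roundTests.sem (e.set (.idx 0) k)) =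
      shiftItems (List.replicate R (I.roundTests X)).flatten := by
    intro R
    induction R with
    | zero => intro j; rfl
    | succ R ih =>
      intro j
      rw [List.range'_succ, List.flatMap_cons, ih, List.replicate_succ, List.flatten_cons,
        shiftItems_append, (h.set_idx 0 j).sem_roundTests]
  exact this _ 0

end Env.Reads

/-- The input that is read off an arbitrary bit string. -/
def parseInput (x : List Bool) : Input where
  n := (parseNat x).1
  S := (parseNat (restBits x)).1
  adj := ⟨(parseNat (restDeg x)).1, (parseGates (restAdjIn x)).1, (parseNats (restAdjGates x)).1⟩
  sgn := ⟨(parseNat (restAdjOuts x)).1, (parseGates (restSgnIn x)).1, (parseNats (restSgnGates x)).1⟩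

theorem reads_inputEnv (k : ℕ) (x : List Bool) : (inputEnv k x).Reads (parseInput x) x.length := by
  constructor <;> simp [Env.len, inputEnv, parseInput]

/-- The verifier is defined on all strings through the parsers; this identity ensures that on an
encoding it runs the tests of the encoded input. -/
theorem parseInput_encInput (I : Input) : parseInput (encInput I) = I := by
  obtain ⟨n, S, ⟨i, g, o⟩, ⟨i', g', o'⟩⟩ := I
  have h := parseNats_encList o' []
  rw [List.append_nil] at h
  simp [parseInput, encInput, encBoolCircuit, restBits, restDeg, restAdjIn, restAdjGates, restAdjOuts,
    restSgnIn, restSgnGates, parseNat_encNat, parseGates_encList, parseNats_encList, h]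

/-- The tests for an input. -/
def inputTests (k : ℕ) (x : List Bool) : List (List QGate × ℕ) :=
  (List.replicate (x.length ^ k) ((parseInput x).roundTests x.length)).flatten

theorem polyTime_inputTests (k : ℕ) :
    Nonempty (Turing.TM2ComputableInPolyTime (id : List Bool → List Bool) encQCircuit
      fun x => testCircuit (11 * x.length) ((inputTests k x).map shiftTest)) :=
  polyTime_testCircuit k Cmd.allTests Cmd.wf_allTests _ fun x => by
    rw [(reads_inputEnv k x).sem_allTests, inputTests, shiftItems]
    simp [Env.len, inputEnv]

end QMABalance

namespace QMABalance

/-! ### The number of rounds -/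

/-- An inverse polynomial is bounded from below at all arguments. -/
theorem IsInvPolyBounded.exists_le {δ : ℕ → ℝ} (h : IsInvPolyBounded δ) :
    ∃ c > 0, ∃ κ : ℕ, ∀ n : ℕ, c / ((n : ℝ) + 1) ^ κ ≤ min (δ n / 2) 1 := by
  obtain ⟨hpos, κ, hO⟩ := h
  obtain ⟨C, hC, hb⟩ := hO.exists_pos
  obtain ⟨N, hN⟩ := eventually_atTop.1 hb.bound
  have hm : ∀ n, 0 < min (δ n / 2) 1 := fun n => lt_min (half_pos (hpos n)) one_pos
  -- The asymptotic bound holds only from N on; the finitely many smaller arguments are covered by a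
  -- minimum of positive numbers.
  obtain ⟨c₁, hc₁, hlow⟩ : ∃ c₁ > 0, ∀ n ∈ Finset.range (N + 1), c₁ ≤ min (δ n / 2) 1 := by
    obtain ⟨n₀, -, h₀⟩ := Finset.exists_min_image (Finset.range (N + 1)) (fun n => min (δ n / 2) 1)
      ⟨0, by simp⟩
    exact ⟨_, hm n₀, h₀⟩
  -- The constant c₁ serves small n, 1/(2C) serves δ/2 for large n, and 1 serves the cap in the
  -- minimum.
  refine ⟨min c₁ (min (1 / (2 * C)) 1), by positivity, κ, fun n => ?_⟩
  have h1 : (1 : ℝ) ≤ ((n : ℝ) + 1) ^ κ := one_le_pow₀ (by linarith [n.cast_nonneg (α := ℝ)])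
  rw [div_le_iff₀ (by linarith)]
  by_cases hn : n < N + 1
  · have := hlow n (Finset.mem_range.2 hn)
    calc _ ≤ c₁ := min_le_left _ _
      _ ≤ min (δ n / 2) 1 := this
      _ ≤ _ := le_mul_of_one_le_right (hm n).le h1
  · have hb := hN n (by omega)
    have hn0 : (0 : ℝ) < n := by exact_mod_cast (by omega : 0 < n)
    rw [Real.norm_of_nonneg (by positivity), Real.norm_of_nonneg (hpos n).le,
      div_le_iff₀ (by positivity)] at hb
    have h2 : (n : ℝ) ^ κ ≤ ((n : ℝ) + 1) ^ κ := pow_le_pow_left₀ hn0.le (by linarith) κ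
    rcases min_choice (δ n / 2) 1 with e | e <;> rw [e]
    · refine ((min_le_right _ _).trans (min_le_left _ _)).trans ?_
      rw [div_le_iff₀ (by positivity)]
      calc (1 : ℝ) ≤ C * δ n * (n : ℝ) ^ κ := hb
        _ ≤ C * δ n * ((n : ℝ) + 1) ^ κ :=
          mul_le_mul_of_nonneg_left h2 (mul_nonneg hC.le (hpos n).le)
        _ = _ := by ring
    · rw [one_mul]
      exact ((min_le_right _ _).trans (min_le_right _ _)).trans h1

/-- Polynomially many rounds suffice. -/
theorem IsInvPolyBounded.exists_rounds {δ : ℕ → ℝ} (h : IsInvPolyBounded δ) :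
    ∃ k : ℕ, ∀ n S X : ℕ, n + 1 ≤ X → S ≤ X → 2 ≤ X → 0 < S →
      (1 - min (δ n / 2) 1 / (S : ℝ) ^ 4) ^ X ^ k ≤ 1 / 3 := by
  obtain ⟨c, hc, κ, hκ⟩ := h.exists_le
  obtain ⟨j, hj⟩ := pow_unbounded_of_one_lt (2 / c) (one_lt_two : (1 : ℝ) < 2)
  -- In the exponent, X ^ κ outweighs the decay of the gap, X ^ 4 the factor S ^ 4, and X ^ j the
  -- constant 2 / c.
  refine ⟨κ + 4 + j, fun n S X hn hS hX hS0 => ?_⟩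
  set ε := min (δ n / 2) 1 with hε
  have hεc := hκ n
  rw [← hε] at hεc
  have hε1 : ε ≤ 1 := min_le_right _ _
  have hSpos : (1 : ℝ) ≤ (S : ℝ) ^ 4 := one_le_pow₀ (by exact_mod_cast hS0)
  have hXn : ((n : ℝ) + 1) ^ κ ≤ (X : ℝ) ^ κ := pow_le_pow_left₀ (by positivity) (by exact_mod_cast hn) κ
  have hXS : (S : ℝ) ^ 4 ≤ (X : ℝ) ^ 4 := pow_le_pow_left₀ (by positivity) (by exact_mod_cast hS) 4
  have hXj : (2 : ℝ) ^ j ≤ (X : ℝ) ^ j := pow_le_pow_left₀ (by norm_num) (by exact_mod_cast hX) j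
  have key : 2 ≤ ε / (S : ℝ) ^ 4 * ((X ^ (κ + 4 + j) : ℕ) : ℝ) := by
    rw [div_lt_iff₀ hc] at hj
    rw [div_le_iff₀ (by positivity)] at hεc
    have hεpos : 0 ≤ ε := le_min (half_pos (h.1 n)).le one_pos.le
    have e1 : c ≤ ε * (X : ℝ) ^ κ := hεc.trans (mul_le_mul_of_nonneg_left hXn hεpos)
    have e2 : 2 ≤ (X : ℝ) ^ j * (ε * (X : ℝ) ^ κ) := hj.le.trans (mul_le_mul hXj e1 hc.le (by positivity))
    push_cast
    rw [div_mul_eq_mul_div, le_div_iff₀ (by linarith), pow_add, pow_add]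
    calc 2 * (S : ℝ) ^ 4 ≤ (X : ℝ) ^ j * (ε * (X : ℝ) ^ κ) * (X : ℝ) ^ 4 :=
          mul_le_mul e2 hXS (by positivity) (by positivity)
      _ = _ := by ring
  have h0 : 0 ≤ 1 - ε / (S : ℝ) ^ 4 := by
    rw [sub_nonneg, div_le_one (by linarith)]
    exact hε1.trans hSpos
  calc (1 - ε / (S : ℝ) ^ 4) ^ X ^ (κ + 4 + j)
      ≤ Real.exp (-(ε / (S : ℝ) ^ 4)) ^ X ^ (κ + 4 + j) :=
        pow_le_pow_left₀ h0 (Real.one_sub_le_exp_neg _) _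
    _ = Real.exp (-(ε / (S : ℝ) ^ 4 * ((X ^ (κ + 4 + j) : ℕ) : ℝ))) := by
        rw [← Real.exp_nat_mul]; congr 1; ring
    _ ≤ Real.exp (-2) := Real.exp_le_exp.2 (by linarith)
    -- From e² ≥ 2 + 1.
    _ ≤ 1 / 3 := by
        rw [Real.exp_neg, one_div]
        exact inv_anti₀ (by norm_num) (by have := Real.add_one_le_exp (2 : ℝ); linarith)

/-! ### The verifier -/

theorem length_encNat (n : ℕ) : (encNat n).length = n + 1 := by simp [encNat_eq]

theorem length_le_encList {α : Type} (enc : α → List Bool) (l : List α) :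
    l.length + 1 ≤ (encList enc l).length := by
  induction l with
  | nil => simp [encList]
  | cons a l ih =>
    simp only [encList, List.length_cons, List.length_append]
    omega

/-- Numbers are encoded in unary and every gate takes at least one bit. The length of the input is
therefore a valid block size and also bounds n and S, as the count of rounds requires. -/
theorem length_encInput_ge (I : Input) : I.n + I.S + 6 + I.adj.numInputs + I.adj.gates.length +
    I.sgn.numInputs + I.sgn.gates.length ≤ (encInput I).length := by
  have h1 := length_le_encList encBoolGate I.adj.gates
  have h2 := length_le_encList encBoolGate I.sgn.gates
  simp only [encInput, encBoolCircuit, List.length_append, length_encNat]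
  omega

/-- The bound 2n + 3 ≤ |x| uses that the adjacency circuit has at least n inputs, which contribute a
second n to the length. -/
theorem Input.Implements.fits {I : Input} {V : Finset ℕ} {G : SignedGraph V} (h : I.Implements V G) :
    I.Fits (encInput I).length := by
  have hl := length_encInput_ge I
  have h1 := h.adj_inputs
  exact ⟨h.adj_wellFormed, h.adj_inputs, h.adj_outputs, h.sgn_wellFormed, h.sgn_inputs, h.sgn_outputs,
    h.two_le_S, by omega, by omega, by omega⟩

/-- The acceptance probability of the verifier. -/
theorem acceptProb_inputTests {I : Input} {V : Finset ℕ} {G : SignedGraph V} (h : I.Implements V G)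
    (k : ℕ) (w : QState (11 * (encInput I).length)) :
    (testCircuit (11 * (encInput I).length) ((inputTests k (encInput I)).map shiftTest)).acceptProb w =
      nsq (testProjs (11 * (encInput I).length) (List.replicate ((encInput I).length ^ k)
        (I.roundTests (encInput I).length)).flatten w) := by
  rw [acceptProb_testCircuit, inputTests, parseInput_encInput]
  intro T hT
  rw [inputTests, parseInput_encInput, List.mem_flatten] at hT
  obtain ⟨Ts, hTs, hT⟩ := hT
  rw [List.eq_of_mem_replicate hTs] at hT
  exact Input.on_roundTests h.fits T hT

end QMABalance

theorem mainTheorem4 (degBound sizeBound : ℕ → ℕ) (δ : ℕ → ℝ)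
    (hdeg : QMABalance.IsPolyBounded degBound) (hsize : QMABalance.IsPolyBounded sizeBound)
    (hδ : QMABalance.IsInvPolyBounded δ) :
    QMABalance.InQMA (QMABalance.promiseSparseBalancedness degBound sizeBound δ) := by
  open QMABalance in
  obtain ⟨k, hk⟩ := hδ.exists_rounds
  -- Eleven blocks of |x| witness qubits.
  refine ⟨Polynomial.C 11 * Polynomial.X,
    fun x => testCircuit (11 * x.length) ((inputTests k x).map shiftTest), polyTime_inputTests k,
    fun x => by simp [testCircuit], ?_, ?_⟩
  · rintro x ⟨I, V, G, rfl, hI, hG⟩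
    obtain ⟨w, hw, hpass⟩ := hI.access.exists_passing hI.access.fits hG
    refine ⟨w, hw, ?_⟩
    rw [acceptProb_inputTests hI.access, testProjs_iterate_eq hpass, hw]
    norm_num
  · rintro x ⟨I, V, G, rfl, hI, hG⟩ w hw
    obtain ⟨μ, hμ, hgap⟩ := hI.gap
    -- A smallest eigenvalue zero would produce a balanced component, so the other alternative of
    -- the promise holds.
    have hδμ : δ I.n ≤ μ := hgap.resolve_left fun h0 => hG (by
      rw [h0] at hμ
      exact hμ.hasBalancedComponent)
    have hl := length_encInput_ge I
    have hS := hI.access.two_le_S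
    refine (acceptProb_inputTests hI.access k w).trans_le ?_
    refine (hI.access.nsq_testProjs_rounds_le hI.access.fits hμ (ε := min (δ I.n / 2) 1)
      ((min_le_left _ _).trans (by linarith)) (min_le_right _ _) _ w).trans ?_
    refine (congrArg (_ * ·) hw).trans_le ?_
    rw [mul_one]
    exact hk I.n I.S _ (by omega) (by omega) (by omega) (by omega)
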